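/- Let $\mathbb F$ be a field of characteristic $2$, let $Q$ be a (finite) group of odd order acting on $P=\mathbb Z/2\times\mathbb Z/2$ by group automorphisms, and let $G=P\rtimes Q$. Let $\varepsilon\to\mathbb F$ be a projective resolution of the trivial module over $\mathbb F[G]$. For a cochain complex $C$ of $\mathbb F[G]$-modules let $\operatorname{Ext}^*_{\mathbb F[P]}(\mathbb F,C)=H^*(\operatorname{Hom}_{\mathbb F[P]}(\varepsilon,C))$, with the $Q$-action induced by $(qf)(x)=q\,f(q^{-1}x)$ and with the action of the graded algebra $H^*(BP;\mathbb F)=\operatorname{Ext}^*_{\mathbb F[P]}(\mathbb F,\mathbb F)=H^*(\operatorname{Hom}_{\mathbb F[P]}(\varepsilon,\varepsilon))$ by composition. Let $Q$ act on $\mathbb F[x_1,x_2]$ ($\deg x_i=1$) by algebra automorphisms, where $x_1,x_2$ are the coordinate homomorphisms $P\to\mathbb F$ and $q$ sends a homomorphism $\chi$ to $\chi(q^{-1}\cdot)$. A complex over $\mathbb F[G]$ is perfect if it is quasi-isomorphic (that is, related by a zigzag of quasi-isomorphisms) to a bounded complex of finitely generated projective modules. A parameter ideal of $\mathbb F[x_1,x_2]$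 is an ideal $J$ generated by two homogeneous elements of positive degree such that $\mathbb F[x_1,x_2]/J$ is finite-dimensional over $\mathbb F$. Then there is a $Q$-equivariant isomorphism of graded algebras $\theta\colon\mathbb F[x_1,x_2]\cong H^*(BP;\mathbb F)$. Moreover, for every such $\theta$ the following assignment is a well-defined bijection from quasi-isomorphism classes of perfect cochain complexes $C$ over $\mathbb F[G]$ with $\dim_{\mathbb F}H^*(C)=4$ (total dimension) to triples $(l,L,J)$, where $l$ is an integer, $L$ is an isomorphism class of one-dimensional $\mathbb F$-linear representations of $Q$, and $J\subset\mathbb F[x_1,x_2]$ is a $Q$-invariant parameter ideal: $l$ is the lowest degree with $H^l(C)\neq0$, $L$ is the class of $\operatorname{Ext}^l_{\mathbb F[P]}(\mathbb F,C)$ (which is one-dimensional), and $J$ is the annihilator of $\operatorname{Ext}^*_{\mathbb F[P]}(\mathbb F,C)$ in $\mathbb F[x_1,x_2]$, acting through $\theta$. -/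

import Mathlib

open CategoryTheory CochainComplex CochainComplex.HomComplex

universe u v w

noncomputable section

/-! ### The Klein four group and its coordinates -/

/-- The group `ℤ/2 × ℤ/2`, written multiplicatively. -/
abbrev KleinFour : Type := Multiplicative (ZMod 2 × ZMod 2)

/-- The two coordinates `ℤ/2 × ℤ/2 → ℤ/2`. -/
def KleinFour.coord (i : Fin 2) (p : KleinFour) : ZMod 2 :=
  ![(Multiplicative.toAdd p).1, (Multiplicative.toAdd p).2] i

/-- The two standard generators of `ℤ/2 × ℤ/2`. -/
def KleinFour.gen (j : Fin 2) : KleinFour :=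
  Multiplicative.ofAdd (![(1, 0), (0, 1)] j)

/-! ### Cohomology of the complex of `F[P]`-linear maps, with its `Q`-action

We write `G = P ⋊[φ] Q`. Modules over the group algebra `F[G]` are objects of `Rep F G`. -/

section HomComplex

variable {F : Type u} [Field F] {P : Type v} [Group P] {Q : Type w} [Group Q]
variable (φ : Q →* MulAut P)

/-- Restriction of a cochain complex over `F[P ⋊ Q]` to `F[P]`. -/
abbrev resP (K : CochainComplex (Rep.{u} F (P ⋊[φ] Q)) ℤ) : CochainComplex (Rep.{u} F P) ℤ :=
  ((Rep.resFunctor (SemidirectProduct.inl : P →* P ⋊[φ] Q)).mapHomologicalComplex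
    (ComplexShape.up ℤ)).obj K

variable (K L M : CochainComplex (Rep.{u} F (P ⋊[φ] Q)) ℤ)

/-- The cocycles of degree `n` in the complex `Hom_{F[P]}(K, L)`. -/
abbrev homCocycles (n : ℤ) : Submodule F (Cochain (resP φ K) (resP φ L) n) :=
  LinearMap.ker (δ_hom F (resP φ K) (resP φ L) n (n + 1))

/-- The coboundaries of degree `n` in the complex `Hom_{F[P]}(K, L)`. -/
abbrev homCoboundaries (n : ℤ) : Submodule F (Cochain (resP φ K) (resP φ L) n) :=
  LinearMap.range (δ_hom F (resP φ K) (resP φ L) (n - 1) n)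

/-- The cohomology `Hⁿ(Hom_{F[P]}(K, L))`. -/
abbrev HomCohomology (n : ℤ) : Type u :=
  homCocycles φ K L n ⧸ (homCoboundaries φ K L n).submoduleOf (homCocycles φ K L n)

variable {K L M} {φ}

/-- For `q ∈ Q` and an `F[P]`-linear map `f : X → Y` between `F[P ⋊ Q]`-modules, the
`F[P]`-linear map `x ↦ q f(q⁻¹ x)`. -/
def conjHom {X Y : Rep.{u} F (P ⋊[φ] Q)} (q : Q)
    (f : Rep.res (SemidirectProduct.inl : P →* P ⋊[φ] Q) X ⟶
      Rep.res (SemidirectProduct.inl : P →* P ⋊[φ] Q) Y) :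
    Rep.res (SemidirectProduct.inl : P →* P ⋊[φ] Q) X ⟶
      Rep.res (SemidirectProduct.inl : P →* P ⋊[φ] Q) Y :=
  Rep.ofHom
    { toLinearMap := Y.ρ (SemidirectProduct.inr q) ∘ₗ f.hom.toLinearMap ∘ₗ
        X.ρ (SemidirectProduct.inr q⁻¹)
      isIntertwining' := by
        intro p
        have key : ∀ (q : Q) (p : P), (SemidirectProduct.inr q * SemidirectProduct.inl p :
            P ⋊[φ] Q) = SemidirectProduct.inl (φ q p) * SemidirectProduct.inr q := by
          intro q p
          rw [SemidirectProduct.inl_aut]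
          simp [mul_assoc]
        have hX : X.ρ (SemidirectProduct.inr q⁻¹) ∘ₗ X.ρ (SemidirectProduct.inl p) =
            X.ρ (SemidirectProduct.inl (φ q⁻¹ p)) ∘ₗ X.ρ (SemidirectProduct.inr q⁻¹) := by
          rw [← Module.End.mul_eq_comp, ← Module.End.mul_eq_comp, ← map_mul, ← map_mul, key]
        have hY : Y.ρ (SemidirectProduct.inr q) ∘ₗ Y.ρ (SemidirectProduct.inl (φ q⁻¹ p)) =
            Y.ρ (SemidirectProduct.inl p) ∘ₗ Y.ρ (SemidirectProduct.inr q) := by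
          rw [← Module.End.mul_eq_comp, ← Module.End.mul_eq_comp, ← map_mul, ← map_mul, key]
          simp
        have hf : f.hom.toLinearMap ∘ₗ X.ρ (SemidirectProduct.inl (φ q⁻¹ p)) =
            Y.ρ (SemidirectProduct.inl (φ q⁻¹ p)) ∘ₗ f.hom.toLinearMap :=
          f.hom.isIntertwining' (φ q⁻¹ p)
        ext x
        have hX' := fun x ↦ LinearMap.congr_fun hX x
        have hY' := fun x ↦ LinearMap.congr_fun hY x
        have hf' := fun x ↦ LinearMap.congr_fun hf x
        simp only [LinearMap.comp_apply] at hX' hY' hf'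
        change Y.ρ _ (f.hom.toLinearMap (X.ρ _ (X.ρ _ x))) =
          Y.ρ _ (Y.ρ _ (f.hom.toLinearMap (X.ρ _ x)))
        rw [hX', hf', hY'] }

section

variable {X Y Z : Rep.{u} F (P ⋊[φ] Q)} (q : Q)
  (f f' : Rep.res (SemidirectProduct.inl : P →* P ⋊[φ] Q) X ⟶
    Rep.res (SemidirectProduct.inl : P →* P ⋊[φ] Q) Y)

lemma resHom_ext (h : ∀ x : X, f.hom x = f'.hom x) : f = f' :=
  Rep.hom_ext (Representation.IntertwiningMap.ext (LinearMap.ext h))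

lemma conjHom_add : conjHom q (f + f') = conjHom q f + conjHom q f' :=
  resHom_ext _ _ fun _ ↦ map_add (Y.ρ (SemidirectProduct.inr q)) _ _

lemma conjHom_smul (c : F) : conjHom q (c • f) = c • conjHom q f :=
  resHom_ext _ _ fun _ ↦ map_smul (Y.ρ (SemidirectProduct.inr q)) _ _

lemma conjHom_units_smul (c : ℤˣ) : conjHom q (c • f) = c • conjHom q f := by
  rcases Int.units_eq_one_or c with rfl | rfl
  · simp
  · simp only [Units.neg_smul, one_smul]
    exact resHom_ext _ _ fun _ ↦ map_neg (Y.ρ (SemidirectProduct.inr q)) _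

lemma conjHom_one : conjHom 1 f = f :=
  resHom_ext _ _ fun x ↦ by
    change Y.ρ (SemidirectProduct.inr 1) (f.hom (X.ρ (SemidirectProduct.inr 1⁻¹) x)) = f.hom x
    rw [inv_one, map_one, map_one, map_one]
    rfl

lemma conjHom_mul (q' : Q) : conjHom (q * q') f = conjHom q (conjHom q' f) :=
  resHom_ext _ _ fun x ↦ by
    change Y.ρ (SemidirectProduct.inr (q * q'))
        (f.hom (X.ρ (SemidirectProduct.inr (q * q')⁻¹) x)) =
      Y.ρ (SemidirectProduct.inr q) (Y.ρ (SemidirectProduct.inr q')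
        (f.hom (X.ρ (SemidirectProduct.inr q'⁻¹) (X.ρ (SemidirectProduct.inr q⁻¹) x))))
    rw [mul_inv_rev, map_mul, map_mul, map_mul, map_mul]
    rfl

lemma conjHom_comp_resMap (g : Y ⟶ Z) :
    conjHom q (f ≫ (Rep.resFunctor SemidirectProduct.inl).map g) =
      conjHom q f ≫ (Rep.resFunctor SemidirectProduct.inl).map g :=
  resHom_ext _ _ fun _ ↦ (Rep.hom_comm_apply g (SemidirectProduct.inr q) _).symm

lemma resMap_comp_conjHom (g : Z ⟶ X) :
    (Rep.resFunctor SemidirectProduct.inl).map g ≫ conjHom q f =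
      conjHom q ((Rep.resFunctor SemidirectProduct.inl).map g ≫ f) :=
  resHom_ext _ _ fun x ↦
    congrArg (fun y ↦ Y.ρ (SemidirectProduct.inr q) (f.hom y))
      (Rep.hom_comm_apply g (SemidirectProduct.inr q⁻¹) x).symm

end

/-- The action of `q ∈ Q` on the cochains of `Hom_{F[P]}(K, L)`: `f ↦ q f(q⁻¹ ·)`. -/
def conjCochain (n : ℤ) (q : Q) :
    Cochain (resP φ K) (resP φ L) n →ₗ[F] Cochain (resP φ K) (resP φ L) n where
  toFun z := Cochain.mk fun i j hij ↦ conjHom (X := K.X i) (Y := L.X j) q (z.v i j hij)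
  map_add' _ _ := Cochain.ext _ _ fun _ _ _ ↦ conjHom_add _ _ _
  map_smul' _ _ := Cochain.ext _ _ fun _ _ _ ↦ conjHom_smul _ _ _

lemma conjCochain_v (n : ℤ) (q : Q) (z : Cochain (resP φ K) (resP φ L) n) (i j : ℤ)
    (hij : i + n = j) :
    (conjCochain n q z).v i j hij = conjHom (X := K.X i) (Y := L.X j) q (z.v i j hij) := rfl

lemma conjCochain_δ (n m : ℤ) (q : Q) (z : Cochain (resP φ K) (resP φ L) n) :
    δ n m (conjCochain n q z) = conjCochain m q (δ n m z) := by
  by_cases hnm : n + 1 = m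
  · refine Cochain.ext _ _ fun i j hij ↦ ?_
    rw [conjCochain_v, δ_v n m hnm _ i j hij (j - 1) (i + 1) rfl rfl,
      δ_v n m hnm _ i j hij (j - 1) (i + 1) rfl rfl, conjCochain_v, conjCochain_v]
    refine Eq.trans ?_ (conjHom_add (X := K.X i) (Y := L.X j) q _ _).symm
    exact congrArg₂ (· + ·) (conjHom_comp_resMap q _ (L.d (j - 1) j)).symm
      ((congrArg (m.negOnePow • ·) (resMap_comp_conjHom q _ (K.d i (i + 1)))).trans
        (conjHom_units_smul (X := K.X i) (Y := L.X j) q _ _).symm)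
  · rw [δ_shape _ _ hnm, δ_shape _ _ hnm, map_zero]

lemma conjCochain_one (n : ℤ) (z : Cochain (resP φ K) (resP φ L) n) :
    conjCochain n 1 z = z :=
  Cochain.ext _ _ fun _ _ _ ↦ conjHom_one _

lemma conjCochain_mul (n : ℤ) (q q' : Q) (z : Cochain (resP φ K) (resP φ L) n) :
    conjCochain n (q * q') z = conjCochain n q (conjCochain n q' z) :=
  Cochain.ext _ _ fun _ _ _ ↦ conjHom_mul _ _ _

variable (K L) in
/-- The action of `Q` on the cohomology of `Hom_{F[P]}(K, L)` induced by `f ↦ q f(q⁻¹ ·)`. -/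
def homCohomologyRep (n : ℤ) : Representation F Q (HomCohomology φ K L n) where
  toFun q := Submodule.mapQ _ _
    ((conjCochain n q).restrict (p := homCocycles φ K L n) (q := homCocycles φ K L n) (by
      intro z hz
      have hz' : δ n (n + 1) z = 0 := hz
      change δ n (n + 1) (conjCochain n q z) = 0
      rw [conjCochain_δ, hz', map_zero])) (by
    rintro ⟨_, hz⟩ ⟨y, rfl⟩
    exact ⟨conjCochain (n - 1) q y, conjCochain_δ _ _ _ _⟩)
  map_one' := by
    refine LinearMap.ext fun t ↦ Submodule.Quotient.induction_on _ t fun z ↦ ?_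
    refine congrArg (Submodule.Quotient.mk) (Subtype.ext ?_)
    exact conjCochain_one n z.1
  map_mul' q q' := by
    refine LinearMap.ext fun t ↦ Submodule.Quotient.induction_on _ t fun z ↦ ?_
    refine congrArg (Submodule.Quotient.mk) (Subtype.ext ?_)
    exact conjCochain_mul n q q' z.1

/-- Composition of cocycles. -/
def cocycleComp {a b c : ℤ} (h : a + b = c) :
    homCocycles φ L M b →ₗ[F] homCocycles φ K L a →ₗ[F] homCocycles φ K M c :=
  LinearMap.mk₂ F
    (fun w z ↦ ⟨z.1.comp w.1 h, by
      have hz : δ a (a + 1) z.1 = 0 := z.2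
      have hw : δ b (b + 1) w.1 = 0 := w.2
      change δ c (c + 1) (z.1.comp w.1 h) = 0
      rw [δ_comp z.1 w.1 h (a + 1) (b + 1) (c + 1) rfl rfl rfl, hz, hw]
      simp⟩)
    (fun _ _ _ ↦ Subtype.ext (Cochain.comp_add (h := h) ..))
    (fun _ _ _ ↦ Subtype.ext (Cochain.comp_smul (h := h) ..))
    (fun _ _ _ ↦ Subtype.ext (Cochain.add_comp (h := h) ..))
    (fun _ _ _ ↦ Subtype.ext (Cochain.smul_comp (h := h) ..))

/-- The composition product
`H^b(Hom_{F[P]}(L, M)) × H^a(Hom_{F[P]}(K, L)) → H^{a+b}(Hom_{F[P]}(K, M))`,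
`(w, z) ↦ w ∘ z`. -/
def homCohomologyComp {a b c : ℤ} (h : a + b = c) :
    HomCohomology φ L M b →ₗ[F] HomCohomology φ K L a →ₗ[F] HomCohomology φ K M c :=
  Submodule.liftQ _
    { toFun := fun w ↦ Submodule.mapQ _ _ (cocycleComp h w) (by
        rintro ⟨_, hz⟩ ⟨y, rfl⟩
        refine ⟨b.negOnePow • y.comp w.1 (by lia), ?_⟩
        have hw : δ b (b + 1) w.1 = 0 := w.2
        change δ (c - 1) c (b.negOnePow • y.comp w.1 _) = Cochain.comp (δ (a - 1) a y) w.1 h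
        rw [δ_units_smul, δ_comp y w.1 (by lia) a (b + 1) c (by lia) (by lia) rfl, hw]
        simp [smul_smul])
      map_add' := fun w w' ↦ by
        refine LinearMap.ext fun t ↦ Submodule.Quotient.induction_on _ t fun z ↦ ?_
        exact congrArg Submodule.Quotient.mk (LinearMap.congr_fun (map_add (cocycleComp h) w w') z)
      map_smul' := fun r w ↦ by
        refine LinearMap.ext fun t ↦ Submodule.Quotient.induction_on _ t fun z ↦ ?_
        exact congrArg Submodule.Quotient.mk
          (LinearMap.congr_fun (map_smul (cocycleComp h) r w) z) } (by
    rintro ⟨_, hw⟩ ⟨y, rfl⟩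
    refine LinearMap.ext fun t ↦ Submodule.Quotient.induction_on _ t fun z ↦ ?_
    refine (Submodule.Quotient.mk_eq_zero _).2 ⟨z.1.comp y (by lia), ?_⟩
    have hz : δ a (a + 1) z.1 = 0 := z.2
    change δ (c - 1) c (z.1.comp y _) = Cochain.comp z.1 (δ (b - 1) b y) h
    rw [δ_comp z.1 y (by lia) (a + 1) b c (by lia) rfl (by lia), hz]
    simp)

variable (K) in
/-- The class of the identity of `K`. -/
def homCohomologyOne : HomCohomology φ K K 0 :=
  Submodule.Quotient.mk ⟨Cochain.ofHom (𝟙 (resP φ K)), δ_ofHom _⟩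

end HomComplex

/-! ### Perfect complexes with four-dimensional homology -/

section Perfect

variable (F : Type u) [Field F] (G : Type v) [Group G]

variable {F G} in
/-- A bounded complex of finitely generated projective `F[G]`-modules. -/
def IsStrictlyPerfect (K : CochainComplex (Rep.{u} F G) ℤ) : Prop :=
  (∃ a b : ℤ, K.IsStrictlyGE a ∧ K.IsStrictlyLE b) ∧
    ∀ i : ℤ, Projective (K.X i) ∧ Module.Finite (MonoidAlgebra F G) (K.X i).ρ.asModule

/-- The equivalence relation on cochain complexes over `F[G]` generated by quasi-isomorphisms. -/
def quasiIsoSetoid : Setoid (CochainComplex (Rep.{u} F G) ℤ) :=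
  Relation.EqvGen.setoid fun K L ↦ ∃ f : K ⟶ L, QuasiIso f

variable {F G} in
/-- A complex is perfect if it is quasi-isomorphic to a bounded complex of finitely generated
projective modules. -/
def IsPerfect (C : CochainComplex (Rep.{u} F G) ℤ) : Prop :=
  ∃ K : CochainComplex (Rep.{u} F G) ℤ, IsStrictlyPerfect K ∧ quasiIsoSetoid F G K C

/-- Perfect cochain complexes over `F[G]` with four-dimensional total homology. -/
def FourDimPerfect : Type _ :=
  {C : CochainComplex (Rep.{u} F G) ℤ //
    IsPerfect C ∧ Module.finrank F (DirectSum ℤ fun i ↦ C.homology i) = 4}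

/-- Quasi-isomorphism of perfect complexes with four-dimensional total homology. -/
instance FourDimPerfect.setoid : Setoid (FourDimPerfect.{u} F G) :=
  (quasiIsoSetoid F G).comap Subtype.val

/-- One-dimensional representations of `G` over `F`. -/
def OneDimRep : Type _ := {V : Rep.{u} F G // Module.finrank F V = 1}

/-- Isomorphism of one-dimensional representations. -/
instance OneDimRep.setoid : Setoid (OneDimRep.{u} F G) :=
  (isIsomorphicSetoid (Rep.{u} F G)).comap Subtype.val

end Perfect

/-! ### Ext over `F[P]` and parameter ideals -/

section Ext

variable {F : Type u} [Field F] {Q : Type v} [Group Q] (φ : Q →* MulAut KleinFour)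

/-- The linear action of `q ∈ Q` on `F[x₁, x₂]`: viewing `x₁, x₂` as the homomorphisms
`P = ℤ/2 × ℤ/2 → F` given by the coordinates, `q` sends a homomorphism `χ` to `χ ∘ φ(q⁻¹)`. -/
def polyAct (q : Q) : MvPolynomial (Fin 2) F →ₐ[F] MvPolynomial (Fin 2) F :=
  MvPolynomial.aeval fun i ↦ ∑ j : Fin 2,
    MvPolynomial.C ((KleinFour.coord i (φ q⁻¹ (KleinFour.gen j))).cast : F) * MvPolynomial.X j

lemma polyAct_isHomogeneous (q : Q) {n : ℕ} {f : MvPolynomial (Fin 2) F}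
    (hf : f ∈ MvPolynomial.homogeneousSubmodule (Fin 2) F n) :
    polyAct φ q f ∈ MvPolynomial.homogeneousSubmodule (Fin 2) F n := by
  have hlin : ∀ i : Fin 2, (∑ j : Fin 2, MvPolynomial.C
      ((KleinFour.coord i (φ q⁻¹ (KleinFour.gen j))).cast : F) *
        MvPolynomial.X j : MvPolynomial (Fin 2) F).IsHomogeneous 1 := fun i ↦
    MvPolynomial.IsHomogeneous.sum _ _ _ fun j _ ↦ MvPolynomial.isHomogeneous_C_mul_X _ j
  have h := MvPolynomial.IsHomogeneous.aeval hf _ hlin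
  rw [one_mul] at h
  exact h

/-- A parameter ideal of `F[x₁, x₂]`: an ideal generated by a homogeneous system of parameters,
that is, by two homogeneous elements of positive degree with finite-dimensional quotient. -/
def IsParameterIdeal (J : Ideal (MvPolynomial (Fin 2) F)) : Prop :=
  (∃ (f g : MvPolynomial (Fin 2) F) (a b : ℕ), 0 < a ∧ 0 < b ∧
    f.IsHomogeneous a ∧ g.IsHomogeneous b ∧ J = Ideal.span {f, g}) ∧
  Module.Finite F (MvPolynomial (Fin 2) F ⧸ J)

variable (F) in
/-- The `Q`-invariant parameter ideals of `F[x₁, x₂]`. -/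
def InvariantParameterIdeal : Type _ :=
  {J : Ideal (MvPolynomial (Fin 2) F) //
    IsParameterIdeal J ∧ ∀ q : Q, ∀ f ∈ J, polyAct φ q f ∈ J}

variable {φ}
variable (ε : ProjectiveResolution (Rep.trivial F (KleinFour ⋊[φ] Q) F))

/-- `Extⁿ_{F[P]}(F, C)` as a representation of `Q`, computed with a projective resolution `ε` of
the trivial module `F` over `F[P ⋊ Q]`. -/
def extRep (C : CochainComplex (Rep.{u} F (KleinFour ⋊[φ] Q)) ℤ) (n : ℤ) : Rep.{u} F Q :=
  Rep.of (homCohomologyRep ε.cochainComplex C n)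

/-- The Yoneda action `Ext^k_{F[P]}(F, C) × Ext^n_{F[P]}(F, F) → Ext^{n+k}_{F[P]}(F, C)`;
for `C = F` (represented by its resolution) it is the product of `H^*(BP; F)`. -/
def extMul {C : CochainComplex (Rep.{u} F (KleinFour ⋊[φ] Q)) ℤ} {n k l : ℤ} (h : n + k = l) :
    extRep ε C k →ₗ[F] extRep ε ε.cochainComplex n →ₗ[F] extRep ε C l :=
  homCohomologyComp h

/-- A `Q`-equivariant isomorphism of graded `F`-algebras
`F[x₁, x₂] ≅ Ext^*_{F[P]}(F, F) = H^*(BP; F)`. -/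
structure CohomologyRingIso where
  /-- the isomorphism in degree `n` -/
  toExt (n : ℕ) :
    MvPolynomial.homogeneousSubmodule (Fin 2) F n ≃ₗ[F] extRep ε ε.cochainComplex n
  subsingleton_of_neg (n : ℤ) (hn : n < 0) : Subsingleton (extRep ε ε.cochainComplex n)
  map_one : toExt 0 ⟨1, MvPolynomial.isHomogeneous_one _ _⟩ = homCohomologyOne ε.cochainComplex
  map_mul (a b : ℕ) (f : MvPolynomial.homogeneousSubmodule (Fin 2) F a)
    (g : MvPolynomial.homogeneousSubmodule (Fin 2) F b) :
    toExt (a + b) ⟨f.1 * g.1, MvPolynomial.IsHomogeneous.mul f.2 g.2⟩ =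
      extMul ε (by push_cast; ring) (toExt a f) (toExt b g)
  map_act (q : Q) (n : ℕ) (f : MvPolynomial.homogeneousSubmodule (Fin 2) F n) :
    toExt n ⟨polyAct φ q f.1, polyAct_isHomogeneous φ q f.2⟩ =
      (extRep ε ε.cochainComplex n).ρ q (toExt n f)

variable {ε}

/-- The annihilator in `F[x₁, x₂] ≅ Ext^*_{F[P]}(F, F)` of the graded module
`Ext^*_{F[P]}(F, C)`. -/
def annihilatorSet (θ : CohomologyRingIso ε)
    (C : CochainComplex (Rep.{u} F (KleinFour ⋊[φ] Q)) ℤ) : Set (MvPolynomial (Fin 2) F) :=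
  {s | ∀ (n : ℕ) (k : ℤ) (m : extRep ε C k),
    extMul ε rfl m (θ.toExt n ⟨MvPolynomial.homogeneousComponent n s,
      MvPolynomial.homogeneousComponent_isHomogeneous n s⟩) = 0}

end Ext

end

/-! In characteristic 2 the group algebra of `P` is an exterior algebra on two generators `w₀`,
`w₁`, where `wᵢ` is the sum of the two nontrivial elements of `P` other than `gen i`. With this
choice the span of the generators is stable under automorphisms of `P`, and `Σ xᵢ ⊗ wᵢ` is
`Q`-invariant. The proof is a hands-on Bernstein–Gelfand–Gelfand correspondence: a bounded complex
`K` is replaced by the twisted complex `F[x₀, x₁] ⊗ K` with differential `D = d + Σ xᵢ ⊗ wᵢ`.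
Cochains from the Koszul resolution of the trivial module to `K` are exactly the homogeneous
elements of this complex (`exists_ev_eq`, `eq_zero_of_ev_eq_zero`, `δ_ev`), so its homology is
`Ext_{F[P]}(F, K)` with its polynomial and `Q`-actions. For the trivial module `D = 0`, which yields
the ring isomorphism.

Let `K` be strictly perfect with four-dimensional homology. On projective modules each `wᵢ` is
contractible, which makes the twisted homology torsion with respect to `x₀` and `x₁`
(`exists_X_pow_smul`). The perturbation lemma shrinks the twisted complex to a free module of rank
four on the homology of `K` (`nonempty_minimalRetract`), and a filtration by socles makes its
differential strictly triangular with entries in the maximal ideal (`exists_triangular`). A torsion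
differential of this shape is, up to a unit and one corner entry, the Koszul complex of two coprime
forms `a`, `b` (`koszul_of_triangular`); the corner entry lies in `(a, b)` because its degree
exceeds the socle degree of the quotient by `(a, b)`. Hence the twisted homology is `F[x₀, x₁]/J`
placed in degree `l`, with `J = (a, b)` (`exists_cyclicComparison`). The generator spans the degree
`l` part, so `Q` acts on it by a character `χ`, and averaging over the odd group `Q` makes the
comparison with the cyclic module equivariant.

Conversely `(l, χ, J)` determines a model: the Koszul complex of `F[x₀, x₁]/J`, twisted by `χ`. It
is strictly perfect, and a dimension count using the one-dimensional socle gives homology of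
dimension four. Applying the first part to the model and evaluating on constant functions shows that
its invariants are `(l, χ, J)`. An equivariant comparison for `K` is the same as a chain map from
`K` to the model that is an isomorphism on twisted homology. Since `x₀, x₁` is a regular sequence on
the free twisted complexes, such a map is a quasi-isomorphism (`isomorphism_of_twisted`). So every
complex is equivalent to a model, and models are separated by their invariants.

An arbitrary ring isomorphism `θ` differs from the Koszul one by a graded, `Q`-equivariant
automorphism of `F[x₀, x₁]`, which merely permutes the invariant parameter ideals. -/

noncomputable section

/-! ### Graded algebra of `F[x₀, x₁]` -/

section Polynomials

open MvPolynomial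

/-- The polynomial ring in two variables. -/
abbrev BiPoly (F : Type u) [Field F] := MvPolynomial (Fin 2) F

variable {F : Type u} [Field F]

/-- The homogeneous part of integral degree `k`. -/
def hpart (k : ℤ) : BiPoly F →ₗ[F] BiPoly F :=
  if 0 ≤ k then homogeneousComponent k.toNat else 0

lemma hpart_natCast (n : ℕ) (f : BiPoly F) : hpart (n : ℤ) f = homogeneousComponent n f := by
  simp [hpart]

lemma hpart_of_neg {k : ℤ} (hk : k < 0) (f : BiPoly F) : hpart k f = 0 := by
  simp [hpart, not_le.2 hk]

lemma hpart_of_isHomogeneous {f : BiPoly F} {n : ℕ} (hf : f.IsHomogeneous n) (k : ℤ) :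
    hpart k f = if k = n then f else 0 := by
  rcases lt_or_ge k 0 with hk | hk
  · rw [hpart_of_neg hk, if_neg (by lia)]
  · lift k to ℕ using hk
    rw [hpart_natCast, homogeneousComponent_of_mem (n := n) hf]
    simp

lemma isHomogeneous_hpart (n : ℕ) (f : BiPoly F) : (hpart (n : ℤ) f).IsHomogeneous n := by
  rw [hpart_natCast]; exact homogeneousComponent_isHomogeneous n f

lemma isHomogeneous_iff_hpart {f : BiPoly F} {n : ℕ} :
    f.IsHomogeneous n ↔ hpart (n : ℤ) f = f :=
  ⟨fun h ↦ by rw [hpart_of_isHomogeneous h, if_pos rfl], fun h ↦ h ▸ isHomogeneous_hpart n f⟩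

lemma hpart_hpart (k m : ℤ) (f : BiPoly F) :
    hpart k (hpart m f) = if k = m then hpart m f else 0 := by
  rcases lt_or_ge m 0 with hm | hm
  · simp [hpart_of_neg hm]
  · lift m to ℕ using hm
    exact hpart_of_isHomogeneous (isHomogeneous_hpart m f) k

lemma sum_hpart (f : BiPoly F) :
    ∑ i ∈ Finset.range (f.totalDegree + 1), hpart (i : ℤ) f = f := by
  simp_rw [hpart_natCast]
  exact sum_homogeneousComponent f

lemma eq_zero_of_hpart {f : BiPoly F} (h : ∀ n : ℕ, hpart (n : ℤ) f = 0) : f = 0 := by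
  rw [← sum_hpart f]
  exact Finset.sum_eq_zero fun i _ ↦ h i

lemma hpart_mul {f : BiPoly F} {n : ℕ} (hf : f.IsHomogeneous n) (k : ℤ) (g : BiPoly F) :
    hpart k (f * g) = f * hpart (k - n) g := by
  conv_lhs => rw [← sum_hpart g]
  conv_rhs => rw [← sum_hpart g]
  rw [Finset.mul_sum, map_sum, map_sum, Finset.mul_sum]
  refine Finset.sum_congr rfl fun i _ ↦ ?_
  rw [hpart_of_isHomogeneous (hf.mul (isHomogeneous_hpart i g)), hpart_hpart]
  by_cases h : k = ((n + i : ℕ) : ℤ)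
  · rw [if_pos h, if_pos (by push_cast at h; lia)]
  · rw [if_neg h, if_neg (by push_cast at h; lia), mul_zero]

lemma hpart_C_mul (k : ℤ) (c : F) (g : BiPoly F) : hpart k (C c * g) = C c * hpart k g := by
  rw [C_mul', C_mul', map_smul]

lemma hpart_X_mul (k : ℤ) (i : Fin 2) (g : BiPoly F) :
    hpart k (X i * g) = X i * hpart (k - 1) g := by
  simpa using hpart_mul (isHomogeneous_X F i) k g

lemma prime_X (i : Fin 2) : Prime (X i : BiPoly F) := MvPolynomial.X_prime

/-- The prime factors of `u` would have to be associated to both variables. All determinants in the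
rank-four argument are recognised as units in this way. -/
lemma isUnit_of_dvd_X_pow {u : BiPoly F} {q : ℕ} (h₀ : u ∣ X 0 ^ q) (h₁ : u ∣ X 1 ^ q) :
    IsUnit u := by
  obtain ⟨i, -, hi⟩ := (dvd_prime_pow (prime_X 0) q).1 h₀
  rcases Nat.eq_zero_or_pos i with rfl | hpos
  · rw [pow_zero] at hi
    exact associated_one_iff_isUnit.1 hi
  · have h : (X 0 : BiPoly F) ∣ X 1 ^ q := ((dvd_pow_self _ hpos.ne').trans hi.symm.dvd).trans h₁
    have := X_dvd_X.1 ((prime_X 0).dvd_of_dvd_pow h)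
    simp at this

lemma not_isUnit_of_constantCoeff {f : BiPoly F} (hf : constantCoeff f = 0) : ¬ IsUnit f := by
  intro h
  have := h.map (constantCoeff (σ := Fin 2) (R := F))
  rw [hf] at this
  exact not_isUnit_zero this

/-- A common divisor of `a` and `b` divides a power of each variable. This extracts coprimality from
a torsion condition. -/
lemma isRelPrime_of_X_pow {a b : BiPoly F} {q : ℕ}
    (h : ∀ i, (X i : BiPoly F) ^ q ∈ Ideal.span {a, b}) : IsRelPrime a b := by
  intro d hda hdb
  have key : ∀ i, d ∣ X i ^ q := fun i ↦ by
    obtain ⟨s, t, hst⟩ := Ideal.mem_span_pair.1 (h i)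
    rw [← hst]
    exact dvd_add (hda.mul_left _) (hdb.mul_left _)
  exact isUnit_of_dvd_X_pow (key 0) (key 1)

/-- By unique factorisation, coprime elements have only the Koszul syzygy. This is the middle
exactness of the Koszul complex of `(a, b)`. -/
lemma exists_common_multiple {a b p q : BiPoly F} (hb : b ≠ 0) (hab : IsRelPrime a b)
    (h : p * a = q * b) : ∃ k, p = b * k ∧ q = a * k := by
  obtain ⟨k, hk⟩ : b ∣ p := hab.symm.dvd_of_dvd_mul_right (h ▸ dvd_mul_left b q)
  refine ⟨k, hk, ?_⟩
  apply mul_right_cancel₀ hb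
  rw [← h, hk]; ring

lemma exists_common_multiple_X {p q : BiPoly F} (h : X 0 * p = X 1 * q) :
    ∃ k, p = X 1 * k ∧ q = X 0 * k := by
  refine exists_common_multiple (a := X 0) (b := X 1) (X_ne_zero _) ?_
    (by rw [mul_comm p, mul_comm q, h])
  apply isRelPrime_of_X_pow (q := 1)
  intro i
  rw [pow_one]
  fin_cases i
  · exact Ideal.subset_span (by simp)
  · exact Ideal.subset_span (by simp)

lemma exists_eq_X_mul_add {f : BiPoly F} (hf : constantCoeff f = 0) :
    ∃ α β, f = X 0 * α + X 1 * β := by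
  have h : f ∈ Ideal.span (Set.range (X : Fin 2 → BiPoly F)) := by
    rw [← Set.image_univ, mem_ideal_span_X_image]
    intro m hm
    by_contra hcon
    push Not at hcon
    have : m = 0 := by ext i; exact hcon i trivial
    subst this
    exact (mem_support_iff.1 hm) (by rw [← constantCoeff_eq, hf])
  obtain ⟨c, hc⟩ := (Ideal.mem_span_range_iff_exists_fun).1 h
  refine ⟨c 0, c 1, ?_⟩
  rw [← hc, Fin.sum_univ_two]; ring

/-- A homogeneous polynomial pair of positive degrees expands through the variables with
homogeneous coefficients. -/
lemma exists_eq_X_mul_add_hpart {f : BiPoly F} {a : ℕ} (ha : 0 < a) (hf : f.IsHomogeneous a) :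
    ∃ α β : BiPoly F, hpart ((a : ℤ) - 1) α = α ∧ hpart ((a : ℤ) - 1) β = β ∧
      f = X 0 * α + X 1 * β := by
  have h0 : constantCoeff f = 0 := by
    rw [constantCoeff_eq]
    exact hf.coeff_eq_zero (by simp; lia)
  obtain ⟨α, β, h⟩ := exists_eq_X_mul_add h0
  refine ⟨hpart ((a : ℤ) - 1) α, hpart ((a : ℤ) - 1) β, by rw [hpart_hpart, if_pos rfl],
    by rw [hpart_hpart, if_pos rfl], ?_⟩
  rw [← hpart_X_mul, ← hpart_X_mul, ← map_add, ← h, isHomogeneous_iff_hpart.1 hf]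

lemma constantCoeff_of_isHomogeneous {f : BiPoly F} {a : ℕ} (ha : 0 < a) (hf : f.IsHomogeneous a) :
    constantCoeff f = 0 := by
  rw [constantCoeff_eq]
  exact hf.coeff_eq_zero (by simp; lia)

lemma eq_C_of_constantCoeff (f : BiPoly F) :
    ∃ α β, f = C (constantCoeff f) + (X 0 * α + X 1 * β) := by
  obtain ⟨α, β, h⟩ := exists_eq_X_mul_add (f := f - C (constantCoeff f)) (by simp)
  exact ⟨α, β, by rw [← h]; ring⟩

lemma hpart_mem_span {f g : BiPoly F} {a b : ℕ} (hf : f.IsHomogeneous a) (hg : g.IsHomogeneous b)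
    {s : BiPoly F} (hs : s ∈ Ideal.span {f, g}) (k : ℤ) : hpart k s ∈ Ideal.span {f, g} := by
  obtain ⟨p, q, rfl⟩ := Ideal.mem_span_pair.1 hs
  rw [map_add, mul_comm p, mul_comm q, hpart_mul hf, hpart_mul hg]
  exact Ideal.add_mem _ (Ideal.mul_mem_right _ _ (Ideal.subset_span (by simp)))
    (Ideal.mul_mem_right _ _ (Ideal.subset_span (by simp)))

/-- The socle of `F[x₀, x₁] / (f, g)` is spanned by the transition determinant. -/
lemma exists_socle {f g : BiPoly F} {a b : ℕ} (ha : 0 < a) (hb : 0 < b)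
    (hf : f.IsHomogeneous a) (hg : g.IsHomogeneous b) (hfg : IsRelPrime f g) :
    ∃ Δ : BiPoly F, hpart ((a : ℤ) + b - 2) Δ = Δ ∧
      ∀ s, X 0 * s ∈ Ideal.span {f, g} → X 1 * s ∈ Ideal.span {f, g} →
        ∃ c : F, s - C c * Δ ∈ Ideal.span {f, g} := by
  obtain ⟨α, β, hα, hβ, hf'⟩ := exists_eq_X_mul_add_hpart ha hf
  obtain ⟨γ, δ, hγ, hδ, hg'⟩ := exists_eq_X_mul_add_hpart hb hg
  have hΔ : ∀ x y : BiPoly F, hpart ((a : ℤ) - 1) x = x → hpart ((b : ℤ) - 1) y = y →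
      hpart ((a : ℤ) + b - 2) (x * y) = x * y := by
    intro x y hx hy
    have h1 : x.IsHomogeneous (a - 1) := by
      rw [isHomogeneous_iff_hpart, ← hx, hpart_hpart, if_pos (by lia)]
    rw [hpart_mul h1, show (a : ℤ) + b - 2 - (a - 1 : ℕ) = b - 1 by lia, hy]
  -- Cramer's rule for `f = x₀α + x₁β`, `g = x₀γ + x₁δ`: both variables multiply the determinant
  -- into `(f, g)`.
  have hf0 : X 0 * (α * δ - β * γ) = δ * f - β * g := by rw [hf', hg']; ring
  have hg0 : X 1 * (α * δ - β * γ) = α * g - γ * f := by rw [hf', hg']; ring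
  have mf : f ∈ Ideal.span {f, g} := Ideal.subset_span (by simp)
  have mg : g ∈ Ideal.span {f, g} := Ideal.subset_span (by simp)
  refine ⟨α * δ - β * γ, by rw [map_sub, hΔ _ _ hα hδ, hΔ _ _ hβ hγ], fun s h₀ h₁ ↦ ?_⟩
  obtain ⟨p, q, h₀⟩ := Ideal.mem_span_pair.1 h₀
  obtain ⟨r, t, h₁⟩ := Ideal.mem_span_pair.1 h₁
  have hg_ne : g ≠ 0 := by
    rintro rfl
    exact not_isUnit_of_constantCoeff (constantCoeff_of_isHomogeneous ha hf)
      (hfg dvd_rfl (dvd_zero f))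
  -- Writing `x₀x₁s` in two ways gives a syzygy of `(f, g)`, hence a multiple `k` of the Koszul one.
  -- Substituting the expansions of `f` and `g` then gives syzygies of the variables, with factors
  -- `m` and `n`.
  obtain ⟨k, hk₀, hk₁⟩ := exists_common_multiple (p := X 1 * p - X 0 * r)
    (q := X 0 * t - X 1 * q) hg_ne hfg (by linear_combination (X 1) * h₀ - (X 0) * h₁)
  obtain ⟨m, hm₀, hm₁⟩ := exists_common_multiple_X (p := r + γ * k) (q := p - δ * k)
    (by rw [hg'] at hk₀; linear_combination -hk₀)
  obtain ⟨n, hn₀, hn₁⟩ := exists_common_multiple_X (p := t - α * k) (q := q + β * k)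
    (by rw [hf'] at hk₁; linear_combination hk₁)
  -- In `s = kΔ + mf + ng` only the constant term of `k` survives modulo `(f, g)`, because the
  -- variables kill `Δ` there.
  obtain ⟨k₀, k₁, hk⟩ := eq_C_of_constantCoeff k
  refine ⟨constantCoeff k, ?_⟩
  have hs : s = k * (α * δ - β * γ) + (m * f + n * g) := by
    apply mul_left_cancel₀ (X_ne_zero (R := F) (0 : Fin 2))
    rw [mul_add, mul_left_comm, hf0, ← h₀]
    linear_combination f * hm₁ + g * hn₁
  have : s - C (constantCoeff k) * (α * δ - β * γ) =
      k₀ * (X 0 * (α * δ - β * γ)) + k₁ * (X 1 * (α * δ - β * γ)) + (m * f + n * g) := by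
    linear_combination hs + (α * δ - β * γ) * hk
  rw [this, hf0, hg0]
  have e : ∀ {x}, x ∈ Ideal.span {f, g} → ∀ y, y * x ∈ Ideal.span {f, g} :=
    fun hx y ↦ Ideal.mul_mem_left _ y hx
  exact add_mem (add_mem (e (sub_mem (e mf _) (e mg _)) _) (e (sub_mem (e mg _) (e mf _)) _))
    (add_mem (e mf _) (e mg _))

/-- A monomial of degree at least `2q` has some exponent at least `q`. -/
lemma isHomogeneous_mem_of_X_pow_mem {I : Ideal (BiPoly F)} {q : ℕ}
    (h : ∀ i, (X i : BiPoly F) ^ q ∈ I) {n : ℕ} (hn : 2 * q ≤ n) {f : BiPoly F}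
    (hf : f.IsHomogeneous n) : f ∈ I := by
  rw [f.as_sum]
  refine Ideal.sum_mem _ fun m hm ↦ ?_
  have hdeg : m 0 + m 1 = n := by
    have := hf (mem_support_iff.1 hm)
    rw [Finsupp.weight_apply, Finsupp.sum_fintype _ _ (by simp)] at this
    simpa [Fin.sum_univ_two] using this
  have key : ∃ i, q ≤ m i := by
    by_contra hcon
    push Not at hcon
    have h0 := hcon 0
    have h1 := hcon 1
    lia
  obtain ⟨i, hi⟩ := key
  have : (X i : BiPoly F) ^ q ∣ monomial m (coeff m f) := by
    rw [X_pow_eq_monomial, monomial_dvd_monomial]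
    exact ⟨Or.inr (by simpa using hi), one_dvd _⟩
  exact Ideal.mem_of_dvd _ this (h i)

/-- `F[x₀, x₁] / (f, g)` vanishes in degrees at least `a + b - 1`. -/
lemma isHomogeneous_mem_span {f g : BiPoly F} {a b q : ℕ} (ha : 0 < a) (hb : 0 < b)
    (hf : f.IsHomogeneous a) (hg : g.IsHomogeneous b)
    (h : ∀ i, (X i : BiPoly F) ^ q ∈ Ideal.span {f, g}) {n : ℕ} (hn : a + b ≤ n + 1) {c : BiPoly F}
    (hc : c.IsHomogeneous n) : c ∈ Ideal.span {f, g} := by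
  obtain ⟨Δ, hΔ, hs⟩ := exists_socle ha hb hf hg (isRelPrime_of_X_pow h)
  -- Downward induction from degree `2q`. If both variables multiply `c` into the ideal, then `c` is
  -- a socle element modulo `(f, g)`; but the socle lives in degree `a + b - 2`, below the degree of
  -- `c`.
  obtain ⟨k, hk⟩ : ∃ k, k = 2 * q - n := ⟨_, rfl⟩
  induction k generalizing n c with
  | zero => exact isHomogeneous_mem_of_X_pow_mem h (by lia) hc
  | succ k ih =>
    have hX : ∀ i, X i * c ∈ Ideal.span {f, g} := fun i ↦
      ih (n := 1 + n) (by lia) ((isHomogeneous_X F i).mul hc) (by lia)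
    obtain ⟨e, he⟩ := hs c (hX 0) (hX 1)
    have := hpart_mem_span hf hg he n
    rwa [map_sub, hpart_C_mul, ← hΔ, hpart_hpart, if_neg (by lia), mul_zero, sub_zero,
      isHomogeneous_iff_hpart.1 hc] at this

end Polynomials
end

/-! ### Homological perturbation, nilpotence of shifts, and twisted complexes -/

noncomputable section

section Perturbation

variable {R : Type*} [Ring R] {d h δ Ti : R}

/-- Put `D = d + δ` and `π = 1 - dh - hd`, and split `D(1 + δh)` along `1 = π + dh + hd`. The `dh`
part vanishes because `(1 + δh)dh = Dh` and `D² = 0`. The `hd` part equals `(1 + δh)d` and dies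
under `π Ti` because `πd = 0`. So `P = π Ti` is a chain map from `D` to the induced differential on
the range of `π`. -/
lemma perturbation_aux (hh : h * h = 0) (hdh : h * d * h = h)
    (hDD : (d + δ) * (d + δ) = 0) (hT : (1 + δ * h) * Ti = 1)
    (hT' : Ti * (1 + δ * h) = 1) (dhd : d * h * d = d) (dd : d * d = 0) :
    (1 - d * h - h * d) * Ti * (d + δ) =
      (1 - d * h - h * d) * Ti * (d + δ) * (1 - d * h - h * d) * Ti := by
  have e1 : (d + δ) * ((1 + δ * h) * (d * h)) = 0 := by
    have : (1 + δ * h) * (d * h) = (d + δ) * h := by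
      calc _ = d * h + δ * (h * d * h) := by noncomm_ring
        _ = _ := by rw [hdh]; noncomm_ring
    rw [this, ← mul_assoc, hDD, zero_mul]
  have e2 : (1 - d * h - h * d) * Ti * ((d + δ) * ((1 + δ * h) * (h * d))) = 0 := by
    have h1 : (d + δ) * ((1 + δ * h) * (h * d)) = (1 + δ * h) * d := by
      calc _ = (d * h * d) + δ * h * d + (d + δ) * δ * (h * h) * d := by noncomm_ring
        _ = _ := by rw [hh, dhd]; noncomm_ring
    calc _ = (1 - d * h - h * d) * (Ti * (1 + δ * h)) * d := by rw [h1]; noncomm_ring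
      _ = d - d * h * d - h * (d * d) := by rw [hT']; noncomm_ring
      _ = 0 := by rw [dhd, dd]; noncomm_ring
  have e3 : (1 + δ * h) * (1 - d * h - h * d) = 1 - d * h - h * d := by
    calc _ = (1 - d * h - h * d) + δ * (h - h * d * h) - δ * (h * h) * d := by noncomm_ring
      _ = _ := by rw [hdh, hh]; noncomm_ring
  have e4 : (d + δ) * (1 + δ * h) = (d + δ) * (1 - d * h - h * d) +
      (d + δ) * ((1 + δ * h) * (d * h)) + (d + δ) * ((1 + δ * h) * (h * d)) := by
    conv_rhs => rw [← e3]
    noncomm_ring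
  calc (1 - d * h - h * d) * Ti * (d + δ)
      = (1 - d * h - h * d) * Ti * (d + δ) * ((1 + δ * h) * Ti) := by rw [hT, mul_one]
    _ = (1 - d * h - h * d) * Ti * ((d + δ) * (1 + δ * h)) * Ti := by noncomm_ring
    _ = (1 - d * h - h * d) * Ti * ((d + δ) * (1 - d * h - h * d)) * Ti +
        (1 - d * h - h * d) * Ti * ((d + δ) * ((1 + δ * h) * (h * d))) * Ti := by
        rw [e4, e1]; noncomm_ring
    _ = _ := by rw [e2]; noncomm_ring

lemma proj_mul_proj (hh : h * h = 0) (hdh : h * d * h = h) (dhd : d * h * d = d) (dd : d * d = 0) :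
    (1 - d * h - h * d) * (1 - d * h - h * d) = 1 - d * h - h * d := by
  calc _ = 1 - d * h - h * d - (d * h - (d * h * d) * h - d * (h * h) * d)
        - (h * d - h * (d * d) * h - (h * d * h) * d) := by noncomm_ring
    _ = _ := by rw [dhd, hh, dd, hdh]; noncomm_ring

lemma inv_mul_proj (hh : h * h = 0) (hdh : h * d * h = h) (hT' : Ti * (1 + δ * h) = 1) :
    Ti * (1 - d * h - h * d) = 1 - d * h - h * d := by
  have e3 : (1 + δ * h) * (1 - d * h - h * d) = 1 - d * h - h * d := by
    calc _ = (1 - d * h - h * d) + δ * (h - h * d * h) - δ * (h * h) * d := by noncomm_ring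
      _ = _ := by rw [hdh, hh]; noncomm_ring
  calc _ = Ti * ((1 + δ * h) * (1 - d * h - h * d)) := by rw [e3]
    _ = _ := by rw [← mul_assoc, hT', one_mul]

lemma proj_mul_inv_mul (hh : h * h = 0) (hdh : h * d * h = h) (hT' : Ti * (1 + δ * h) = 1) :
    (1 - d * h - h * d) * Ti * h = 0 := by
  have e : Ti * h = h := by
    calc _ = Ti * (h + δ * (h * h)) := by rw [hh]; noncomm_ring
      _ = Ti * (1 + δ * h) * h := by noncomm_ring
      _ = h := by rw [hT', one_mul]
  calc _ = (1 - d * h - h * d) * (Ti * h) := by noncomm_ring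
    _ = h - d * (h * h) - h * d * h := by rw [e]; noncomm_ring
    _ = 0 := by rw [hh, hdh]; noncomm_ring

end Perturbation

section PerturbationModule

variable {S M : Type*} [CommRing S] [AddCommGroup M] [Module S M] {d h δ Ti : Module.End S M}

/-- With `u' = Ti v` the hypothesis on `P` reads `u' = dhu' + hdu'`, so `v = (1 + δh)u' = Dhu' +
hdu'`. Then `Dv = 0` becomes `(1 + δh)du' = 0`, hence `du' = 0`. Thus `h Ti` contracts the cycles in
the kernel of `P`. -/
lemma exists_eq_of_proj_eq_zero (hdh : h * d * h = h) (hh : h * h = 0)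
    (hDD : (d + δ) * (d + δ) = 0) (hT : (1 + δ * h) * Ti = 1)
    (hT' : Ti * (1 + δ * h) = 1) (dhd : d * h * d = d) (v : M)
    (hP : ((1 - d * h - h * d) * Ti) v = 0) (hD : (d + δ) v = 0) :
    v = (d + δ) ((h * Ti) v) := by
  set u' := Ti v with hu
  have hv : v = (1 + δ * h) u' := by rw [hu, ← Module.End.mul_apply, hT]; rfl
  have hpu : u' = d (h u') + h (d u') := by
    have : u' - d (h u') - h (d u') = 0 := hP
    rw [sub_sub, sub_eq_zero] at this
    exact this
  have e1 : (1 + δ * h) (d (h u')) = (d + δ) (h u') := by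
    have : (1 + δ * h) * (d * h) = (d + δ) * h := by
      calc _ = d * h + δ * (h * d * h) := by noncomm_ring
        _ = _ := by rw [hdh]; noncomm_ring
    exact LinearMap.congr_fun this u'
  have e2 : (1 + δ * h) (h (d u')) = h (d u') := by
    have : (1 + δ * h) * (h * d) = h * d := by
      calc _ = h * d + δ * (h * h) * d := by noncomm_ring
        _ = _ := by rw [hh]; noncomm_ring
    exact LinearMap.congr_fun this u'
  have hv' : v = (d + δ) (h u') + h (d u') := by
    rw [hv]; conv_lhs => rw [hpu]
    rw [map_add, e1, e2]
  have e3 : (1 + δ * h) (d u') = 0 := by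
    have h1 : (d + δ) (h (d u')) = 0 := by
      have := hD
      rw [hv', map_add, ← Module.End.mul_apply, hDD] at this
      simpa using this
    have h2 : (d + δ) * (h * d) = (1 + δ * h) * d := by
      calc _ = (d * h * d) + δ * h * d := by noncomm_ring
        _ = _ := by rw [dhd]; noncomm_ring
    have h3 := LinearMap.congr_fun h2 u'
    exact h3.symm.trans h1
  have e4 : d u' = 0 := by
    have := congrArg Ti e3
    rw [← Module.End.mul_apply, hT', map_zero] at this
    exact this
  conv_lhs => rw [hv', e4, map_zero, add_zero]
  rfl

end PerturbationModule

section Nilpotent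

/-- An operator of nonzero degree leaves a finite range of degrees after enough iterations. -/
lemma isNilpotent_of_shift {R : Type*} [Ring R] {p : ℤ → R} {s : Finset ℤ}
    (hs : ∑ n ∈ s, p n = 1) (hp : ∀ n ∉ s, p n = 0) {T : R} {e : ℤ} (he : e ≠ 0)
    (hT : ∀ n, T * p n = p (n + e) * T) : IsNilpotent T := by
  have hpow : ∀ (k : ℕ) (n : ℤ), T ^ k * p n = p (n + k * e) * T ^ k := by
    intro k
    induction k with
    | zero => intro n; simp
    | succ k ih =>
      intro n
      rw [pow_succ, mul_assoc, hT, ← mul_assoc, ih, mul_assoc]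
      congr 2; push_cast; ring
  obtain ⟨k, hk⟩ : ∃ k : ℕ, ∀ n ∈ s, n + k * e ∉ s := by
    -- All degrees in `s` have absolute value at most the sum, so two of them differ by at most
    -- twice the sum; one more step leaves `s`.
    refine ⟨2 * (∑ n ∈ s, n.natAbs) + 1, fun n hn hmem ↦ ?_⟩
    have h1 : n.natAbs ≤ ∑ n ∈ s, n.natAbs :=
      Finset.single_le_sum (f := Int.natAbs) (fun _ _ ↦ Nat.zero_le _) hn
    have h2 : (n + ((2 * (∑ n ∈ s, n.natAbs) + 1 : ℕ) : ℤ) * e).natAbs ≤ ∑ n ∈ s, n.natAbs :=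
      Finset.single_le_sum (f := Int.natAbs) (fun _ _ ↦ Nat.zero_le _) hmem
    set B := ∑ n ∈ s, n.natAbs
    have h3 : (((2 * B + 1 : ℕ) : ℤ) * e).natAbs ≤ 2 * B := by
      have := Int.natAbs_sub_le (n + ((2 * B + 1 : ℕ) : ℤ) * e) n
      rw [add_sub_cancel_left] at this
      lia
    rw [Int.natAbs_mul, Int.natAbs_natCast] at h3
    have h4 : 1 ≤ e.natAbs := Int.natAbs_pos.2 he
    nlinarith
  refine ⟨k, ?_⟩
  rw [← mul_one (T ^ k), ← hs, Finset.mul_sum]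
  refine Finset.sum_eq_zero fun n hn ↦ ?_
  rw [hpow, hp _ (hk n hn), zero_mul]

end Nilpotent

lemma add_self_of_charTwo (F : Type*) [Field F] [CharP F 2] {V : Type*} [AddCommGroup V] [Module F V]
    (x : V) : x + x = 0 := by
  rw [← two_smul F x, CharTwo.two_eq_zero, zero_smul]

lemma neg_eq_of_charTwo (F : Type*) [Field F] [CharP F 2] {V : Type*} [AddCommGroup V] [Module F V]
    (x : V) : -x = x :=
  neg_eq_of_add_eq_zero_left (add_self_of_charTwo F x)

lemma sub_eq_of_charTwo (F : Type*) [Field F] [CharP F 2] {V : Type*} [AddCommGroup V] [Module F V]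
    (x y : V) : x - y = x + y := by
  rw [sub_eq_add_neg, neg_eq_of_charTwo F]

/-! ### Twisted modules over the polynomial ring -/

open scoped TensorProduct
open MvPolynomial (X)

/-- A bounded graded vector space with a differential `d` and two commuting square-zero operators
`w₀`, `w₁` of degree zero commuting with `d`; this is the total space of a bounded complex of
modules over an exterior algebra on two generators. -/
structure ExteriorComplex (F : Type u) (A : Type v) [Field F] [AddCommGroup A] [Module F A] where
  /-- the projections onto the graded pieces -/
  pr : ℤ → Module.End F A
  /-- the degrees that occur -/
  supp : Finset ℤ
  pr_mul_pr (m n : ℤ) : pr m * pr n = if m = n then pr n else 0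
  sum_pr : ∑ n ∈ supp, pr n = 1
  /-- the differential -/
  d : Module.End F A
  /-- the exterior generators -/
  w : Fin 2 → Module.End F A
  d_mul_pr (n : ℤ) : d * pr n = pr (n + 1) * d
  w_mul_pr (i : Fin 2) (n : ℤ) : w i * pr n = pr n * w i
  d_mul_d : d * d = 0
  w_mul_w (i : Fin 2) : w i * w i = 0
  w_comm : w 0 * w 1 = w 1 * w 0
  d_mul_w (i : Fin 2) : d * w i = w i * d

namespace ExteriorComplex

variable {F : Type u} {A : Type v} [Field F] [AddCommGroup A] [Module F A]
variable (T : ExteriorComplex F A)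

/-- Base change of operators to the polynomial ring. -/
abbrev bc (f : Module.End F A) : Module.End (BiPoly F) (BiPoly F ⊗[F] A) :=
  Module.End.baseChangeHom F (BiPoly F) A f

lemma bc_tmul (f : Module.End F A) (s : BiPoly F) (a : A) :
    bc f (s ⊗ₜ[F] a) = s ⊗ₜ[F] f a := rfl

/-- The twisting term `Σ xᵢ ⊗ wᵢ`. -/
def twist : Module.End (BiPoly F) (BiPoly F ⊗[F] A) :=
  (X 0 : BiPoly F) • bc (T.w 0) + (X 1 : BiPoly F) • bc (T.w 1)

/-- The twisted differential `d + Σ xᵢ ⊗ wᵢ`. -/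
def D : Module.End (BiPoly F) (BiPoly F ⊗[F] A) := bc T.d + T.twist

lemma D_tmul (s : BiPoly F) (a : A) :
    T.D (s ⊗ₜ[F] a) = s ⊗ₜ[F] T.d a + ((X 0 * s) ⊗ₜ[F] T.w 0 a + (X 1 * s) ⊗ₜ[F] T.w 1 a) := rfl

/-- The squares vanish, and each mixed term occurs twice because all operators commute, so
characteristic 2 replaces signs. -/
lemma D_mul_D [CharP F 2] : T.D * T.D = 0 := by
  have hd : bc T.d * bc T.d = 0 := by rw [← map_mul, T.d_mul_d, map_zero]
  have hw : ∀ i, bc (T.w i) * bc (T.w i) = 0 := fun i ↦ by rw [← map_mul, T.w_mul_w, map_zero]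
  have hc : bc (T.w 0) * bc (T.w 1) = bc (T.w 1) * bc (T.w 0) := by
    rw [← map_mul, T.w_comm, map_mul]
  have hdw : ∀ i, bc T.d * bc (T.w i) = bc (T.w i) * bc T.d := fun i ↦ by
    rw [← map_mul, T.d_mul_w, map_mul]
  simp only [D, twist, mul_add, add_mul, smul_mul_assoc, mul_smul_comm, hd, hw, hc, hdw, smul_zero,
    add_zero, zero_add, smul_add]
  rw [smul_comm (X 1 : BiPoly F) (X 0 : BiPoly F)]
  generalize (X 0 : BiPoly F) • (bc (T.w 0) * bc T.d) = a
  generalize (X 1 : BiPoly F) • (bc (T.w 1) * bc T.d) = b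
  generalize (X 0 : BiPoly F) • (X 1 : BiPoly F) • (bc (T.w 1) * bc (T.w 0)) = c
  calc _ = (a + a) + (b + b) + (c + c) := by abel
    _ = 0 := by
      rw [add_self_of_charTwo F a, add_self_of_charTwo F b, add_self_of_charTwo F c]; simp

lemma D_D [CharP F 2] (v : BiPoly F ⊗[F] A) : T.D (T.D v) = 0 :=
  LinearMap.congr_fun T.D_mul_D v

lemma pr_of_notMem {n : ℤ} (hn : n ∉ T.supp) : T.pr n = 0 := by
  rw [← mul_one (T.pr n), ← T.sum_pr, Finset.mul_sum]
  refine Finset.sum_eq_zero fun m hm ↦ ?_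
  rw [T.pr_mul_pr, if_neg (by rintro rfl; exact hn hm)]

lemma pr_pr (m n : ℤ) (a : A) : T.pr m (T.pr n a) = if m = n then T.pr n a else 0 := by
  have := LinearMap.congr_fun (T.pr_mul_pr m n) a
  rw [Module.End.mul_apply] at this
  rw [this]; split_ifs <;> rfl

lemma sum_pr_apply (a : A) : ∑ n ∈ T.supp, T.pr n a = a := by
  have := LinearMap.congr_fun T.sum_pr a
  rwa [LinearMap.sum_apply] at this

/-- The elements of total degree `n` of `F[x₀, x₁] ⊗ A`. -/
def total (n : ℤ) : Submodule F (BiPoly F ⊗[F] A) :=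
  Submodule.span F {v | ∃ (j : ℤ) (s : BiPoly F) (a : A),
    hpart j s = s ∧ T.pr (n - j) a = a ∧ v = s ⊗ₜ[F] a}

variable {T}

lemma tmul_mem_total {j n : ℤ} {s : BiPoly F} {a : A} (hs : hpart j s = s)
    (ha : T.pr n a = a) : s ⊗ₜ[F] a ∈ T.total (j + n) :=
  Submodule.subset_span ⟨j, s, a, hs, by rwa [add_sub_cancel_left], rfl⟩

lemma one_tmul_mem_total {n : ℤ} {a : A} (ha : T.pr n a = a) : (1 : BiPoly F) ⊗ₜ[F] a ∈ T.total n := by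
  have h1 : hpart 0 (1 : BiPoly F) = 1 := by
    simpa using hpart_of_isHomogeneous (MvPolynomial.isHomogeneous_one (Fin 2) F) 0
  simpa using tmul_mem_total h1 ha

lemma bc_mem_total {f : Module.End F A} {e : ℤ} (hf : ∀ n, f * T.pr n = T.pr (n + e) * f) {n : ℤ}
    {v : BiPoly F ⊗[F] A} (hv : v ∈ T.total n) : bc f v ∈ T.total (n + e) := by
  induction hv using Submodule.span_induction with
  | mem v hv =>
    obtain ⟨j, s, a, hs, ha, rfl⟩ := hv
    rw [bc_tmul]
    have : T.pr (n - j + e) (f a) = f a := by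
      conv_rhs => rw [← ha]
      exact (LinearMap.congr_fun (hf (n - j)) a).symm
    have h2 := tmul_mem_total hs this
    rwa [show j + (n - j + e) = n + e by ring] at h2
  | zero => rw [map_zero]; exact zero_mem _
  | add x y _ _ hx hy => rw [map_add]; exact add_mem hx hy
  | smul c x _ hx =>
    rw [← IsScalarTower.algebraMap_smul (BiPoly F) c x, map_smul, IsScalarTower.algebraMap_smul]
    exact Submodule.smul_mem _ c hx

lemma X_smul_mem_total (i : Fin 2) {n : ℤ} {v : BiPoly F ⊗[F] A} (hv : v ∈ T.total n) :
    (X i : BiPoly F) • v ∈ T.total (n + 1) := by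
  induction hv using Submodule.span_induction with
  | mem v hv =>
    obtain ⟨j, s, a, hs, ha, rfl⟩ := hv
    rw [TensorProduct.smul_tmul']
    have h1 : hpart (j + 1) ((X i : BiPoly F) • s) = (X i : BiPoly F) • s := by
      rw [smul_eq_mul, hpart_X_mul, add_sub_cancel_right, hs]
    have h2 := tmul_mem_total h1 ha
    rwa [show j + 1 + (n - j) = n + 1 by ring] at h2
  | zero => rw [smul_zero]; exact zero_mem _
  | add x y _ _ hx hy => rw [smul_add]; exact add_mem hx hy
  | smul c x _ hx => rw [smul_comm]; exact Submodule.smul_mem _ c hx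

lemma twist_mem_total {n : ℤ} {v : BiPoly F ⊗[F] A} (hv : v ∈ T.total n) :
    T.twist v ∈ T.total (n + 1) := by
  have h : ∀ i, bc (T.w i) v ∈ T.total n := fun i ↦ by
    simpa using bc_mem_total (e := 0) (fun n ↦ by rw [add_zero, T.w_mul_pr]) hv
  exact add_mem (X_smul_mem_total 0 (h 0)) (X_smul_mem_total 1 (h 1))

lemma D_mem_total {n : ℤ} {v : BiPoly F ⊗[F] A} (hv : v ∈ T.total n) :
    T.D v ∈ T.total (n + 1) :=
  add_mem (bc_mem_total T.d_mul_pr hv) (twist_mem_total hv)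

lemma twist_mul_bc_pr (n : ℤ) : T.twist * bc (T.pr n) = bc (T.pr n) * T.twist := by
  simp only [twist, add_mul, mul_add, smul_mul_assoc, mul_smul_comm, ← map_mul, T.w_mul_pr]

variable (T)

/-- A graded generalized inverse of the differential of square zero. -/
lemma exists_generalized_inverse : ∃ h : Module.End F A,
    (∀ n, h * T.pr n = T.pr (n - 1) * h) ∧ h * h = 0 ∧ h * T.d * h = h ∧ T.d * h * T.d = T.d := by
  -- An ungraded linear section of `d` over its range, extended to `A`, gives `d g₀ d = d`. The
  -- remaining steps correct it.
  obtain ⟨s, hs⟩ := LinearMap.exists_rightInverse_of_surjective T.d.rangeRestrict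
    T.d.range_rangeRestrict
  obtain ⟨g₀, hg₀⟩ := LinearMap.exists_extend s
  have hd₀ : T.d * g₀ * T.d = T.d := by
    ext a
    have h1 : g₀ (T.d a) = s (T.d.rangeRestrict a) := by rw [← hg₀]; rfl
    have h2 := congrArg Subtype.val (LinearMap.congr_fun hs (T.d.rangeRestrict a))
    rw [Module.End.mul_apply, Module.End.mul_apply, h1]
    exact h2
  -- The component of `g₀` of degree `-1`; since `d` is homogeneous, `d g d = d` persists.
  set g : Module.End F A := ∑ n ∈ T.supp, T.pr n * g₀ * T.pr (n + 1) with hg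
  have hgl : ∀ n, T.pr n * g = T.pr n * g₀ * T.pr (n + 1) := by
    intro n
    by_cases hn : n ∈ T.supp
    · rw [hg, Finset.mul_sum, Finset.sum_eq_single n]
      · rw [← mul_assoc, ← mul_assoc, T.pr_mul_pr, if_pos rfl]
      · intro m _ hm
        rw [← mul_assoc, ← mul_assoc, T.pr_mul_pr, if_neg hm.symm, zero_mul, zero_mul]
      · exact fun h ↦ absurd hn h
    · rw [T.pr_of_notMem hn]; simp
  have hgr : ∀ n, g * T.pr n = T.pr (n - 1) * g := by
    intro n
    rw [hgl, sub_add_cancel, hg, Finset.sum_mul]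
    by_cases hn : n - 1 ∈ T.supp
    · rw [Finset.sum_eq_single (n - 1)]
      · rw [mul_assoc, T.pr_mul_pr, if_pos (by ring)]
      · intro m _ hm
        rw [mul_assoc, T.pr_mul_pr, if_neg (by lia), mul_zero]
      · exact fun h ↦ absurd hn h
    · rw [T.pr_of_notMem hn]
      simp only [zero_mul]
      refine Finset.sum_eq_zero fun m hm ↦ ?_
      rw [mul_assoc, T.pr_mul_pr, if_neg, mul_zero]
      rintro rfl
      exact hn (by simpa using hm)
  have dgd : T.d * g * T.d = T.d := by
    have key : ∀ n, T.d * g * T.d * T.pr n = T.d * T.pr n := by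
      intro n
      calc _ = T.d * g * (T.d * T.pr n) := by noncomm_ring
        _ = T.d * (g * T.pr (n + 1)) * T.d := by rw [T.d_mul_pr]; noncomm_ring
        _ = T.d * (T.pr n * g₀ * T.pr (n + 1)) * T.d := by
          rw [hgr, add_sub_cancel_right, hgl]
        _ = (T.d * T.pr n) * g₀ * (T.pr (n + 1) * T.d) := by noncomm_ring
        _ = T.pr (n + 1) * (T.d * g₀ * T.d) * T.pr n := by
          rw [T.d_mul_pr n]; nth_rewrite 2 [← T.d_mul_pr n]; noncomm_ring
        _ = T.d * T.pr n := by
          rw [hd₀, ← T.d_mul_pr, mul_assoc, T.pr_mul_pr, if_pos rfl]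
    calc _ = ∑ n ∈ T.supp, T.d * g * T.d * T.pr n := by rw [← Finset.mul_sum, T.sum_pr, mul_one]
      _ = ∑ n ∈ T.supp, T.d * T.pr n := Finset.sum_congr rfl fun n _ ↦ key n
      _ = T.d := by rw [← Finset.mul_sum, T.sum_pr, mul_one]
  -- The usual passage from `dgd = d` to a reflexive inverse, with also `g₁ d g₁ = g₁`.
  set g₁ := g * T.d * g with hg₁
  have h1 : g₁ * T.d * g₁ = g₁ := by
    calc _ = g * (T.d * g * T.d) * g * T.d * g := by rw [hg₁]; noncomm_ring
      _ = g * T.d * g * T.d * g := by rw [dgd]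
      _ = g * (T.d * g * T.d) * g := by noncomm_ring
      _ = _ := by rw [dgd]
  have h2 : T.d * g₁ * T.d = T.d := by
    calc _ = (T.d * g * T.d) * g * T.d := by rw [hg₁]; noncomm_ring
      _ = _ := by rw [dgd, dgd]
  have h3 : ∀ n, g₁ * T.pr n = T.pr (n - 1) * g₁ := by
    intro n
    calc _ = g * T.d * (g * T.pr n) := by rw [hg₁]; noncomm_ring
      _ = g * (T.d * T.pr (n - 1)) * g := by rw [hgr]; noncomm_ring
      _ = (g * T.pr n) * T.d * g := by rw [T.d_mul_pr, sub_add_cancel]; noncomm_ring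
      _ = _ := by rw [hgr, hg₁]; noncomm_ring
  -- The factor `1 - d g₁` forces square zero: the square contains `(g₁ - g₁ d g₁) = 0`. The other
  -- two identities survive because `d² = 0`.
  refine ⟨(1 - T.d * g₁) * g₁, fun n ↦ ?_, ?_, ?_, ?_⟩
  · calc _ = (1 - T.d * g₁) * (g₁ * T.pr n) := by noncomm_ring
      _ = (T.pr (n - 1) - T.d * (g₁ * T.pr (n - 1))) * g₁ := by rw [h3]; noncomm_ring
      _ = (T.pr (n - 1) - T.d * T.pr (n - 1 - 1) * g₁) * g₁ := by rw [h3 (n - 1)]; noncomm_ring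
      _ = _ := by rw [T.d_mul_pr, sub_add_cancel]; noncomm_ring
  · calc _ = (1 - T.d * g₁) * (g₁ - g₁ * T.d * g₁) * g₁ := by noncomm_ring
      _ = 0 := by rw [h1]; noncomm_ring
  · calc _ = (1 - T.d * g₁) * (g₁ * T.d * g₁ - g₁ * (T.d * T.d) * g₁ * g₁) := by noncomm_ring
      _ = _ := by rw [h1, T.d_mul_d]; noncomm_ring
  · calc _ = (T.d * g₁ * T.d) - (T.d * T.d) * g₁ * g₁ * T.d := by noncomm_ring
      _ = _ := by rw [h2, T.d_mul_d]; noncomm_ring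

end ExteriorComplex
end

/-! ### Triangular differentials of rank four and the minimal retract -/

noncomputable section

open scoped TensorProduct
open MvPolynomial (X C constantCoeff)

/-- A strictly upper triangular `4 × 4` differential with entries in the maximal ideal and with
homology supported at the origin is a Koszul complex up to its corner entry. -/
lemma koszul_of_triangular {F : Type u} [Field F] [CharP F 2] {a b c d e f : BiPoly F} {q : ℕ}
    (ha : constantCoeff a = 0) (hb : constantCoeff b = 0)
    (hc : constantCoeff c = 0)
    (h₁ : a * d = 0) (h₂ : a * e + b * f = 0) (h₃ : d * f = 0)
    (htor : ∀ v₀ v₁ v₂ v₃ : BiPoly F, a * v₁ + b * v₂ + c * v₃ = 0 → d * v₂ + e * v₃ = 0 →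
      f * v₃ = 0 → ∀ i, ∃ y₁ y₂ y₃ : BiPoly F, X i ^ q * v₀ = a * y₁ + b * y₂ + c * y₃ ∧
        X i ^ q * v₁ = d * y₂ + e * y₃ ∧ X i ^ q * v₂ = f * y₃) :
    d = 0 ∧ (∀ i, (X i : BiPoly F) ^ q ∈ Ideal.span {a, b}) ∧ b ≠ 0 ∧
      ∃ u, IsUnit u ∧ e = u * b ∧ f = u * a := by
  have hX : ∀ (i : Fin 2) (n : ℕ), (X i : BiPoly F) ^ n ≠ 0 := fun i n ↦
    pow_ne_zero _ (MvPolynomial.X_ne_zero i)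
  -- If `d ≠ 0`, then `a = f = 0`, so the first two basis vectors are cycles and all boundaries lie
  -- in their span. Torsion of both makes the minor `be - cd` divide powers of both variables, hence
  -- a unit, although it lies in the maximal ideal.
  have hd0 : d = 0 := by
    by_contra hd0
    have ha0 : a = 0 := (mul_eq_zero.1 h₁).resolve_right hd0
    have hf0 : f = 0 := (mul_eq_zero.1 h₃).resolve_left hd0
    have key : ∀ i, (b * e - c * d) ∣ X i ^ (2 * q) := by
      intro i
      obtain ⟨y₁, y₂, y₃, hy₁, hy₂, -⟩ := htor 1 0 0 0 (by simp) (by simp) (by simp) i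
      obtain ⟨z₁, z₂, z₃, hz₁, hz₂, -⟩ := htor 0 1 0 0 (by simp [ha0]) (by simp) (by simp) i
      refine ⟨y₂ * z₃ - y₃ * z₂, ?_⟩
      rw [ha0] at hy₁ hz₁
      rw [two_mul, pow_add]
      linear_combination X i ^ q * hy₁ + (b * y₂ + c * y₃) * hz₂ - (b * z₂ + c * z₃) * hy₂
    refine not_isUnit_of_constantCoeff ?_ (isUnit_of_dvd_X_pow (key 0) (key 1))
    rw [map_sub, map_mul, map_mul, hb, hc, zero_mul, zero_mul, sub_zero]
  -- The first basis vector is a torsion cycle. Either the coefficient `y₃` vanishes and the claim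
  -- is read off, or `e = f = 0`. In the second case the cycle `(0, b, -a, 0)` could not be torsion
  -- unless `a = b = 0`, and then the second basis vector is a non-torsion cycle.
  have hspan : ∀ i, (X i : BiPoly F) ^ q ∈ Ideal.span {a, b} := by
    intro i
    obtain ⟨y₁, y₂, y₃, hy₁, hy₂, hy₃⟩ := htor 1 0 0 0 (by simp) (by simp) (by simp) i
    rw [hd0] at hy₂
    by_cases hy0 : y₃ = 0
    · rw [hy0] at hy₁
      rw [Ideal.mem_span_pair]
      exact ⟨y₁, y₂, by linear_combination -hy₁⟩
    · exfalso
      have he0 : e = 0 := by simpa [hy0] using hy₂.symm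
      have hf0 : f = 0 := by simpa [hy0] using hy₃.symm
      obtain ⟨z₁, z₂, z₃, -, hz₂, hz₃⟩ := htor 0 b (-a) 0 (by ring) (by simp [hd0]) (by simp) i
      rw [hd0, he0] at hz₂
      rw [hf0] at hz₃
      have hb0 : b = 0 := by simpa [hX] using hz₂
      have ha0 : a = 0 := by simpa [hX] using hz₃
      obtain ⟨z₁, z₂, z₃, -, hz₂, -⟩ := htor 0 1 0 0 (by simp [ha0]) (by simp) (by simp) i
      rw [hd0, he0] at hz₂
      exact hX i q (by simp at hz₂)
  have hrel := isRelPrime_of_X_pow hspan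
  have hb0 : b ≠ 0 := by
    rintro rfl
    exact not_isUnit_of_constantCoeff ha (hrel dvd_rfl (dvd_zero a))
  have hsign : b * f = -(b * f) := (neg_eq_of_charTwo F _).symm
  -- In characteristic 2 the relation `ae + bf = 0` says that `(e, f)` is a syzygy of `(a, b)`,
  -- hence `k` times `(b, a)`.
  obtain ⟨k, hk₁, hk₂⟩ := exists_common_multiple (p := e) (q := f) hb0 hrel
    (by linear_combination h₂ - hsign)
  refine ⟨hd0, hspan, hb0, k, ?_, by rw [hk₁, mul_comm], by rw [hk₂, mul_comm]⟩
  -- The Koszul cycle `(0, b, -a, 0)` is torsion, and only the last basis vector can bound it. This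
  -- bounds `k` by powers of both variables.
  have key : ∀ i, k ∣ X i ^ q := by
    intro i
    obtain ⟨y₁, y₂, y₃, -, hy₂, -⟩ := htor 0 b (-a) 0 (by ring) (by simp [hd0]) (by simp) i
    refine ⟨y₃, mul_right_cancel₀ hb0 ?_⟩
    rw [hy₂, hd0, hk₁]; ring
  exact isUnit_of_dvd_X_pow (key 0) (key 1)

lemma one_add_mul_geom_sum {R : Type*} [Ring R] {y : R} {k : ℕ} (hk : y ^ k = 0) :
    (1 + y) * ∑ i ∈ Finset.range k, (-y) ^ i = 1 ∧
      (∑ i ∈ Finset.range k, (-y) ^ i) * (1 + y) = 1 := by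
  have h1 := mul_neg_geom_sum (-y) k
  have h2 := geom_sum_mul_neg (-y) k
  rw [sub_neg_eq_add, neg_pow y k, hk, mul_zero, sub_zero] at h1 h2
  exact ⟨h1, h2⟩

namespace ExteriorComplex

variable {F : Type u} {A : Type v} [Field F] [AddCommGroup A] [Module F A]
variable (T : ExteriorComplex F A)

lemma bc_mem_baseChange {f : Module.End F A} {U V : Submodule F A} (h : ∀ a ∈ U, f a ∈ V)
    {v : BiPoly F ⊗[F] A} (hv : v ∈ U.baseChange (BiPoly F)) :
    bc f v ∈ V.baseChange (BiPoly F) := by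
  rw [Submodule.baseChange_eq_span] at hv
  induction hv using Submodule.span_induction with
  | mem v hv =>
    obtain ⟨a, ha, rfl⟩ := hv
    exact Submodule.tmul_mem_baseChange_of_mem _ (h a ha)
  | zero => rw [map_zero]; exact zero_mem _
  | add x y _ _ hx hy => rw [map_add]; exact add_mem hx hy
  | smul c x _ hx => rw [map_smul]; exact Submodule.smul_mem _ c hx

lemma bc_zero : bc (0 : Module.End F A) = 0 := LinearMap.baseChange_zero

lemma bc_one : bc (1 : Module.End F A) = 1 := LinearMap.baseChange_id

lemma bc_mul (f g : Module.End F A) : bc (f * g) = bc f * bc g := LinearMap.baseChange_mul _ _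

lemma bc_sub (f g : Module.End F A) : bc (f - g) = bc f - bc g := LinearMap.baseChange_sub _ _

/-- The part of degree at most `n`. -/
def lowPart (n : ℤ) : Submodule F A := ⨅ m : {m : ℤ // n < m}, LinearMap.ker (T.pr m)

variable {T} in
lemma mem_lowPart {n : ℤ} {a : A} : a ∈ T.lowPart n ↔ ∀ m, n < m → T.pr m a = 0 := by
  simp [lowPart, Submodule.mem_iInf]

lemma map_lowPart {f : Module.End F A} {e : ℤ} (hf : ∀ n, f * T.pr n = T.pr (n + e) * f) {n : ℤ}
    {a : A} (ha : a ∈ T.lowPart n) : f a ∈ T.lowPart (n + e) := by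
  rw [mem_lowPart] at ha ⊢
  intro m hm
  have := LinearMap.congr_fun (hf (m - e)) a
  rw [sub_add_cancel] at this
  change f (T.pr (m - e) a) = T.pr m (f a) at this
  rw [← this, ha _ (by lia), map_zero]

lemma twist_mem_baseChange {U : Submodule F A} (h : ∀ i, ∀ a ∈ U, T.w i a ∈ U)
    {v : BiPoly F ⊗[F] A} (hv : v ∈ U.baseChange (BiPoly F)) :
    T.twist v ∈ U.baseChange (BiPoly F) :=
  add_mem (Submodule.smul_mem _ _ (bc_mem_baseChange (h 0) hv))
    (Submodule.smul_mem _ _ (bc_mem_baseChange (h 1) hv))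

/-- A retract of `(F[x₀, x₁] ⊗ A, D)` onto a minimal twisted complex on the homology of `A`. -/
structure MinimalRetract where
  /-- the projection onto the homology of `A` -/
  π : Module.End F A
  /-- the projection of the twisted complex -/
  P : Module.End (BiPoly F) (BiPoly F ⊗[F] A)
  /-- the contraction of the kernel of `P` -/
  g : Module.End (BiPoly F) (BiPoly F ⊗[F] A)
  π_mul_π : π * π = π
  π_mul_pr (n : ℤ) : π * T.pr n = T.pr n * π
  d_mul_π : T.d * π = 0
  π_mul_d : π * T.d = 0
  -- The operators `π wᵢ` on the range of `π` model the action of the `wᵢ` on homology, so there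
  -- they inherit square zero and commutativity.
  π_w (i j : Fin 2) (a : A) (ha : π a = a) : π (T.w i (π (T.w j a))) = π (T.w i (T.w j a))
  eq_d (a : A) (ha : T.d a = 0) (hπ : π a = 0) : ∃ b, a = T.d b
  finrank_π [FiniteDimensional F A] : Module.finrank F (LinearMap.ker T.d) =
    Module.finrank F (LinearMap.range T.d) + Module.finrank F (LinearMap.range π)
  P_mul_D : P * T.D = P * T.D * bc π * P
  P_mul_π : P * bc π = bc π
  π_mul_P : bc π * P = P
  P_mul_g : P * g = 0
  eq_D_g (v : BiPoly F ⊗[F] A) (hP : P v = 0) (hD : T.D v = 0) : v = T.D (g v)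
  P_mem {n : ℤ} {v : BiPoly F ⊗[F] A} (hv : v ∈ T.total n) : P v ∈ T.total n
  g_mem {n : ℤ} {v : BiPoly F ⊗[F] A} (hv : v ∈ T.total n) : g v ∈ T.total (n - 1)
  -- Here `U` contains everything of lower degree in the range of `π` together with the first-order
  -- terms `π wᵢ a`; this alone controls the full perturbed differential of `a`.
  triangular (a : A) (n : ℤ) (ha : π a = a) (hn : T.pr n a = a) (U : Submodule F A)
    (hw : ∀ i, π (T.w i a) ∈ U) (hU : ∀ m < n, ∀ b, π b = b → T.pr m b = b → b ∈ U) :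
    P (T.D (1 ⊗ₜ a)) ∈ U.baseChange (BiPoly F)

variable [CharP F 2]

/-- The perturbation lemma for `d` perturbed by the twist `τ`, with a graded generalized inverse `h`
of `d`: `π = 1 - dh - hd`, `P = π(1 + τh)⁻¹` and `g = h(1 + τh)⁻¹`. -/
lemma nonempty_minimalRetract : Nonempty T.MinimalRetract := by
  obtain ⟨h, hpr, hh, hdh, dhd⟩ := T.exists_generalized_inverse
  have dd := T.d_mul_d
  set π : Module.End F A := 1 - T.d * h - h * T.d with hπ
  have hbπ : bc π = 1 - bc T.d * bc h - bc h * bc T.d := by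
    rw [hπ, bc_sub, bc_sub, bc_one, bc_mul, bc_mul]
  have bhh : bc h * bc h = 0 := by rw [← bc_mul, hh, bc_zero]
  have bdd : bc T.d * bc T.d = 0 := by rw [← bc_mul, dd, bc_zero]
  have bhdh : bc h * bc T.d * bc h = bc h := by rw [← bc_mul, ← bc_mul, hdh]
  have bdhd : bc T.d * bc h * bc T.d = bc T.d := by rw [← bc_mul, ← bc_mul, dhd]
  set Y := T.twist * bc h with hY
  -- The twist preserves the grading of `A` and `h` lowers it by one. As the grading is bounded, `1
  -- + τh` is invertible by a finite geometric sum.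
  have hYnil : IsNilpotent Y := by
    refine isNilpotent_of_shift (p := fun n ↦ bc (T.pr n)) (s := T.supp) (e := -1) ?_ ?_ (by lia) ?_
    · rw [← map_sum, T.sum_pr]; exact bc_one
    · exact fun n hn ↦ by rw [T.pr_of_notMem hn, bc_zero]
    · intro n
      rw [hY, mul_assoc, ← bc_mul, hpr, bc_mul, ← mul_assoc, twist_mul_bc_pr, mul_assoc]; rfl
  obtain ⟨k, hk⟩ := hYnil
  set Ti := ∑ i ∈ Finset.range k, (-Y) ^ i with hTi
  obtain ⟨hT, hT'⟩ : (1 + T.twist * bc h) * Ti = 1 ∧ Ti * (1 + T.twist * bc h) = 1 :=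
    one_add_mul_geom_sum (R := Module.End (BiPoly F) (BiPoly F ⊗[F] A)) hk
  have hDD : (bc T.d + T.twist) * (bc T.d + T.twist) = 0 := T.D_mul_D
  have dπ : T.d * π = 0 := by
    calc _ = T.d - (T.d * T.d) * h - T.d * h * T.d := by rw [hπ]; noncomm_ring
      _ = 0 := by rw [dd, dhd]; noncomm_ring
  have πd : π * T.d = 0 := by
    calc _ = T.d - T.d * h * T.d - h * (T.d * T.d) := by rw [hπ]; noncomm_ring
      _ = 0 := by rw [dd, dhd]; noncomm_ring
  have πpr : ∀ n, π * T.pr n = T.pr n * π := by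
    intro n
    have e1 : T.d * h * T.pr n = T.pr n * (T.d * h) := by
      rw [mul_assoc, hpr, ← mul_assoc, T.d_mul_pr, sub_add_cancel, mul_assoc]
    have e2 : h * T.d * T.pr n = T.pr n * (h * T.d) := by
      rw [mul_assoc, T.d_mul_pr, ← mul_assoc, hpr, add_sub_cancel_right, mul_assoc]
    rw [hπ, sub_mul, sub_mul, e1, e2]; noncomm_ring
  have πa : ∀ a, π a = a - T.d (h a) - h (T.d a) := fun a ↦ rfl
  have ππ : π * π = π := proj_mul_proj hh hdh dhd dd
  have dπa : ∀ a, T.d (π a) = 0 := fun a ↦ LinearMap.congr_fun dπ a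
  have πda : ∀ a, π (T.d a) = 0 := fun a ↦ LinearMap.congr_fun πd a
  have hYtot : ∀ {n : ℤ} {v : BiPoly F ⊗[F] A}, v ∈ T.total n → Y v ∈ T.total n := by
    intro n v hv
    have := T.twist_mem_total (bc_mem_total (e := -1) hpr hv)
    rwa [neg_add_cancel_right] at this
  have hYpow : ∀ (V : Submodule F (BiPoly F ⊗[F] A)), (∀ v ∈ V, Y v ∈ V) → ∀ v ∈ V, Ti v ∈ V := by
    intro V hV v hv
    rw [hTi, LinearMap.sum_apply]
    refine Submodule.sum_mem _ fun i hi ↦ ?_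
    clear hi
    induction i with
    | zero => simpa using hv
    | succ i ih =>
      rw [pow_succ', Module.End.mul_apply, LinearMap.neg_apply]
      exact neg_mem (hV _ ih)
  have hTitot : ∀ {n : ℤ} {v : BiPoly F ⊗[F] A}, v ∈ T.total n → Ti v ∈ T.total n :=
    fun hv ↦ hYpow _ (fun _ ↦ hYtot) _ hv
  refine ⟨⟨π, bc π * Ti, bc h * Ti, ππ, πpr, dπ, πd, ?_, ?_, ?_, ?_, ?_, ?_, ?_, ?_, ?_, ?_, ?_⟩⟩
  -- For a cycle, `π` subtracts a boundary. Boundaries stay boundaries under `wᵢ`, and `π` kills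
  -- them.
  · intro i j a ha
    have hwd : ∀ i b, T.w i (T.d b) = T.d (T.w i b) := fun i b ↦
      (LinearMap.congr_fun (T.d_mul_w i) b).symm
    have h1 : T.d (T.w j a) = 0 := by rw [← ha, ← hwd, dπa, map_zero]
    rw [πa (T.w j a), h1, map_zero, sub_zero, map_sub, map_sub, hwd, πda, sub_zero]
  · intro a ha hpa
    refine ⟨h a, ?_⟩
    rw [πa, ha, map_zero, sub_zero, sub_eq_zero] at hpa
    exact hpa
  · intro _
    have hsup : LinearMap.ker T.d = LinearMap.range T.d ⊔ LinearMap.range π := by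
      apply le_antisymm
      · intro a ha
        have ha' : T.d a = 0 := ha
        have : a = T.d (h a) + π a := by rw [πa, ha', map_zero]; abel
        rw [this]
        exact Submodule.add_mem_sup ⟨_, rfl⟩ ⟨_, rfl⟩
      · rw [sup_le_iff]
        refine ⟨?_, ?_⟩
        · rintro _ ⟨b, rfl⟩; exact LinearMap.congr_fun dd b
        · rintro _ ⟨b, rfl⟩; exact dπa b
    have hinf : LinearMap.range T.d ⊓ LinearMap.range π = ⊥ := by
      rw [eq_bot_iff]
      rintro _ ⟨⟨b, rfl⟩, ⟨c, hc⟩⟩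
      have : π (T.d b) = T.d b := by
        rw [← hc]; exact LinearMap.congr_fun ππ c
      rw [πda] at this
      exact this.symm
    have := Submodule.finrank_sup_add_finrank_inf_eq (LinearMap.range T.d) (LinearMap.range π)
    rw [hinf, finrank_bot, add_zero, ← hsup] at this
    exact this
  · have := perturbation_aux (R := Module.End (BiPoly F) (BiPoly F ⊗[F] A)) bhh bhdh hDD hT hT' bdhd bdd
    rw [← hbπ] at this
    rw [← mul_assoc, mul_assoc _ (bc π) (bc π), ← bc_mul, ππ]
    exact this
  · have := inv_mul_proj (R := Module.End (BiPoly F) (BiPoly F ⊗[F] A)) bhh bhdh hT'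
    rw [← hbπ] at this
    rw [mul_assoc, this, ← bc_mul, ππ]
  · rw [← mul_assoc, ← bc_mul, ππ]
  · have := proj_mul_inv_mul (R := Module.End (BiPoly F) (BiPoly F ⊗[F] A)) bhh bhdh hT'
    rw [← hbπ] at this
    rw [← mul_assoc, this, zero_mul]
  · intro v hP hD
    rw [hbπ] at hP
    exact exists_eq_of_proj_eq_zero bhdh bhh hDD hT hT' bdhd v hP hD
  · intro n v hv
    have := bc_mem_total (e := 0) (fun n ↦ by rw [add_zero, πpr]) (hTitot hv)
    rwa [add_zero] at this
  · intro n v hv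
    exact bc_mem_total (e := -1) hpr (hTitot hv)
  · intro a n ha hn U hw hU
    have hda : T.d a = 0 := by rw [← ha, dπa]
    have hD1 : T.D (1 ⊗ₜ a) = T.twist (1 ⊗ₜ a) := by
      rw [T.D_tmul, hda, TensorProduct.tmul_zero, zero_add]; rfl
    have hlow : a ∈ T.lowPart n := by
      rw [mem_lowPart]
      intro m hm
      rw [← hn, T.pr_pr, if_neg (by lia)]
    have hwlow : ∀ m i, ∀ b ∈ T.lowPart m, T.w i b ∈ T.lowPart m := by
      intro m i b hb
      have := T.map_lowPart (e := 0) (fun n ↦ by rw [add_zero, T.w_mul_pr i]) hb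
      rwa [add_zero] at this
    have hhlow : ∀ m, ∀ b ∈ T.lowPart m, h b ∈ T.lowPart (m - 1) := fun m b hb ↦
      T.map_lowPart (e := -1) hpr hb
    have hlow1 : ∀ m, T.lowPart (m - 1) ≤ T.lowPart m := by
      intro m b hb
      rw [mem_lowPart] at hb ⊢
      exact fun k hk ↦ hb k (by lia)
    rw [hD1]
    set y := Ti (T.twist (1 ⊗ₜ a)) with hy
    have hymem : y ∈ (T.lowPart n).baseChange (BiPoly F) := by
      refine hYpow (((T.lowPart n).baseChange (BiPoly F)).restrictScalars F) ?_ _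
        (T.twist_mem_baseChange (hwlow n) (Submodule.tmul_mem_baseChange_of_mem _ hlow))
      intro v hv
      exact T.twist_mem_baseChange (hwlow n)
        (Submodule.baseChange_mono _ (hlow1 n) (bc_mem_baseChange (hhlow n) hv))
    -- The first-order term is `Σ xᵢ ⊗ π wᵢ a`, which is in `U` by assumption. The remainder passes
    -- through `h`, so it lies in degrees below `n`, where `U` contains everything.
    have hy2 : y = T.twist (1 ⊗ₜ a) - T.twist (bc h y) := by
      have := LinearMap.congr_fun hT (T.twist (1 ⊗ₜ a))
      change y + T.twist (bc h y) = T.twist (1 ⊗ₜ a) at this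
      rw [← this]; abel
    change bc π y ∈ _
    rw [hy2, map_sub]
    refine sub_mem ?_ ?_
    · change (X 0 : BiPoly F) • (1 : BiPoly F) ⊗ₜ[F] π (T.w 0 a) +
        (X 1 : BiPoly F) • (1 : BiPoly F) ⊗ₜ[F] π (T.w 1 a) ∈ _
      exact add_mem (Submodule.smul_mem _ _ (Submodule.tmul_mem_baseChange_of_mem _ (hw 0)))
        (Submodule.smul_mem _ _ (Submodule.tmul_mem_baseChange_of_mem _ (hw 1)))
    · refine bc_mem_baseChange (U := T.lowPart (n - 1)) ?_
        (T.twist_mem_baseChange (hwlow (n - 1)) (bc_mem_baseChange (hhlow n) hymem))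
      intro b hb
      rw [mem_lowPart] at hb
      rw [← T.sum_pr_apply b, map_sum]
      refine Submodule.sum_mem _ fun m _ ↦ ?_
      rcases lt_or_ge m n with hm | hm
      · refine hU m hm _ (LinearMap.congr_fun ππ _) ?_
        have := LinearMap.congr_fun (πpr m) (T.pr m b)
        change π (T.pr m (T.pr m b)) = T.pr m (π (T.pr m b)) at this
        rw [← this, T.pr_pr, if_pos rfl]
      · rw [hb m (by lia), map_zero]; exact zero_mem _

end ExteriorComplex
end

/-! ### Socle filtrations of the homology and cyclic comparisons -/

noncomputable section

open scoped TensorProduct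
open MvPolynomial (X C constantCoeff)

section

variable {F : Type u} [Field F]

lemma finite_quotient_of_X_pow_mem {J : Ideal (BiPoly F)} {q : ℕ}
    (h : ∀ i, (X i : BiPoly F) ^ q ∈ J) : Module.Finite F (BiPoly F ⧸ J) := by
  set s : Set (Fin 2 →₀ ℕ) := {m | ∀ i, m i < q} with hs
  have hfin : s.Finite := by
    refine Set.Finite.subset (Set.finite_Iic (Finsupp.equivFunOnFinite.symm fun _ : Fin 2 ↦ q)) ?_
    intro m hm i
    exact (hm i).le
  refine Module.finite_def.2 ⟨(hfin.image fun m ↦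
    Ideal.Quotient.mk J (MvPolynomial.monomial m 1)).toFinset, ?_⟩
  rw [Set.Finite.coe_toFinset, eq_top_iff]
  rintro x -
  obtain ⟨p, rfl⟩ := Ideal.Quotient.mk_surjective x
  rw [p.as_sum, map_sum]
  refine Submodule.sum_mem _ fun m _ ↦ ?_
  by_cases hm : m ∈ s
  · have : MvPolynomial.monomial m (MvPolynomial.coeff m p) =
        MvPolynomial.coeff m p • MvPolynomial.monomial m (1 : F) := by
      rw [MvPolynomial.smul_monomial, smul_eq_mul, mul_one]
    rw [this]
    exact Submodule.smul_mem _ _ (Submodule.subset_span (Set.mem_image_of_mem _ hm))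
  · rw [hs, Set.mem_ofPred_eq] at hm
    push Not at hm
    obtain ⟨i, hi⟩ := hm
    have hdvd : (X i : BiPoly F) ^ q ∣ MvPolynomial.monomial m (MvPolynomial.coeff m p) := by
      rw [MvPolynomial.X_pow_eq_monomial, MvPolynomial.monomial_dvd_monomial]
      exact ⟨Or.inr (by simpa using hi), one_dvd _⟩
    rw [Ideal.Quotient.eq_zero_iff_mem.2 (Ideal.mem_of_dvd _ hdvd (h i))]
    exact zero_mem _

lemma exists_isHomogeneous_of_hpart {f : BiPoly F} {k : ℤ} (hf : hpart k f = f) (h0 : f ≠ 0)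
    (hc : constantCoeff f = 0) : ∃ n : ℕ, k = n ∧ 0 < n ∧ f.IsHomogeneous n := by
  rcases lt_or_ge k 0 with hk | hk
  · exact absurd (by rw [← hf, hpart_of_neg hk]) h0
  · lift k to ℕ using hk
    have hh := isHomogeneous_iff_hpart.2 hf
    refine ⟨k, rfl, Nat.pos_of_ne_zero ?_, hh⟩
    rintro rfl
    rw [Nat.cast_zero, show (0 : ℤ) = ((0 : ℕ) : ℤ) from rfl, hpart_natCast,
      MvPolynomial.homogeneousComponent_zero, ← MvPolynomial.constantCoeff_eq, hc, map_zero] at hf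
    exact h0 hf.symm

end

namespace ExteriorComplex

variable {F : Type u} {A : Type v} [Field F] [AddCommGroup A] [Module F A]
variable {T : ExteriorComplex F A}

namespace MinimalRetract

variable (R : T.MinimalRetract)

/-- In the lowest degree where the range of `π` is not contained in `U`, the two commuting
square-zero operators `π wᵢ` act modulo `U`, so they have a common null vector outside `U`. It
serves as the next vector of a triangular basis. -/
lemma exists_socle_mem {U : Submodule F A} (hUw : ∀ i, ∀ a ∈ U, R.π (T.w i a) ∈ U)
    (hU : ¬ LinearMap.range R.π ≤ U) : ∃ (e : A) (n : ℤ), R.π e = e ∧ T.pr n e = e ∧ e ∉ U ∧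
      (∀ i, R.π (T.w i e) ∈ U) ∧ ∀ m < n, ∀ b, R.π b = b → T.pr m b = b → b ∈ U := by
  have ππ : ∀ a, R.π (R.π a) = R.π a := fun a ↦ LinearMap.congr_fun R.π_mul_π a
  have πpr : ∀ n a, R.π (T.pr n a) = T.pr n (R.π a) := fun n a ↦
    LinearMap.congr_fun (R.π_mul_pr n) a
  have wpr : ∀ i n a, T.w i (T.pr n a) = T.pr n (T.w i a) := fun i n a ↦
    LinearMap.congr_fun (T.w_mul_pr i n) a
  obtain ⟨n, ⟨v, hv, hvn, hvU⟩, hmin⟩ : ∃ n, (∃ b, R.π b = b ∧ T.pr n b = b ∧ b ∉ U) ∧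
      ∀ m < n, ∀ b, R.π b = b → T.pr m b = b → b ∈ U := by
    classical
    set s := T.supp.filter fun n ↦ ∃ b, R.π b = b ∧ T.pr n b = b ∧ b ∉ U with hs
    have hne : s.Nonempty := by
      by_contra hcon
      rw [Finset.not_nonempty_iff_eq_empty] at hcon
      refine hU ?_
      rintro _ ⟨a, rfl⟩
      rw [← T.sum_pr_apply (R.π a)]
      refine Submodule.sum_mem _ fun n hn ↦ ?_
      by_contra hnot
      have : n ∈ s := by
        rw [hs, Finset.mem_filter]
        exact ⟨hn, T.pr n (R.π a), by rw [πpr, ππ], by rw [T.pr_pr, if_pos rfl], hnot⟩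
      rw [hcon] at this
      simp at this
    obtain ⟨n, hn, hle⟩ := Finset.exists_min_image s id hne
    refine ⟨n, (Finset.mem_filter.1 hn).2, fun m hm b hb hbm ↦ ?_⟩
    by_contra hnot
    have hmem : m ∈ T.supp := by
      by_contra hm'
      rw [T.pr_of_notMem hm'] at hbm
      exact hnot (by rw [← hbm]; exact zero_mem _)
    exact absurd (hle m (Finset.mem_filter.2 ⟨hmem, b, hb, hbm, hnot⟩)) (not_le.2 hm)
  have step : ∀ i b, R.π b = b → T.pr n b = b → R.π (R.π (T.w i b)) = R.π (T.w i b) ∧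
      T.pr n (R.π (T.w i b)) = R.π (T.w i b) := fun i b _ hbn ↦
    ⟨ππ _, by rw [← πpr, ← wpr, hbn]⟩
  have sq : ∀ i b, R.π b = b → R.π (T.w i (R.π (T.w i b))) = 0 := fun i b hb ↦ by
    have h0 : T.w i (T.w i b) = 0 := LinearMap.congr_fun (T.w_mul_w i) b
    rw [R.π_w i i b hb, h0, map_zero]
  -- If `π w₀ v` is still outside `U`, it replaces `v`, since `π w₀` kills it. The same is done for
  -- `w₁`; commutativity and stability of `U` keep the condition for `w₀`.
  obtain ⟨v', hv', hvn', hvU', h0⟩ : ∃ b, R.π b = b ∧ T.pr n b = b ∧ b ∉ U ∧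
      R.π (T.w 0 b) ∈ U := by
    by_cases h : R.π (T.w 0 v) ∈ U
    · exact ⟨v, hv, hvn, hvU, h⟩
    · exact ⟨_, (step 0 v hv hvn).1, (step 0 v hv hvn).2, h, by rw [sq 0 v hv]; exact zero_mem _⟩
  by_cases h : R.π (T.w 1 v') ∈ U
  · exact ⟨v', n, hv', hvn', hvU', Fin.forall_fin_two.2 ⟨h0, h⟩, hmin⟩
  · refine ⟨_, n, (step 1 v' hv' hvn').1, (step 1 v' hv' hvn').2, h,
      Fin.forall_fin_two.2 ⟨?_, by rw [sq 1 v' hv']; exact zero_mem _⟩, hmin⟩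
    have hc : T.w 0 (T.w 1 v') = T.w 1 (T.w 0 v') := LinearMap.congr_fun T.w_comm v'
    rw [R.π_w 0 1 v' hv', hc, ← R.π_w 1 0 v' hv']
    exact hUw 1 _ h0

/-- Each new vector is a socle vector of lowest degree modulo the span of the previous ones. These
are exactly the hypotheses of `MinimalRetract.triangular`. -/
lemma exists_triangular [FiniteDimensional F A] (k : ℕ)
    (hk : k ≤ Module.finrank F (LinearMap.range R.π)) :
    ∃ (e : ℕ → A) (n : ℕ → ℤ), LinearIndependent F (fun i : Fin k ↦ e i) ∧
      ∀ j < k, R.π (e j) = e j ∧ T.pr (n j) (e j) = e j ∧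
        (∀ i, R.π (T.w i (e j)) ∈ Submodule.span F (Set.range fun i : Fin j ↦ e i)) ∧
        ∀ m < n j, ∀ b, R.π b = b → T.pr m b = b →
          b ∈ Submodule.span F (Set.range fun i : Fin j ↦ e i) := by
  induction k with
  | zero => exact ⟨0, 0, linearIndependent_empty_type, by simp⟩
  | succ k ih =>
    obtain ⟨e, n, hli, he⟩ := ih (by lia)
    set U := Submodule.span F (Set.range fun i : Fin k ↦ e i) with hU
    have hmono : ∀ j < k, Submodule.span F (Set.range fun i : Fin j ↦ e i) ≤ U := fun j hj ↦
      Submodule.span_mono (by rintro _ ⟨i, rfl⟩; exact ⟨⟨i, by lia⟩, rfl⟩)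
    obtain ⟨x, m, hx, hxm, hxU, hxw, hmin⟩ := R.exists_socle_mem (U := U) (by
      intro i a ha
      induction ha using Submodule.span_induction with
      | mem a ha =>
        obtain ⟨j, rfl⟩ := ha
        exact hmono j j.2 ((he j j.2).2.2.1 i)
      | zero => rw [map_zero, map_zero]; exact zero_mem _
      | add x y _ _ hx hy => rw [map_add, map_add]; exact add_mem hx hy
      | smul c x _ hx => rw [map_smul, map_smul]; exact Submodule.smul_mem _ c hx) (by
      intro hle
      have h1 := Submodule.finrank_mono hle
      rw [hU, finrank_span_eq_card hli, Fintype.card_fin] at h1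
      lia)
    have hup : ∀ j ≤ k, (fun i : Fin j ↦ Function.update e k x i) = fun i : Fin j ↦ e i := by
      intro j hj
      funext i
      rw [Function.update_of_ne (by have := i.2; lia)]
    refine ⟨Function.update e k x, Function.update n k m, ?_, fun j hj ↦ ?_⟩
    · rw [linearIndependent_finSucc']
      have hinit : Fin.init (fun i : Fin (k + 1) ↦ Function.update e k x i) =
          fun i : Fin k ↦ e i := hup k le_rfl
      rw [hinit]
      refine ⟨hli, ?_⟩
      rw [Fin.val_last, Function.update_self]
      exact hxU
    · rw [hup j (by lia)]
      rcases Nat.lt_succ_iff_lt_or_eq.1 hj with hj | rfl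
      · rw [Function.update_of_ne hj.ne, Function.update_of_ne hj.ne]
        exact he j hj
      · rw [Function.update_self, Function.update_self]
        exact ⟨hx, hxm, hxw, hmin⟩

end MinimalRetract

/-- The `F[x₀, x₁]`-linear extension of a linear map to the polynomial ring. -/
def polyExt (ψ : A →ₗ[F] BiPoly F) : BiPoly F ⊗[F] A →ₗ[BiPoly F] BiPoly F :=
  ψ.liftBaseChange (BiPoly F)

lemma polyExt_tmul (ψ : A →ₗ[F] BiPoly F) (s : BiPoly F) (a : A) :
    polyExt ψ (s ⊗ₜ[F] a) = s * ψ a :=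
  LinearMap.liftBaseChange_tmul ..

lemma polyExt_mem_hpart {ψ : A →ₗ[F] BiPoly F} {l : ℤ}
    (hψ : ∀ m a, T.pr m a = a → hpart (m - l) (ψ a) = ψ a) {m : ℤ} {v : BiPoly F ⊗[F] A}
    (hv : v ∈ T.total m) : hpart (m - l) (polyExt ψ v) = polyExt ψ v := by
  induction hv using Submodule.span_induction with
  | mem v hv =>
    obtain ⟨j, s, a, hs, ha, rfl⟩ := hv
    rw [polyExt_tmul]
    rcases lt_or_ge j 0 with hj | hj
    · rw [← hs, hpart_of_neg hj, zero_mul, map_zero]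
    · lift j to ℕ using hj
      rw [hpart_mul (isHomogeneous_iff_hpart.2 hs), show m - l - j = m - j - l by ring, hψ _ _ ha]
  | zero => rw [map_zero, map_zero]
  | add x y _ _ hx hy => rw [map_add, map_add, hx, hy]
  | smul c x _ hx =>
    rw [← IsScalarTower.algebraMap_smul (BiPoly F) c x, map_smul, IsScalarTower.algebraMap_smul,
      map_smul, hx]

/-- Comparison of the homology of a twisted complex with a cyclic module `F[x₀, x₁] / J` placed in
degree `l`, along an `F[x₀, x₁]`-linear chain map. -/
structure CyclicComparison (T : ExteriorComplex F A) (l : ℤ) (J : Ideal (BiPoly F)) where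
  /-- the comparison map -/
  ψ : A →ₗ[F] BiPoly F
  hpart_ψ (m : ℤ) (a : A) (ha : T.pr m a = a) : hpart (m - l) (ψ a) = ψ a
  ψ_D (v : BiPoly F ⊗[F] A) : polyExt ψ (T.D v) ∈ J
  exists_gen : ∃ z ∈ T.total l, T.D z = 0 ∧ polyExt ψ z = 1
  exists_eq_D (v : BiPoly F ⊗[F] A) (hv : T.D v = 0) (hψ : polyExt ψ v ∈ J) : ∃ y, v = T.D y
  exists_homology : ∃ a, T.pr l a = a ∧ T.d a = 0 ∧ ¬ ∃ b, a = T.d b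
  le_of_homology (m : ℤ) (a : A) (hm : m < l) (hma : T.pr m a = a) (ha : T.d a = 0) :
    ∃ b, a = T.d b

end ExteriorComplex
end

/-! ### Twisted homology of a complex with four-dimensional homology -/

noncomputable section

open scoped TensorProduct
open MvPolynomial (X C constantCoeff)

namespace ExteriorComplex

variable {F : Type u} {A : Type v} [Field F] [AddCommGroup A] [Module F A]
variable {T : ExteriorComplex F A}

namespace MinimalRetract

variable (R : T.MinimalRetract)

/-- A homogeneous basis of the range of `π` for which the minimal differential is strictly
triangular, together with the coordinates of the projection `P`. -/
lemma exists_coords [CharP F 2] [FiniteDimensional F A]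
    (hfr : Module.finrank F (LinearMap.range R.π) = 4) :
    ∃ (e : Fin 4 → A) (n : Fin 4 → ℤ) (c : Fin 4 → BiPoly F ⊗[F] A →ₗ[BiPoly F] BiPoly F),
      (∀ j, R.π (e j) = e j ∧ T.pr (n j) (e j) = e j) ∧
      (∀ m < n 0, ∀ b, R.π b = b → T.pr m b = b → b = 0) ∧
      (∀ j k, c k (1 ⊗ₜ e j) = if j = k then 1 else 0) ∧
      (∀ v, bc R.π v = ∑ k, c k v • (1 : BiPoly F) ⊗ₜ[F] e k) ∧
      (∀ k m v, v ∈ T.total m → hpart (m - n k) (c k v) = c k v) ∧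
      ∀ j k, j ≤ k → c k (R.P (T.D (1 ⊗ₜ e j))) = 0 := by
  obtain ⟨e, n, hli, he⟩ := R.exists_triangular 4 hfr.ge
  have hspan : Submodule.span F (Set.range fun i : Fin 4 ↦ e i) = LinearMap.range R.π := by
    apply Submodule.eq_of_le_of_finrank_eq
    · rw [Submodule.span_le]
      rintro _ ⟨i, rfl⟩
      exact ⟨e i, (he i i.2).1⟩
    · rw [finrank_span_eq_card hli, hfr, Fintype.card_fin]
  set b := Module.Basis.span hli with hb
  set p : A →ₗ[F] Submodule.span F (Set.range fun i : Fin 4 ↦ e i) :=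
    R.π.codRestrict _ (fun a ↦ by rw [hspan]; exact ⟨a, rfl⟩) with hp
  set φ : Fin 4 → A →ₗ[F] F := fun k ↦ b.coord k ∘ₗ p with hφ
  have hb_coe : ∀ i, (b i : A) = e i := fun i ↦
    congrArg Subtype.val (Module.Basis.span_apply hli i)
  have hφ1 : ∀ a, R.π a = ∑ k, φ k a • e k := by
    intro a
    have := congrArg Subtype.val (b.sum_repr (p a))
    rw [AddSubmonoidClass.coe_finsetSum] at this
    simp only [Submodule.coe_smul, hb_coe] at this
    exact this.symm
  have hφ2 : ∀ j k : Fin 4, φ k (e j) = if j = k then 1 else 0 := by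
    intro j k
    have : p (e j) = b j := Subtype.ext (by rw [hb_coe]; exact (he j j.2).1)
    change b.coord k (p (e j)) = _
    rw [this, Module.Basis.coord_apply, Module.Basis.repr_self, Finsupp.single_apply]
  have hφ3 : ∀ (k : Fin 4) m a, T.pr m a = a → m ≠ n k → φ k a = 0 := by
    intro k m a ha hm
    have h1 : T.pr m (R.π a) = R.π a := by
      have := LinearMap.congr_fun (R.π_mul_pr m) a
      change R.π (T.pr m a) = T.pr m (R.π a) at this
      rw [← this, ha]
    have h2 : φ k (R.π a) = φ k a := by
      have : p (R.π a) = p a := Subtype.ext (LinearMap.congr_fun R.π_mul_π a)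
      change b.coord k (p (R.π a)) = b.coord k (p a)
      rw [this]
    rw [← h2, ← h1, hφ1, map_sum, map_sum]
    refine Finset.sum_eq_zero fun j _ ↦ ?_
    rw [map_smul, ← (he j j.2).2.1, T.pr_pr]
    split_ifs with h
    · rw [(he j j.2).2.1, map_smul, hφ2, if_neg (by rintro rfl; exact hm h), smul_zero]
    · rw [smul_zero, map_zero]
  set c : Fin 4 → BiPoly F ⊗[F] A →ₗ[BiPoly F] BiPoly F :=
    fun k ↦ polyExt (Algebra.linearMap F (BiPoly F) ∘ₗ φ k) with hc
  have hct : ∀ k s a, c k (s ⊗ₜ[F] a) = s * C (φ k a) := fun k s a ↦ polyExt_tmul _ _ _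
  refine ⟨fun i ↦ e i, fun i ↦ n i, c, fun j ↦ ⟨(he j j.2).1, (he j j.2).2.1⟩, ?_, ?_, ?_, ?_, ?_⟩
  · intro m hm x hx hxm
    have := (he 0 (by lia)).2.2.2 m hm x hx hxm
    simpa using this
  · intro j k
    rw [hct, hφ2]; split_ifs <;> simp
  · intro v
    induction v using TensorProduct.induction_on with
    | zero => simp
    | tmul s a =>
      rw [bc_tmul, hφ1, TensorProduct.tmul_sum]
      refine Finset.sum_congr rfl fun k _ ↦ ?_
      rw [hct, TensorProduct.smul_tmul', TensorProduct.tmul_smul, TensorProduct.smul_tmul',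
        smul_eq_mul, mul_one, mul_comm, MvPolynomial.C_mul']
    | add x y hx hy => rw [map_add, hx, hy]; simp [add_smul, Finset.sum_add_distrib]
  · intro k m v hv
    refine polyExt_mem_hpart (l := n k) (fun m a ha ↦ ?_) hv
    by_cases h : m = n k
    · rw [h, sub_self]
      have := hpart_of_isHomogeneous (MvPolynomial.isHomogeneous_C (Fin 2) (φ k a)) 0
      simpa using this
    · have : (Algebra.linearMap F (BiPoly F) ∘ₗ φ k) a = 0 := by
        rw [LinearMap.comp_apply, hφ3 k m a ha h, map_zero]
      rw [this, map_zero]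
  · intro j k hjk
    have := R.triangular (e j) (n j) (he j j.2).1 (he j j.2).2.1 _ (he j j.2).2.2.1
      (he j j.2).2.2.2
    rw [Submodule.baseChange_span] at this
    refine (Submodule.span_le (p := LinearMap.ker (c k))).2 ?_ this
    rintro _ ⟨_, ⟨i, rfl⟩, rfl⟩
    have hij : (⟨i, by lia⟩ : Fin 4) ≠ k := by
      rintro rfl
      have h1 : (j : ℕ) ≤ i := hjk
      have := i.2
      lia
    have h2 := hφ2 ⟨i, by lia⟩ k
    rw [if_neg hij] at h2
    change c k (1 ⊗ₜ[F] e i) = 0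
    rw [hct]
    change 1 * C (φ k (e i)) = 0
    change φ k (e i) = 0 at h2
    rw [h2, map_zero, mul_zero]

end MinimalRetract

/-- A twisted complex with torsion homology whose underlying complex has four-dimensional homology
is a shifted cyclic module by a parameter ideal. -/
theorem exists_cyclicComparison [CharP F 2] [FiniteDimensional F A] (T : ExteriorComplex F A)
    (hdim : Module.finrank F (LinearMap.ker T.d) = Module.finrank F (LinearMap.range T.d) + 4)
    (q : ℕ) (htor : ∀ v, T.D v = 0 → ∀ i, ∃ y, (X i : BiPoly F) ^ q • v = T.D y) :
    ∃ (l : ℤ) (J : Ideal (BiPoly F)), IsParameterIdeal J ∧ Nonempty (T.CyclicComparison l J) := by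
  obtain ⟨R⟩ := T.nonempty_minimalRetract
  have hfr : Module.finrank F (LinearMap.range R.π) = 4 := by
    have := R.finrank_π; lia
  obtain ⟨e, n, c, he, hlow, hce, hπ, hhom, htri⟩ := R.exists_coords hfr
  have ππ : ∀ a, R.π (R.π a) = R.π a := fun a ↦ LinearMap.congr_fun R.π_mul_π a
  have dπ : ∀ a, T.d (R.π a) = 0 := fun a ↦ LinearMap.congr_fun R.d_mul_π a
  have πd : ∀ a, R.π (T.d a) = 0 := fun a ↦ LinearMap.congr_fun R.π_mul_d a
  have πP : ∀ v, bc R.π (R.P v) = R.P v := fun v ↦ LinearMap.congr_fun R.π_mul_P v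
  have Pπ : ∀ v, R.P (bc R.π v) = bc R.π v := fun v ↦ LinearMap.congr_fun R.P_mul_π v
  have Pg : ∀ v, R.P (R.g v) = 0 := fun v ↦ LinearMap.congr_fun R.P_mul_g v
  have PD : ∀ v, R.P (T.D v) = R.P (T.D (R.P v)) := fun v ↦ by
    have := LinearMap.congr_fun R.P_mul_D v
    change R.P (T.D v) = R.P (T.D (bc R.π (R.P v))) at this
    rw [this, πP]
  have hde : ∀ j, T.d (e j) = 0 := fun j ↦ by rw [← (he j).1, dπ]
  have hPe : ∀ j, R.P (1 ⊗ₜ e j) = 1 ⊗ₜ e j := fun j ↦ by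
    have : bc R.π (1 ⊗ₜ[F] e j) = 1 ⊗ₜ e j := by rw [bc_tmul, (he j).1]
    rw [← this, Pπ]
  have hPsum : ∀ v, R.P v = ∑ k, c k (R.P v) • (1 : BiPoly F) ⊗ₜ[F] e k := fun v ↦ by
    rw [← hπ, πP]
  set m : Fin 4 → Fin 4 → BiPoly F := fun k j ↦ c k (R.P (T.D (1 ⊗ₜ e j))) with hm
  have hcD : ∀ k v, c k (R.P (T.D v)) = ∑ j, m k j * c j (R.P v) := by
    intro k v
    rw [PD, hPsum v, map_sum, map_sum, map_sum]
    refine Finset.sum_congr rfl fun j _ ↦ ?_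
    rw [map_smul, map_smul, map_smul, smul_eq_mul, mul_comm, ← hPsum v]
  have hcsum : ∀ (k : Fin 4) (s : Fin 4 → BiPoly F),
      c k (∑ j, s j • (1 : BiPoly F) ⊗ₜ[F] e j) = s k := by
    intro k s
    rw [map_sum, Finset.sum_eq_single k]
    · rw [map_smul, hce, if_pos rfl, smul_eq_mul, mul_one]
    · intro j _ hj
      rw [map_smul, hce, if_neg hj, smul_zero]
    · simp
  have hPs : ∀ (s : Fin 4 → BiPoly F), R.P (∑ j, s j • (1 : BiPoly F) ⊗ₜ[F] e j) =
      ∑ j, s j • (1 : BiPoly F) ⊗ₜ[F] e j := by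
    intro s
    rw [map_sum]
    exact Finset.sum_congr rfl fun j _ ↦ by rw [map_smul, hPe]
  -- Minimality: `e j` is a cycle for `d`, so its twisted differential is divisible into terms with
  -- a factor `x₀` or `x₁`.
  have hconst : ∀ k j, constantCoeff (m k j) = 0 := by
    intro k j
    have h1 : T.D (1 ⊗ₜ e j) = (X 0 : BiPoly F) • bc (T.w 0) (1 ⊗ₜ e j) +
        (X 1 : BiPoly F) • bc (T.w 1) (1 ⊗ₜ e j) := by
      rw [T.D_tmul, hde, TensorProduct.tmul_zero, zero_add]; rfl
    change constantCoeff (c k (R.P (T.D (1 ⊗ₜ e j)))) = 0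
    rw [h1, map_add, map_add, map_smul, map_smul, map_smul, map_smul, smul_eq_mul, smul_eq_mul]
    simp
  have hdeg : ∀ k j, hpart (n j + 1 - n k) (m k j) = m k j := fun k j ↦
    hhom k _ _ (R.P_mem (T.D_mem_total (one_tmul_mem_total (he j).2)))
  have m0 : ∀ j k, j ≤ k → m k j = 0 := htri
  have hmm : ∀ k j, ∑ i, m k i * m i j = 0 := by
    intro k j
    have h1 : R.P (T.D (R.P (T.D (1 ⊗ₜ e j)))) = 0 := by
      rw [← PD, T.D_D, map_zero]
    have h2 : c k (R.P (T.D (R.P (T.D (1 ⊗ₜ e j))))) = ∑ i, m k i * m i j := by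
      rw [hcD]
      refine Finset.sum_congr rfl fun i _ ↦ ?_
      rw [← πP (T.D _), Pπ, πP]
    rw [← h2, h1, map_zero]
  have h02 := hmm 0 2
  have h03 := hmm 0 3
  have h13 := hmm 1 3
  have z : ∀ k, m k 0 = 0 := fun k ↦ m0 0 k (Fin.zero_le k)
  have z11 := m0 1 1 le_rfl
  have z12 := m0 1 2 (by decide)
  have z13 := m0 1 3 (by decide)
  have z22 := m0 2 2 le_rfl
  have z23 := m0 2 3 (by decide)
  have z33 := m0 3 3 le_rfl
  simp only [Fin.sum_univ_four, z, z11, z22, z23, z33, zero_mul, mul_zero, add_zero,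
    zero_add] at h02 h03 h13
  have hcD0 : ∀ v, c 0 (R.P (T.D v)) =
      m 0 1 * c 1 (R.P v) + m 0 2 * c 2 (R.P v) + m 0 3 * c 3 (R.P v) := fun v ↦ by
    rw [hcD, Fin.sum_univ_four, z]; ring
  have hcD1 : ∀ v, c 1 (R.P (T.D v)) = m 1 2 * c 2 (R.P v) + m 1 3 * c 3 (R.P v) := fun v ↦ by
    rw [hcD, Fin.sum_univ_four, z, z11]; ring
  have hcD2 : ∀ v, c 2 (R.P (T.D v)) = m 2 3 * c 3 (R.P v) := fun v ↦ by
    rw [hcD, Fin.sum_univ_four, z, z12, z22]; ring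
  have hcD3 : ∀ v, c 3 (R.P (T.D v)) = 0 := fun v ↦ by
    rw [hcD, Fin.sum_univ_four, z, z13, z23, z33]; ring
  have hext : ∀ v w, (∀ k, c k (R.P v) = c k (R.P w)) → R.P v = R.P w := fun v w h ↦ by
    rw [hPsum v, hPsum w]; exact Finset.sum_congr rfl fun k _ ↦ by rw [h k]
  -- A cycle `y` of the minimal complex lifts to the honest cycle `y - g D y`, with the same image
  -- under `P`. Torsion of twisted homology therefore passes to the minimal complex.
  have hlift : ∀ y, R.P y = y → R.P (T.D y) = 0 → T.D (y - R.g (T.D y)) = 0 ∧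
      R.P (y - R.g (T.D y)) = y := by
    intro y hy hD
    refine ⟨?_, by rw [map_sub, Pg, sub_zero, hy]⟩
    rw [map_sub, ← R.eq_D_g _ hD (T.D_D y), sub_self]
  obtain ⟨hd0, hspan, hb0, u', hu', he', hf'⟩ := koszul_of_triangular (q := q)
    (hconst 0 1) (hconst 0 2) (hconst 0 3) (a := m 0 1) (b := m 0 2) (c := m 0 3) (d := m 1 2)
    (e := m 1 3) (f := m 2 3) h02 h03 h13 (by
      intro v₀ v₁ v₂ v₃ e₀ e₁ e₂ i
      set y := ∑ j, (![v₀, v₁, v₂, v₃] : Fin 4 → BiPoly F) j • (1 : BiPoly F) ⊗ₜ[F] e j with hy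
      have hPy : R.P y = y := hPs _
      have hcy : ∀ k, c k (R.P y) = (![v₀, v₁, v₂, v₃] : Fin 4 → BiPoly F) k := fun k ↦ by
        rw [hPy]; exact hcsum k _
      have hPDy : R.P (T.D y) = 0 := by
        rw [← map_zero R.P]
        apply hext
        intro k
        rw [map_zero, map_zero]
        fin_cases k
        · exact (hcD0 y).trans (by rw [hcy, hcy, hcy]; exact e₀)
        · exact (hcD1 y).trans (by rw [hcy, hcy]; exact e₁)
        · exact (hcD2 y).trans (by rw [hcy]; exact e₂)
        · exact hcD3 y
      obtain ⟨hz1, hz2⟩ := hlift y hPy hPDy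
      obtain ⟨t, ht⟩ := htor _ hz1 i
      have ht' : ∀ k, X i ^ q * (![v₀, v₁, v₂, v₃] : Fin 4 → BiPoly F) k = c k (R.P (T.D t)) := by
        intro k
        rw [← ht, map_smul, map_smul, hz2, ← hPy, hcy, smul_eq_mul]
      exact ⟨c 1 (R.P t), c 2 (R.P t), c 3 (R.P t), (ht' 0).trans (hcD0 t),
        (ht' 1).trans (hcD1 t), (ht' 2).trans (hcD2 t)⟩)
  have ha0 : m 0 1 ≠ 0 := by
    intro h0
    have hrel := isRelPrime_of_X_pow hspan
    exact not_isUnit_of_constantCoeff (hconst 0 2) (hrel (h0 ▸ dvd_zero _) dvd_rfl)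
  obtain ⟨da, hda, hda0, hha⟩ := exists_isHomogeneous_of_hpart (hdeg 0 1) ha0 (hconst 0 1)
  obtain ⟨db, hdb, hdb0, hhb⟩ := exists_isHomogeneous_of_hpart (hdeg 0 2) hb0 (hconst 0 2)
  obtain ⟨u₀, hu₀, rfl⟩ := MvPolynomial.isUnit_iff_eq_C_of_isReduced.1 hu'
  -- Since the entry `m 2 3` is a unit multiple of `m 0 1`, the degrees of the basis vectors force
  -- the corner entry into degree `da + db - 1`, one above the socle degree of the quotient, hence
  -- into the ideal.
  have hc_mem : m 0 3 ∈ Ideal.span {m 0 1, m 0 2} := by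
    have h1 := hdeg 2 3
    rw [hf', hpart_C_mul, hpart_of_isHomogeneous hha] at h1
    have h2 : n 3 + 1 - n 2 = da := by
      by_contra hne
      rw [if_neg hne, mul_zero] at h1
      exact mul_ne_zero hu'.ne_zero ha0 h1.symm
    have h3 : n 3 + 1 - n 0 = ((da + db - 1 : ℕ) : ℤ) := by lia
    have h4 := hdeg 0 3
    rw [h3] at h4
    exact isHomogeneous_mem_span hda0 hdb0 hha hhb hspan (by lia) (isHomogeneous_iff_hpart.2 h4)
  -- The coordinate along the lowest basis vector `e 0`, whose class generates the cyclic homology.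
  set ψ : A →ₗ[F] BiPoly F :=
    ((c 0 ∘ₗ R.P).restrictScalars F) ∘ₗ (TensorProduct.mk F (BiPoly F) A 1) with hψ
  have hψe : ∀ v, polyExt ψ v = c 0 (R.P v) := by
    intro v
    induction v using TensorProduct.induction_on with
    | zero => simp
    | tmul s a =>
      rw [polyExt_tmul]
      change s * c 0 (R.P (1 ⊗ₜ a)) = _
      rw [← smul_eq_mul, ← map_smul, ← map_smul, TensorProduct.smul_tmul', smul_eq_mul, mul_one]
    | add x y hx hy => rw [map_add, map_add, map_add, hx, hy]
  have hm1 : m 0 1 ∈ Ideal.span {m 0 1, m 0 2} := Ideal.subset_span (by simp)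
  have hm2 : m 0 2 ∈ Ideal.span {m 0 1, m 0 2} := Ideal.subset_span (by simp)
  refine ⟨n 0, Ideal.span {m 0 1, m 0 2}, ⟨⟨_, _, da, db, hda0, hdb0, hha, hhb, rfl⟩,
    finite_quotient_of_X_pow_mem hspan⟩, ⟨⟨ψ, ?_, ?_, ?_, ?_, ?_, ?_⟩⟩⟩
  · intro k a ha
    exact hhom 0 k _ (R.P_mem (one_tmul_mem_total ha))
  · intro v
    rw [hψe, hcD0]
    exact add_mem (add_mem (Ideal.mul_mem_right _ _ hm1) (Ideal.mul_mem_right _ _ hm2))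
      (Ideal.mul_mem_right _ _ hc_mem)
  · have hPD0 : R.P (T.D (1 ⊗ₜ e 0)) = 0 := by
      rw [← map_zero R.P]
      apply hext
      intro k
      rw [map_zero, map_zero]
      exact z k
    obtain ⟨h1, h2⟩ := hlift _ (hPe 0) hPD0
    refine ⟨_, ?_, h1, ?_⟩
    · have h0 := one_tmul_mem_total (he 0).2
      have h3 := R.g_mem (T.D_mem_total h0)
      rw [add_sub_cancel_right] at h3
      exact sub_mem h0 h3
    · rw [hψe, h2, hce, if_pos rfl]
  · intro v hv hJ
    rw [hψe] at hJ
    have e0 := hcD0 v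
    have e1 := hcD1 v
    rw [hv, map_zero, map_zero] at e0 e1
    rw [hd0, zero_mul, zero_add, he'] at e1
    have s3 : c 3 (R.P v) = 0 := by
      rcases mul_eq_zero.1 e1.symm with h | h
      · exact absurd h (mul_ne_zero hu'.ne_zero hb0)
      · exact h
    rw [s3, mul_zero, add_zero] at e0
    -- The second row forces the last coordinate of a cycle to vanish, and the first row is then a
    -- syzygy of the two coprime entries.
    obtain ⟨k, hk1, hk2⟩ := exists_common_multiple (p := c 1 (R.P v)) (q := c 2 (R.P v)) hb0
      (isRelPrime_of_X_pow hspan) (by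
        have := neg_eq_of_charTwo F (m 0 2 * c 2 (R.P v))
        linear_combination -e0 + this)
    obtain ⟨α, β, hαβ⟩ := Ideal.mem_span_pair.1 (sub_mem hJ (Ideal.mul_mem_right
      (C u₀⁻¹ * k) _ hc_mem))
    -- The coefficient `u₀⁻¹k` of `e 3` bounds the two middle coordinates. It also contributes the
    -- corner entry to the first coordinate, which was subtracted before choosing `α` and `β`.
    set y := ∑ j, (![0, α, β, C u₀⁻¹ * k] : Fin 4 → BiPoly F) j • (1 : BiPoly F) ⊗ₜ[F] e j with hy
    have hPy : R.P y = y := hPs _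
    have hcy : ∀ i, c i (R.P y) = (![0, α, β, C u₀⁻¹ * k] : Fin 4 → BiPoly F) i := fun i ↦ by
      rw [hPy]; exact hcsum i _
    have huu : (C u₀ : BiPoly F) * C u₀⁻¹ = 1 := by
      rw [← map_mul, mul_inv_cancel₀ hu₀.ne_zero, map_one]
    have hPeq : R.P v = R.P (T.D y) := by
      apply hext
      intro i
      fin_cases i
      · refine Eq.trans ?_ (hcD0 y).symm
        rw [hcy, hcy, hcy]
        change c 0 (R.P v) = m 0 1 * α + m 0 2 * β + m 0 3 * (C u₀⁻¹ * k)
        linear_combination -hαβ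
      · refine Eq.trans ?_ (hcD1 y).symm
        rw [hcy, hcy, hd0, he']
        change c 1 (R.P v) = 0 * β + C u₀ * m 0 2 * (C u₀⁻¹ * k)
        linear_combination hk1 - m 0 2 * k * huu
      · refine Eq.trans ?_ (hcD2 y).symm
        rw [hcy, hf']
        change c 2 (R.P v) = C u₀ * m 0 1 * (C u₀⁻¹ * k)
        linear_combination hk2 - m 0 1 * k * huu
      · exact s3.trans (hcD3 y).symm
    refine ⟨y + R.g (v - T.D y), ?_⟩
    rw [map_add, ← R.eq_D_g (v - T.D y) (by rw [map_sub, hPeq, sub_self])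
      (by rw [map_sub, hv, T.D_D, sub_zero])]
    abel
  · refine ⟨e 0, (he 0).2, hde 0, ?_⟩
    rintro ⟨b, hb⟩
    have h1 : e 0 = 0 := by rw [← (he 0).1, hb, πd]
    have h2 := hce 0 0
    rw [h1, TensorProduct.tmul_zero, map_zero, if_pos rfl] at h2
    exact zero_ne_one h2
  · intro k a hk hka ha
    refine R.eq_d a ha (hlow k hk _ (ππ a) ?_)
    have := LinearMap.congr_fun (R.π_mul_pr k) a
    change R.π (T.pr k a) = T.pr k (R.π a) at this
    rw [← this, hka]

end ExteriorComplex
end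

/-! ### Reduction modulo the variables: from twisted homology to homology -/

noncomputable section

open scoped TensorProduct
open MvPolynomial (X C constantCoeff)

section

variable {F : Type u} [Field F]

lemma exists_smul_X_eq {A : Type v} [AddCommGroup A] [Module F A] [FiniteDimensional F A]
    {u v : BiPoly F ⊗[F] A} (h : (X 0 : BiPoly F) • u = (X 1 : BiPoly F) • v) :
    ∃ t, u = (X 1 : BiPoly F) • t ∧ v = (X 0 : BiPoly F) • t := by
  set b := (Module.finBasis F A).baseChange (BiPoly F) with hb
  have hk : ∀ k, ∃ t, b.repr u k = X 1 * t ∧ b.repr v k = X 0 * t := fun k ↦ by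
    refine exists_common_multiple_X ?_
    have := congrArg (fun x ↦ b.repr x k) h
    simpa using this
  choose t ht using hk
  refine ⟨b.equivFun.symm t, b.ext_elem fun k ↦ ?_, b.ext_elem fun k ↦ ?_⟩
  · rw [(ht k).1, map_smul, Finsupp.smul_apply, ← Module.Basis.equivFun_apply,
      LinearEquiv.apply_symm_apply, smul_eq_mul]
  · rw [(ht k).2, map_smul, Finsupp.smul_apply, ← Module.Basis.equivFun_apply,
      LinearEquiv.apply_symm_apply, smul_eq_mul]

lemma eq_zero_of_smul_X {A : Type v} [AddCommGroup A] [Module F A] {u : BiPoly F ⊗[F] A}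
    {i : Fin 2} (h : (X i : BiPoly F) • u = 0) : u = 0 :=
  (smul_eq_zero.1 h).resolve_left (MvPolynomial.X_ne_zero i)

/-- If a differential module over `F[x₀, x₁]` is acyclic and `x₀, x₁` is a regular sequence on it,
then its reduction modulo `(x₀, x₁)` is acyclic. -/
lemma exists_eq_add_smul_X [CharP F 2] {N : Type v} [AddCommGroup N] [Module (BiPoly F) N]
    (D : Module.End (BiPoly F) N) (hD : ∀ v, D (D v) = 0)
    (hac : ∀ v, D v = 0 → ∃ y, v = D y)
    (hreg : ∀ u v : N, (X 0 : BiPoly F) • u = (X 1 : BiPoly F) • v →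
      ∃ t, u = (X 1 : BiPoly F) • t ∧ v = (X 0 : BiPoly F) • t)
    (hinj : ∀ u : N, (X 1 : BiPoly F) • u = 0 → u = 0) {v u₀ u₁ : N}
    (h : D v = (X 0 : BiPoly F) • u₀ + (X 1 : BiPoly F) • u₁) :
    ∃ y s₀ s₁, v = D y + (X 0 : BiPoly F) • s₀ + (X 1 : BiPoly F) • s₁ := by
  have hneg : ∀ x : N, -x = x := fun x ↦ by
    rw [← one_smul (BiPoly F) x, ← neg_smul, neg_eq_of_charTwo F (1 : BiPoly F)]
  -- From `D² = 0` the elements `D u₀`, `D u₁` form a syzygy of the variables with factor `t`, a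
  -- cycle and so some `D r`. Correcting by `r` turns `u₀` and `u₁` into cycles, hence boundaries of
  -- `s₀`, `s₁`. Then `v - x₀s₀ - x₁s₁` is a cycle, hence a boundary.
  obtain ⟨t, ht₀, ht₁⟩ := hreg (D u₀) (D u₁) (by
    have := hD v
    rw [h, map_add, map_smul, map_smul, add_eq_zero_iff_eq_neg, hneg] at this
    exact this)
  obtain ⟨r, rfl⟩ := hac t (hinj _ (by rw [← map_smul, ← ht₀, hD]))
  obtain ⟨s₀, hs₀⟩ := hac (u₀ - (X 1 : BiPoly F) • r) (by rw [map_sub, map_smul, ht₀, sub_self])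
  obtain ⟨s₁, hs₁⟩ := hac (u₁ - (X 0 : BiPoly F) • r) (by rw [map_sub, map_smul, ht₁, sub_self])
  obtain ⟨y, hy⟩ := hac (v - (X 0 : BiPoly F) • s₀ - (X 1 : BiPoly F) • s₁) (by
    rw [map_sub, map_sub, map_smul, map_smul, h, ← hs₀, ← hs₁, smul_sub, smul_sub,
      smul_comm (X 1 : BiPoly F) (X 0 : BiPoly F) r]
    have h2 := hneg ((X 0 : BiPoly F) • (X 1 : BiPoly F) • r)
    rw [neg_eq_iff_add_eq_zero] at h2
    rw [← h2]; abel)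
  exact ⟨y, s₀, s₁, by rw [← hy]; abel⟩

end

/-- Reduction modulo `(x₀, x₁)`. -/
def constPart (F : Type u) (A : Type v) [Field F] [AddCommGroup A] [Module F A] :
    BiPoly F ⊗[F] A →ₗ[F] A :=
  TensorProduct.lid F A ∘ₗ (MvPolynomial.lcoeff F 0).rTensor A

section

variable {F : Type u} {A : Type v} [Field F] [AddCommGroup A] [Module F A]

lemma constPart_tmul (s : BiPoly F) (a : A) :
    constPart F A (s ⊗ₜ a) = constantCoeff s • a := by
  simp [constPart, MvPolynomial.constantCoeff_eq]

lemma constPart_smul_X (i : Fin 2) (v : BiPoly F ⊗[F] A) :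
    constPart F A ((X i : BiPoly F) • v) = 0 := by
  induction v using TensorProduct.induction_on with
  | zero => simp
  | tmul s a => rw [TensorProduct.smul_tmul', constPart_tmul]; simp
  | add x y hx hy => rw [smul_add, map_add, hx, hy, add_zero]

lemma constPart_baseChange {A' : Type w} [AddCommGroup A'] [Module F A'] (f : A →ₗ[F] A')
    (v : BiPoly F ⊗[F] A) :
    constPart F A' (f.baseChange (BiPoly F) v) = f (constPart F A v) := by
  induction v using TensorProduct.induction_on with
  | zero => simp
  | tmul s a => simp [constPart_tmul]
  | add x y hx hy => rw [map_add, map_add, hx, hy, map_add, map_add]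

end

namespace ExteriorComplex

variable {F : Type u} {A : Type v} {A' : Type w} [Field F] [AddCommGroup A] [Module F A]
  [AddCommGroup A'] [Module F A'] (T : ExteriorComplex F A) (T' : ExteriorComplex F A')

lemma constPart_D (v : BiPoly F ⊗[F] A) : constPart F A (T.D v) = T.d (constPart F A v) := by
  induction v using TensorProduct.induction_on with
  | zero => simp
  | tmul s a =>
    simp [D_tmul, constPart_tmul]
  | add x y hx hy => rw [map_add, map_add, map_add, hx, hy, map_add]

variable {T T'} in
lemma baseChange_D {f : A →ₗ[F] A'} (hd : ∀ a, f (T.d a) = T'.d (f a))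
    (hw : ∀ i a, f (T.w i a) = T'.w i (f a)) (v : BiPoly F ⊗[F] A) :
    f.baseChange (BiPoly F) (T.D v) = T'.D (f.baseChange (BiPoly F) v) := by
  induction v using TensorProduct.induction_on with
  | zero => simp
  | tmul s a => simp [D_tmul, hd, hw]
  | add x y hx hy => rw [map_add, map_add, map_add, hx, hy, map_add]

/-- A map of complexes that induces an isomorphism on twisted homology induces an isomorphism on
homology. -/
theorem isomorphism_of_twisted [CharP F 2] [FiniteDimensional F A] [FiniteDimensional F A']
    (f : A →ₗ[F] A') (hd : ∀ a, f (T.d a) = T'.d (f a))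
    (hw : ∀ i a, f (T.w i a) = T'.w i (f a))
    (hinj : ∀ v, T.D v = 0 → (∃ y, f.baseChange (BiPoly F) v = T'.D y) → ∃ y, v = T.D y)
    (hsurj : ∀ v', T'.D v' = 0 → ∃ v y, T.D v = 0 ∧
      v' = f.baseChange (BiPoly F) v + T'.D y) :
    (∀ a, T.d a = 0 → (∃ b, f a = T'.d b) → ∃ b, a = T.d b) ∧
      ∀ a', T'.d a' = 0 → ∃ a b, T.d a = 0 ∧ a' = f a + T'.d b := by
  have hD := baseChange_D hd hw
  have dd : ∀ a, T.d (T.d a) = 0 := fun a ↦ LinearMap.congr_fun T.d_mul_d a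
  set g := f.baseChange (BiPoly F) with hg
  have two : ∀ x : BiPoly F ⊗[F] A', x + x = 0 := fun x ↦ add_self_of_charTwo F x
  have two' : ∀ x : A', x + x = 0 := fun x ↦ add_self_of_charTwo F x
  -- The mapping cone of the twisted map: the hypotheses say that it is acyclic, and both variables
  -- form a regular sequence on it. Reduction modulo the variables gives the cone of `f`, which is
  -- therefore acyclic.
  set N := (BiPoly F ⊗[F] A) × (BiPoly F ⊗[F] A')
  set D : Module.End (BiPoly F) N := LinearMap.prod (T.D ∘ₗ LinearMap.fst _ _ _)
    (g ∘ₗ LinearMap.fst _ _ _ + T'.D ∘ₗ LinearMap.snd _ _ _) with hDN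
  have hDapp : ∀ v v', D (v, v') = (T.D v, g v + T'.D v') := fun _ _ ↦ rfl
  have key : ∀ a a', T.d a = 0 → f a + T'.d a' = 0 → ∃ b b', a = T.d b ∧ a' = f b + T'.d b' := by
    intro a a' ha ha'
    have haa : f a = T'.d a' := by rw [add_eq_zero_iff_eq_neg, neg_eq_of_charTwo F] at ha'; exact ha'
    -- The lift `(1 ⊗ a, 1 ⊗ a')` of a cycle of the cone of `f` is a cycle up to the twisting terms,
    -- which are multiples of the variables.
    obtain ⟨⟨y, y'⟩, ⟨s₀, s₀'⟩, ⟨s₁, s₁'⟩, hy⟩ : ∃ y s₀ s₁ : N, ((1 ⊗ₜ a, 1 ⊗ₜ a') : N) =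
        D y + (X 0 : BiPoly F) • s₀ + (X 1 : BiPoly F) • s₁ := by
      refine exists_eq_add_smul_X (F := F) D ?_ ?_ ?_ ?_
        (u₀ := (1 ⊗ₜ T.w 0 a, 1 ⊗ₜ T'.w 0 a')) (u₁ := (1 ⊗ₜ T.w 1 a, 1 ⊗ₜ T'.w 1 a')) ?_
      · rintro ⟨v, v'⟩
        rw [hDapp, hDapp, map_add, hD, T.D_D, T'.D_D, add_zero, two]; rfl
      · rintro ⟨v, v'⟩ hv
        rw [hDapp] at hv
        have h1 : T.D v = 0 := congrArg Prod.fst hv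
        have h2 : g v + T'.D v' = 0 := congrArg Prod.snd hv
        obtain ⟨y, rfl⟩ := hinj v h1 ⟨v', by
          rw [add_eq_zero_iff_eq_neg, neg_eq_of_charTwo F] at h2; exact h2⟩
        rw [hD, ← map_add] at h2
        obtain ⟨z, y', hz, hzy⟩ := hsurj _ h2
        refine ⟨(y - z, y'), ?_⟩
        rw [hDapp, map_sub, hz, sub_zero, map_sub]
        refine Prod.ext rfl ?_
        change v' = g y - g z + T'.D y'
        rw [sub_eq_of_charTwo F, add_assoc, ← hzy, ← add_assoc, two, zero_add]
      · rintro ⟨u, u'⟩ ⟨v, v'⟩ h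
        obtain ⟨t, h1, h2⟩ := exists_smul_X_eq (congrArg Prod.fst h)
        obtain ⟨t', h1', h2'⟩ := exists_smul_X_eq (congrArg Prod.snd h)
        exact ⟨(t, t'), Prod.ext h1 h1', Prod.ext h2 h2'⟩
      · rintro ⟨u, u'⟩ h
        exact Prod.ext (eq_zero_of_smul_X (congrArg Prod.fst h))
          (eq_zero_of_smul_X (congrArg Prod.snd h))
      · rw [hDapp, T.D_tmul, T'.D_tmul, ha, TensorProduct.tmul_zero, zero_add]
        have h1 : g (1 ⊗ₜ[F] a) = 1 ⊗ₜ f a := by simp [g]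
        rw [h1, haa, ← add_assoc, two, zero_add]
        refine Prod.ext ?_ ?_
        · change _ = (X 0 : BiPoly F) • _ + (X 1 : BiPoly F) • _
          simp only [TensorProduct.smul_tmul', smul_eq_mul]
        · change _ = (X 0 : BiPoly F) • _ + (X 1 : BiPoly F) • _
          simp only [TensorProduct.smul_tmul', smul_eq_mul]
    rw [hDapp] at hy
    refine ⟨constPart F A y, constPart F A' y', ?_, ?_⟩
    · have h1 : 1 ⊗ₜ a = T.D y + (X 0 : BiPoly F) • s₀ + (X 1 : BiPoly F) • s₁ :=
        congrArg Prod.fst hy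
      have h2 := congrArg (constPart F A) h1
      simpa only [map_add, constPart_smul_X, constPart_tmul, constPart_D, map_one, one_smul,
        add_zero] using h2
    · have h1 : 1 ⊗ₜ a' = g y + T'.D y' + (X 0 : BiPoly F) • s₀' + (X 1 : BiPoly F) • s₁' :=
        congrArg Prod.snd hy
      have h2 := congrArg (constPart F A') h1
      simpa only [map_add, constPart_smul_X, constPart_tmul, constPart_D, map_one, one_smul,
        add_zero, hg, constPart_baseChange] using h2
  refine ⟨fun a ha ⟨b, hb⟩ ↦ ?_, fun a' ha' ↦ ?_⟩
  · obtain ⟨c, _, hc, _⟩ := key a b ha (by rw [hb, two'])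
    exact ⟨c, hc⟩
  · obtain ⟨c, c', h1, h2⟩ := key 0 a' (map_zero _) (by rw [map_zero, ha', add_zero])
    exact ⟨c, c', h1.symm, h2⟩

end ExteriorComplex
end

noncomputable section

open KleinFour (gen coord)

lemma KleinFour.mul_self (p : KleinFour) : p * p = 1 := by
  revert p; decide

lemma KleinFour.inv_eq (p : KleinFour) : p⁻¹ = p := by
  revert p; decide

lemma KleinFour.sum_univ {M : Type*} [AddCommMonoid M] (f : KleinFour → M) :
    ∑ p, f p = f 1 + f (gen 0) + f (gen 1) + f (gen 0 * gen 1) := by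
  have h : (Finset.univ : Finset KleinFour) = {1, gen 0, gen 1, gen 0 * gen 1} := by decide
  rw [h, Finset.sum_insert (by decide), Finset.sum_insert (by decide),
    Finset.sum_insert (by decide), Finset.sum_singleton]
  abel

/-! ### The exterior generators of the group algebra of the Klein four group -/

section ExteriorGenerators

variable {F : Type u} [Field F] {Y : Type v} [AddCommGroup Y] [Module F Y]
  (ρ : Representation F KleinFour Y)

/-- The action of the exterior generator `wᵢ` of the group algebra of the Klein four group. -/
def extGen (i : Fin 2) : Module.End F Y := ρ (gen (i + 1)) + ρ (gen 0 * gen 1)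

lemma extGen_apply (i : Fin 2) (y : Y) :
    extGen ρ i y = ρ (gen (i + 1)) y + ρ (gen 0 * gen 1) y := rfl

lemma extGen_comm (i j : Fin 2) : extGen ρ i * extGen ρ j = extGen ρ j * extGen ρ i := by
  have h : ∀ p q, ρ p * ρ q = ρ q * ρ p := fun p q ↦ by rw [← map_mul, mul_comm, map_mul]
  simp only [extGen, mul_add, add_mul]
  rw [h (gen (i + 1)), h (gen (i + 1)), h (gen 0 * gen 1) (gen (j + 1))]
  abel

lemma extGen_mul_self [CharP F 2] (i : Fin 2) : extGen ρ i * extGen ρ i = 0 := by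
  have h : ∀ p q, ρ p * ρ q = ρ (p * q) := fun p q ↦ (map_mul ρ p q).symm
  simp only [extGen, mul_add, add_mul, h, KleinFour.mul_self]
  rw [mul_comm (gen (i + 1)) (gen 0 * gen 1)]
  rw [show ∀ a b : Module.End F Y, a + b + (b + a) = (a + b) + (a + b) by intros; abel,
    add_self_of_charTwo F]

/-- For `a ≠ 1` let `w(a)` be the sum of the other two nontrivial elements. This description is
invariant under automorphisms and additive in `a` (with `w(1) = 0`), and `wᵢ = w(gen i)`. So
automorphisms act on the generators by their matrix in coordinates, exactly and not only modulo the
square of the augmentation ideal. -/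
lemma extGen_conj [CharP F 2] (α : MulAut KleinFour) (i : Fin 2) :
    ρ (α (gen (i + 1))) + ρ (α (gen 0 * gen 1)) =
      ∑ k, ((coord k (α (gen i))).cast : F) • extGen ρ k := by
  have key : ∀ a b : KleinFour, a ≠ 1 → b ≠ 1 → a ≠ b → ρ b + ρ (a * b) =
      ∑ k, ((coord k a).cast : F) • extGen ρ k := by
    intro a b ha hb hab
    rw [Fin.sum_univ_two]
    have h4 : ∀ p : KleinFour, p = 1 ∨ p = gen 0 ∨ p = gen 1 ∨ p = gen 0 * gen 1 := by decide
    have c00 : coord 0 (gen 0) = 1 := rfl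
    have c10 : coord 1 (gen 0) = 0 := rfl
    have c01 : coord 0 (gen 1) = 0 := rfl
    have c11 : coord 1 (gen 1) = 1 := rfl
    have c02 : coord 0 (gen 0 * gen 1) = 1 := rfl
    have c12 : coord 1 (gen 0 * gen 1) = 1 := rfl
    have e1 : gen 0 * (gen 0 * gen 1) = gen 1 := by decide
    have e2 : gen 1 * gen 0 = gen 0 * gen 1 := by decide
    have e3 : gen 1 * (gen 0 * gen 1) = gen 0 := by decide
    have e4 : gen 0 * gen 1 * gen 0 = gen 1 := by decide
    have e5 : gen 0 * gen 1 * gen 1 = gen 0 := by decide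
    have o1 : (1 : Fin 2) + 1 = 0 := rfl
    have t := add_self_of_charTwo F (ρ (gen 0 * gen 1))
    have one : ((1 : ZMod 2).cast : F) = 1 := ZMod.cast_one'
    rcases h4 a with rfl | rfl | rfl | rfl <;> rcases h4 b with rfl | rfl | rfl | rfl <;>
      first
      | exact absurd rfl ha
      | exact absurd rfl hb
      | exact absurd rfl hab
      | (simp only [c00, c10, c01, c11, c02, c12, extGen, e1, e2, e3, e4, e5, one, ZMod.cast_zero,
          one_smul, zero_smul, add_zero, zero_add, o1]
         first | done | abel1 | (rw [add_add_add_comm, t, add_zero]; first | done | abel1))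
  rw [← key (α (gen i)) (α (gen (i + 1))), ← map_mul]
  · have : gen 0 * gen 1 = gen i * gen (i + 1) := by revert i; decide
    rw [this]
  · rw [Ne, EmbeddingLike.map_eq_one_iff]; revert i; decide
  · rw [Ne, EmbeddingLike.map_eq_one_iff]; revert i; decide
  · rw [Ne, EmbeddingLike.apply_eq_iff_eq]; revert i; decide

end ExteriorGenerators

/-! ### Induced representations -/

section Induced

variable {F : Type u} [Field F] {Q : Type u} [Group Q] (φ : Q →* MulAut KleinFour)

section

variable {V : Type v} [AddCommGroup V] [Module F V] (ρ : Representation F Q V)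

/-- The representation of `P ⋊ Q` on functions `P → V` induced from the representation `V` of `Q`,
where `P` is the Klein four group. -/
def indRep : Representation F (KleinFour ⋊[φ] Q) (KleinFour → V) where
  toFun g :=
    { toFun f x := ρ g.right (f (φ g.right⁻¹ (g.left⁻¹ * x)))
      map_add' _ _ := funext fun _ ↦ map_add _ _ _
      map_smul' _ _ := funext fun _ ↦ map_smul _ _ _ }
  map_one' := by
    refine LinearMap.ext fun f ↦ funext fun x ↦ ?_
    simp
  map_mul' g h := by
    refine LinearMap.ext fun f ↦ funext fun x ↦ ?_
    have key : φ (g * h).right⁻¹ ((g * h).left⁻¹ * x) =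
        φ h.right⁻¹ (h.left⁻¹ * φ g.right⁻¹ (g.left⁻¹ * x)) := by
      rw [SemidirectProduct.mul_right, SemidirectProduct.mul_left, mul_inv_rev, map_mul φ,
        MulAut.mul_apply, mul_inv_rev, mul_assoc, map_mul (φ g.right⁻¹), map_inv (φ g.right⁻¹),
        ← MulAut.mul_apply _ (φ g.right⁻¹), ← map_mul φ, inv_mul_cancel, map_one, MulAut.one_apply]
    change ρ (g * h).right (f (φ (g * h).right⁻¹ ((g * h).left⁻¹ * x))) =
      ρ g.right (ρ h.right (f (φ h.right⁻¹ (h.left⁻¹ * φ g.right⁻¹ (g.left⁻¹ * x)))))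
    rw [key, SemidirectProduct.mul_right, map_mul, Module.End.mul_apply]

lemma indRep_apply (g : KleinFour ⋊[φ] Q) (f : KleinFour → V) (x : KleinFour) :
    indRep φ ρ g f x = ρ g.right (f (φ g.right⁻¹ (g.left⁻¹ * x))) := rfl

lemma indRep_inl (p : KleinFour) (f : KleinFour → V) (x : KleinFour) :
    indRep φ ρ (SemidirectProduct.inl p) f x = f (p⁻¹ * x) := by
  simp [indRep_apply]

lemma indRep_inr (q : Q) (f : KleinFour → V) (x : KleinFour) :
    indRep φ ρ (SemidirectProduct.inr q) f x = ρ q (f (φ q⁻¹ x)) := by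
  simp [indRep_apply]

end

variable {φ}

/-- The restriction of a representation of `P ⋊ Q` to `P`. -/
abbrev repP {Y : Type v} [AddCommGroup Y] [Module F Y]
    (σ : Representation F (KleinFour ⋊[φ] Q) Y) : Representation F KleinFour Y :=
  σ.comp SemidirectProduct.inl

section

variable {V : Type v} [AddCommGroup V] [Module F V] (ρ : Representation F Q V)
variable {Y : Type w} [AddCommGroup Y] [Module F Y] (σ : Representation F (KleinFour ⋊[φ] Q) Y)

/-- The `P`-equivariant map on functions `P → V` extending a linear map on `V`. -/
def indLift (τ : Representation F KleinFour Y) (ζ : V →ₗ[F] Y) : (KleinFour → V) →ₗ[F] Y :=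
  ∑ p, τ p ∘ₗ ζ ∘ₗ LinearMap.proj p

lemma indLift_apply (τ : Representation F KleinFour Y) (ζ : V →ₗ[F] Y) (f : KleinFour → V) :
    indLift τ ζ f = ∑ p, τ p (ζ (f p)) := by
  simp [indLift]

lemma indLift_single (τ : Representation F KleinFour Y) (ζ : V →ₗ[F] Y) (x : V) :
    indLift τ ζ (Pi.single 1 x) = ζ x := by
  rw [indLift_apply, Finset.sum_eq_single 1]
  · simp
  · intro p _ hp; rw [Pi.single_eq_of_ne hp, map_zero, map_zero]
  · simp

lemma indLift_inl (τ : Representation F KleinFour Y) (ζ : V →ₗ[F] Y) (p : KleinFour)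
    (f : KleinFour → V) :
    indLift τ ζ (indRep φ ρ (SemidirectProduct.inl p) f) = τ p (indLift τ ζ f) := by
  rw [indLift_apply, indLift_apply, map_sum]
  refine Fintype.sum_equiv (Equiv.mulLeft p⁻¹) _ _ fun x ↦ ?_
  rw [indRep_inl, ← Module.End.mul_apply, ← map_mul]
  simp

lemma indLift_equivariant {ζ : V →ₗ[F] Y}
    (h : ∀ q v, ζ (ρ q v) = σ (SemidirectProduct.inr q) (ζ v)) (g : KleinFour ⋊[φ] Q)
    (f : KleinFour → V) :
    indLift (repP σ) ζ (indRep φ ρ g f) = σ g (indLift (repP σ) ζ f) := by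
  have hr : ∀ q f, indLift (repP σ) ζ (indRep φ ρ (SemidirectProduct.inr q) f) =
      σ (SemidirectProduct.inr q) (indLift (repP σ) ζ f) := by
    intro q f
    rw [indLift_apply, indLift_apply, map_sum]
    refine Fintype.sum_equiv (φ q⁻¹).toEquiv _ _ fun x ↦ ?_
    rw [indRep_inr, h]
    change σ _ (σ _ _) = σ _ (σ _ _)
    rw [← Module.End.mul_apply, ← Module.End.mul_apply, ← map_mul, ← map_mul]
    congr 2
    ext <;> simp
  rw [← SemidirectProduct.inl_left_mul_inr_right g, map_mul, map_mul, Module.End.mul_apply,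
    indLift_inl, hr, Module.End.mul_apply, MonoidHom.comp_apply]

lemma indRep_ext (τ : Representation F KleinFour Y) {f g : (KleinFour → V) →ₗ[F] Y}
    (hf : ∀ p x, f (indRep φ ρ (SemidirectProduct.inl p) x) = τ p (f x))
    (hg : ∀ p x, g (indRep φ ρ (SemidirectProduct.inl p) x) = τ p (g x))
    (h : ∀ v, f (Pi.single 1 v) = g (Pi.single 1 v)) : f = g := by
  refine LinearMap.pi_ext fun p v ↦ ?_
  have hp : (Pi.single p v : KleinFour → V) =
      indRep φ ρ (SemidirectProduct.inl p) (Pi.single 1 v) := by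
    funext x
    rw [indRep_inl, Pi.single_apply, Pi.single_apply]
    simp only [inv_mul_eq_one, eq_comm]
  rw [hp, hf, hg, h]

end

/-- Averaging over `Q` makes a linear map equivariant. -/
lemma exists_equivariant [CharP F 2] (hQ : Odd (Nat.card Q)) {V : Type v} {Y : Type w} {Z : Type*}
    [AddCommGroup V] [Module F V] [AddCommGroup Y] [Module F Y] [AddCommGroup Z] [Module F Z]
    (ρ : Representation F Q V) (σ : Representation F Q Y) (τ : Representation F Q Z)
    (e : Y →ₗ[F] Z) (he : ∀ q y, e (σ q y) = τ q (e y)) (ζ : V →ₗ[F] Y)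
    (hζ : ∀ q v, e (ζ (ρ q v)) = τ q (e (ζ v))) :
    ∃ ζ' : V →ₗ[F] Y, (∀ q v, ζ' (ρ q v) = σ q (ζ' v)) ∧ ∀ v, e (ζ' v) = e (ζ v) := by
  have : Finite Q := Nat.finite_of_card_ne_zero hQ.pos.ne'
  have := Fintype.ofFinite Q
  -- Odd order in characteristic 2: the number of summands is already `1` in `F`, so the average
  -- needs no denominator.
  have h1 : ((Nat.card Q : ℕ) : F) = 1 := by
    obtain ⟨k, hk⟩ := hQ
    rw [hk, Nat.cast_add, Nat.cast_mul, show ((2 : ℕ) : F) = 0 from CharP.cast_eq_zero F 2]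
    simp
  have happ : ∀ v, (∑ q, σ q ∘ₗ ζ ∘ₗ ρ q⁻¹) v = ∑ q, σ q (ζ (ρ q⁻¹ v)) := fun v ↦ by simp
  refine ⟨∑ q, σ q ∘ₗ ζ ∘ₗ ρ q⁻¹, fun q v ↦ ?_, fun v ↦ ?_⟩
  · rw [happ, happ, map_sum]
    refine Fintype.sum_equiv (Equiv.mulLeft q⁻¹) _ _ fun x ↦ ?_
    rw [← Module.End.mul_apply, ← map_mul, ← Module.End.mul_apply, ← map_mul]
    simp
  · rw [happ, map_sum]
    have : ∀ q, e (σ q (ζ (ρ q⁻¹ v))) = e (ζ v) := fun q ↦ by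
      rw [he, ← hζ, ← Module.End.mul_apply, ← map_mul]; simp
    rw [Finset.sum_congr rfl fun q _ ↦ this q, Finset.sum_const, Finset.card_univ,
      ← Nat.card_eq_fintype_card, ← Nat.cast_smul_eq_nsmul F, h1, one_smul]

end Induced
end

/-! ### Contractions of the exterior generators and projective modules -/

noncomputable section

open KleinFour (gen coord)

section Contraction

variable {F : Type u} [Field F] {V : Type v} [AddCommGroup V] [Module F V]

/-- The derivative with respect to the exterior generator `wᵢ` on functions on the Klein four
group. -/
def genDeriv (i : Fin 2) : Module.End F (KleinFour → V) where
  toFun f x := if x = 1 then f (gen i) + f (gen 0 * gen 1) else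
    if x = gen (i + 1) then 0 else f (gen i) + f (gen (i + 1)) + f (gen 0 * gen 1)
  map_add' f g := by
    funext x
    simp only [Pi.add_apply]
    split_ifs
    · abel
    · rw [add_zero]
    · abel
  map_smul' c f := by
    funext x
    simp only [Pi.smul_apply, RingHom.id_apply]
    split_ifs <;> simp

variable {Q : Type u} [Group Q] (φ : Q →* MulAut KleinFour) (ρ : Representation F Q V)

lemma extGen_indRep (i : Fin 2) (f : KleinFour → V) (x : KleinFour) :
    extGen (repP (indRep φ ρ)) i f x = f (gen (i + 1) * x) + f (gen 0 * gen 1 * x) := by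
  rw [extGen_apply, Pi.add_apply]
  change indRep φ ρ _ f x + indRep φ ρ _ f x = _
  rw [indRep_inl, indRep_inl, KleinFour.inv_eq, KleinFour.inv_eq]

lemma genDeriv_eq (i : Fin 2) (f : KleinFour → V) (x : KleinFour) :
    genDeriv (F := F) i f x = if x = 1 then f (gen i) + f (gen 0 * gen 1) else
      if x = gen (i + 1) then 0 else f (gen i) + f (gen (i + 1)) + f (gen 0 * gen 1) := rfl

lemma genDeriv_apply (i : Fin 2) (f : KleinFour → V) :
    genDeriv (F := F) i f 1 = f (gen i) + f (gen 0 * gen 1) ∧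
      genDeriv (F := F) i f (gen i) = f (gen i) + f (gen (i + 1)) + f (gen 0 * gen 1) ∧
      genDeriv (F := F) i f (gen (i + 1)) = 0 ∧
      genDeriv (F := F) i f (gen 0 * gen 1) = f (gen i) + f (gen (i + 1)) + f (gen 0 * gen 1) := by
  have h1 : gen i ≠ 1 := by revert i; decide
  have h2 : gen i ≠ gen (i + 1) := by revert i; decide
  have h3 : gen (i + 1) ≠ 1 := by revert i; decide
  have h4 : gen 0 * gen 1 ≠ 1 := by decide
  have h5 : gen 0 * gen 1 ≠ gen (i + 1) := by revert i; decide
  refine ⟨?_, ?_, ?_, ?_⟩ <;> rw [genDeriv_eq]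
  · rw [if_pos rfl]
  · rw [if_neg h1, if_neg h2]
  · rw [if_neg h3, if_pos rfl]
  · rw [if_neg h4, if_neg h5]

lemma KleinFour.cases (i : Fin 2) (x : KleinFour) :
    x = 1 ∨ x = gen i ∨ x = gen (i + 1) ∨ x = gen 0 * gen 1 := by
  revert i x; decide

lemma eq_of_add_self {V : Type v} [AddCommGroup V] (t : ∀ v : V, v + v = 0) {a b s : V}
    (h : a = b + (s + s)) : a = b := by
  rw [h, t, add_zero]

variable [CharP F 2]

/-- In the basis `1, w₀, w₁, w₀w₁` of the group algebra, `genDeriv i` is the partial derivative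
`∂/∂wᵢ`, so this is the canonical relation `∂w + w∂ = 1`. The four cases check it value by value. -/
lemma genDeriv_mul_extGen_add (i : Fin 2) :
    genDeriv i * extGen (repP (indRep φ ρ)) i + extGen (repP (indRep φ ρ)) i * genDeriv i = 1 := by
  refine LinearMap.ext fun f ↦ funext fun x ↦ ?_
  have e1 : gen (i + 1) * gen i = gen 0 * gen 1 := by revert i; decide
  have e2 : gen (i + 1) * gen (i + 1) = 1 := by revert i; decide
  have e3 : gen (i + 1) * (gen 0 * gen 1) = gen i := by revert i; decide
  have e4 : gen 0 * gen 1 * gen i = gen (i + 1) := by revert i; decide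
  have e5 : gen 0 * gen 1 * gen (i + 1) = gen i := by revert i; decide
  have e6 : gen 0 * gen 1 * (gen 0 * gen 1) = 1 := by decide
  have t : ∀ v : V, v + v = 0 := fun v ↦ add_self_of_charTwo F v
  obtain ⟨h1, h2, h3, h4⟩ := genDeriv_apply (F := F) i f
  obtain ⟨k1, k2, k3, k4⟩ := genDeriv_apply (F := F) i (extGen (repP (indRep φ ρ)) i f)
  change genDeriv (F := F) i (extGen (repP (indRep φ ρ)) i f) x +
    extGen (repP (indRep φ ρ)) i (genDeriv (F := F) i f) x = f x
  rw [extGen_indRep]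
  rcases KleinFour.cases i x with rfl | rfl | rfl | rfl
  · rw [k1, mul_one, mul_one, h3, h4, extGen_indRep, extGen_indRep, e1, e4, e3, e6]
    exact eq_of_add_self t (s := (f (gen i)) + (f (gen (i + 1))) + (f (gen 0 * gen 1))) (by abel)
  · rw [k2, e1, e4, h4, h3, extGen_indRep, extGen_indRep, extGen_indRep, e1, e4, e3, e6, e2, e5]
    exact eq_of_add_self t
      (s := f (gen i) + f 1 + f (gen (i + 1)) + f (gen 0 * gen 1)) (by abel)
  · rw [k3, e2, e5, h1, h2]
    exact eq_of_add_self t (s := (f (gen i)) + (f (gen 0 * gen 1))) (by abel)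
  · rw [k4, e3, e6, h1, h2, extGen_indRep, extGen_indRep, extGen_indRep, e1, e4, e3, e6, e2, e5]
    exact eq_of_add_self t
      (s := f (gen i) + f (gen i) + f 1 + f (gen (i + 1)) + f (gen 0 * gen 1)) (by abel)

lemma genDeriv_mul_extGen_of_ne {i j : Fin 2} (hij : i ≠ j) :
    genDeriv i * extGen (repP (indRep φ ρ)) j = extGen (repP (indRep φ ρ)) j * genDeriv i := by
  obtain rfl : j = i + 1 := by revert i j; decide
  refine LinearMap.ext fun f ↦ funext fun x ↦ ?_
  have e0 : gen (i + 1 + 1) = gen i := by revert i; decide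
  have e1 : gen i * gen i = 1 := by revert i; decide
  have e2 : gen i * gen (i + 1) = gen 0 * gen 1 := by revert i; decide
  have e3 : gen i * (gen 0 * gen 1) = gen (i + 1) := by revert i; decide
  have e4 : gen 0 * gen 1 * gen i = gen (i + 1) := by revert i; decide
  have e5 : gen 0 * gen 1 * gen (i + 1) = gen i := by revert i; decide
  have e6 : gen 0 * gen 1 * (gen 0 * gen 1) = 1 := by decide
  have t : ∀ v : V, v + v = 0 := fun v ↦ add_self_of_charTwo F v
  obtain ⟨h1, h2, h3, h4⟩ := genDeriv_apply (F := F) i f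
  obtain ⟨k1, k2, k3, k4⟩ := genDeriv_apply (F := F) i (extGen (repP (indRep φ ρ)) (i + 1) f)
  change genDeriv (F := F) i (extGen (repP (indRep φ ρ)) (i + 1) f) x =
    extGen (repP (indRep φ ρ)) (i + 1) (genDeriv (F := F) i f) x
  have w : ∀ f x, extGen (repP (indRep φ ρ)) (i + 1) f x = f (gen i * x) + f (gen 0 * gen 1 * x) :=
    fun f x ↦ by rw [extGen_indRep, e0]
  rw [w]
  rcases KleinFour.cases i x with rfl | rfl | rfl | rfl
  · rw [k1, mul_one, mul_one, h2, h4, w, w, e1, e4, e3, e6, t]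
    exact eq_of_add_self t (s := (f 1) + (f (gen (i + 1)))) (by abel)
  · rw [k2, e1, e4, h1, h3, w, w, w, e1, e4, e3, e6, e2, e5]
    exact eq_of_add_self t (s := (f 1) + (f (gen (i + 1)))) (by abel)
  · rw [k3, e2, e5, h2, h4, t]
  · rw [k4, e3, e6, h1, h3, w, w, w, e1, e4, e3, e6, e2, e5]
    exact eq_of_add_self t (s := (f 1) + (f (gen (i + 1)))) (by abel)

end Contraction

section Projective

variable {F : Type u} [Field F] {Q : Type u} [Group Q] {φ : Q →* MulAut KleinFour}

lemma indRep_inr_single {V : Type v} [AddCommGroup V] [Module F V] (ρ : Representation F Q V)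
    (q : Q) (v : V) : indRep φ ρ (SemidirectProduct.inr q) (Pi.single 1 v) =
      Pi.single 1 (ρ q v) := by
  funext x
  rw [indRep_inr, Pi.single_apply, Pi.single_apply]
  simp only [map_eq_one_iff _ (φ q⁻¹).injective]
  split_ifs <;> simp

/-- A lift is determined by its restriction to functions supported at the identity, which only has
to be `Q`-equivariant; an arbitrary linear lift becomes so by averaging. -/
lemma projective_indRep [CharP F 2] (hQ : Odd (Nat.card Q)) {V : Type u} [AddCommGroup V]
    [Module F V] (ρ : Representation F Q V) : Projective (Rep.of (indRep φ ρ)) where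
  factors {E Z} f e _ := by
    obtain ⟨s, hs⟩ := e.hom.toLinearMap.exists_rightInverse_of_surjective
      (LinearMap.range_eq_top.2 ((Rep.epi_iff_surjective e).1 inferInstance))
    have hs' : ∀ z, e.hom (s z) = z := fun z ↦ LinearMap.congr_fun hs z
    obtain ⟨ζ, hζ, heζ⟩ := exists_equivariant hQ ρ (E.ρ.comp SemidirectProduct.inr)
      (Z.ρ.comp SemidirectProduct.inr) e.hom.toLinearMap (fun q y ↦ Rep.hom_comm_apply e _ y)
      (s ∘ₗ f.hom.toLinearMap ∘ₗ LinearMap.single F (fun _ : KleinFour ↦ V) 1) (fun q v ↦ by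
        change e.hom (s (f.hom (Pi.single 1 (ρ q v)))) =
          Z.ρ (SemidirectProduct.inr q) (e.hom (s (f.hom (Pi.single 1 v))))
        rw [hs', hs', ← indRep_inr_single (φ := φ)]
        exact Rep.hom_comm_apply f _ _)
    refine ⟨Rep.ofHom (LinearMap.intertwiningMap_of_isIntertwiningMap _ _
      (indLift (repP E.ρ) ζ) (indLift_equivariant ρ E.ρ hζ)), ?_⟩
    refine Rep.hom_ext (Representation.IntertwiningMap.ext ?_)
    refine indRep_ext ρ (repP Z.ρ) (fun p x ↦ ?_) (fun p x ↦ Rep.hom_comm_apply f _ _) fun v ↦ ?_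
    · exact Rep.hom_comm_apply (Rep.ofHom (LinearMap.intertwiningMap_of_isIntertwiningMap _ _
        (indLift (repP E.ρ) ζ) (indLift_equivariant ρ E.ρ hζ)) ≫ e) (SemidirectProduct.inl p) x
    · change e.hom (indLift (repP E.ρ) ζ (Pi.single 1 v)) = f.hom (Pi.single 1 v)
      rw [indLift_single]
      exact (heζ v).trans (hs' _)

lemma projective_res_indRep {V : Type u} [AddCommGroup V]
    [Module F V] (ρ : Representation F Q V) :
    Projective (Rep.res (SemidirectProduct.inl : KleinFour →* KleinFour ⋊[φ] Q)
      (Rep.of (indRep φ ρ))) where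
  factors {E Z} f e _ := by
    obtain ⟨s, hs⟩ := e.hom.toLinearMap.exists_rightInverse_of_surjective
      (LinearMap.range_eq_top.2 ((Rep.epi_iff_surjective e).1 inferInstance))
    set ζ := s ∘ₗ f.hom.toLinearMap ∘ₗ LinearMap.single F (fun _ : KleinFour ↦ V) 1
    set g := Rep.ofHom (LinearMap.intertwiningMap_of_isIntertwiningMap
      (repP (indRep φ ρ)) E.ρ (indLift E.ρ ζ) (fun p f ↦ indLift_inl ρ E.ρ ζ p f)) with hg
    refine ⟨g, Rep.hom_ext (Representation.IntertwiningMap.ext ?_)⟩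
    refine indRep_ext ρ Z.ρ (fun p x ↦ Rep.hom_comm_apply (g ≫ e) p x)
      (fun p x ↦ Rep.hom_comm_apply f p x) fun v ↦ ?_
    change e.hom (indLift E.ρ ζ (Pi.single 1 v)) = f.hom (Pi.single 1 v)
    rw [indLift_single]
    exact LinearMap.congr_fun hs _

/-- Every `Y` is a quotient of the module induced from its restriction to `Q`, and projectivity
splits the quotient map. Facts about induced modules thus pass to all projective ones. -/
lemma exists_retract_indRep (Y : Rep.{u} F (KleinFour ⋊[φ] Q)) [Projective Y] :
    ∃ (ι : Y ⟶ Rep.of (indRep φ (Y.ρ.comp SemidirectProduct.inr)))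
      (r : Rep.of (indRep φ (Y.ρ.comp SemidirectProduct.inr)) ⟶ Y), ι ≫ r = 𝟙 Y := by
  set r : Rep.of (indRep φ (Y.ρ.comp SemidirectProduct.inr)) ⟶ Y :=
    Rep.ofHom (LinearMap.intertwiningMap_of_isIntertwiningMap _ _
      (indLift (repP Y.ρ) LinearMap.id) (indLift_equivariant _ Y.ρ fun _ _ ↦ rfl))
  have : Epi r := (Rep.epi_iff_surjective r).2 fun y ↦ ⟨Pi.single 1 y, indLift_single _ _ _⟩
  exact ⟨Projective.factorThru (𝟙 Y) r, r, Projective.factorThru_comp _ _⟩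

lemma projective_res (Y : Rep.{u} F (KleinFour ⋊[φ] Q)) [Projective Y] :
    Projective (Rep.res (SemidirectProduct.inl : KleinFour →* KleinFour ⋊[φ] Q) Y) := by
  obtain ⟨ι, r, h⟩ := exists_retract_indRep Y
  have := projective_res_indRep (φ := φ) (Y.ρ.comp SemidirectProduct.inr)
  let R : Retract Y (Rep.of (indRep φ (Y.ρ.comp SemidirectProduct.inr))) := ⟨ι, r, h⟩
  exact (R.map (Rep.resFunctor SemidirectProduct.inl)).projective

/-- The derivatives `∂/∂wᵢ` of the induced module are compressed along the retraction. The relations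
survive because both maps of the retract commute with the `wⱼ`. -/
lemma exists_contraction [CharP F 2] (Y : Rep.{u} F (KleinFour ⋊[φ] Q)) [Projective Y] :
    ∃ h : Fin 2 → Module.End F Y,
      (∀ i, h i * extGen (repP Y.ρ) i + extGen (repP Y.ρ) i * h i = 1) ∧
      ∀ i j, i ≠ j → h i * extGen (repP Y.ρ) j = extGen (repP Y.ρ) j * h i := by
  let τ := indRep φ (Y.ρ.comp SemidirectProduct.inr)
  obtain ⟨ι, r, hr⟩ : ∃ (ι : Y ⟶ Rep.of τ) (r : Rep.of τ ⟶ Y), ι ≫ r = 𝟙 Y :=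
    exists_retract_indRep Y
  have hι : ∀ i y, ι.hom (extGen (repP Y.ρ) i y) = extGen (repP τ) i (ι.hom y) := fun i y ↦ by
    rw [extGen_apply, extGen_apply, map_add]
    exact congrArg₂ (· + ·) (Rep.hom_comm_apply ι _ y) (Rep.hom_comm_apply ι _ y)
  have hr' : ∀ i f, r.hom (extGen (repP τ) i f) = extGen (repP Y.ρ) i (r.hom f) := fun i f ↦ by
    rw [extGen_apply, extGen_apply, map_add]
    exact congrArg₂ (· + ·) (Rep.hom_comm_apply r _ f) (Rep.hom_comm_apply r _ f)
  have hrι : ∀ y, r.hom (ι.hom y) = y := fun y ↦ by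
    exact congrArg (fun g : Y ⟶ Y ↦ g.hom y) hr
  refine ⟨fun i ↦ r.hom.toLinearMap ∘ₗ genDeriv (F := F) i ∘ₗ ι.hom.toLinearMap, fun i ↦ ?_,
    fun i j hij ↦ ?_⟩
  · refine LinearMap.ext fun y ↦ ?_
    change r.hom (genDeriv (F := F) i (ι.hom (extGen (repP Y.ρ) i y))) +
      extGen (repP Y.ρ) i (r.hom (genDeriv (F := F) i (ι.hom y))) = y
    rw [hι, ← hr', ← map_add]
    refine (congrArg r.hom ?_).trans (hrι y)
    exact LinearMap.congr_fun (genDeriv_mul_extGen_add φ _ i) (ι.hom y)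
  · refine LinearMap.ext fun y ↦ ?_
    change r.hom (genDeriv (F := F) i (ι.hom (extGen (repP Y.ρ) j y))) =
      extGen (repP Y.ρ) j (r.hom (genDeriv (F := F) i (ι.hom y)))
    rw [hι, ← hr']
    refine congrArg r.hom ?_
    exact LinearMap.congr_fun (genDeriv_mul_extGen_of_ne φ _ hij) (ι.hom y)

end Projective
end

/-! ### Complexes of representations as exterior complexes -/

noncomputable section

open scoped TensorProduct DirectSum
open MvPolynomial (X C constantCoeff)

section Total

variable {F : Type u} [Field F]

section

variable (V : ℤ → Type v) [∀ n, AddCommGroup (V n)] [∀ n, Module F (V n)]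

/-- The projection of a graded vector space to one of its pieces. -/
def gradedProj (n : ℤ) : Module.End F (⨁ n, V n) :=
  DirectSum.lof F ℤ V n ∘ₗ DirectSum.component F ℤ V n

variable {V}

lemma gradedProj_lof (n m : ℤ) (x : V m) :
    gradedProj (F := F) V n (DirectSum.lof F ℤ V m x) =
      if m = n then DirectSum.lof F ℤ V m x else 0 := by
  rw [gradedProj, LinearMap.comp_apply, DirectSum.component.of]
  split_ifs with h
  · subst h; rfl
  · rw [map_zero]

lemma eq_lof_of_gradedProj {n : ℤ} {a : ⨁ n, V n} (h : gradedProj (F := F) V n a = a) :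
    a = DirectSum.lof F ℤ V n (a n) := h.symm

end

variable {Q : Type u} [Group Q] {φ : Q →* MulAut KleinFour}
variable (K L : CochainComplex (Rep.{u} F (KleinFour ⋊[φ] Q)) ℤ)

/-- The total space of a complex of representations. -/
abbrev TotalSpace : Type u := ⨁ n, (K.X n : Type u)

variable {K L}

/-- The map on total spaces induced by linear maps that raise the degree by `e`. -/
def totalMap (e : ℤ) (f : ∀ n, K.X n →ₗ[F] L.X (n + e)) : TotalSpace K →ₗ[F] TotalSpace L :=
  DirectSum.toModule F ℤ _ fun n ↦ DirectSum.lof F ℤ (fun n ↦ (L.X n : Type u)) (n + e) ∘ₗ f n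

lemma totalMap_lof (e : ℤ) (f : ∀ n, K.X n →ₗ[F] L.X (n + e)) (n : ℤ) (x : K.X n) :
    totalMap e f (DirectSum.lof F ℤ (fun n ↦ (K.X n : Type u)) n x) =
      DirectSum.lof F ℤ (fun n ↦ (L.X n : Type u)) (n + e) (f n x) :=
  DirectSum.toModule_lof ..

lemma totalMap_gradedProj (e : ℤ) (f : ∀ n, K.X n →ₗ[F] L.X (n + e)) (n : ℤ)
    (a : TotalSpace K) :
    totalMap e f (gradedProj (F := F) _ n a) = gradedProj (F := F) _ (n + e) (totalMap e f a) := by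
  induction a using DirectSum.induction_on with
  | zero => simp
  | of m x =>
    change totalMap e f (gradedProj (F := F) _ n (DirectSum.lof F ℤ _ m x)) =
      gradedProj (F := F) _ (n + e) (totalMap e f (DirectSum.lof F ℤ _ m x))
    rw [totalMap_lof, gradedProj_lof, gradedProj_lof]
    by_cases h : m = n
    · rw [if_pos h, if_pos (by rw [h]), totalMap_lof]
    · rw [if_neg h, if_neg (by lia), map_zero]
  | add x y hx hy => simp only [map_add, hx, hy]

variable (K) in
/-- The differential on the total space. -/
def totalD : Module.End F (TotalSpace K) := totalMap 1 fun n ↦ (K.d n (n + 1)).hom.toLinearMap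

lemma totalD_lof (n : ℤ) (x : K.X n) :
    totalD K (DirectSum.lof F ℤ (fun n ↦ (K.X n : Type u)) n x) =
      DirectSum.lof F ℤ (fun n ↦ (K.X n : Type u)) (n + 1) ((K.d n (n + 1)).hom x) :=
  totalMap_lof ..

lemma totalD_gradedProj (n : ℤ) (a : TotalSpace K) :
    totalD K (gradedProj (F := F) _ n a) = gradedProj (F := F) _ (n + 1) (totalD K a) := by
  rw [totalD, totalMap_gradedProj]

/-- The map on total spaces induced by linear maps in each degree. -/
def gradedMap (f : ∀ n, K.X n →ₗ[F] L.X n) : TotalSpace K →ₗ[F] TotalSpace L :=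
  DirectSum.lmap f

lemma gradedMap_lof (f : ∀ n, K.X n →ₗ[F] L.X n) (n : ℤ) (x : K.X n) :
    gradedMap f (DirectSum.lof F ℤ (fun n ↦ (K.X n : Type u)) n x) =
      DirectSum.lof F ℤ (fun n ↦ (L.X n : Type u)) n (f n x) :=
  DirectSum.lmap_lof ..

lemma total_ext {W : Type*} [AddCommGroup W] [Module F W] {f g : TotalSpace K →ₗ[F] W}
    (h : ∀ n (x : K.X n), f (DirectSum.lof F ℤ (fun n ↦ (K.X n : Type u)) n x) =
      g (DirectSum.lof F ℤ (fun n ↦ (K.X n : Type u)) n x)) : f = g :=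
  DirectSum.linearMap_ext F fun n ↦ LinearMap.ext fun x ↦ h n x

lemma gradedMap_gradedProj (f : ∀ n, K.X n →ₗ[F] L.X n) (n : ℤ) (a : TotalSpace K) :
    gradedMap f (gradedProj (F := F) _ n a) = gradedProj (F := F) _ n (gradedMap f a) := by
  refine LinearMap.congr_fun (f := gradedMap f ∘ₗ gradedProj (F := F) _ n)
    (g := gradedProj (F := F) _ n ∘ₗ gradedMap f) (total_ext fun m x ↦ ?_) a
  rw [LinearMap.comp_apply, LinearMap.comp_apply, gradedMap_lof, gradedProj_lof, gradedProj_lof]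
  split_ifs
  · rw [gradedMap_lof]
  · rw [map_zero]

variable (K) in
/-- The action of the exterior generators on the total space. -/
def totalW (i : Fin 2) : Module.End F (TotalSpace K) :=
  gradedMap fun n ↦ extGen (repP (K.X n).ρ) i

lemma totalW_lof (i : Fin 2) (n : ℤ) (x : K.X n) :
    totalW K i (DirectSum.lof F ℤ (fun n ↦ (K.X n : Type u)) n x) =
      DirectSum.lof F ℤ (fun n ↦ (K.X n : Type u)) n (extGen (repP (K.X n).ρ) i x) :=
  gradedMap_lof ..

lemma totalW_gradedProj (i : Fin 2) (n : ℤ) (a : TotalSpace K) :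
    totalW K i (gradedProj (F := F) _ n a) = gradedProj (F := F) _ n (totalW K i a) := by
  rw [totalW, gradedMap_gradedProj]

lemma hom_extGen {Y Z : Rep.{u} F (KleinFour ⋊[φ] Q)} (f : Y ⟶ Z) (i : Fin 2) (y : Y) :
    f.hom (extGen (repP Y.ρ) i y) = extGen (repP Z.ρ) i (f.hom y) := by
  rw [extGen_apply, extGen_apply, map_add]
  exact congrArg₂ (· + ·) (Rep.hom_comm_apply f _ y) (Rep.hom_comm_apply f _ y)

lemma d_d_apply (n m k : ℤ) (x : K.X n) : (K.d m k).hom ((K.d n m).hom x) = 0 :=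
  congrArg (fun g : K.X n ⟶ K.X k ↦ g.hom x) (K.d_comp_d n m k)

variable [CharP F 2] (K)

/-- The total space of a bounded complex as a complex over the exterior algebra. -/
def totalExt (s : Finset ℤ) (hs : ∀ n ∉ s, Subsingleton (K.X n)) :
    ExteriorComplex F (TotalSpace K) where
  pr := gradedProj _
  supp := s
  pr_mul_pr m n := by
    refine total_ext fun k x ↦ ?_
    rw [Module.End.mul_apply, gradedProj_lof]
    by_cases hmn : m = n
    · subst hmn
      rw [if_pos rfl, gradedProj_lof]
      split_ifs with h
      · rw [gradedProj_lof, if_pos h]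
      · rw [map_zero]
    · rw [if_neg hmn]
      split_ifs with h
      · rw [gradedProj_lof, if_neg (by lia)]; rfl
      · rw [map_zero]; rfl
  sum_pr := by
    refine total_ext fun k x ↦ ?_
    rw [LinearMap.sum_apply, Module.End.one_apply]
    simp only [gradedProj_lof]
    rw [Finset.sum_ite_eq]
    split_ifs with h
    · rfl
    · have := hs k h
      rw [Subsingleton.elim x 0, map_zero]
  d := totalD K
  w := totalW K
  d_mul_pr n := LinearMap.ext fun a ↦ totalD_gradedProj n a
  w_mul_pr i n := LinearMap.ext fun a ↦ totalW_gradedProj i n a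
  d_mul_d := by
    refine total_ext fun k x ↦ ?_
    rw [Module.End.mul_apply, totalD_lof, totalD_lof, d_d_apply, map_zero]; rfl
  w_mul_w i := by
    refine total_ext fun k x ↦ ?_
    rw [Module.End.mul_apply, totalW_lof, totalW_lof, ← Module.End.mul_apply, extGen_mul_self]
    simp
  w_comm := by
    refine total_ext fun k x ↦ ?_
    rw [Module.End.mul_apply, Module.End.mul_apply, totalW_lof, totalW_lof, totalW_lof, totalW_lof,
      ← Module.End.mul_apply, extGen_comm, Module.End.mul_apply]
  d_mul_w i := by
    refine total_ext fun k x ↦ ?_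
    rw [Module.End.mul_apply, Module.End.mul_apply, totalW_lof, totalD_lof, totalD_lof, totalW_lof,
      hom_extGen]

lemma finite_totalSpace (s : Finset ℤ) (hs : ∀ n ∉ s, Subsingleton (K.X n))
    (hf : ∀ n, Module.Finite F (K.X n)) : Module.Finite F (TotalSpace K) := by
  refine Module.Finite.of_surjective
    (∑ n : s, DirectSum.lof F ℤ (fun n ↦ (K.X n : Type u)) n ∘ₗ
      LinearMap.proj (φ := fun n : s ↦ (K.X n : Type u)) n) fun a ↦ ?_
  refine ⟨fun n ↦ a n, ?_⟩
  rw [LinearMap.sum_apply]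
  refine Eq.trans ?_ ((totalExt K s hs).sum_pr_apply a)
  exact Finset.sum_coe_sort s fun n ↦ gradedProj (F := F) _ n a

end Total
end

/-! ### Torsion of twisted homology for projective complexes -/

noncomputable section

open scoped TensorProduct DirectSum
open MvPolynomial (X C constantCoeff)

lemma add_mul_geom_sum {R : Type*} [Ring R] (h2 : ∀ r : R, r + r = 0) {x n : R}
    (hc : Commute x n) {k : ℕ} (hn : n ^ k = 0) :
    (x + n) * ∑ j ∈ Finset.range k, x ^ j * n ^ (k - 1 - j) = x ^ k := by
  have h := hc.mul_geom_sum₂ k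
  rw [hn, sub_zero, sub_eq_add_neg, neg_eq_of_add_eq_zero_left (h2 n)] at h
  exact h

namespace ExteriorComplex

variable {F : Type u} {A : Type v} [Field F] [CharP F 2] [AddCommGroup A] [Module F A]
variable (T : ExteriorComplex F A)

/-- Since `h` contracts `wᵢ` and commutes with the other generator, the anticommutator of `D` and
`h` has only two terms: `xᵢ`, from the twist, and that of `d` and `h`. So `xᵢ` is homotopic to an
operator of degree one in the grading of `A`. -/
lemma D_contraction {h : Module.End F A} {i : Fin 2} (hi : h * T.w i + T.w i * h = 1)
    (hj : ∀ j, i ≠ j → h * T.w j = T.w j * h) (v : BiPoly F ⊗[F] A) :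
    T.D (bc h v) + bc h (T.D v) = (X i : BiPoly F) • v + bc (h * T.d + T.d * h) v := by
  have h2 : ∀ x : BiPoly F ⊗[F] A, x + x = 0 := fun x ↦ add_self_of_charTwo F x
  have hi' : ∀ a, h (T.w i a) + T.w i (h a) = a := fun a ↦ LinearMap.congr_fun hi a
  have hj' : ∀ j, i ≠ j → ∀ a, h (T.w j a) = T.w j (h a) := fun j hij a ↦
    LinearMap.congr_fun (hj j hij) a
  induction v using TensorProduct.induction_on with
  | zero => simp
  | add x y hx hy =>
    simp only [map_add, smul_add] at hx hy ⊢
    rw [add_add_add_comm, hx, hy, add_add_add_comm]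
  | tmul s a =>
    rw [D_tmul, map_add, map_add, bc_tmul, bc_tmul, bc_tmul, bc_tmul, bc_tmul, D_tmul]
    have e1 : s ⊗ₜ[F] (h * T.d + T.d * h) a = s ⊗ₜ h (T.d a) + s ⊗ₜ T.d (h a) := by
      rw [← TensorProduct.tmul_add]; rfl
    rw [e1, TensorProduct.smul_tmul', smul_eq_mul]
    have e2 : (X i * s) ⊗ₜ[F] a = (X i * s) ⊗ₜ[F] h (T.w i a) + (X i * s) ⊗ₜ T.w i (h a) := by
      rw [← TensorProduct.tmul_add, hi']
    rw [e2]
    fin_cases i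
    · have e3 := hj' 1 (by decide) a
      change s ⊗ₜ[F] T.d (h a) + ((X 0 * s) ⊗ₜ[F] T.w 0 (h a) + (X 1 * s) ⊗ₜ[F] T.w 1 (h a)) +
        (s ⊗ₜ[F] h (T.d a) + ((X 0 * s) ⊗ₜ[F] h (T.w 0 a) + (X 1 * s) ⊗ₜ[F] h (T.w 1 a))) =
        (X 0 * s) ⊗ₜ[F] h (T.w 0 a) + (X 0 * s) ⊗ₜ[F] T.w 0 (h a) +
          (s ⊗ₜ[F] h (T.d a) + s ⊗ₜ[F] T.d (h a))
      rw [e3]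
      exact eq_of_add_self h2 (s := (X 1 * s) ⊗ₜ[F] T.w 1 (h a)) (by abel)
    · have e3 := hj' 0 (by decide) a
      change s ⊗ₜ[F] T.d (h a) + ((X 0 * s) ⊗ₜ[F] T.w 0 (h a) + (X 1 * s) ⊗ₜ[F] T.w 1 (h a)) +
        (s ⊗ₜ[F] h (T.d a) + ((X 0 * s) ⊗ₜ[F] h (T.w 0 a) + (X 1 * s) ⊗ₜ[F] h (T.w 1 a))) =
        (X 1 * s) ⊗ₜ[F] h (T.w 1 a) + (X 1 * s) ⊗ₜ[F] T.w 1 (h a) +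
          (s ⊗ₜ[F] h (T.d a) + s ⊗ₜ[F] T.d (h a))
      rw [e3]
      exact eq_of_add_self h2 (s := (X 0 * s) ⊗ₜ[F] T.w 0 (h a)) (by abel)

/-- A contraction of `wᵢ` makes twisted homology torsion with respect to `xᵢ`. -/
lemma exists_X_pow_smul {h : Module.End F A} {i : Fin 2} (hi : h * T.w i + T.w i * h = 1)
    (hj : ∀ j, i ≠ j → h * T.w j = T.w j * h) (hpr : ∀ n, h * T.pr n = T.pr n * h) :
    ∃ q, ∀ k, q ≤ k → ∀ v, T.D v = 0 → ∃ y, (X i : BiPoly F) ^ k • v = T.D y := by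
  set n := h * T.d + T.d * h with hn
  -- As `h` preserves the grading of `A`, the operator `n` raises it by one, and the grading is
  -- bounded.
  obtain ⟨q, hq⟩ : IsNilpotent n := by
    refine isNilpotent_of_shift (e := 1) T.sum_pr (fun n hn ↦ T.pr_of_notMem hn) one_ne_zero
      fun m ↦ ?_
    rw [hn, add_mul, mul_add, mul_assoc, T.d_mul_pr, ← mul_assoc, hpr, mul_assoc,
      mul_assoc T.d h, hpr, ← mul_assoc T.d, T.d_mul_pr, mul_assoc (T.pr _)]
  set c : Module.End (BiPoly F) (BiPoly F ⊗[F] A) := (X i : BiPoly F) • 1 + bc n with hc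
  have hcD : ∀ v, c v = T.D (bc h v) + bc h (T.D v) := fun v ↦ (T.D_contraction hi hj v).symm
  have hDc : ∀ v, T.D (c v) = c (T.D v) := fun v ↦ by
    rw [hcD, hcD, map_add, T.D_D, T.D_D, map_zero, zero_add, add_zero]
  have hDn : ∀ v, T.D (bc n v) = bc n (T.D v) := fun v ↦ by
    have h1 := hDc v
    rw [hc] at h1
    simp only [LinearMap.add_apply, LinearMap.smul_apply, Module.End.one_apply, map_add,
      map_smul] at h1
    exact add_left_cancel h1
  refine ⟨q, fun k hk ↦ ?_⟩
  have hbn : (bc n) ^ k = 0 := by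
    have : (bc n) ^ k = bc (n ^ k) := (map_pow (Module.End.baseChangeHom F (BiPoly F) A) n k).symm
    rw [this, pow_eq_zero_of_le hk hq, bc_zero]
  have hcomm : Commute ((X i : BiPoly F) • (1 : Module.End (BiPoly F) (BiPoly F ⊗[F] A)))
      (bc n) := (Commute.one_left _).smul_left _
  set S := ∑ j ∈ Finset.range k, ((X i : BiPoly F) •
    (1 : Module.End (BiPoly F) (BiPoly F ⊗[F] A))) ^ j * (bc n) ^ (k - 1 - j) with hS
  -- The operator `c = xᵢ + n` is null-homotopic and `n` is nilpotent, so a power of `xᵢ` is a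
  -- multiple of `c` by a chain map. Hence it kills homology.
  have hgeom : c * S = (X i : BiPoly F) ^ k • 1 := by
    have h1 := add_mul_geom_sum (R := Module.End (BiPoly F) (BiPoly F ⊗[F] A))
      (fun r ↦ add_self_of_charTwo F r) hcomm hbn
    rw [smul_pow, one_pow] at h1
    exact h1
  have hSD : Commute T.D S := by
    refine Commute.sum_right _ _ _ fun j _ ↦ ?_
    refine Commute.mul_right (Commute.pow_right ((Commute.one_right _).smul_right _) _)
      (Commute.pow_right (LinearMap.ext hDn) _)
  intro v hv
  refine ⟨bc h (S v), ?_⟩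
  have h1 : T.D (S v) = 0 := by
    have := LinearMap.congr_fun hSD v
    change T.D (S v) = S (T.D v) at this
    rw [this, hv, map_zero]
  have h2 : c (S v) = (X i : BiPoly F) ^ k • v := LinearMap.congr_fun hgeom v
  rw [← h2, hcD, h1, map_zero, add_zero]

end ExteriorComplex

section

variable {F : Type u} [Field F] [CharP F 2] {Q : Type u} [Group Q] {φ : Q →* MulAut KleinFour}

lemma exists_X_pow_smul_totalExt (K : CochainComplex (Rep.{u} F (KleinFour ⋊[φ] Q)) ℤ)
    (s : Finset ℤ) (hs : ∀ n ∉ s, Subsingleton (K.X n)) (hK : ∀ n, Projective (K.X n)) :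
    ∃ q : ℕ, ∀ v, (totalExt K s hs).D v = 0 → ∀ i,
      ∃ y, (X i : BiPoly F) ^ q • v = (totalExt K s hs).D y := by
  choose h h1 h2 using fun n ↦ exists_contraction (K.X n)
  have hex : ∀ i, ∃ q, ∀ k, q ≤ k → ∀ v, (totalExt K s hs).D v = 0 →
      ∃ y, (X i : BiPoly F) ^ k • v = (totalExt K s hs).D y := by
    intro i
    refine ExteriorComplex.exists_X_pow_smul (totalExt K s hs)
      (h := gradedMap fun n ↦ h n i) (i := i) ?_ ?_ ?_
    · refine total_ext fun n x ↦ ?_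
      change gradedMap (fun n ↦ h n i) (totalW K i _) + totalW K i (gradedMap (fun n ↦ h n i) _) = _
      rw [totalW_lof, gradedMap_lof, gradedMap_lof, totalW_lof, ← map_add]
      exact congrArg _ (LinearMap.congr_fun (h1 n i) x)
    · intro j hij
      refine total_ext fun n x ↦ ?_
      change gradedMap (fun n ↦ h n i) (totalW K j _) = totalW K j (gradedMap (fun n ↦ h n i) _)
      rw [totalW_lof, gradedMap_lof, gradedMap_lof, totalW_lof]
      exact congrArg _ (LinearMap.congr_fun (h2 n i j hij) x)
    · exact fun n ↦ LinearMap.ext fun a ↦ gradedMap_gradedProj _ n a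
  choose q hq using hex
  exact ⟨max (q 0) (q 1), fun v hv i ↦ hq i _ (by fin_cases i <;> simp) v hv⟩

end
end

/-! ### Homology of complexes of representations in terms of elements -/

noncomputable section

open scoped DirectSum

section Homology

variable {F : Type u} [Field F] {H : Type v} [Group H]

lemma Rep.exact_iff (S : ShortComplex (Rep.{u} F H)) :
    S.Exact ↔ ∀ x : S.X₂, S.g.hom x = 0 → ∃ y : S.X₁, S.f.hom y = x :=
  (S.exact_map_iff_of_faithful (forget₂ (Rep.{u} F H) (ModuleCat.{u} F))).symm.trans
    (ShortComplex.moduleCat_exact_iff _)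

variable {K L : CochainComplex (Rep.{u} F H) ℤ}

lemma exists_iCycles_eq {n m : ℤ} (hm : n + 1 = m) {x : K.X n} (hx : (K.d n m).hom x = 0) :
    ∃ c, (K.iCycles n).hom c = x := by
  subst hm
  exact (Rep.exact_iff (ShortComplex.mk (K.iCycles n) (K.d n (n + 1)) (by simp))).1
    (ShortComplex.exact_of_f_is_kernel _ (K.cyclesIsKernel n (n + 1) (by simp))) x hx

lemma d_iCycles (n m : ℤ) (c : K.cycles n) : (K.d n m).hom ((K.iCycles n).hom c) = 0 :=
  congrArg (fun g : K.cycles n ⟶ K.X m ↦ g.hom c) (K.iCycles_d n m)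

lemma iCycles_injective (n : ℤ) : Function.Injective (K.iCycles n).hom :=
  (Rep.mono_iff_injective _).1 inferInstance

lemma homologyπ_surjective (n : ℤ) : Function.Surjective (K.homologyπ n).hom :=
  (Rep.epi_iff_surjective _).1 inferInstance

lemma homologyπ_eq_zero_iff {k n : ℤ} (hk : k + 1 = n) {c : K.cycles n} :
    (K.homologyπ n).hom c = 0 ↔ ∃ y, (K.iCycles n).hom c = (K.d k n).hom y := by
  subst hk
  have hi : ∀ y, (K.iCycles (k + 1)).hom ((K.toCycles k (k + 1)).hom y) = (K.d k (k + 1)).hom y :=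
    fun y ↦ congrArg (fun g : K.X k ⟶ K.X (k + 1) ↦ g.hom y) (K.toCycles_i k (k + 1))
  constructor
  · intro h
    obtain ⟨y, hy⟩ := (Rep.exact_iff (ShortComplex.mk (K.toCycles k (k + 1)) (K.homologyπ (k + 1))
      (by simp))).1 (ShortComplex.exact_of_g_is_cokernel _ (K.homologyIsCokernel k (k + 1)
        (by simp))) c h
    exact ⟨y, by rw [← hy]; exact hi y⟩
  · rintro ⟨y, hy⟩
    rw [← hi] at hy
    rw [iCycles_injective _ hy]
    exact congrArg (fun g : K.X k ⟶ K.homology (k + 1) ↦ g.hom y)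
      (K.toCycles_comp_homologyπ k (k + 1))

lemma nontrivial_homology_iff {k n m : ℤ} (hk : k + 1 = n) (hm : n + 1 = m) :
    Nontrivial (K.homology n) ↔
      ∃ x : K.X n, (K.d n m).hom x = 0 ∧ ¬ ∃ y, x = (K.d k n).hom y := by
  constructor
  · intro h
    obtain ⟨h, hh⟩ := exists_ne (0 : K.homology n)
    obtain ⟨c, rfl⟩ := homologyπ_surjective n h
    exact ⟨(K.iCycles n).hom c, d_iCycles n m c, fun hy ↦ hh ((homologyπ_eq_zero_iff hk).2 hy)⟩
  · rintro ⟨x, hx, hxy⟩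
    obtain ⟨c, rfl⟩ := exists_iCycles_eq hm hx
    exact ⟨⟨_, 0, fun h ↦ hxy ((homologyπ_eq_zero_iff hk).1 h)⟩⟩

lemma quasiIso_iff_forall (f : K ⟶ L) : QuasiIso f ↔ ∀ n : ℤ,
    (∀ x, (K.d n (n + 1)).hom x = 0 → (∃ y, (f.f n).hom x = (L.d (n - 1) n).hom y) →
      ∃ y, x = (K.d (n - 1) n).hom y) ∧
    ∀ x', (L.d n (n + 1)).hom x' = 0 → ∃ x y, (K.d n (n + 1)).hom x = 0 ∧
      x' = (f.f n).hom x + (L.d (n - 1) n).hom y := by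
  rw [quasiIso_iff]
  refine forall_congr' fun n ↦ ?_
  rw [quasiIsoAt_iff_isIso_homologyMap]
  have hc : ∀ c, (L.iCycles n).hom ((HomologicalComplex.cyclesMap f n).hom c) =
      (f.f n).hom ((K.iCycles n).hom c) := fun c ↦
    congrArg (fun g : K.cycles n ⟶ L.X n ↦ g.hom c) (HomologicalComplex.cyclesMap_i f n)
  have hπ : ∀ c, (HomologicalComplex.homologyMap f n).hom ((K.homologyπ n).hom c) =
      (L.homologyπ n).hom ((HomologicalComplex.cyclesMap f n).hom c) := fun c ↦
    congrArg (fun g : K.cycles n ⟶ L.homology n ↦ g.hom c) (HomologicalComplex.homologyπ_naturality f n)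
  have hk : n - 1 + 1 = n := by ring
  constructor
  · intro h
    have hi : Function.Injective (HomologicalComplex.homologyMap f n).hom :=
      (Rep.mono_iff_injective _).1 inferInstance
    have hs : Function.Surjective (HomologicalComplex.homologyMap f n).hom :=
      (Rep.epi_iff_surjective _).1 inferInstance
    constructor
    · intro x hx hy
      obtain ⟨c, rfl⟩ := exists_iCycles_eq rfl hx
      rw [← hc, ← homologyπ_eq_zero_iff hk, ← hπ] at hy
      rw [← homologyπ_eq_zero_iff hk]
      exact hi (hy.trans (map_zero _).symm)
    · intro x' hx'
      obtain ⟨c', rfl⟩ := exists_iCycles_eq rfl hx'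
      obtain ⟨h, hh⟩ := hs ((L.homologyπ n).hom c')
      obtain ⟨c, rfl⟩ := homologyπ_surjective n h
      rw [hπ] at hh
      have h0 : (L.homologyπ n).hom (c' - (HomologicalComplex.cyclesMap f n).hom c) = 0 := by
        rw [map_sub, hh, sub_self]
      obtain ⟨y, hy⟩ := (homologyπ_eq_zero_iff hk).1 h0
      refine ⟨(K.iCycles n).hom c, y, d_iCycles _ _ _, ?_⟩
      rw [← hc, ← hy, map_sub]
      abel
  · rintro ⟨hi, hs⟩
    have : Mono (HomologicalComplex.homologyMap f n) := by
      rw [Rep.mono_iff_injective, injective_iff_map_eq_zero]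
      intro h hh
      obtain ⟨c, rfl⟩ := homologyπ_surjective n h
      rw [hπ, homologyπ_eq_zero_iff hk, hc] at hh
      exact (homologyπ_eq_zero_iff hk).2 (hi _ (d_iCycles _ _ _) hh)
    have : Epi (HomologicalComplex.homologyMap f n) := by
      rw [Rep.epi_iff_surjective]
      intro h
      obtain ⟨c', rfl⟩ := homologyπ_surjective n h
      obtain ⟨x, y, hx, hxy⟩ := hs _ (d_iCycles n (n + 1) c')
      obtain ⟨c, rfl⟩ := exists_iCycles_eq rfl hx
      refine ⟨(K.homologyπ n).hom c, ?_⟩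
      rw [hπ, ← sub_eq_zero, ← map_sub, homologyπ_eq_zero_iff hk]
      refine ⟨-y, ?_⟩
      rw [map_sub, hc, hxy, map_neg]
      abel
    exact isIso_of_mono_of_epi _

end Homology

section Total

variable {F : Type u} [Field F] {Q : Type u} [Group Q] {φ : Q →* MulAut KleinFour}
variable (K : CochainComplex (Rep.{u} F (KleinFour ⋊[φ] Q)) ℤ)

lemma totalD_apply (a : TotalSpace K) (n : ℤ) :
    (totalD K a) (n + 1) = (K.d n (n + 1)).hom (a n) := by
  induction a using DirectSum.induction_on with
  | zero => simp
  | of m x =>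
    change (totalD K (DirectSum.lof F ℤ (fun n ↦ (K.X n : Type u)) m x)) (n + 1) = _
    rw [totalD_lof]
    by_cases h : m = n
    · subst h
      rw [DirectSum.lof_apply, DirectSum.of_eq_same]
    · rw [DirectSum.of_eq_of_ne _ _ _ (Ne.symm h), map_zero]
      exact DirectSum.of_eq_of_ne _ _ _ (by lia)
  | add x y hx hy => rw [map_add, DirectSum.add_apply, hx, hy, DirectSum.add_apply, map_add]

lemma lof_d_mem_range {k n : ℤ} (hk : k + 1 = n) (y : K.X k) :
    DirectSum.lof F ℤ (fun n ↦ (K.X n : Type u)) n ((K.d k n).hom y) ∈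
      LinearMap.range (totalD K) := by
  subst hk
  exact ⟨_, totalD_lof k y⟩

variable {K} in
lemma mem_of_forall_lof {V : ℤ → Type u} [∀ n, AddCommGroup (V n)] [∀ n, Module F (V n)]
    {W : Submodule F (TotalSpace K)} (f : (⨁ n, V n) →ₗ[F] TotalSpace K) (a : ⨁ n, V n)
    (h : ∀ n, f (DirectSum.lof F ℤ V n (a n)) ∈ W) : f a ∈ W := by
  classical
  rw [← DirectSum.sum_support_of a, map_sum]
  exact Submodule.sum_mem _ fun n _ ↦ h n

/-- The total homology has dimension `dim ker d - dim range d`. -/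
lemma finrank_homology [Module.Finite F (TotalSpace K)] :
    Module.finrank F (LinearMap.ker (totalD K)) =
      Module.finrank F (LinearMap.range (totalD K)) +
        Module.finrank F (⨁ n, (K.homology n : Type u)) := by
  -- The sum of all cycles is embedded onto the kernel of `d` by `α` and mapped onto the total
  -- homology by `β`, whose kernel is carried by `α` onto the range of `d`.
  set α : (⨁ n, (K.cycles n : Type u)) →ₗ[F] TotalSpace K :=
    DirectSum.lmap fun n ↦ (K.iCycles n).hom.toLinearMap with hα
  set β : (⨁ n, (K.cycles n : Type u)) →ₗ[F] ⨁ n, (K.homology n : Type u) :=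
    DirectSum.lmap fun n ↦ (K.homologyπ n).hom.toLinearMap with hβ
  have hαl : ∀ n c, α (DirectSum.lof F ℤ (fun n ↦ (K.cycles n : Type u)) n c) =
    DirectSum.lof F ℤ (fun n ↦ (K.X n : Type u)) n ((K.iCycles n).hom c) := fun n c ↦
      DirectSum.lmap_lof ..
  have hβl : ∀ n c, β (DirectSum.lof F ℤ (fun n ↦ (K.cycles n : Type u)) n c) =
    DirectSum.lof F ℤ (fun n ↦ (K.homology n : Type u)) n ((K.homologyπ n).hom c) := fun n c ↦
      DirectSum.lmap_lof ..
  have hαi : Function.Injective α := (DirectSum.lmap_injective _).2 fun n ↦ iCycles_injective n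
  have hβs : Function.Surjective β := (DirectSum.lmap_surjective _).2 fun n ↦ homologyπ_surjective n
  have hαr : LinearMap.range α = LinearMap.ker (totalD K) := by
    apply le_antisymm
    · rintro _ ⟨z, rfl⟩
      have : totalD K ∘ₗ α = 0 := by
        refine DirectSum.linearMap_ext F fun n ↦ LinearMap.ext fun c ↦ ?_
        change totalD K (α (DirectSum.lof F ℤ (fun n ↦ (K.cycles n : Type u)) n c)) = 0
        rw [hαl, totalD_lof, d_iCycles, map_zero]
      exact LinearMap.congr_fun this z
    · intro a ha
      refine mem_of_forall_lof LinearMap.id a fun n ↦ ?_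
      have h0 : (K.d n (n + 1)).hom (a n) = 0 := by
        rw [← totalD_apply, LinearMap.mem_ker.1 ha]; rfl
      obtain ⟨c, hc⟩ := exists_iCycles_eq rfl h0
      exact ⟨_, (hαl n c).trans (by rw [hc]; rfl)⟩
  have hker : (LinearMap.ker β).map α = LinearMap.range (totalD K) := by
    apply le_antisymm
    · rintro _ ⟨z, hz, rfl⟩
      refine mem_of_forall_lof α z fun n ↦ ?_
      rw [hαl]
      have h0 : (K.homologyπ n).hom (z n) = 0 := by
        have := congrArg (fun x : ⨁ n, (K.homology n : Type u) ↦ x n) (LinearMap.mem_ker.1 hz)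
        simpa [hβ, DirectSum.lmap_apply] using this
      obtain ⟨y, hy⟩ := (homologyπ_eq_zero_iff (k := n - 1) (by ring)).1 h0
      rw [hy]
      exact lof_d_mem_range K (by ring) y
    · rintro _ ⟨a, rfl⟩
      refine mem_of_forall_lof (totalD K) a fun n ↦ ?_
      obtain ⟨c, hc⟩ := exists_iCycles_eq (n := n + 1) rfl (d_d_apply n (n + 1) _ (a n))
      refine ⟨DirectSum.lof F ℤ (fun n ↦ (K.cycles n : Type u)) (n + 1) c, ?_, ?_⟩
      · refine LinearMap.mem_ker.2 ?_
        rw [hβl, (homologyπ_eq_zero_iff rfl).2 ⟨_, hc⟩, map_zero]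
      · rw [hαl, hc, totalD_lof]
  have : Module.Finite F (⨁ n, (K.cycles n : Type u)) := Module.Finite.of_injective α hαi
  have h1 := LinearMap.finrank_range_add_finrank_ker β
  rw [LinearMap.range_eq_top.2 hβs, finrank_top] at h1
  rw [← hker, ← hαr, LinearMap.finrank_range_of_inj hαi, ← h1,
    ← (Submodule.equivMapOfInjective α hαi (LinearMap.ker β)).finrank_eq, add_comm]

end Total
end

/-! ### Lifting along quasi-isomorphisms and composition in Hom cohomology -/

noncomputable section

section KProjectiveLifting

lemma postcomp_toHom {C : Type*} [Category* C] [Abelian C] {K L M : CochainComplex C ℤ}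
    (g : L ⟶ M) (n : ℤ) (z : Cocycle K L n) :
    CohomologyClass.toHom (CohomologyClass.mk (z.postcomp g)) =
      CohomologyClass.toHom (CohomologyClass.mk z) ≫
        (HomotopyCategory.quotient C (.up ℤ)).map (g⟦n⟧') := by
  rw [CohomologyClass.toHom_mk, CohomologyClass.toHom_mk, Cocycle.equivHomShift_symm_postcomp,
    Functor.map_comp]

variable {C : Type*} [Category* C] [Abelian C] {K L M : CochainComplex C ℤ} [K.IsKProjective]

-- Homotopy classes of maps out of a K-projective complex are its morphisms in the derived category,
-- where a quasi-isomorphism is invertible.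
attribute [local instance] HasDerivedCategory.standard in
lemma bijective_quotient_comp_of_quasiIso (g : L ⟶ M) [QuasiIso g] :
    Function.Bijective fun f : (HomotopyCategory.quotient C (.up ℤ)).obj K ⟶
      (HomotopyCategory.quotient C (.up ℤ)).obj L ↦
        f ≫ (HomotopyCategory.quotient C (.up ℤ)).map g := by
  have h := IsKProjective.Qh_map_bijective K ((HomotopyCategory.quotient C (.up ℤ)).obj M)
  have hL := IsKProjective.Qh_map_bijective K ((HomotopyCategory.quotient C (.up ℤ)).obj L)
  have : IsIso (DerivedCategory.Qh.map ((HomotopyCategory.quotient C (.up ℤ)).map g)) :=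
    inferInstanceAs (IsIso (DerivedCategory.Q.map g))
  rw [← Function.Bijective.of_comp_iff' h]
  have e : (DerivedCategory.Qh.map ∘ fun f : (HomotopyCategory.quotient C (.up ℤ)).obj K ⟶
      (HomotopyCategory.quotient C (.up ℤ)).obj L ↦
        f ≫ (HomotopyCategory.quotient C (.up ℤ)).map g) =
      (fun f ↦ f ≫ DerivedCategory.Qh.map ((HomotopyCategory.quotient C (.up ℤ)).map g)) ∘
        DerivedCategory.Qh.map := by
    ext f
    exact Functor.map_comp _ _ _
  rw [e]
  exact ((asIso (DerivedCategory.Qh.map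
    ((HomotopyCategory.quotient C (.up ℤ)).map g))).homToEquiv).bijective.comp hL

instance quasiIso_shift_map (g : L ⟶ M) [QuasiIso g] (n : ℤ) : QuasiIso (g⟦n⟧') := by
  rw [← HomologicalComplex.mem_quasiIso_iff] at *
  exact MorphismProperty.IsCompatibleWithShift.iff _ g n |>.2 ‹_›

/-- A cocycle of degree `n` is a chain map to the shift by `n` and cohomologous means homotopic, so
the bijection on homotopy classes for the shifted `g` gives surjectivity on cohomology; the next
lemma is injectivity. -/
lemma exists_cocycle_of_quasiIso (g : L ⟶ M) [QuasiIso g] {n : ℤ} (z : Cochain K M n)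
    (hz : δ n (n + 1) z = 0) :
    ∃ z' : Cochain K L n, δ n (n + 1) z' = 0 ∧
      ∃ y : Cochain K M (n - 1), δ (n - 1) n y = z - z'.comp (Cochain.ofHom g) (add_zero n) := by
  obtain ⟨t, ht⟩ := (bijective_quotient_comp_of_quasiIso (K := K) (g⟦n⟧')).2
    (CohomologyClass.toHom (CohomologyClass.mk (Cocycle.mk z (n + 1) rfl hz)))
  obtain ⟨t, rfl⟩ := (CohomologyClass.toHom_bijective K L n).2 t
  obtain ⟨z', rfl⟩ := t.mk_surjective
  refine ⟨z'.1, z'.δ_eq_zero _, ?_⟩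
  have h := (CohomologyClass.toHom_bijective K M n).1 ((postcomp_toHom g n z').trans ht)
  have h' := sub_eq_zero.2 h.symm
  rw [← CohomologyClass.mk_sub, CohomologyClass.mk_eq_zero_iff,
    mem_coboundaries_iff _ (n - 1) (by lia)] at h'
  exact h'

lemma exists_coboundary_of_quasiIso (g : L ⟶ M) [QuasiIso g] {n : ℤ} (z : Cochain K L n)
    (hz : δ n (n + 1) z = 0) (y : Cochain K M (n - 1))
    (hy : δ (n - 1) n y = z.comp (Cochain.ofHom g) (add_zero n)) :
    ∃ y' : Cochain K L (n - 1), δ (n - 1) n y' = z := by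
  have h : CohomologyClass.mk ((Cocycle.mk z (n + 1) rfl hz).postcomp g) = 0 := by
    rw [CohomologyClass.mk_eq_zero_iff, mem_coboundaries_iff _ (n - 1) (by lia)]
    exact ⟨y, hy⟩
  have h' := postcomp_toHom g n (Cocycle.mk z (n + 1) rfl hz)
  rw [h, map_zero] at h'
  have h'' := (bijective_quotient_comp_of_quasiIso (K := K) (g⟦n⟧')).1
    (a₁ := 0) (Limits.zero_comp.trans h')
  rw [← map_zero CohomologyClass.toHom] at h''
  have h3 := ((CohomologyClass.toHom_bijective K L n).1 h'').symm
  rw [CohomologyClass.mk_eq_zero_iff, mem_coboundaries_iff _ (n - 1) (by lia)] at h3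
  exact h3

lemma exists_lift_of_quasiIso (g : L ⟶ M) [QuasiIso g] (f : K ⟶ M) :
    ∃ f' : K ⟶ L, Nonempty (Homotopy (f' ≫ g) f) := by
  obtain ⟨t, ht⟩ := (bijective_quotient_comp_of_quasiIso (K := K) g).2
    ((HomotopyCategory.quotient C (.up ℤ)).map f)
  obtain ⟨f', rfl⟩ := (HomotopyCategory.quotient _ _).map_surjective t
  exact ⟨f', ⟨HomotopyCategory.homotopyOfEq _ _ ((Functor.map_comp _ _ _).trans ht)⟩⟩

lemma exists_homotopyInverse_of_quasiIso [M.IsKProjective] (g : K ⟶ M) [QuasiIso g] :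
    ∃ g' : M ⟶ K, Nonempty (Homotopy (g ≫ g') (𝟙 K)) ∧ Nonempty (Homotopy (g' ≫ g) (𝟙 M)) := by
  obtain ⟨e, he⟩ := (IsKProjective.quasiIso_iff g).1 inferInstance
  subst he
  exact ⟨e.inv, ⟨e.homotopyHomInvId⟩, ⟨e.homotopyInvHomId⟩⟩

end KProjectiveLifting

section HomCohomologyFunctoriality

variable {F : Type u} [Field F] {P : Type v} [Group P] {Q : Type w} [Group Q]
  {φ : Q →* MulAut P} {K L M N : CochainComplex (Rep.{u} F (P ⋊[φ] Q)) ℤ}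

variable (φ) in
/-- Restriction of a chain map over `F[P ⋊ Q]` to `F[P]`. -/
abbrev resPMap (f : K ⟶ L) : resP φ K ⟶ resP φ L :=
  ((Rep.resFunctor (SemidirectProduct.inl : P →* P ⋊[φ] Q)).mapHomologicalComplex
    (ComplexShape.up ℤ)).map f

/-- The class of a cocycle of `F[P]`-linear maps. -/
def homMk {n : ℤ} (z : Cochain (resP φ K) (resP φ L) n) (hz : δ n (n + 1) z = 0) :
    HomCohomology φ K L n :=
  Submodule.Quotient.mk ⟨z, hz⟩

lemma exists_homMk_eq {n : ℤ} (x : HomCohomology φ K L n) : ∃ z hz, x = homMk z hz := by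
  obtain ⟨z, rfl⟩ := Submodule.Quotient.mk_surjective _ x
  exact ⟨z.1, z.2, rfl⟩

lemma homMk_eq_homMk_iff {n : ℤ} {z z' : Cochain (resP φ K) (resP φ L) n} {hz : δ n (n + 1) z = 0}
    {hz' : δ n (n + 1) z' = 0} : homMk z hz = homMk z' hz' ↔ ∃ y, δ (n - 1) n y = z - z' :=
  Submodule.Quotient.eq _

lemma homMk_eq_zero_iff {n : ℤ} {z : Cochain (resP φ K) (resP φ L) n} {hz : δ n (n + 1) z = 0} :
    homMk z hz = 0 ↔ ∃ y, δ (n - 1) n y = z :=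
  Submodule.Quotient.mk_eq_zero _

lemma homCohomologyComp_homMk {a b c : ℤ} (h : a + b = c) (w : Cochain (resP φ L) (resP φ M) b)
    (hw : δ b (b + 1) w = 0) (z : Cochain (resP φ K) (resP φ L) a) (hz : δ a (a + 1) z = 0) :
    ∃ hwz, homCohomologyComp h (homMk w hw) (homMk z hz) = homMk (z.comp w h) hwz :=
  ⟨(cocycleComp h ⟨w, hw⟩ ⟨z, hz⟩).2, rfl⟩

lemma homCohomologyComp_assoc {a b c ab bc abc : ℤ} (hab : a + b = ab) (hbc : b + c = bc)
    (h : ab + c = abc) (h' : a + bc = abc) (x : HomCohomology φ K L a)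
    (y : HomCohomology φ L M b) (z : HomCohomology φ M N c) :
    homCohomologyComp h z (homCohomologyComp hab y x) =
      homCohomologyComp h' (homCohomologyComp hbc z y) x := by
  obtain ⟨x, hx, rfl⟩ := exists_homMk_eq x
  obtain ⟨y, hy, rfl⟩ := exists_homMk_eq y
  obtain ⟨z, hz, rfl⟩ := exists_homMk_eq z
  exact congrArg Submodule.Quotient.mk (Subtype.ext (Cochain.comp_assoc x y z hab hbc (by lia)))

/-- The class of a chain map over `F[P ⋊ Q]`. -/
def homClass (f : K ⟶ L) : HomCohomology φ K L 0 :=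
  homMk (Cochain.ofHom (resPMap φ f)) (δ_ofHom _)

lemma homClass_id : homClass (𝟙 K) = homCohomologyOne (φ := φ) K :=
  congrArg Submodule.Quotient.mk (Subtype.ext
    (congrArg Cochain.ofHom (CategoryTheory.Functor.map_id _ K)))

lemma homClass_comp (f : K ⟶ L) (g : L ⟶ M) :
    homCohomologyComp (φ := φ) (zero_add 0) (homClass g) (homClass f) = homClass (f ≫ g) :=
  congrArg Submodule.Quotient.mk (Subtype.ext
    ((Cochain.ofHom_comp _ _).symm.trans
      (congrArg Cochain.ofHom (CategoryTheory.Functor.map_comp _ f g).symm)))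

lemma homClass_id_homCohomologyComp {n : ℤ} (x : HomCohomology φ K L n) :
    homCohomologyComp (zero_add n) x (homClass (𝟙 K)) = x := by
  obtain ⟨x, hx, rfl⟩ := exists_homMk_eq x
  refine congrArg Submodule.Quotient.mk (Subtype.ext ?_)
  change (Cochain.ofHom (resPMap φ (𝟙 K))).comp x (zero_add n) = x
  rw [show resPMap φ (𝟙 K) = 𝟙 _ from CategoryTheory.Functor.map_id _ K]
  exact Cochain.id_comp x

lemma homClass_eq_of_homotopy {f g : K ⟶ L} (h : Homotopy f g) :
    homClass (φ := φ) f = homClass g :=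
  homMk_eq_homMk_iff.2 ⟨Cochain.ofHomotopy (Functor.mapHomotopy _ h), δ_ofHomotopy _⟩

lemma conjHom_comp {X Y Z : Rep.{u} F (P ⋊[φ] Q)} (q : Q)
    (f : Rep.res (SemidirectProduct.inl : P →* P ⋊[φ] Q) X ⟶
      Rep.res (SemidirectProduct.inl : P →* P ⋊[φ] Q) Y)
    (g : Rep.res (SemidirectProduct.inl : P →* P ⋊[φ] Q) Y ⟶
      Rep.res (SemidirectProduct.inl : P →* P ⋊[φ] Q) Z) :
    conjHom q (f ≫ g) = conjHom q f ≫ conjHom q g :=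
  resHom_ext _ _ fun x ↦ by
    change Z.ρ (SemidirectProduct.inr q) (g.hom (f.hom (X.ρ (SemidirectProduct.inr q⁻¹) x))) =
      Z.ρ (SemidirectProduct.inr q) (g.hom (Y.ρ (SemidirectProduct.inr q⁻¹)
        (Y.ρ (SemidirectProduct.inr q) (f.hom (X.ρ (SemidirectProduct.inr q⁻¹) x)))))
    rw [← Module.End.mul_apply (Y.ρ _), ← map_mul, ← map_mul, inv_mul_cancel, map_one, map_one]
    rfl

lemma conjCochain_comp {a b c : ℤ} (h : a + b = c) (q : Q) (z : Cochain (resP φ K) (resP φ L) a)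
    (w : Cochain (resP φ L) (resP φ M) b) :
    conjCochain c q (z.comp w h) = (conjCochain a q z).comp (conjCochain b q w) h := by
  refine Cochain.ext _ _ fun i j hij ↦ ?_
  rw [conjCochain_v, Cochain.comp_v _ _ h i (i + a) j rfl (by lia),
    Cochain.comp_v _ _ h i (i + a) j rfl (by lia)]
  exact conjHom_comp q _ _

lemma homCohomologyRep_homCohomologyComp {a b c : ℤ} (h : a + b = c) (q : Q)
    (w : HomCohomology φ L M b) (z : HomCohomology φ K L a) :
    homCohomologyRep K M c q (homCohomologyComp h w z) =
      homCohomologyComp h (homCohomologyRep L M b q w) (homCohomologyRep K L a q z) := by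
  obtain ⟨w, hw, rfl⟩ := exists_homMk_eq w
  obtain ⟨z, hz, rfl⟩ := exists_homMk_eq z
  exact congrArg Submodule.Quotient.mk (Subtype.ext (conjCochain_comp h q z w))

lemma conjCochain_ofHom (q : Q) (f : K ⟶ L) :
    conjCochain 0 q (Cochain.ofHom (resPMap φ f)) = Cochain.ofHom (resPMap φ f) := by
  refine Cochain.ext _ _ fun i j hij ↦ ?_
  obtain rfl : i = j := by lia
  rw [conjCochain_v, Cochain.ofHom_v]
  refine resHom_ext _ _ fun x ↦ ?_
  change (L.X i).ρ (SemidirectProduct.inr q) ((f.f i).hom ((K.X i).ρ (SemidirectProduct.inr q⁻¹) x))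
    = (f.f i).hom x
  rw [← Rep.hom_comm_apply (f.f i), ← Module.End.mul_apply ((K.X i).ρ _), ← map_mul, ← map_mul,
    mul_inv_cancel, map_one, map_one]
  rfl

lemma homCohomologyRep_homClass (q : Q) (f : K ⟶ L) :
    homCohomologyRep K L 0 q (homClass f) = homClass f :=
  congrArg Submodule.Quotient.mk (Subtype.ext (conjCochain_ofHom q f))

lemma bijective_homClass_homCohomologyComp [(resP φ K).IsKProjective] (f : L ⟶ M)
    [QuasiIso (resPMap φ f)] (n : ℤ) :
    Function.Bijective (homCohomologyComp (φ := φ) (K := K) (add_zero n) (homClass f)) := by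
  refine ⟨(injective_iff_map_eq_zero _).2 fun x hx ↦ ?_, fun x ↦ ?_⟩
  · obtain ⟨x, hx', rfl⟩ := exists_homMk_eq x
    obtain ⟨h, e⟩ := homCohomologyComp_homMk (add_zero n) (Cochain.ofHom (resPMap φ f))
      (δ_ofHom _) x hx'
    obtain ⟨y, hy⟩ := homMk_eq_zero_iff.1 (e.symm.trans hx)
    exact homMk_eq_zero_iff.2 (exists_coboundary_of_quasiIso (resPMap φ f) x hx' y hy)
  · obtain ⟨x, hx', rfl⟩ := exists_homMk_eq x
    obtain ⟨z, hz, y, hy⟩ := exists_cocycle_of_quasiIso (resPMap φ f) x hx'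
    refine ⟨homMk z hz, ?_⟩
    obtain ⟨h, e⟩ := homCohomologyComp_homMk (add_zero n) (Cochain.ofHom (resPMap φ f))
      (δ_ofHom _) z hz
    exact e.trans (homMk_eq_homMk_iff.2 ⟨-y, by rw [δ_neg, hy, neg_sub]⟩)

lemma quasiIso_resPMap (f : K ⟶ L) [QuasiIso f] : QuasiIso (resPMap φ f) :=
  (quasiIso_iff_forall _).2 ((quasiIso_iff_forall f).1 inferInstance)

end HomCohomologyFunctoriality
end

noncomputable section

open KleinFour (gen coord)

/-! ### Koszul complexes of induced representations -/

section Koszul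

variable {F : Type u} [Field F] {Q : Type u} [Group Q] (φ : Q →* MulAut KleinFour)

/-- A graded module over `F[x₀, x₁]` with a semilinear action of `Q`. -/
structure GradedQModule (B : Type u) [AddCommGroup B] [Module F B] where
  /-- multiplication by the variables -/
  mulX : Fin 2 → Module.End F B
  mulX_comm : mulX 0 * mulX 1 = mulX 1 * mulX 0
  /-- the action of the group -/
  act : Representation F Q B
  act_mulX (q : Q) (i : Fin 2) (b : B) :
    act q (mulX i b) = ∑ j, ((coord i (φ q⁻¹ (gen j))).cast : F) • mulX j (act q b)
  /-- the graded pieces -/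
  gr : ℤ → Submodule F B
  mulX_mem (i : Fin 2) {n : ℤ} {b : B} (hb : b ∈ gr n) : mulX i b ∈ gr (n + 1)
  act_mem (q : Q) {n : ℤ} {b : B} (hb : b ∈ gr n) : act q b ∈ gr n

namespace GradedQModule

variable {φ} {B : Type u} [AddCommGroup B] [Module F B] (N : GradedQModule (F := F) φ B)

/-- The action of `Q` on a graded piece. -/
def grAct (n : ℤ) : Representation F Q (N.gr n) where
  toFun q := (N.act q).restrict fun _ hb ↦ N.act_mem q hb
  map_one' := LinearMap.ext fun b ↦ Subtype.ext (LinearMap.congr_fun (map_one N.act) b.1)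
  map_mul' q q' := LinearMap.ext fun b ↦ Subtype.ext (LinearMap.congr_fun (map_mul N.act q q') b.1)

lemma coe_grAct (n : ℤ) (q : Q) (b : N.gr n) : (N.grAct n q b : B) = N.act q b := rfl

/-- The terms of the Koszul complex. -/
abbrev koszulX (n : ℤ) : Rep.{u} F (KleinFour ⋊[φ] Q) := Rep.of (indRep φ (N.grAct n))

/-- The differential of the Koszul complex as a linear map. -/
def koszulDLin (n : ℤ) : (KleinFour → N.gr n) →ₗ[F] (KleinFour → N.gr (n + 1)) where
  toFun f x := ⟨∑ i, N.mulX i (f (gen (i + 1) * x) + f (gen 0 * gen 1 * x)),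
    Submodule.sum_mem _ fun i _ ↦ N.mulX_mem i (add_mem (f _).2 (f _).2)⟩
  map_add' f g := by
    funext x
    refine Subtype.ext ?_
    simp only [Pi.add_apply, Submodule.coe_add, map_add, Fin.sum_univ_two]
    abel
  map_smul' c f := by
    funext x
    refine Subtype.ext ?_
    simp only [Pi.smul_apply, Submodule.coe_smul, map_add, map_smul, Fin.sum_univ_two, smul_add,
      RingHom.id_apply]

lemma coe_koszulDLin (n : ℤ) (f : KleinFour → N.gr n) (x : KleinFour) :
    (N.koszulDLin n f x : B) = ∑ i, N.mulX i (f (gen (i + 1) * x) + f (gen 0 * gen 1 * x)) := rfl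

variable [CharP F 2]

/-- An element of `Q` changes the variables and the generators `wᵢ` by transposed matrices, by
`act_mulX` and `extGen_conj`, so `Σ xᵢ wᵢ` is unchanged. -/
lemma koszulDLin_inr (n : ℤ) (q : Q) (f : KleinFour → N.gr n) :
    N.koszulDLin n (indRep φ (N.grAct n) (SemidirectProduct.inr q) f) =
      indRep φ (N.grAct (n + 1)) (SemidirectProduct.inr q) (N.koszulDLin n f) := by
  funext x
  refine Subtype.ext ?_
  rw [indRep_inr, coe_grAct, coe_koszulDLin, coe_koszulDLin, map_sum]
  simp only [indRep_inr, coe_grAct, N.act_mulX]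
  rw [Finset.sum_comm]
  refine Finset.sum_congr rfl fun j _ ↦ ?_
  have h := congrFun (LinearMap.congr_fun
    (extGen_conj (repP (indRep φ N.act)) (φ q⁻¹) j) fun x ↦ (N.act q (f x))) (φ q⁻¹ x)
  simp only [LinearMap.add_apply, LinearMap.sum_apply, LinearMap.smul_apply, extGen_indRep,
    Pi.add_apply, Finset.sum_apply, Pi.smul_apply] at h
  have e : ∀ p : KleinFour, repP (indRep φ N.act) p (fun x ↦ (N.act q (f x))) (φ q⁻¹ x) =
      N.act q (f (p * φ q⁻¹ x)) := fun p ↦ by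
    change indRep φ N.act _ _ _ = _
    rw [indRep_inl, KleinFour.inv_eq]
  rw [e, e] at h
  rw [map_mul, map_mul, h, map_sum]
  simp only [map_smul, map_add]

lemma koszulDLin_equivariant (n : ℤ) (g : KleinFour ⋊[φ] Q) (f : KleinFour → N.gr n) :
    N.koszulDLin n (indRep φ (N.grAct n) g f) =
      indRep φ (N.grAct (n + 1)) g (N.koszulDLin n f) := by
  rw [← SemidirectProduct.inl_left_mul_inr_right g, map_mul, map_mul, Module.End.mul_apply,
    Module.End.mul_apply, ← koszulDLin_inr]
  funext x
  refine Subtype.ext ?_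
  rw [indRep_inl, coe_koszulDLin, coe_koszulDLin]
  simp only [indRep_inl, mul_left_comm]

lemma koszulDLin_koszulDLin (n : ℤ) (f : KleinFour → N.gr n) :
    N.koszulDLin (n + 1) (N.koszulDLin n f) = 0 := by
  funext x
  refine Subtype.ext ?_
  have e1 : ∀ x : KleinFour, gen 0 * (gen 1 * x) = gen 0 * gen 1 * x := fun x ↦ (mul_assoc _ _ _).symm
  have e2 : ∀ x : KleinFour, gen 1 * (gen 0 * x) = gen 0 * gen 1 * x := by decide
  have e3 : ∀ x : KleinFour, gen 0 * (gen 0 * x) = x := by decide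
  have e4 : ∀ x : KleinFour, gen 1 * (gen 1 * x) = x := by decide
  have e5 : ∀ x : KleinFour, gen 0 * (gen 0 * gen 1 * x) = gen 1 * x := by decide
  have e6 : ∀ x : KleinFour, gen 1 * (gen 0 * gen 1 * x) = gen 0 * x := by decide
  have e7 : ∀ x : KleinFour, gen 0 * gen 1 * (gen 0 * x) = gen 1 * x := by decide
  have e8 : ∀ x : KleinFour, gen 0 * gen 1 * (gen 1 * x) = gen 0 * x := by decide
  have e9 : ∀ x : KleinFour, gen 0 * gen 1 * (gen 0 * gen 1 * x) = x := by decide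
  have o1 : (1 : Fin 2) + 1 = 0 := rfl
  have hc : ∀ b, N.mulX 0 (N.mulX 1 b) = N.mulX 1 (N.mulX 0 b) := LinearMap.congr_fun N.mulX_comm
  rw [coe_koszulDLin]
  simp only [coe_koszulDLin, Fin.sum_univ_two, zero_add, o1, map_add, e1, e2, e3, e4, e5, e6, e7,
    e8, e9, hc]
  have t : ∀ b : B, (2 : ℤ) • b = 0 := fun b ↦ (two_smul ℤ b).trans (add_self_of_charTwo F b)
  abel_nf
  simp only [t, add_zero]
  rfl

/-- The Koszul complex of a graded module over `F[x₀, x₁]` with a semilinear action of `Q`: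
the term of degree `n` is induced from the piece of degree `n`. -/
def koszul : CochainComplex (Rep.{u} F (KleinFour ⋊[φ] Q)) ℤ :=
  CochainComplex.of N.koszulX
    (fun n ↦ Rep.ofHom (LinearMap.intertwiningMap_of_isIntertwiningMap _ _ (N.koszulDLin n)
      (N.koszulDLin_equivariant n)))
    (fun n ↦ Rep.hom_ext (Representation.IntertwiningMap.ext
      (LinearMap.ext (N.koszulDLin_koszulDLin n))))

lemma koszul_d_apply (n : ℤ) (f : KleinFour → N.gr n) :
    (N.koszul.d n (n + 1)).hom f = N.koszulDLin n f :=
  congrArg (fun g : N.koszulX n ⟶ N.koszulX (n + 1) ↦ g.hom f) (CochainComplex.of_d ..)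

end GradedQModule

end Koszul
end

/-! ### Kernels of Koszul differentials and exactness of the Koszul resolution -/

noncomputable section

open KleinFour (gen coord)
open MvPolynomial (X C constantCoeff)

namespace GradedQModule

section KernelOfDifferential

variable {F : Type u} [Field F] {Q : Type u} [Group Q] {φ : Q →* MulAut KleinFour}
  {B : Type u} [AddCommGroup B] [Module F B] (N : GradedQModule (F := F) φ B)

/-- The Koszul differential on all functions with values in the module. -/
def koszulEnd : Module.End F (KleinFour → B) where
  toFun f x := ∑ i, N.mulX i (f (gen (i + 1) * x) + f (gen 0 * gen 1 * x))
  map_add' f g := by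
    funext x
    simp only [Pi.add_apply, map_add, Fin.sum_univ_two]
    abel
  map_smul' c f := by
    funext x
    simp only [Pi.smul_apply, map_add, map_smul, Fin.sum_univ_two, smul_add, RingHom.id_apply]

lemma koszulEnd_apply (f : KleinFour → B) (x : KleinFour) :
    N.koszulEnd f x = ∑ i, N.mulX i (f (gen (i + 1) * x) + f (gen 0 * gen 1 * x)) := rfl

lemma koszulEnd_values (f : KleinFour → B) :
    N.koszulEnd f 1 = N.mulX 0 (f (gen 1) + f (gen 0 * gen 1)) +
        N.mulX 1 (f (gen 0) + f (gen 0 * gen 1)) ∧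
      N.koszulEnd f (gen 0) = N.mulX 0 (f (gen 0 * gen 1) + f (gen 1)) +
        N.mulX 1 (f 1 + f (gen 1)) ∧
      N.koszulEnd f (gen 1) = N.mulX 0 (f 1 + f (gen 0)) +
        N.mulX 1 (f (gen 0 * gen 1) + f (gen 0)) ∧
      N.koszulEnd f (gen 0 * gen 1) = N.mulX 0 (f (gen 0) + f 1) +
        N.mulX 1 (f (gen 1) + f 1) := by
  have o1 : (1 : Fin 2) + 1 = 0 := rfl
  have e1 : gen 1 * gen 0 = gen 0 * gen 1 := by decide
  have e2 : gen 0 * gen 1 * gen 0 = gen 1 := by decide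
  have e3 : gen 0 * gen 0 = 1 := by decide
  have e4 : gen 1 * gen 1 = 1 := by decide
  have e5 : gen 0 * gen 1 * gen 1 = gen 0 := by decide
  have e6 : gen 1 * (gen 0 * gen 1) = gen 0 := by decide
  have e7 : gen 0 * gen 1 * (gen 0 * gen 1) = 1 := by decide
  have e8 : gen 0 * (gen 0 * gen 1) = gen 1 := by decide
  simp only [koszulEnd_apply, Fin.sum_univ_two, o1, zero_add, mul_one, e1, e2, e3, e4, e5, e6, e7,
    e8, and_self]

/-- The value of the differential at the fourth point is the sum of the other three. Adding the
values at `gen 1` and `gen 0` to the one at `1` gives `x₀` and `x₁` times the total sum of `f`, so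
three independent equations remain. -/
lemma koszulEnd_eq_zero_iff [CharP F 2] (f : KleinFour → B) : N.koszulEnd f = 0 ↔
    (∀ i, N.mulX i (f 1 + f (gen 0) + f (gen 1) + f (gen 0 * gen 1)) = 0) ∧
      N.mulX 0 (f (gen 1) + f (gen 0 * gen 1)) + N.mulX 1 (f (gen 0) + f (gen 0 * gen 1)) = 0 := by
  obtain ⟨h1, h2, h3, h4⟩ := N.koszulEnd_values f
  have t : ∀ b : B, (2 : ℤ) • b = 0 := fun b ↦ (two_smul ℤ b).trans (add_self_of_charTwo F b)
  have a0 : N.koszulEnd f 1 + N.koszulEnd f (gen 1) =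
      N.mulX 0 (f 1 + f (gen 0) + f (gen 1) + f (gen 0 * gen 1)) := by
    rw [h1, h3]
    simp only [map_add]
    abel_nf
    simp only [t, zero_add]
  have a1 : N.koszulEnd f 1 + N.koszulEnd f (gen 0) =
      N.mulX 1 (f 1 + f (gen 0) + f (gen 1) + f (gen 0 * gen 1)) := by
    rw [h1, h2]
    simp only [map_add]
    abel_nf
    simp only [t, zero_add]
  have a2 : N.koszulEnd f 1 + N.koszulEnd f (gen 0) + N.koszulEnd f (gen 1) =
      N.koszulEnd f (gen 0 * gen 1) := by
    rw [h1, h2, h3, h4]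
    simp only [map_add]
    abel_nf
    simp only [t, zero_add]
  constructor
  · intro h
    refine ⟨fun i ↦ ?_, by rw [← h1, h]; rfl⟩
    fin_cases i
    · exact a0.symm.trans (by rw [h]; simp)
    · exact a1.symm.trans (by rw [h]; simp)
  · rintro ⟨hs, h⟩
    rw [← h1] at h
    rw [hs 0, h, zero_add] at a0
    rw [hs 1, h, zero_add] at a1
    rw [h, a0, a1, add_zero, add_zero] at a2
    funext x
    rcases KleinFour.cases 0 x with rfl | rfl | rfl | rfl
    exacts [h, a1, a0, a2.symm]

lemma koszulDLin_eq_zero_iff (n : ℤ) (f : KleinFour → N.gr n) :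
    N.koszulDLin n f = 0 ↔ N.koszulEnd (fun x ↦ f x) = 0 :=
  ⟨fun h ↦ funext fun x ↦ congrArg Subtype.val (congrFun h x),
    fun h ↦ funext fun x ↦ Subtype.ext (congrFun h x)⟩

end KernelOfDifferential

end GradedQModule

/-! ### The action on polynomials -/

section PolyAct

variable {F : Type u} [Field F] {Q : Type u} [Group Q] (φ : Q →* MulAut KleinFour)

lemma KleinFour.coord_map (α : MulAut KleinFour) (i : Fin 2) (p : KleinFour) :
    coord i (α p) = ∑ j, coord i (α (gen j)) * coord j p := by
  have hc : ∀ i a b, coord i (a * b) = coord i a + coord i b := by decide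
  have h1 : ∀ i, coord i 1 = 0 := by decide
  have c00 : coord 0 (gen 0) = 1 := rfl
  have c10 : coord 1 (gen 0) = 0 := rfl
  have c01 : coord 0 (gen 1) = 0 := rfl
  have c11 : coord 1 (gen 1) = 1 := rfl
  rw [Fin.sum_univ_two]
  rcases KleinFour.cases 0 p with rfl | rfl | rfl | rfl
  · simp [h1]
  · rw [c00, c10]; ring
  · change coord i (α (gen 1)) = _ * coord 0 (gen 1) + _ * coord 1 (gen 1)
    rw [c01, c11]; ring
  · rw [map_mul, hc, hc, hc, c00, c10, c01, c11]; ring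

lemma polyAct_X (q : Q) (i : Fin 2) : polyAct φ q (X i : BiPoly F) =
    ∑ j, C ((coord i (φ q⁻¹ (gen j))).cast : F) * X j :=
  MvPolynomial.aeval_X _ _

lemma hpart_polyAct (q : Q) (k : ℤ) (s : BiPoly F) :
    hpart k (polyAct φ q s) = polyAct φ q (hpart k s) := by
  conv_lhs => rw [← sum_hpart s]
  conv_rhs => rw [← sum_hpart s]
  simp only [map_sum]
  refine Finset.sum_congr rfl fun i _ ↦ ?_
  have h : (polyAct φ q (hpart (i : ℤ) s)).IsHomogeneous i :=
    polyAct_isHomogeneous φ q (isHomogeneous_hpart i s)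
  rw [hpart_of_isHomogeneous h, hpart_of_isHomogeneous (isHomogeneous_hpart i s)]
  split_ifs
  · rfl
  · rw [map_zero]

variable [CharP F 2]

lemma polyAct_one : polyAct (F := F) φ 1 = AlgHom.id F _ := by
  refine MvPolynomial.algHom_ext fun i ↦ ?_
  rw [polyAct_X, inv_one, map_one, Fin.sum_univ_two, AlgHom.id_apply]
  fin_cases i
  · change C ((1 : ZMod 2).cast : F) * X 0 + C ((0 : ZMod 2).cast : F) * X 1 = X 0
    rw [ZMod.cast_one', ZMod.cast_zero]; simp
  · change C ((0 : ZMod 2).cast : F) * X 0 + C ((1 : ZMod 2).cast : F) * X 1 = X 1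
    rw [ZMod.cast_one', ZMod.cast_zero]; simp

lemma polyAct_mul (q q' : Q) :
    polyAct (F := F) φ (q * q') = (polyAct φ q).comp (polyAct φ q') := by
  refine MvPolynomial.algHom_ext fun i ↦ ?_
  rw [AlgHom.comp_apply, polyAct_X, polyAct_X, map_sum]
  have h : ∀ j, polyAct (F := F) φ q (C ((coord i (φ q'⁻¹ (gen j))).cast : F) * X j) =
      ∑ k, C ((coord i (φ q'⁻¹ (gen j)) * coord j (φ q⁻¹ (gen k))).cast : F) * X k := by
    intro j
    rw [map_mul, polyAct_X, MvPolynomial.algHom_C, Finset.mul_sum]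
    refine Finset.sum_congr rfl fun k _ ↦ ?_
    rw [ZMod.cast_mul (dvd_refl 2), map_mul, mul_assoc]
    rfl
  simp only [h]
  rw [Finset.sum_comm]
  refine Finset.sum_congr rfl fun k _ ↦ ?_
  rw [← Finset.sum_mul, ← map_sum, mul_inv_rev, map_mul, MulAut.mul_apply, KleinFour.coord_map]
  congr 2
  rw [Fin.sum_univ_two, Fin.sum_univ_two, ZMod.cast_add (dvd_refl 2)]

lemma polyAct_polyAct_inv (q : Q) (s : BiPoly F) : polyAct φ q (polyAct φ q⁻¹ s) = s := by
  rw [← AlgHom.comp_apply, ← polyAct_mul, mul_inv_cancel, polyAct_one, AlgHom.id_apply]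

lemma polyAct_inv_polyAct (q : Q) (s : BiPoly F) : polyAct φ q⁻¹ (polyAct φ q s) = s := by
  rw [← AlgHom.comp_apply, ← polyAct_mul, inv_mul_cancel, polyAct_one, AlgHom.id_apply]

end PolyAct

/-! ### The dual of the polynomial ring and the Koszul resolution -/

section Resolution

variable {F : Type u} [Field F] [CharP F 2] {Q : Type u} [Group Q] (φ : Q →* MulAut KleinFour)

variable (F) in
/-- The graded dual of the polynomial ring, as pieces of the full dual. -/
def dualModule : GradedQModule (F := F) φ (Module.Dual F (BiPoly F)) where
  mulX i := (LinearMap.mulLeft F (X i : BiPoly F)).dualMap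
  mulX_comm := LinearMap.ext fun l ↦ LinearMap.ext fun s ↦ congrArg l (mul_left_comm _ _ _)
  act :=
    { toFun q := (polyAct φ q⁻¹).toLinearMap.dualMap
      map_one' := by
        refine LinearMap.ext fun l ↦ LinearMap.ext fun s ↦ congrArg l ?_
        rw [inv_one, polyAct_one]; rfl
      map_mul' q q' := by
        refine LinearMap.ext fun l ↦ LinearMap.ext fun s ↦ congrArg l ?_
        rw [mul_inv_rev, polyAct_mul]; rfl }
  act_mulX q i l := by
    refine LinearMap.ext fun s ↦ ?_
    rw [LinearMap.sum_apply]
    change l (X i * polyAct φ q⁻¹ s) = ∑ j, ((coord i (φ q⁻¹ (gen j))).cast : F) •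
      l (polyAct φ q⁻¹ (X j * s))
    simp only [← map_smul, ← map_sum]
    congr 1
    rw [← polyAct_inv_polyAct φ q (X i), ← map_mul, polyAct_X, Finset.sum_mul]
    simp only [MvPolynomial.C_mul', smul_mul_assoc]
  -- Functionals that see only polynomials of degree `-n`: the resolution is a cochain complex in
  -- nonpositive degrees.
  gr n := {
    carrier := {l | ∀ s, l (hpart (-n) s) = l s}
    add_mem' := fun ha hb s ↦ congrArg₂ (· + ·) (ha s) (hb s)
    zero_mem' := fun _ ↦ rfl
    smul_mem' := fun c _ ha s ↦ congrArg (c • ·) (ha s) }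
  mulX_mem i n l hl s := by
    change l (X i * hpart _ s) = l (X i * s)
    rw [← hl (X i * s), hpart_X_mul, neg_add, sub_eq_add_neg]
  act_mem q n l hl s := by
    change l (polyAct φ q⁻¹ (hpart _ s)) = l (polyAct φ q⁻¹ s)
    rw [← hpart_polyAct]
    exact hl _

lemma dualModule_mulX (i : Fin 2) (l : Module.Dual F (BiPoly F)) (s : BiPoly F) :
    (dualModule F φ).mulX i l s = l (X i * s) := rfl

/-- The projection of the dual to a graded piece. -/
def dualProj (n : ℤ) : Module.Dual F (BiPoly F) →ₗ[F] (dualModule F φ).gr n :=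
  (hpart (-n)).dualMap.codRestrict _ fun l s ↦ by
    change l (hpart _ (hpart _ s)) = l (hpart _ s)
    rw [hpart_hpart, if_pos rfl]

lemma dualProj_apply (n : ℤ) (l : Module.Dual F (BiPoly F)) (s : BiPoly F) :
    (dualProj φ n l : Module.Dual F (BiPoly F)) s = l (hpart (-n) s) := rfl

variable (F) in
/-- The Koszul resolution of the trivial module. -/
def koszulResolution : CochainComplex (Rep.{u} F (KleinFour ⋊[φ] Q)) ℤ := (dualModule F φ).koszul

lemma subsingleton_dualModule_gr {n : ℤ} (hn : 0 < n) :
    Subsingleton ((dualModule F φ).gr n) := by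
  refine ⟨fun a b ↦ Subtype.ext (LinearMap.ext fun s ↦ ?_)⟩
  rw [← a.2, ← b.2, hpart_of_neg (by lia), map_zero, map_zero]

/-- Multiplication by `x₀` is injective on polynomials, so its transpose is surjective. -/
lemma exists_mulX_eq {n : ℤ} (b : (dualModule F φ).gr n) :
    ∃ a : (dualModule F φ).gr (n - 1), (dualModule F φ).mulX 0 a = b := by
  have hinj : Function.Injective (LinearMap.mulLeft F (X 0 : BiPoly F)) := fun a b h ↦
    mul_left_cancel₀ (MvPolynomial.X_ne_zero 0) h
  obtain ⟨a, ha⟩ := LinearMap.dualMap_surjective_of_injective hinj b.1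
  refine ⟨dualProj φ (n - 1) a, LinearMap.ext fun s ↦ ?_⟩
  rw [dualModule_mulX, dualProj_apply, hpart_X_mul, ← b.2, ← ha]
  change a (X 0 * _) = a (X 0 * _)
  congr 3
  lia

/-- Transpose of the fact that the variables have only the trivial syzygy: a functional on pairs
extends through `(a, b) ↦ x₀a + x₁b` as soon as it kills the kernel. -/
lemma exists_mulX_eq_mulX {n : ℤ} {p r : (dualModule F φ).gr n}
    (h : (dualModule F φ).mulX 0 p.1 + (dualModule F φ).mulX 1 r.1 = 0) :
    ∃ t : (dualModule F φ).gr (n - 1),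
      (dualModule F φ).mulX 1 t = p.1 ∧ (dualModule F φ).mulX 0 t = r.1 := by
  let j : BiPoly F × BiPoly F →ₗ[F] BiPoly F :=
    (LinearMap.mulLeft F (X 0)).coprod (LinearMap.mulLeft F (X 1))
  have hj : LinearMap.coprod r.1 p.1 ∈ LinearMap.range j.dualMap := by
    rw [LinearMap.range_dualMap_eq_dualAnnihilator_ker, Submodule.mem_dualAnnihilator]
    rintro ⟨a, b⟩ hab
    have hab' : X 0 * a = X 1 * b := by
      have : X 0 * a + X 1 * b = 0 := hab
      rw [← neg_eq_of_charTwo F (X 1 * b)]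
      exact eq_neg_of_add_eq_zero_left this
    obtain ⟨k, rfl, rfl⟩ := exists_common_multiple_X hab'
    have := LinearMap.congr_fun h k
    rw [add_comm] at this
    exact this
  obtain ⟨t, ht⟩ := hj
  have h0 : ∀ s, t (X 0 * s) = r.1 s := fun s ↦ by
    have := LinearMap.congr_fun ht (s, 0)
    simpa [j] using this
  have h1 : ∀ s, t (X 1 * s) = p.1 s := fun s ↦ by
    have := LinearMap.congr_fun ht (0, s)
    simpa [j] using this
  refine ⟨dualProj φ (n - 1) t, LinearMap.ext fun s ↦ ?_, LinearMap.ext fun s ↦ ?_⟩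
  · rw [dualModule_mulX, dualProj_apply, hpart_X_mul, h1, show -(n - 1) - 1 = -n by lia]
    exact p.2 s
  · rw [dualModule_mulX, dualProj_apply, hpart_X_mul, h0, show -(n - 1) - 1 = -n by lia]
    exact r.2 s


lemma eq_zero_of_mulX_eq_zero {n : ℤ} {b : (dualModule F φ).gr n}
    (h : ∀ i, (dualModule F φ).mulX i b.1 = 0) (h0 : b.1 1 = 0) : b.1 = 0 := by
  refine LinearMap.ext fun s ↦ ?_
  obtain ⟨α, β, hs⟩ := eq_C_of_constantCoeff s
  have h1 : ∀ c : F, b.1 (C c) = 0 := fun c ↦ by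
    rw [← mul_one (C c), MvPolynomial.C_mul', map_smul, h0, smul_zero]
  have h2 := LinearMap.congr_fun (h 0) α
  have h3 := LinearMap.congr_fun (h 1) β
  rw [dualModule_mulX] at h2 h3
  rw [hs, map_add, map_add, h1, h2, h3]
  simp

lemma apply_one_of_mem_dualModule_gr {n : ℤ} (hn : n ≠ 0) (b : (dualModule F φ).gr n) :
    b.1 1 = 0 := by
  rw [← b.2, show (1 : BiPoly F) = hpart ((0 : ℕ) : ℤ) 1 from
    (isHomogeneous_iff_hpart.1 (MvPolynomial.isHomogeneous_one _ _)).symm, hpart_hpart,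
    if_neg (by lia), map_zero]

/-- The augmentation of the degree zero part of the Koszul resolution. -/
def koszulAug : (KleinFour → (dualModule F φ).gr 0) →ₗ[F] F where
  toFun f := ∑ p, (f p).1 1
  map_add' f g := by simp [Finset.sum_add_distrib]
  map_smul' c f := by simp [Finset.mul_sum]

lemma koszulAug_apply (f : KleinFour → (dualModule F φ).gr 0) :
    koszulAug φ f = ∑ p, (f p).1 1 := rfl

lemma koszulAug_equivariant (g : KleinFour ⋊[φ] Q) (f : KleinFour → (dualModule F φ).gr 0) :
    koszulAug φ (indRep φ ((dualModule F φ).grAct 0) g f) = koszulAug φ f := by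
  rw [koszulAug_apply, koszulAug_apply]
  refine Fintype.sum_equiv ((Equiv.mulLeft g.left⁻¹).trans (φ g.right⁻¹).toEquiv) _ _ fun x ↦ ?_
  change (f _).1 (polyAct φ g.right⁻¹ 1) = (f _).1 1
  rw [map_one]
  rfl

lemma koszulAug_koszulDLin (f : KleinFour → (dualModule F φ).gr (-1)) :
    koszulAug φ ((dualModule F φ).koszulDLin (-1) f) = 0 := by
  have e : koszulAug φ ((dualModule F φ).koszulDLin (-1) f) =
      ∑ p, ((dualModule F φ).koszulEnd (fun x ↦ (f x).1) p) 1 := rfl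
  obtain ⟨h1, h2, h3, h4⟩ := (dualModule F φ).koszulEnd_values fun x ↦ (f x).1
  rw [e, KleinFour.sum_univ, h1, h2, h3, h4]
  have t : ∀ b : F, (2 : ℤ) • b = 0 := fun b ↦ (two_smul ℤ b).trans (add_self_of_charTwo F b)
  simp only [map_add, LinearMap.add_apply]
  abel_nf
  simp only [t, add_zero]

/-- The sum of the values of a cycle is killed by both variables, so it vanishes on the maximal
ideal, and `h0` removes its value at `1`. The remaining equation is a relation between two
differences of values, solved by a common `t`. -/
lemma exists_eq_koszulDLin {n : ℤ} (f : KleinFour → (dualModule F φ).gr n)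
    (hf : (dualModule F φ).koszulDLin n f = 0) (h0 : ∑ p, (f p).1 1 = 0) :
    ∃ g : KleinFour → (dualModule F φ).gr (n - 1),
      ∀ x, ((dualModule F φ).koszulEnd (fun x ↦ (g x).1) x) = (f x).1 := by
  rw [GradedQModule.koszulDLin_eq_zero_iff, GradedQModule.koszulEnd_eq_zero_iff] at hf
  obtain ⟨hs, hpr⟩ := hf
  have hs0 : f 1 + f (gen 0) + f (gen 1) + f (gen 0 * gen 1) = 0 := by
    refine Subtype.ext (eq_zero_of_mulX_eq_zero φ hs ?_)
    rw [KleinFour.sum_univ] at h0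
    exact h0
  obtain ⟨t, ht1, ht0⟩ := exists_mulX_eq_mulX φ (p := f (gen 1) + f (gen 0 * gen 1))
    (r := f (gen 0) + f (gen 0 * gen 1)) hpr
  obtain ⟨a, ha⟩ := exists_mulX_eq φ (f (gen 0 * gen 1))
  have d1 : gen 0 ≠ 1 := by decide
  have d2 : gen 1 ≠ 1 := by decide
  have d3 : gen 1 ≠ gen 0 := by decide
  have d4 : gen 0 * gen 1 ≠ 1 := by decide
  have d5 : gen 0 * gen 1 ≠ gen 0 := by decide
  have d6 : gen 0 * gen 1 ≠ gen 1 := by decide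
  -- Dictated by the four values of the differential: `a` solves the equation at `gen 0 * gen 1`,
  -- and adding `t` at that point produces the prescribed differences.
  let g : KleinFour → (dualModule F φ).gr (n - 1) := fun x ↦
    if x = 1 then 0 else if x = gen 0 then a else if x = gen 1 then 0 else t + a
  have g1 : g 1 = 0 := if_pos rfl
  have g2 : g (gen 0) = a := by simp [g, d1]
  have g3 : g (gen 1) = 0 := by simp [g, d2, d3]
  have g4 : g (gen 0 * gen 1) = t + a := by simp only [g, d4, d5, d6, if_false]
  have t2 : ∀ b : Module.Dual F (BiPoly F), (2 : ℤ) • b = 0 :=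
    fun b ↦ (two_smul ℤ b).trans (add_self_of_charTwo F b)
  obtain ⟨h1, h2, h3, h4⟩ := (dualModule F φ).koszulEnd_values fun x ↦ (g x).1
  have k2 := congrArg Subtype.val hs0
  simp only [Submodule.coe_add, Submodule.coe_zero] at k2 ht0 ht1
  have k1 : (f 1 : Module.Dual F (BiPoly F)) = f (gen 0) + f (gen 1) + f (gen 0 * gen 1) := by
    rw [← neg_eq_of_charTwo F (_ + _ + _), eq_neg_iff_add_eq_zero, ← k2]
    abel
  refine ⟨g, fun x ↦ ?_⟩
  rcases KleinFour.cases 0 x with rfl | rfl | hx | rfl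
  · rw [h1, g2, g3, g4, k1]
    simp only [Submodule.coe_add, Submodule.coe_zero, map_add, map_zero, ht1, ht0, ha]
    have t3 : ∀ b : Module.Dual F (BiPoly F), (3 : ℤ) • b = b := fun b ↦ by
      rw [show (3 : ℤ) = 2 + 1 from rfl, add_smul, t2, zero_add, one_smul]
    abel_nf
    simp only [t2, t3, zero_add]
  · rw [h2, g1, g3, g4]
    simp only [Submodule.coe_add, Submodule.coe_zero, map_add, map_zero, ht0, ha]
    abel_nf
    simp only [t2, add_zero]
  · obtain rfl : x = gen 1 := hx
    rw [h3, g1, g2, g4]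
    simp only [Submodule.coe_add, Submodule.coe_zero, map_add, map_zero, ht1, ha]
    abel_nf
    simp only [t2, add_zero, zero_add]
  · rw [h4, g1, g2, g3]
    simp only [Submodule.coe_zero, map_zero, ha, add_zero]

lemma exists_koszulAug_eq (c : F) : ∃ f, koszulAug φ f = c := by
  refine ⟨Pi.single 1 (dualProj φ 0 (c • (MvPolynomial.lcoeff F 0))), ?_⟩
  rw [koszulAug_apply, Finset.sum_eq_single 1]
  · rw [Pi.single_eq_same, dualProj_apply, show (1 : BiPoly F) = hpart ((0 : ℕ) : ℤ) 1 from
      (isHomogeneous_iff_hpart.1 (MvPolynomial.isHomogeneous_one _ _)).symm, hpart_hpart]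
    simp [hpart, MvPolynomial.lcoeff]
  · intro p _ hp
    rw [Pi.single_eq_of_ne hp]
    rfl
  · simp

end Resolution
end

/-! ### The Koszul resolution as a projective resolution -/

noncomputable section

open KleinFour (gen coord)
open MvPolynomial (X C constantCoeff)

section Single

variable {F : Type u} [Field F]

/-- The terms of a single complex in nonzero degree vanish. -/
lemma subsingleton_single_X {G : Type v} [Group G] (A : Rep.{u} F G) {n : ℤ} (hn : n ≠ 0) :
    Subsingleton (((CochainComplex.singleFunctor (Rep.{u} F G) 0).obj A).X n) :=
  (Rep.isZero_iff _ _ _).1 (HomologicalComplex.isZero_single_obj_X (ComplexShape.up ℤ) 0 A n hn)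

lemma single_d_apply {G : Type v} [Group G] (A : Rep.{u} F G) (n m : ℤ)
    (x : ((CochainComplex.singleFunctor (Rep.{u} F G) 0).obj A).X n) :
    (((CochainComplex.singleFunctor (Rep.{u} F G) 0).obj A).d n m).hom x = 0 := by
  have h : ((CochainComplex.singleFunctor (Rep.{u} F G) 0).obj A).d n m = 0 :=
    HomologicalComplex.single_obj_d ..
  rw [h]
  rfl

/-- The identification of the degree zero part of a single complex. -/
def singleZeroIso {G : Type v} [Group G] (A : Rep.{u} F G) :
    ((CochainComplex.singleFunctor (Rep.{u} F G) 0).obj A).X 0 ≅ A :=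
  HomologicalComplex.singleObjXSelf (ComplexShape.up ℤ) 0 A

lemma singleZeroIso_hom_injective {G : Type v} [Group G] (A : Rep.{u} F G) :
    Function.Injective (singleZeroIso A).hom.hom := fun x y h ↦ by
  have h' := congrArg (singleZeroIso A).inv.hom h
  have e := fun x ↦ congrArg
    (fun g : ((CochainComplex.singleFunctor (Rep.{u} F G) 0).obj A).X 0 ⟶ _ ↦ g.hom x)
    (singleZeroIso A).hom_inv_id
  exact (e x).symm.trans (h'.trans (e y))

end Single

section Resolution

variable {F : Type u} [Field F] {Q : Type u} [Group Q] (φ : Q →* MulAut KleinFour)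

lemma isKProjective_resP (K : CochainComplex (Rep.{u} F (KleinFour ⋊[φ] Q)) ℤ) (b : ℤ)
    [K.IsStrictlyLE b] (hK : ∀ n, Projective (K.X n)) : (resP φ K).IsKProjective := by
  have : (resP φ K).IsStrictlyLE b := by
    rw [CochainComplex.isStrictlyLE_iff]
    intro i hi
    have := (Rep.isZero_iff _ _ _).1 (K.isZero_of_isStrictlyLE b i hi)
    exact (Rep.isZero_iff _ _ _).2 this
  have : ∀ n, Projective ((resP φ K).X n) := fun n ↦ projective_res (K.X n)
  exact isKProjective_of_projective _ b

variable [CharP F 2]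

lemma projective_koszul_X (hQ : Odd (Nat.card Q)) {B : Type u} [AddCommGroup B] [Module F B]
    (N : GradedQModule (F := F) φ B) (n : ℤ) : Projective (N.koszul.X n) :=
  projective_indRep hQ (N.grAct n)

instance : (koszulResolution F φ).IsStrictlyLE 0 := by
  rw [CochainComplex.isStrictlyLE_iff]
  intro i hi
  have := subsingleton_dualModule_gr (F := F) φ hi
  have : Subsingleton (((koszulResolution F φ).X i : Rep.{u} F (KleinFour ⋊[φ] Q)) : Type u) :=
    inferInstanceAs (Subsingleton (KleinFour → (dualModule F φ).gr i))
  exact (Rep.isZero_iff _ _ _).2 this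

variable (F) in
/-- The augmentation of the Koszul resolution. -/
def koszulResolutionπ : koszulResolution F φ ⟶
    (CochainComplex.singleFunctor (Rep.{u} F (KleinFour ⋊[φ] Q)) 0).obj
      (Rep.trivial F (KleinFour ⋊[φ] Q) F) :=
  HomologicalComplex.mkHomToSingle (Rep.ofHom (LinearMap.intertwiningMap_of_isIntertwiningMap _ _
    (koszulAug φ) (koszulAug_equivariant φ))) (by
      intro i hi
      obtain rfl : i = -1 := by simp at hi; lia
      refine Rep.hom_ext (Representation.IntertwiningMap.ext (LinearMap.ext fun f ↦ ?_))
      have := koszulAug_koszulDLin φ f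
      rw [← (dualModule F φ).koszul_d_apply (-1) f] at this
      exact this)


lemma singleZeroIso_koszulResolutionπ (f : KleinFour → (dualModule F φ).gr 0) :
    (singleZeroIso (Rep.trivial F (KleinFour ⋊[φ] Q) F)).hom.hom
      (((koszulResolutionπ F φ).f 0).hom f) = koszulAug φ f := by
  have h : (koszulResolutionπ F φ).f 0 ≫ (singleZeroIso _).hom = _ :=
    (congrArg (· ≫ (singleZeroIso _).hom) (HomologicalComplex.mkHomToSingle_f _ _)).trans
      ((Category.assoc _ _ _).trans ((congrArg (_ ≫ ·) (Iso.inv_hom_id _)).trans (Category.comp_id _)))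
  exact congrArg (fun g : (koszulResolution F φ).X 0 ⟶ Rep.trivial F (KleinFour ⋊[φ] Q) F ↦
    g.hom f) h

/-- Away from degree zero functionals in `gr n` vanish at `1`, so the condition on the augmentation
is automatic; in degree zero it is exactly the vanishing of the image in the trivial module. -/
instance : QuasiIso (koszulResolutionπ F φ) := by
  rw [quasiIso_iff_forall]
  intro n
  have hd : ∀ n (f : KleinFour → (dualModule F φ).gr n),
      ((koszulResolution F φ).d n (n + 1)).hom f = (dualModule F φ).koszulDLin n f :=
    fun n f ↦ (dualModule F φ).koszul_d_apply n f
  have hd' : ∀ n (f : KleinFour → (dualModule F φ).gr n) (g : KleinFour → (dualModule F φ).gr (n - 1)),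
      (∀ x, ((dualModule F φ).koszulEnd (fun x ↦ (g x).1) x) = (f x).1) →
        f = ((koszulResolution F φ).d (n - 1) n).hom g := by
    intro n f g h
    obtain ⟨m, rfl⟩ : ∃ m, n = m + 1 := ⟨n - 1, by lia⟩
    have e : m + 1 - 1 = m := by lia
    have : ∀ (k : ℤ) (hk : k = m) (g : KleinFour → (dualModule F φ).gr k),
      (∀ x, ((dualModule F φ).koszulEnd (fun x ↦ (g x).1) x) = (f x).1) →
        f = ((koszulResolution F φ).d k (m + 1)).hom g := by
      rintro _ rfl g h
      refine Eq.trans ?_ (hd _ g).symm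
      exact funext fun x ↦ Subtype.ext (h x).symm
    exact this _ e g h
  constructor
  · rintro (f : KleinFour → (dualModule F φ).gr n) hf ⟨y, hy⟩
    have hf' : (dualModule F φ).koszulDLin n f = 0 := (hd n f).symm.trans hf
    obtain ⟨g, hg⟩ := exists_eq_koszulDLin φ f hf' (by
      by_cases hn : n = 0
      · subst hn
        rw [← koszulAug_apply, ← singleZeroIso_koszulResolutionπ, hy, single_d_apply, map_zero]
      · exact Finset.sum_eq_zero fun p _ ↦ apply_one_of_mem_dualModule_gr φ hn (f p))
    exact ⟨g, hd' n f g hg⟩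
  · intro x' _
    by_cases hn : n = 0
    · subst hn
      obtain ⟨f, hf⟩ := exists_koszulAug_eq φ ((singleZeroIso _).hom.hom x')
      refine ⟨f, 0, ?_, ?_⟩
      · have := subsingleton_dualModule_gr (F := F) φ (n := 0 + 1) (by lia)
        exact Subsingleton.elim (α := KleinFour → (dualModule F φ).gr (0 + 1)) _ _
      · rw [map_zero, add_zero]
        refine singleZeroIso_hom_injective _ ?_
        exact hf.symm.trans (singleZeroIso_koszulResolutionπ φ f).symm
    · have := subsingleton_single_X (Rep.trivial F (KleinFour ⋊[φ] Q) F) hn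
      exact ⟨0, 0, map_zero _, Subsingleton.elim _ _⟩

/-- A projective resolution is homotopy equivalent to the Koszul resolution. -/
lemma exists_homotopyEquiv_koszulResolution (hQ : Odd (Nat.card Q))
    (ε : ProjectiveResolution (Rep.trivial F (KleinFour ⋊[φ] Q) F)) :
    ∃ (u : ε.cochainComplex ⟶ koszulResolution F φ) (v : koszulResolution F φ ⟶ ε.cochainComplex),
      Nonempty (Homotopy (u ≫ v) (𝟙 _)) ∧ Nonempty (Homotopy (v ≫ u) (𝟙 _)) ∧
        QuasiIso (u ≫ koszulResolutionπ F φ) := by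
  have := fun n ↦ projective_koszul_X φ hQ (dualModule F φ) n
  have : ∀ n, Projective ((koszulResolution F φ).X n) := this
  have : (koszulResolution F φ).IsKProjective := isKProjective_of_projective _ 0
  have : ε.cochainComplex.IsKProjective := isKProjective_of_projective _ 0
  obtain ⟨u, ⟨h⟩⟩ := exists_lift_of_quasiIso (koszulResolutionπ F φ) ε.π'
  have hu : QuasiIso (u ≫ koszulResolutionπ F φ) := by
    rw [quasiIso_iff]
    intro n
    rw [quasiIsoAt_iff_isIso_homologyMap, h.homologyMap_eq n, ← quasiIsoAt_iff_isIso_homologyMap]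
    infer_instance
  have : QuasiIso u := quasiIso_of_comp_right u (koszulResolutionπ F φ)
  obtain ⟨v, h1, h2⟩ := exists_homotopyInverse_of_quasiIso u
  exact ⟨u, v, h1, h2, hu⟩

end Resolution
end

/-! ### Cochains on the Koszul resolution as elements of the twisted complex -/

noncomputable section

open scoped TensorProduct DirectSum
open KleinFour (gen coord)
open MvPolynomial (X C constantCoeff)

section Contraction

variable {F : Type u} [Field F] {S A : Type*} [AddCommGroup S] [Module F S] [AddCommGroup A]
  [Module F A]

/-- Contraction of a tensor with a functional on the left factor. -/
def contract : Module.Dual F S →ₗ[F] S ⊗[F] A →ₗ[F] A :=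
  LinearMap.compRight F (TensorProduct.lid F A).toLinearMap ∘ₗ LinearMap.rTensorHom A

lemma contract_tmul (l : Module.Dual F S) (s : S) (a : A) : contract l (s ⊗ₜ[F] a) = l s • a :=
  TensorProduct.lid_tmul ..

lemma contract_map (l : Module.Dual F S) (f : S →ₗ[F] S) (g : A →ₗ[F] A) (v : S ⊗[F] A) :
    contract l (TensorProduct.map f g v) = g (contract (l ∘ₗ f) v) := by
  induction v using TensorProduct.induction_on with
  | zero => simp
  | tmul s a => simp [contract_tmul]
  | add x y hx hy => simp only [map_add, hx, hy]

end Contraction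

lemma BiPoly.eq_zero_of_contract {F : Type u} [Field F] {A : Type*} [AddCommGroup A] [Module F A]
    {v : BiPoly F ⊗[F] A} (h : ∀ m, contract (MvPolynomial.lcoeff F m) v = 0) : v = 0 := by
  refine (TensorProduct.equivFinsuppOfBasisLeft
    (MvPolynomial.basisMonomials (Fin 2) F)).injective ?_
  rw [map_zero]
  ext m
  refine Eq.trans ?_ (h m)
  clear h
  induction v using TensorProduct.induction_on with
  | zero => simp
  | tmul s a =>
    rw [contract_tmul, TensorProduct.equivFinsuppOfBasisLeft_apply_tmul_apply]
    rfl
  | add x y hx hy => rw [map_add, map_add, Finsupp.add_apply, hx, hy]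

lemma MvPolynomial.sum_antidiag_of_isHomogeneous {F : Type u} [Field F] {f : BiPoly F} {k : ℕ}
    (hf : f.IsHomogeneous k) :
    ∑ m ∈ Finset.finsuppAntidiag Finset.univ k, MvPolynomial.monomial m (f.coeff m) = f := by
  conv_rhs => rw [f.as_sum]
  symm
  refine Finset.sum_subset (fun m hm ↦ ?_) fun m _ hm ↦ ?_
  · rw [Finset.mem_finsuppAntidiag]
    refine ⟨?_, Finset.subset_univ _⟩
    have := hf (MvPolynomial.mem_support_iff.1 hm)
    rw [← this, Finsupp.weight_apply, Finsupp.sum_fintype _ _ (by simp)]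
    simp
  · rw [MvPolynomial.notMem_support_iff.1 hm, map_zero]

section Koszul

variable {F : Type u} [Field F] {Q : Type u} [Group Q] {φ : Q →* MulAut KleinFour}
  {B : Type u} [AddCommGroup B] [Module F B] (N : GradedQModule (F := F) φ B)

lemma GradedQModule.koszul_hom_ext {n : ℤ} {Y : Rep.{u} F (KleinFour ⋊[φ] Q)}
    {f g : Rep.res (SemidirectProduct.inl : KleinFour →* KleinFour ⋊[φ] Q) (N.koszulX n) ⟶
      Rep.res (SemidirectProduct.inl : KleinFour →* KleinFour ⋊[φ] Q) Y}
    (h : ∀ b, f.hom (Pi.single 1 b : KleinFour → N.gr n) = g.hom (Pi.single 1 b : KleinFour → N.gr n)) :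
    f = g :=
  Rep.hom_ext (Representation.IntertwiningMap.ext (indRep_ext (ρ := N.grAct n) (repP Y.ρ)
    (fun p x ↦ Rep.hom_comm_apply f p x) (fun p x ↦ Rep.hom_comm_apply g p x) h))

lemma GradedQModule.koszulDLin_single (n : ℤ) (b : N.gr n) :
    N.koszulDLin n (Pi.single 1 b) = ∑ i, extGen (repP (indRep φ (N.grAct (n + 1)))) i
      (Pi.single 1 ⟨N.mulX i b, N.mulX_mem i b.2⟩) := by
  funext x
  refine Subtype.ext ?_
  rw [N.coe_koszulDLin, Finset.sum_apply, Submodule.coe_sum]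
  refine Finset.sum_congr rfl fun i _ ↦ ?_
  rw [extGen_indRep, Submodule.coe_add, map_add]
  have h : ∀ y : KleinFour, N.mulX i ((Pi.single 1 b : KleinFour → N.gr n) y : B) =
      ((Pi.single 1 ⟨N.mulX i b, N.mulX_mem i b.2⟩ : KleinFour → N.gr (n + 1)) y : B) := by
    intro y
    rw [Pi.single_apply, Pi.single_apply]
    split_ifs
    · rfl
    · exact map_zero _
  rw [h, h]

/-- The `F[P]`-linear extension of a linear map from a graded piece. -/
def GradedQModule.koszulLift (n : ℤ) (Y : Rep.{u} F (KleinFour ⋊[φ] Q)) (ζ : N.gr n →ₗ[F] Y) :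
    Rep.res (SemidirectProduct.inl : KleinFour →* KleinFour ⋊[φ] Q) (N.koszulX n) ⟶
      Rep.res (SemidirectProduct.inl : KleinFour →* KleinFour ⋊[φ] Q) Y :=
  Rep.ofHom
    { toLinearMap := indLift (repP Y.ρ) ζ
      isIntertwining' := fun p ↦
        LinearMap.ext (indLift_inl (ρ := N.grAct n) (repP Y.ρ) ζ p) }

lemma GradedQModule.koszulLift_single (n : ℤ) (Y : Rep.{u} F (KleinFour ⋊[φ] Q))
    (ζ : N.gr n →ₗ[F] Y) (b : N.gr n) :
    (N.koszulLift n Y ζ).hom (Pi.single 1 b : KleinFour → N.gr n) = ζ b :=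
  indLift_single (repP Y.ρ) ζ b

lemma resHom_extGen {Y Z : Rep.{u} F (KleinFour ⋊[φ] Q)}
    (f : Rep.res (SemidirectProduct.inl : KleinFour →* KleinFour ⋊[φ] Q) Y ⟶
      Rep.res (SemidirectProduct.inl : KleinFour →* KleinFour ⋊[φ] Q) Z) (i : Fin 2) (y : Y) :
    f.hom (extGen (repP Y.ρ) i y) = extGen (repP Z.ρ) i (f.hom y) := by
  rw [extGen_apply, extGen_apply]
  exact (map_add f.hom _ _).trans
    (congrArg₂ (· + ·) (Rep.hom_comm_apply f _ y) (Rep.hom_comm_apply f _ y))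

lemma totalSpace_add_apply {K : CochainComplex (Rep.{u} F (KleinFour ⋊[φ] Q)) ℤ}
    (a b : TotalSpace K) (n : ℤ) : (a + b) n = a n + b n :=
  DirectSum.add_apply ..

lemma totalW_apply (K : CochainComplex (Rep.{u} F (KleinFour ⋊[φ] Q)) ℤ) (i : Fin 2)
    (a : TotalSpace K) (n : ℤ) : totalW K i a n = extGen (repP (K.X n).ρ) i (a n) :=
  DirectSum.lmap_apply ..

end Koszul

section Evaluation

variable {F : Type u} [Field F] [CharP F 2] {Q : Type u} [Group Q] {φ : Q →* MulAut KleinFour}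
variable (K : CochainComplex (Rep.{u} F (KleinFour ⋊[φ] Q)) ℤ)

variable {K}

/-- The linear map from a graded piece of the dual of the polynomial ring given by contraction. -/
def evLin (v : BiPoly F ⊗[F] TotalSpace K) (i j : ℤ) : (dualModule F φ).gr i →ₗ[F] K.X j :=
  DirectSum.component F ℤ (fun n ↦ (K.X n : Type u)) j ∘ₗ contract.flip v ∘ₗ
    ((dualModule F φ).gr i).subtype

/-- The cochain on the Koszul resolution given by contraction. -/
def ev (n : ℤ) (v : BiPoly F ⊗[F] TotalSpace K) :
    Cochain (resP φ (koszulResolution F φ)) (resP φ K) n :=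
  Cochain.mk fun i j _ ↦ (dualModule F φ).koszulLift i (K.X j) (evLin v i j)

lemma ev_v_single (n : ℤ) (v : BiPoly F ⊗[F] TotalSpace K) (i j : ℤ) (hij : i + n = j)
    (b : (dualModule F φ).gr i) :
    ((ev n v).v i j hij).hom (Pi.single 1 b : KleinFour → (dualModule F φ).gr i) =
      contract b.1 v j :=
  (dualModule F φ).koszulLift_single i (K.X j) (evLin v i j) b

lemma cochain_koszulResolution_ext {n : ℤ}
    {z z' : Cochain (resP φ (koszulResolution F φ)) (resP φ K) n}
    (h : ∀ i j hij (b : (dualModule F φ).gr i),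
      (z.v i j hij).hom (Pi.single 1 b : KleinFour → (dualModule F φ).gr i) =
        (z'.v i j hij).hom (Pi.single 1 b : KleinFour → (dualModule F φ).gr i)) : z = z' :=
  Cochain.ext _ _ fun i j hij ↦
    (dualModule F φ).koszul_hom_ext (Y := K.X j) (h i j hij)

lemma ev_add (n : ℤ) (v v' : BiPoly F ⊗[F] TotalSpace K) : ev n (v + v') = ev n v + ev n v' :=
  cochain_koszulResolution_ext fun i j hij b ↦ by
    rw [ev_v_single, map_add]
    exact (congrArg₂ (· + ·) (ev_v_single n v i j hij b) (ev_v_single n v' i j hij b)).symm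

lemma ev_smul (n : ℤ) (c : F) (v : BiPoly F ⊗[F] TotalSpace K) : ev n (c • v) = c • ev n v :=
  cochain_koszulResolution_ext fun i j hij b ↦ by
    rw [ev_v_single, map_smul]
    exact (congrArg (c • ·) (ev_v_single n v i j hij b)).symm

variable {s : Finset ℤ} (hs : ∀ n ∉ s, Subsingleton (K.X n))

/-- Multiplication by `xᵢ` on the polynomial factor is moved onto the functional, where it is the
variable action on the dual module, and so the Koszul differential. -/
lemma contract_D (l : Module.Dual F (BiPoly F)) (v : BiPoly F ⊗[F] TotalSpace K) :
    contract l ((totalExt K s hs).D v) = totalD K (contract l v) +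
      ∑ i, totalW K i (contract ((dualModule F φ).mulX i l) v) := by
  induction v using TensorProduct.induction_on with
  | zero => simp
  | tmul p a =>
    rw [ExteriorComplex.D_tmul, Fin.sum_univ_two]
    simp only [map_add, contract_tmul, map_smul]
    rfl
  | add x y hx hy =>
    simp only [map_add, hx, hy, Fin.sum_univ_two]
    abel

lemma units_smul_of_charTwo {V : Type*} [AddCommGroup V] [Module F V] (c : ℤˣ) (x : V) :
    c • x = x := by
  rcases Int.units_eq_one_or c with rfl | rfl
  · exact one_smul _ _
  · rw [Units.neg_smul, one_smul, neg_eq_of_charTwo F]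

/-- Both sides are compared on functions supported at the identity, which generate over `P`. There
the Koszul differential yields the terms `wᵢ` of an `xᵢ`-translated functional, and these are the
twisting terms of `D`; signs disappear in characteristic 2. -/
lemma δ_ev (n : ℤ) (v : BiPoly F ⊗[F] TotalSpace K) :
    δ n (n + 1) (ev n v) = ev (n + 1) ((totalExt K s hs).D v) := by
  refine cochain_koszulResolution_ext fun i j hij b ↦ ?_
  obtain ⟨k, rfl⟩ : ∃ k, j = k + 1 := ⟨j - 1, by lia⟩
  rw [δ_v n (n + 1) rfl _ i (k + 1) hij k (i + 1) (by lia) rfl, units_smul_of_charTwo (F := F),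
    ev_v_single, contract_D]
  have h1 := ev_v_single n v i k (by lia) b
  have h2 := fun b ↦ ev_v_single n v (i + 1) (k + 1) (by lia) b
  have e : (((ev n v).v i k (by lia) ≫ (resP φ K).d k (k + 1) +
      (resP φ (koszulResolution F φ)).d i (i + 1) ≫ (ev n v).v (i + 1) (k + 1) (by lia)).hom
      (Pi.single 1 b : KleinFour → (dualModule F φ).gr i)) =
      HAdd.hAdd (α := K.X (k + 1)) (β := K.X (k + 1)) (γ := K.X (k + 1))
        ((K.d k (k + 1)).hom (((ev n v).v i k (by lia)).hom
        (Pi.single 1 b : KleinFour → (dualModule F φ).gr i)))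
      (((ev n v).v (i + 1) (k + 1) (by lia)).hom (((koszulResolution F φ).d i (i + 1)).hom
        (Pi.single 1 b : KleinFour → (dualModule F φ).gr i))) := rfl
  refine e.trans ?_
  have e2 : ((koszulResolution F φ).d i (i + 1)).hom
      (Pi.single 1 b : KleinFour → (dualModule F φ).gr i) = _ :=
    ((dualModule F φ).koszul_d_apply i _).trans ((dualModule F φ).koszulDLin_single i b)
  rw [h1, e2]
  rw [Fin.sum_univ_two, Fin.sum_univ_two, totalSpace_add_apply, totalSpace_add_apply, totalD_apply,
    totalW_apply, totalW_apply]
  refine congrArg₂ (HAdd.hAdd (α := K.X (k + 1)) (β := K.X (k + 1)) (γ := K.X (k + 1))) rfl ?_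
  refine (map_add ((ev n v).v (i + 1) (k + 1) (by lia)).hom _ _).trans ?_
  refine congrArg₂ (HAdd.hAdd (α := K.X (k + 1)) (β := K.X (k + 1)) (γ := K.X (k + 1))) ?_ ?_
  · refine (resHom_extGen (Y := (dualModule F φ).koszulX (i + 1)) (Z := K.X (k + 1)) _ _ _).trans ?_
    exact congrArg _ (h2 _)
  · refine (resHom_extGen (Y := (dualModule F φ).koszulX (i + 1)) (Z := K.X (k + 1)) _ _ _).trans ?_
    exact congrArg _ (h2 _)

end Evaluation
end

noncomputable section

open scoped TensorProduct DirectSum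
open KleinFour (gen coord)
open MvPolynomial (X C constantCoeff)

section Evaluation

variable {F : Type u} [Field F] [CharP F 2] {Q : Type u} [Group Q] {φ : Q →* MulAut KleinFour}
variable {K : CochainComplex (Rep.{u} F (KleinFour ⋊[φ] Q)) ℤ}
variable {s : Finset ℤ} (hs : ∀ n ∉ s, Subsingleton (K.X n))

lemma δ_ev_of_eq {n m : ℤ} (h : n + 1 = m) (v : BiPoly F ⊗[F] TotalSpace K) :
    δ n m (ev n v) = ev m ((totalExt K s hs).D v) := by
  subst h; exact δ_ev hs n v

lemma gradedProj_contract {n i : ℤ} {v : BiPoly F ⊗[F] TotalSpace K}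
    (hv : v ∈ (totalExt K s hs).total n) (b : (dualModule F φ).gr i) :
    gradedProj (F := F) (fun n ↦ (K.X n : Type u)) (i + n) (contract b.1 v) = contract b.1 v := by
  induction hv using Submodule.span_induction with
  | mem v hv =>
    obtain ⟨j, p, a, hp, ha, rfl⟩ := hv
    rw [contract_tmul, map_smul]
    by_cases h : j = -i
    · subst h
      rw [show i + n = n - -i by ring]
      exact congrArg _ ha
    · rw [← b.2, ← hp, hpart_hpart, if_neg (Ne.symm h), map_zero, zero_smul, zero_smul]
  | zero => simp
  | add x y _ _ hx hy => rw [map_add, map_add, hx, hy]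
  | smul c x _ hx => rw [map_smul, map_smul, hx]

lemma dualProj_of_mem {n : ℤ} {l : Module.Dual F (BiPoly F)} (hl : l ∈ (dualModule F φ).gr n) :
    (dualProj φ n l : Module.Dual F (BiPoly F)) = l :=
  LinearMap.ext fun p ↦ hl p

lemma lcoeff_mem_dualModule_gr (m : Fin 2 →₀ ℕ) :
    MvPolynomial.lcoeff F m ∈ (dualModule F φ).gr (-(m.degree : ℤ)) := by
  intro p
  rw [neg_neg, hpart_natCast]
  change MvPolynomial.coeff m (MvPolynomial.homogeneousComponent _ p) = MvPolynomial.coeff m p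
  rw [MvPolynomial.coeff_homogeneousComponent, if_pos rfl]

/-- Coefficient functionals separate tensors, and homogeneity places each contraction in the single
degree recorded by the cochain. With `exists_ev_eq`, elements of total degree `n` correspond exactly
to `n`-cochains. -/
lemma eq_zero_of_ev_eq_zero {n : ℤ} {v : BiPoly F ⊗[F] TotalSpace K}
    (hv : v ∈ (totalExt K s hs).total n) (h : ev (φ := φ) n v = 0) : v = 0 := by
  refine BiPoly.eq_zero_of_contract fun m ↦ ?_
  have hb := gradedProj_contract hs hv ⟨_, lcoeff_mem_dualModule_gr (φ := φ) m⟩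
  rw [eq_lof_of_gradedProj hb]
  have h' := ev_v_single n v (-(m.degree : ℤ)) _ rfl ⟨_, lcoeff_mem_dualModule_gr (φ := φ) m⟩
  rw [h] at h'
  rw [← h']
  exact map_zero _

lemma sum_apply_monomial_smul_lcoeff {i : ℤ} (b : (dualModule F φ).gr i) {k : ℕ} (hk : -i = k) :
    ∑ m ∈ Finset.finsuppAntidiag (Finset.univ : Finset (Fin 2)) k,
      b.1 (MvPolynomial.monomial m 1) • dualProj φ i (MvPolynomial.lcoeff F m) = b := by
  refine Subtype.ext (LinearMap.ext fun p ↦ ?_)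
  rw [Submodule.coe_sum, LinearMap.sum_apply, ← b.2 p, hk,
    ← MvPolynomial.sum_antidiag_of_isHomogeneous (isHomogeneous_hpart k p), map_sum]
  refine Finset.sum_congr rfl fun m _ ↦ ?_
  rw [Submodule.coe_smul, LinearMap.smul_apply, dualProj_apply, hk]
  change b.1 _ * MvPolynomial.coeff m (hpart (k : ℤ) p) = _
  rw [mul_comm, ← smul_eq_mul, ← map_smul, MvPolynomial.smul_monomial, smul_eq_mul, mul_one]

lemma exists_ev_eq {n : ℤ} (z : Cochain (resP φ (koszulResolution F φ)) (resP φ K) n) :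
    ∃ v ∈ (totalExt K s hs).total n, ev n v = z := by
  let ζ : ∀ i j, i + n = j → (dualModule F φ).gr i →ₗ[F] K.X j := fun i j hij ↦
    (z.v i j hij).hom.toLinearMap ∘ₗ
      LinearMap.single F (fun _ : KleinFour ↦ (dualModule F φ).gr i) 1
  have hζ : ∀ i j hij (b : (dualModule F φ).gr i), ζ i j hij b =
      (z.v i j hij).hom (Pi.single 1 b : KleinFour → (dualModule F φ).gr i) := fun _ _ _ _ ↦ rfl
  -- Expansion in the monomial basis and its dual: in each of the finitely many degrees `j` of `K`,
  -- a monomial of degree `n - j` is paired with the value of `z` on the dual monomial. For `n < j`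
  -- the truncated degree is harmless because the dual piece is zero.
  refine ⟨∑ j ∈ s, ∑ m ∈ Finset.finsuppAntidiag (Finset.univ : Finset (Fin 2)) (n - j).toNat,
    MvPolynomial.monomial m (1 : F) ⊗ₜ[F] DirectSum.lof F ℤ (fun n ↦ (K.X n : Type u)) j
      (ζ (j - n) j (by lia) (dualProj φ _ (MvPolynomial.lcoeff F m))), ?_, ?_⟩
  · refine Submodule.sum_mem _ fun j _ ↦ Submodule.sum_mem _ fun m hm ↦ ?_
    rcases lt_or_ge n j with hj | hj
    · have := subsingleton_dualModule_gr (F := F) φ (n := j - n) (by lia)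
      rw [Subsingleton.elim (dualProj φ (j - n) _) 0, map_zero, map_zero, TensorProduct.tmul_zero]
      exact zero_mem _
    · obtain ⟨k, hk⟩ := Int.eq_ofNat_of_zero_le (sub_nonneg.2 hj)
      rw [hk, Int.toNat_natCast, Finset.mem_finsuppAntidiag] at hm
      have hm' : (MvPolynomial.monomial m (1 : F)).IsHomogeneous k := by
        refine MvPolynomial.isHomogeneous_monomial _ ?_
        rw [Finsupp.degree_eq_sum]
        exact hm.1
      have := ExteriorComplex.tmul_mem_total (T := totalExt K s hs) (j := n - j) (n := j)
        (s := MvPolynomial.monomial m (1 : F)) (a := DirectSum.lof F ℤ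
          (fun n ↦ (K.X n : Type u)) j (ζ (j - n) j (by lia) (dualProj φ _ (MvPolynomial.lcoeff F m))))
        (by rw [hk, hpart_of_isHomogeneous hm', if_pos rfl])
        ((gradedProj_lof _ _ _).trans (if_pos rfl))
      rwa [sub_add_cancel] at this
  · refine cochain_koszulResolution_ext fun i j hij b ↦ ?_
    refine (ev_v_single _ _ i j hij b).trans (Eq.trans ?_ (hζ i j hij b))
    obtain rfl : i = j - n := by lia
    have key : ∀ j', contract b.1 (∑ m ∈ Finset.finsuppAntidiag (Finset.univ : Finset (Fin 2))
        (n - j').toNat, MvPolynomial.monomial m (1 : F) ⊗ₜ[F]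
          DirectSum.lof F ℤ (fun n ↦ (K.X n : Type u)) j'
            (ζ (j' - n) j' (by lia) (dualProj φ _ (MvPolynomial.lcoeff F m)))) =
        DirectSum.lof F ℤ (fun n ↦ (K.X n : Type u)) j' (ζ (j' - n) j' (by lia)
          (∑ m ∈ Finset.finsuppAntidiag (Finset.univ : Finset (Fin 2)) (n - j').toNat,
            b.1 (MvPolynomial.monomial m 1) • dualProj φ _ (MvPolynomial.lcoeff F m))) := by
      intro j'
      simp only [map_sum, map_smul, contract_tmul]
    rw [map_sum, Finset.sum_congr rfl fun j' _ ↦ key j']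
    change DirectSum.component F ℤ (fun n ↦ (K.X n : Type u)) j _ = _
    rw [map_sum, Finset.sum_eq_single j]
    · rw [DirectSum.component.lof_self]
      congr 1
      rcases lt_or_ge n j with hj | hj
      · have := subsingleton_dualModule_gr (F := F) φ (n := j - n) (by lia)
        exact Subsingleton.elim _ _
      · exact sum_apply_monomial_smul_lcoeff b (by lia)
    · intro j' _ hj'
      rw [DirectSum.component.of, dif_neg hj']
    · intro hj
      have := hs j hj
      exact Subsingleton.elim _ _

end Evaluation
end

/-! ### Polynomials as cochains of the Koszul resolution and the action of `Q` -/

noncomputable section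

open scoped TensorProduct DirectSum
open KleinFour (gen coord)
open MvPolynomial (X C constantCoeff)

lemma contract_smul {F : Type u} [Field F] {A : Type*} [AddCommGroup A] [Module F A] (l : Module.Dual F (BiPoly F))
    (f : BiPoly F) (v : BiPoly F ⊗[F] A) :
    contract l (f • v) = contract (l ∘ₗ LinearMap.mulLeft F f) v := by
  induction v using TensorProduct.induction_on with
  | zero => simp
  | tmul s a => simp [contract_tmul, TensorProduct.smul_tmul']
  | add x y hx hy => simp only [smul_add, map_add, hx, hy]

lemma gradedMap_apply {F : Type u} [Field F] {Q : Type u} [Group Q] {φ : Q →* MulAut KleinFour}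
    {K L : CochainComplex (Rep.{u} F (KleinFour ⋊[φ] Q)) ℤ} (f : ∀ n, K.X n →ₗ[F] L.X n)
    (a : TotalSpace K) (n : ℤ) : gradedMap f a n = f n (a n) :=
  DirectSum.lmap_apply ..

section MulCochain

variable {F : Type u} [Field F] [CharP F 2] {Q : Type u} [Group Q] {φ : Q →* MulAut KleinFour}
variable {K : CochainComplex (Rep.{u} F (KleinFour ⋊[φ] Q)) ℤ}

lemma comp_mulLeft_mem {n m k : ℤ} {f : BiPoly F} (hf : hpart k f = f) (h : n + k = m)
    {l : Module.Dual F (BiPoly F)} (hl : l ∈ (dualModule F φ).gr n) :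
    l ∘ₗ LinearMap.mulLeft F f ∈ (dualModule F φ).gr m := by
  subst h
  intro p
  change l (f * hpart _ p) = l (f * p)
  rcases lt_or_ge k 0 with hk | hk
  · rw [← hf, hpart_of_neg hk, zero_mul, zero_mul]
  · lift k to ℕ using hk
    rw [← hl (f * p), hpart_mul (isHomogeneous_iff_hpart.2 hf), neg_add, sub_eq_add_neg]

/-- The functional `b(f · )` on polynomials, projected to a graded piece. -/
def mulLin (f : BiPoly F) (i j : ℤ) : (dualModule F φ).gr i →ₗ[F] (KleinFour → (dualModule F φ).gr j) :=
  LinearMap.single F (fun _ : KleinFour ↦ (dualModule F φ).gr j) 1 ∘ₗ dualProj φ j ∘ₗ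
    (LinearMap.mulLeft F f).dualMap ∘ₗ ((dualModule F φ).gr i).subtype

variable (φ) in
/-- The cochain of degree `n` of the Koszul resolution given by a polynomial. -/
def mulCochain (n : ℤ) (f : BiPoly F) :
    Cochain (resP φ (koszulResolution F φ)) (resP φ (koszulResolution F φ)) n :=
  Cochain.mk fun i j _ ↦ (dualModule F φ).koszulLift i ((koszulResolution F φ).X j) (mulLin f i j)

lemma mulCochain_v_single (n : ℤ) (f : BiPoly F) (i j : ℤ) (hij : i + n = j)
    (b : (dualModule F φ).gr i) :
    ((mulCochain φ n f).v i j hij).hom (Pi.single 1 b : KleinFour → (dualModule F φ).gr i) =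
      (Pi.single 1 (dualProj φ j (b.1 ∘ₗ LinearMap.mulLeft F f)) :
        KleinFour → (dualModule F φ).gr j) :=
  (dualModule F φ).koszulLift_single i ((koszulResolution F φ).X j) (mulLin f i j) b

lemma mulCochain_add (n : ℤ) (f g : BiPoly F) :
    mulCochain φ n (f + g) = mulCochain φ n f + mulCochain φ n g :=
  cochain_koszulResolution_ext fun i j hij b ↦ by
    have h : mulLin (φ := φ) (f + g) i j b = mulLin f i j b + mulLin g i j b := by
      have e : b.1 ∘ₗ LinearMap.mulLeft F (f + g) =
          b.1 ∘ₗ LinearMap.mulLeft F f + b.1 ∘ₗ LinearMap.mulLeft F g :=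
        LinearMap.ext fun p ↦ (congrArg b.1 (add_mul f g p)).trans (map_add _ _ _)
      change (Pi.single 1 (dualProj φ j (b.1 ∘ₗ LinearMap.mulLeft F (f + g))) :
        KleinFour → (dualModule F φ).gr j) =
        Pi.single 1 (dualProj φ j (b.1 ∘ₗ LinearMap.mulLeft F f)) +
          Pi.single 1 (dualProj φ j (b.1 ∘ₗ LinearMap.mulLeft F g))
      rw [e, map_add, Pi.single_add]
    exact (mulCochain_v_single n (f + g) i j hij b).trans (h.trans (congrArg₂ (· + ·)
      (mulCochain_v_single n f i j hij b) (mulCochain_v_single n g i j hij b)).symm)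

lemma mulCochain_smul (n : ℤ) (c : F) (f : BiPoly F) :
    mulCochain φ n (c • f) = c • mulCochain φ n f :=
  cochain_koszulResolution_ext fun i j hij b ↦ by
    have h : mulLin (φ := φ) (c • f) i j b = c • mulLin f i j b := by
      have e : b.1 ∘ₗ LinearMap.mulLeft F (c • f) = c • (b.1 ∘ₗ LinearMap.mulLeft F f) :=
        LinearMap.ext fun p ↦ (congrArg b.1 (smul_mul_assoc c f p)).trans (map_smul _ _ _)
      change (Pi.single 1 (dualProj φ j (b.1 ∘ₗ LinearMap.mulLeft F (c • f))) :
        KleinFour → (dualModule F φ).gr j) =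
        c • Pi.single 1 (dualProj φ j (b.1 ∘ₗ LinearMap.mulLeft F f))
      rw [e, map_smul, Pi.single_smul]
    exact (mulCochain_v_single n (c • f) i j hij b).trans (h.trans (congrArg (c • ·)
      (mulCochain_v_single n f i j hij b)).symm)

lemma mulCochain_one : mulCochain φ 0 (1 : BiPoly F) =
    Cochain.ofHom (𝟙 (resP φ (koszulResolution F φ))) :=
  cochain_koszulResolution_ext fun i j hij b ↦ by
    obtain rfl : i = j := by lia
    rw [Cochain.ofHom_v]
    refine (mulCochain_v_single 0 1 i i hij b).trans ?_
    change (Pi.single 1 _ : KleinFour → (dualModule F φ).gr i) = Pi.single 1 b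
    congr 1
    refine Subtype.ext (LinearMap.ext fun p ↦ ?_)
    rw [dualProj_apply]
    change b.1 (1 * _) = b.1 p
    rw [one_mul, b.2]

/-- Precomposing a functional with multiplication by `f` and then contracting is the same as
contracting `f • v`. -/
lemma mulCochain_comp_ev {a n c : ℤ} {f : BiPoly F} (hf : hpart a f = f) (h : a + n = c)
    (v : BiPoly F ⊗[F] TotalSpace K) :
    (mulCochain φ a f).comp (ev n v) h = ev c (f • v) :=
  cochain_koszulResolution_ext fun i j hij b ↦ by
    rw [Cochain.comp_v _ _ h i (i + a) j rfl (by lia)]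
    refine Eq.trans ?_ (ev_v_single c (f • v) i j hij b).symm
    refine (congrArg ((ev n v).v (i + a) j (by lia)).hom
      (mulCochain_v_single a f i (i + a) rfl b)).trans ?_
    refine (ev_v_single n v (i + a) j (by lia) _).trans ?_
    rw [contract_smul, dualProj_of_mem (comp_mulLeft_mem hf rfl b.2)]

lemma mulCochain_comp_mulCochain {a n c : ℤ} {f g : BiPoly F} (hf : hpart a f = f)
    (h : a + n = c) :
    (mulCochain φ a f).comp (mulCochain φ n g) h = mulCochain φ c (f * g) :=
  cochain_koszulResolution_ext fun i j hij b ↦ by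
    rw [Cochain.comp_v _ _ h i (i + a) j rfl (by lia)]
    refine Eq.trans ?_ (mulCochain_v_single c (f * g) i j hij b).symm
    refine (congrArg ((mulCochain φ n g).v (i + a) j (by lia)).hom
      (mulCochain_v_single a f i (i + a) rfl b)).trans ?_
    refine (mulCochain_v_single n g (i + a) j (by lia) _).trans ?_
    rw [dualProj_of_mem (comp_mulLeft_mem hf rfl b.2), LinearMap.comp_assoc]
    congr 3
    exact LinearMap.ext fun p ↦ (mul_assoc f g p).symm

/-- Multiplication by `f` commutes with that by the variables, so its transpose commutes with the
Koszul differential; the two equal terms of the coboundary cancel in characteristic 2. -/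
lemma δ_mulCochain {n : ℤ} {f : BiPoly F} (hf : hpart n f = f) :
    δ n (n + 1) (mulCochain φ n f) = 0 := by
  refine cochain_koszulResolution_ext fun i j hij b ↦ ?_
  obtain ⟨k, rfl⟩ : ∃ k, j = k + 1 := ⟨j - 1, by lia⟩
  rw [δ_v n (n + 1) rfl _ i (k + 1) hij k (i + 1) (by lia) rfl, units_smul_of_charTwo (F := F)]
  have h1 := mulCochain_v_single n f i k (by lia) b
  have h2 := fun b ↦ mulCochain_v_single (φ := φ) n f (i + 1) (k + 1) (by lia) b
  have e : (((mulCochain φ n f).v i k (by lia) ≫ (resP φ (koszulResolution F φ)).d k (k + 1) +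
      (resP φ (koszulResolution F φ)).d i (i + 1) ≫
        (mulCochain φ n f).v (i + 1) (k + 1) (by lia)).hom
      (Pi.single 1 b : KleinFour → (dualModule F φ).gr i)) =
      HAdd.hAdd (α := KleinFour → (dualModule F φ).gr (k + 1)) (β := KleinFour → (dualModule F φ).gr (k + 1))
        (γ := KleinFour → (dualModule F φ).gr (k + 1))
        (((koszulResolution F φ).d k (k + 1)).hom (((mulCochain φ n f).v i k (by lia)).hom
        (Pi.single 1 b : KleinFour → (dualModule F φ).gr i)))
      (((mulCochain φ n f).v (i + 1) (k + 1) (by lia)).hom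
        (((koszulResolution F φ).d i (i + 1)).hom
        (Pi.single 1 b : KleinFour → (dualModule F φ).gr i))) := rfl
  have e2 : ∀ i (b : (dualModule F φ).gr i), ((koszulResolution F φ).d i (i + 1)).hom
      (Pi.single 1 b : KleinFour → (dualModule F φ).gr i) = _ := fun i b ↦
    ((dualModule F φ).koszul_d_apply i _).trans ((dualModule F φ).koszulDLin_single i b)
  have e3 : ((mulCochain φ n f).v (i + 1) (k + 1) (by lia)).hom
      (∑ x, extGen (repP (indRep φ ((dualModule F φ).grAct (i + 1)))) x
        (Pi.single 1 ⟨(dualModule F φ).mulX x b, (dualModule F φ).mulX_mem x b.2⟩)) =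
      ∑ x, extGen (repP (indRep φ ((dualModule F φ).grAct (k + 1)))) x (Pi.single 1
        (dualProj φ (k + 1) ((dualModule F φ).mulX x b ∘ₗ LinearMap.mulLeft F f))) := by
    refine (map_sum ((mulCochain φ n f).v (i + 1) (k + 1) (by lia)).hom _ _).trans ?_
    refine Finset.sum_congr rfl fun x _ ↦ ?_
    refine (resHom_extGen (Y := (dualModule F φ).koszulX (i + 1))
      (Z := (dualModule F φ).koszulX (k + 1)) _ _ _).trans ?_
    exact congrArg _ (h2 _)
  have e4 : ∀ x, (⟨(dualModule F φ).mulX x (dualProj φ k (b.1 ∘ₗ LinearMap.mulLeft F f)),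
      (dualModule F φ).mulX_mem x (dualProj φ k (b.1 ∘ₗ LinearMap.mulLeft F f)).2⟩ :
        (dualModule F φ).gr (k + 1)) =
      dualProj φ (k + 1) ((dualModule F φ).mulX x b ∘ₗ LinearMap.mulLeft F f) := by
    intro x
    refine Subtype.ext ?_
    rw [dualProj_of_mem (comp_mulLeft_mem hf (by lia) ((dualModule F φ).mulX_mem x b.2))]
    refine (congrArg ((dualModule F φ).mulX x)
      (dualProj_of_mem (comp_mulLeft_mem hf (by lia) b.2))).trans ?_
    exact LinearMap.ext fun p ↦ congrArg b.1 (mul_left_comm _ _ _)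
  have hA : ((koszulResolution F φ).d k (k + 1)).hom (Pi.single 1 (dualProj φ k
      (b.1 ∘ₗ LinearMap.mulLeft F f)) : KleinFour → (dualModule F φ).gr k) =
      ∑ x, extGen (repP (indRep φ ((dualModule F φ).grAct (k + 1)))) x (Pi.single 1
        (dualProj φ (k + 1) ((dualModule F φ).mulX x b ∘ₗ LinearMap.mulLeft F f))) :=
    (e2 k _).trans (Finset.sum_congr rfl fun x _ ↦ by rw [← e4 x])
  have hB := (congrArg ((mulCochain φ n f).v (i + 1) (k + 1) (by lia)).hom (e2 i b)).trans e3
  refine e.trans ?_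
  rw [h1, hA, hB]
  exact add_self_of_charTwo F (V := KleinFour → (dualModule F φ).gr (k + 1)) _

lemma conjCochain_mulCochain (q : Q) (n : ℤ) (f : BiPoly F) :
    conjCochain n q (mulCochain φ n f) = mulCochain φ n (polyAct φ q f) :=
  cochain_koszulResolution_ext fun i j hij b ↦ by
    rw [conjCochain_v]
    refine Eq.trans ?_ (mulCochain_v_single n (polyAct φ q f) i j hij b).symm
    change indRep φ ((dualModule F φ).grAct j) (SemidirectProduct.inr q)
      (((mulCochain φ n f).v i j hij).hom
        (indRep φ ((dualModule F φ).grAct i) (SemidirectProduct.inr q⁻¹) (Pi.single 1 b))) = _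
    rw [indRep_inr_single]
    refine (congrArg _ (mulCochain_v_single n f i j hij _)).trans ?_
    rw [indRep_inr_single]
    congr 1
    refine Subtype.ext (LinearMap.ext fun p ↦ ?_)
    change b.1 (polyAct φ q⁻¹⁻¹ (f * hpart _ (polyAct φ q⁻¹ p))) =
      b.1 (polyAct φ q f * hpart _ p)
    rw [inv_inv, map_mul, hpart_polyAct, polyAct_polyAct_inv]

/-- The action of `Q` on the twisted complex. -/
def twistAct (K : CochainComplex (Rep.{u} F (KleinFour ⋊[φ] Q)) ℤ) (q : Q) :
    BiPoly F ⊗[F] TotalSpace K →ₗ[F] BiPoly F ⊗[F] TotalSpace K :=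
  TensorProduct.map (polyAct φ q).toLinearMap
    (gradedMap fun n ↦ (K.X n).ρ (SemidirectProduct.inr q))

lemma conjCochain_ev (q : Q) (n : ℤ) (v : BiPoly F ⊗[F] TotalSpace K) :
    conjCochain n q (ev (φ := φ) n v) = ev n (twistAct K q v) :=
  cochain_koszulResolution_ext fun i j hij b ↦ by
    rw [conjCochain_v]
    refine Eq.trans ?_ (ev_v_single n (twistAct K q v) i j hij b).symm
    change (K.X j).ρ (SemidirectProduct.inr q) (((ev n v).v i j hij).hom
        (indRep φ ((dualModule F φ).grAct i) (SemidirectProduct.inr q⁻¹) (Pi.single 1 b))) = _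
    rw [indRep_inr_single]
    refine (congrArg _ (ev_v_single n v i j hij _)).trans ?_
    rw [twistAct, contract_map]
    rw [gradedMap_apply]
    refine congrArg (fun l : Module.Dual F (BiPoly F) ↦
      (K.X j).ρ (SemidirectProduct.inr q) (contract l v j)) (LinearMap.ext fun p ↦ ?_)
    change b.1 (polyAct φ q⁻¹⁻¹ p) = _
    rw [inv_inv]
    rfl

end MulCochain
end

/-! ### Ext classes of twisted cycles and change of resolution -/

noncomputable section

open scoped TensorProduct DirectSum
open KleinFour (gen coord)
open MvPolynomial (X C constantCoeff)

section Classes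

variable {F : Type u} [Field F] [CharP F 2] {Q : Type u} [Group Q] {φ : Q →* MulAut KleinFour}
variable {K : CochainComplex (Rep.{u} F (KleinFour ⋊[φ] Q)) ℤ}

lemma ev_zero (n : ℤ) : ev (φ := φ) n (0 : BiPoly F ⊗[F] TotalSpace K) = 0 := by
  rw [← zero_smul F (0 : BiPoly F ⊗[F] TotalSpace K), ev_smul, zero_smul]

section

variable {s : Finset ℤ} (hs : ∀ n ∉ s, Subsingleton (K.X n))

/-- The class of the cochain given by contraction with a cycle of the twisted complex. -/
def evClass (n : ℤ) (z : BiPoly F ⊗[F] TotalSpace K) (hz : (totalExt K s hs).D z = 0) :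
    HomCohomology φ (koszulResolution F φ) K n :=
  homMk (ev n z) (by rw [δ_ev hs, hz, ev_zero])

lemma exists_evClass_eq {n : ℤ} (x : HomCohomology φ (koszulResolution F φ) K n) :
    ∃ z ∈ (totalExt K s hs).total n, ∃ hz, x = evClass hs n z hz := by
  obtain ⟨y, hy, rfl⟩ := exists_homMk_eq x
  obtain ⟨z, hz, rfl⟩ := exists_ev_eq hs y
  refine ⟨z, hz, ?_, rfl⟩
  rw [δ_ev hs] at hy
  exact eq_zero_of_ev_eq_zero hs (ExteriorComplex.D_mem_total hz) hy

/-- The primitive `y` need not be homogeneous: a cochain of degree `n - 1` reads only one component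
of it. Conversely a primitive cochain comes from a homogeneous `y`, and injectivity of `ev` compares
`D y` with `z`. -/
lemma evClass_eq_zero_iff {n : ℤ} {z : BiPoly F ⊗[F] TotalSpace K}
    (hzn : z ∈ (totalExt K s hs).total n) {hz : (totalExt K s hs).D z = 0} :
    evClass hs n z hz = 0 ↔ ∃ y, z = (totalExt K s hs).D y := by
  refine homMk_eq_zero_iff.trans ⟨?_, ?_⟩
  · rintro ⟨y, hy⟩
    obtain ⟨y, hyn, rfl⟩ := exists_ev_eq hs y
    refine ⟨y, ?_⟩
    rw [δ_ev_of_eq hs (by lia : n - 1 + 1 = n)] at hy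
    have hD := ExteriorComplex.D_mem_total hyn
    rw [sub_add_cancel] at hD
    rw [← sub_eq_zero]
    refine eq_zero_of_ev_eq_zero hs (φ := φ) (sub_mem hzn hD) ?_
    rw [sub_eq_of_charTwo F, ev_add, hy]
    exact add_self_of_charTwo F _
  · rintro ⟨y, hy⟩
    exact ⟨ev (n - 1) y, by rw [δ_ev_of_eq hs (by lia : n - 1 + 1 = n), ← hy]⟩

variable (φ) in
/-- The class of the cochain given by a homogeneous polynomial. -/
def mulClass (n : ℤ) (f : BiPoly F) (hf : hpart n f = f) :
    HomCohomology φ (koszulResolution F φ) (koszulResolution F φ) n :=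
  homMk (mulCochain φ n f) (δ_mulCochain hf)

lemma evClass_mulClass {a n c : ℤ} (h : a + n = c) {f : BiPoly F} (hf : hpart a f = f)
    {z : BiPoly F ⊗[F] TotalSpace K} (hz : (totalExt K s hs).D z = 0) :
    homCohomologyComp h (evClass hs n z hz) (mulClass φ a f hf) =
      evClass hs c (f • z) (by rw [map_smul, hz, smul_zero]) :=
  congrArg Submodule.Quotient.mk (Subtype.ext (mulCochain_comp_ev hf h z))

lemma evClass_rep (q : Q) (n : ℤ) {z : BiPoly F ⊗[F] TotalSpace K}
    (hz : (totalExt K s hs).D z = 0) (hz' : (totalExt K s hs).D (twistAct K q z) = 0) :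
    homCohomologyRep _ _ n q (evClass hs n z hz) = evClass hs n (twistAct K q z) hz' :=
  congrArg Submodule.Quotient.mk (Subtype.ext (conjCochain_ev q n z))

end

lemma mulClass_mulClass {a n c : ℤ} (h : a + n = c) {f g : BiPoly F} (hf : hpart a f = f)
    (hg : hpart n g = g) (hfg : hpart c (f * g) = f * g) :
    homCohomologyComp h (mulClass φ n g hg) (mulClass φ a f hf) = mulClass φ c (f * g) hfg :=
  congrArg Submodule.Quotient.mk (Subtype.ext (mulCochain_comp_mulCochain hf h))

lemma mulClass_rep (q : Q) (n : ℤ) {f : BiPoly F} (hf : hpart n f = f) :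
    homCohomologyRep _ _ n q (mulClass φ n f hf) =
      mulClass φ n (polyAct φ q f) (by rw [hpart_polyAct, hf]) :=
  congrArg Submodule.Quotient.mk (Subtype.ext (conjCochain_mulCochain q n f))

lemma mulClass_one (h : hpart 0 (1 : BiPoly F) = 1) :
    mulClass φ 0 1 h = homClass (𝟙 (koszulResolution F φ)) := by
  rw [homClass_id]
  exact congrArg Submodule.Quotient.mk (Subtype.ext mulCochain_one)

variable (ε : ProjectiveResolution (Rep.trivial F (KleinFour ⋊[φ] Q) F))

/-- A homotopy equivalence between a projective resolution and the Koszul resolution. -/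
structure KoszulComparison where
  /-- the comparison map -/
  u : ε.cochainComplex ⟶ koszulResolution F φ
  /-- the inverse comparison map -/
  v : koszulResolution F φ ⟶ ε.cochainComplex
  u_v : Nonempty (Homotopy (u ≫ v) (𝟙 _))
  v_u : Nonempty (Homotopy (v ≫ u) (𝟙 _))
  quasiIso : QuasiIso (u ≫ koszulResolutionπ F φ)

lemma nonempty_koszulComparison (hQ : Odd (Nat.card Q)) : Nonempty (KoszulComparison ε) := by
  obtain ⟨u, v, h1, h2, h3⟩ := exists_homotopyEquiv_koszulResolution φ hQ ε
  exact ⟨⟨u, v, h1, h2, h3⟩⟩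

namespace KoszulComparison

variable {ε} (c : KoszulComparison ε)

lemma homClass_u_v : homCohomologyComp (φ := φ) (zero_add 0) (homClass c.v) (homClass c.u) =
    homClass (𝟙 _) := by
  rw [homClass_comp]
  exact homClass_eq_of_homotopy c.u_v.some

lemma homClass_v_u : homCohomologyComp (φ := φ) (zero_add 0) (homClass c.u) (homClass c.v) =
    homClass (𝟙 _) := by
  rw [homClass_comp]
  exact homClass_eq_of_homotopy c.v_u.some

lemma comp_u_comp_v {n : ℤ} (x : HomCohomology φ (koszulResolution F φ) K n) :
    homCohomologyComp (zero_add n) (homCohomologyComp (zero_add n) x (homClass c.u))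
      (homClass c.v) = x := by
  rw [← homCohomologyComp_assoc (zero_add 0) _ (zero_add n), homClass_v_u,
    homClass_id_homCohomologyComp]

lemma comp_v_comp_u {n : ℤ} (x : HomCohomology φ ε.cochainComplex K n) :
    homCohomologyComp (zero_add n) (homCohomologyComp (zero_add n) x (homClass c.v))
      (homClass c.u) = x := by
  rw [← homCohomologyComp_assoc (zero_add 0) _ (zero_add n), homClass_u_v,
    homClass_id_homCohomologyComp]

/-- The class in `Ext` of a polynomial. -/
def extClass (n : ℤ) (f : BiPoly F) (hf : hpart n f = f) : extRep ε ε.cochainComplex n :=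
  homCohomologyComp (add_zero n) (homClass c.v)
    (homCohomologyComp (zero_add n) (mulClass φ n f hf) (homClass c.u))

/-- The class of a polynomial is conjugated by the homotopy equivalence, and the inner composite of
its two maps is homotopic to the identity. -/
lemma comp_extClass {a n d : ℤ} (h : a + n = d)
    (x : HomCohomology φ (koszulResolution F φ) K n) {f : BiPoly F} (hf : hpart a f = f) :
    homCohomologyComp h (homCohomologyComp (zero_add n) x (homClass c.u)) (c.extClass a f hf) =
      homCohomologyComp (zero_add d) (homCohomologyComp h x (mulClass φ a f hf))
        (homClass c.u) :=
  ((homCohomologyComp_assoc (add_zero a) (zero_add n) h h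
    (homCohomologyComp (zero_add a) (mulClass φ a f hf) (homClass c.u)) (homClass c.v)
    (homCohomologyComp (zero_add n) x (homClass c.u))).trans
    (congrArg (fun y ↦ homCohomologyComp h y
      (homCohomologyComp (zero_add a) (mulClass φ a f hf) (homClass c.u))) (c.comp_u_comp_v x))).trans
    (homCohomologyComp_assoc (zero_add a) h h (zero_add d) (homClass c.u) (mulClass φ a f hf) x)

lemma extClass_eq (n : ℤ) (f : BiPoly F) (hf : hpart n f = f) : c.extClass n f hf =
    homCohomologyComp (zero_add n) (homCohomologyComp (add_zero n) (homClass c.v)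
      (mulClass φ n f hf)) (homClass c.u) :=
  homCohomologyComp_assoc (zero_add n) (add_zero n) (add_zero n) (zero_add n) (homClass c.u)
    (mulClass φ n f hf) (homClass c.v)

/-- Composition of transposed multiplications reverses the order of the factors, which is harmless
in a commutative ring. -/
lemma extClass_mul {a b d : ℤ} {f g : BiPoly F} (hf : hpart a f = f) (hg : hpart b g = g)
    (hfg : hpart d (f * g) = f * g) (h : b + a = d) :
    c.extClass d (f * g) hfg = homCohomologyComp h (c.extClass a f hf) (c.extClass b g hg) := by
  have h1 : homCohomologyComp h (homCohomologyComp (add_zero a) (homClass c.v)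
      (mulClass φ a f hf)) (mulClass φ b g hg) =
      homCohomologyComp (add_zero d) (homClass c.v) (mulClass φ d (f * g) hfg) := by
    refine (homCohomologyComp_assoc h (add_zero a) (add_zero d) h (mulClass φ b g hg)
      (mulClass φ a f hf) (homClass c.v)).symm.trans (congrArg _ ?_)
    refine (mulClass_mulClass h hg hf (by rw [mul_comm, hfg])).trans ?_
    simp only [mul_comm g f]
  exact (extClass_eq c d (f * g) hfg).trans (((congrArg (fun y ↦
    homCohomologyComp (zero_add d) y (homClass c.u)) h1).symm.trans
    (comp_extClass c h _ hg).symm).trans (congrArg (fun y ↦ homCohomologyComp h y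
      (c.extClass b g hg)) (extClass_eq c a f hf).symm))

lemma extClass_one (h : hpart 0 (1 : BiPoly F) = 1) :
    c.extClass 0 1 h = homCohomologyOne ε.cochainComplex := by
  have h1 : homCohomologyComp (zero_add 0) (mulClass φ 0 1 h) (homClass c.u) = homClass c.u := by
    rw [mulClass_one, homClass_comp, Category.comp_id]
  exact ((congrArg (homCohomologyComp (add_zero 0) (homClass c.v)) h1).trans
    c.homClass_u_v).trans homClass_id

lemma extClass_rep (q : Q) (n : ℤ) (f : BiPoly F) (hf : hpart n f = f) :
    c.extClass n (polyAct φ q f) (by rw [hpart_polyAct, hf]) =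
      (extRep ε ε.cochainComplex n).ρ q (c.extClass n f hf) := by
  have h1 := (homCohomologyRep_homCohomologyComp (zero_add n) q (mulClass φ n f hf)
    (homClass c.u)).trans (congrArg₂ (fun x y ↦ homCohomologyComp (zero_add n) x y)
      (mulClass_rep q n hf) (homCohomologyRep_homClass q c.u))
  have h2 := (homCohomologyRep_homCohomologyComp (add_zero n) q (homClass c.v)
    (homCohomologyComp (zero_add n) (mulClass φ n f hf) (homClass c.u))).trans
      (congrArg₂ (fun x y ↦ homCohomologyComp (add_zero n) x y)
        (homCohomologyRep_homClass q c.v) h1)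
  exact h2.symm

/-- The class in `Ext` of a cycle of the twisted complex. -/
def cycleClass {s : Finset ℤ} (hs : ∀ n ∉ s, Subsingleton (K.X n)) (n : ℤ)
    (z : BiPoly F ⊗[F] TotalSpace K) (hz : (totalExt K s hs).D z = 0) : extRep ε K n :=
  homCohomologyComp (zero_add n) (evClass hs n z hz) (homClass c.u)

section

variable {s : Finset ℤ} (hs : ∀ n ∉ s, Subsingleton (K.X n))

lemma exists_cycleClass_eq {n : ℤ} (x : extRep ε K n) :
    ∃ z ∈ (totalExt K s hs).total n, ∃ hz, x = c.cycleClass hs n z hz := by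
  obtain ⟨z, hz, hz', h⟩ := exists_evClass_eq hs (homCohomologyComp (zero_add n) x (homClass c.v))
  refine ⟨z, hz, hz', ?_⟩
  rw [cycleClass, ← h]
  exact (c.comp_v_comp_u x).symm

lemma cycleClass_eq_zero_iff {n : ℤ} {z : BiPoly F ⊗[F] TotalSpace K}
    (hzn : z ∈ (totalExt K s hs).total n) {hz : (totalExt K s hs).D z = 0} :
    c.cycleClass hs n z hz = 0 ↔ ∃ y, z = (totalExt K s hs).D y := by
  rw [← evClass_eq_zero_iff hs hzn (hz := hz)]
  constructor
  · intro h
    rw [← c.comp_u_comp_v (evClass hs n z hz)]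
    refine (congrArg (fun x ↦ homCohomologyComp (zero_add n) x (homClass c.v)) h).trans ?_
    change homCohomologyComp (zero_add n) (0 : HomCohomology φ ε.cochainComplex K n) _ = 0
    rw [map_zero, LinearMap.zero_apply]
  · intro h
    rw [cycleClass, h, map_zero, LinearMap.zero_apply]
    rfl

lemma cycleClass_extClass {a n d : ℤ} (h : a + n = d) {f : BiPoly F} (hf : hpart a f = f)
    {z : BiPoly F ⊗[F] TotalSpace K} (hz : (totalExt K s hs).D z = 0) :
    extMul ε h (c.cycleClass hs n z hz) (c.extClass a f hf) =
      c.cycleClass hs d (f • z) (by rw [map_smul, hz, smul_zero]) := by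
  refine (c.comp_extClass h (evClass hs n z hz) hf).trans ?_
  rw [evClass_mulClass hs h hf hz]
  rfl

lemma cycleClass_rep (q : Q) (n : ℤ) {z : BiPoly F ⊗[F] TotalSpace K}
    (hz : (totalExt K s hs).D z = 0) (hz' : (totalExt K s hs).D (twistAct K q z) = 0) :
    (extRep ε K n).ρ q (c.cycleClass hs n z hz) = c.cycleClass hs n (twistAct K q z) hz' := by
  change homCohomologyRep _ _ n q (homCohomologyComp (zero_add n) (evClass hs n z hz)
    (homClass c.u)) = _
  rw [homCohomologyRep_homCohomologyComp, homCohomologyRep_homClass, evClass_rep hs q n hz hz']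
  rfl

lemma cycleClass_smul (n : ℤ) (a : F) {z : BiPoly F ⊗[F] TotalSpace K}
    (hz : (totalExt K s hs).D z = 0) (haz : (totalExt K s hs).D (a • z) = 0) :
    c.cycleClass hs n (a • z) haz = a • c.cycleClass hs n z hz := by
  have h : evClass hs n (a • z) haz = a • evClass hs n z hz :=
    congrArg Submodule.Quotient.mk (Subtype.ext (ev_smul n a z))
  rw [cycleClass, h, map_smul, LinearMap.smul_apply]
  rfl

lemma cycleClass_add (n : ℤ) {z z' : BiPoly F ⊗[F] TotalSpace K}
    (hz : (totalExt K s hs).D z = 0) (hz' : (totalExt K s hs).D z' = 0)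
    (h : (totalExt K s hs).D (z + z') = 0) :
    c.cycleClass hs n (z + z') h = c.cycleClass hs n z hz + c.cycleClass hs n z' hz' := by
  have h : evClass hs n (z + z') h = evClass hs n z hz + evClass hs n z' hz' :=
    congrArg Submodule.Quotient.mk (Subtype.ext (ev_add n z z'))
  rw [cycleClass, h, map_add, LinearMap.add_apply]
  rfl

end

end KoszulComparison

end Classes
end

/-! ### The ring isomorphism from the twisted complex of the trivial module -/

noncomputable section

open scoped TensorProduct DirectSum
open KleinFour (gen coord)
open MvPolynomial (X C constantCoeff)

section RingIso

variable {F : Type u} [Field F] {Q : Type u} [Group Q] {φ : Q →* MulAut KleinFour}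

variable (F φ) in
/-- The trivial module as a complex concentrated in degree zero. -/
abbrev trivialComplex : CochainComplex (Rep.{u} F (KleinFour ⋊[φ] Q)) ℤ :=
  (CochainComplex.singleFunctor (Rep.{u} F (KleinFour ⋊[φ] Q)) 0).obj
    (Rep.trivial F (KleinFour ⋊[φ] Q) F)

lemma subsingleton_trivialComplex (n : ℤ) (hn : n ∉ ({0} : Finset ℤ)) :
    Subsingleton ((trivialComplex F φ).X n) :=
  subsingleton_single_X _ (by simpa using hn)

variable (F φ) in
/-- The unit of the trivial module in the total space of the trivial complex. -/
def trivialUnit : TotalSpace (trivialComplex F φ) :=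
  DirectSum.lof F ℤ (fun n ↦ ((trivialComplex F φ).X n : Type u)) 0
    ((singleZeroIso (Rep.trivial F (KleinFour ⋊[φ] Q) F)).inv.hom (1 : F))

lemma singleZeroIso_hom_inv (a : F) :
    (singleZeroIso (Rep.trivial F (KleinFour ⋊[φ] Q) F)).hom.hom
      ((singleZeroIso (Rep.trivial F (KleinFour ⋊[φ] Q) F)).inv.hom a) = a :=
  congrArg (fun g : Rep.trivial F (KleinFour ⋊[φ] Q) F ⟶ _ ↦ g.hom a)
    (singleZeroIso (Rep.trivial F (KleinFour ⋊[φ] Q) F)).inv_hom_id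

lemma singleZeroIso_hom_smul_inv (a : F) :
    (singleZeroIso (Rep.trivial F (KleinFour ⋊[φ] Q) F)).hom.hom
      (a • (singleZeroIso (Rep.trivial F (KleinFour ⋊[φ] Q) F)).inv.hom (1 : F)) = a :=
  ((map_smul (singleZeroIso (Rep.trivial F (KleinFour ⋊[φ] Q) F)).hom.hom a _).trans
    (congrArg (a • ·) (singleZeroIso_hom_inv (1 : F)))).trans (mul_one a)

lemma trivialComplex_zero_eq (x : (trivialComplex F φ).X 0) :
    ∃ a : F, x = a • (singleZeroIso (Rep.trivial F (KleinFour ⋊[φ] Q) F)).inv.hom (1 : F) := by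
  refine ⟨(singleZeroIso (Rep.trivial F (KleinFour ⋊[φ] Q) F)).hom.hom x,
    singleZeroIso_hom_injective _ ?_⟩
  exact (singleZeroIso_hom_smul_inv _).symm

lemma eq_zero_of_tmul_trivialUnit {f : BiPoly F} (h : f ⊗ₜ[F] trivialUnit F φ = 0) : f = 0 := by
  refine MvPolynomial.ext _ _ fun m ↦ ?_
  have h1 := congrArg (contract (MvPolynomial.lcoeff F m)) h
  rw [contract_tmul, map_zero] at h1
  have h2 : (f.coeff m • trivialUnit F φ) 0 = 0 := congrArg (fun a : TotalSpace _ ↦ a 0) h1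
  rw [trivialUnit, ← map_smul] at h2
  have h3 := (DirectSum.component.lof_self (R := F) (ι := ℤ)
    (M := fun n ↦ ((trivialComplex F φ).X n : Type u)) 0 _).symm.trans h2
  have h4 := congrArg (singleZeroIso (Rep.trivial F (KleinFour ⋊[φ] Q) F)).hom.hom h3
  exact (singleZeroIso_hom_smul_inv _).symm.trans (h4.trans (map_zero _))

variable [CharP F 2]

/-- Each `wᵢ` is a sum of two group elements, so it acts on the trivial module as `1 + 1 = 0`. Hence
the twisted homology is the whole polynomial ring. -/
lemma totalExt_trivialComplex_D (v : BiPoly F ⊗[F] TotalSpace (trivialComplex F φ)) :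
    (totalExt (trivialComplex F φ) {0} subsingleton_trivialComplex).D v = 0 := by
  have hd : totalD (trivialComplex F φ) = 0 := total_ext fun n x ↦ by
    rw [totalD_lof, single_d_apply, map_zero]; rfl
  have hw : ∀ i, totalW (trivialComplex F φ) i = 0 := fun i ↦ total_ext fun n x ↦ by
    rw [totalW_lof]
    by_cases hn : n = 0
    · subst hn
      have h : extGen (repP ((trivialComplex F φ).X 0).ρ) i x = 0 := by
        refine singleZeroIso_hom_injective _ ?_
        rw [hom_extGen]
        exact (add_self_of_charTwo F _).trans (map_zero _).symm
      rw [h, map_zero]; rfl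
    · have := subsingleton_single_X (Rep.trivial F (KleinFour ⋊[φ] Q) F) hn
      rw [Subsingleton.elim x 0]
      simp
  induction v using TensorProduct.induction_on with
  | zero => exact map_zero _
  | tmul p a =>
    rw [ExteriorComplex.D_tmul]
    change p ⊗ₜ[F] totalD _ a + (_ ⊗ₜ[F] totalW _ 0 a + _ ⊗ₜ[F] totalW _ 1 a) = 0
    rw [hd, hw, hw]
    simp
  | add x y hx hy => rw [map_add, hx, hy, add_zero]

lemma gradedProj_trivialUnit :
    (totalExt (trivialComplex F φ) {0} subsingleton_trivialComplex).pr 0 (trivialUnit F φ) =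
      trivialUnit F φ :=
  (gradedProj_lof _ _ _).trans (if_pos rfl)

lemma tmul_trivialUnit_mem_total {n : ℤ} {f : BiPoly F} (hf : hpart n f = f) :
    f ⊗ₜ[F] trivialUnit F φ ∈
      (totalExt (trivialComplex F φ) {0} subsingleton_trivialComplex).total n := by
  have := ExteriorComplex.tmul_mem_total hf (gradedProj_trivialUnit (F := F) (φ := φ))
  rwa [add_zero] at this

lemma exists_eq_tmul_trivialUnit {n : ℤ} {v : BiPoly F ⊗[F] TotalSpace (trivialComplex F φ)}
    (hv : v ∈ (totalExt (trivialComplex F φ) {0} subsingleton_trivialComplex).total n) :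
    ∃ f : BiPoly F, hpart n f = f ∧ v = f ⊗ₜ[F] trivialUnit F φ := by
  induction hv using Submodule.span_induction with
  | mem v hv =>
    obtain ⟨j, p, a, hp, ha, rfl⟩ := hv
    have ha' := eq_lof_of_gradedProj ha
    by_cases h : n - j = 0
    · obtain rfl : n = j := by lia
      rw [h] at ha'
      obtain ⟨c, hc⟩ := trivialComplex_zero_eq (a 0)
      refine ⟨c • p, by rw [map_smul, hp], ?_⟩
      rw [TensorProduct.smul_tmul, trivialUnit, ← map_smul, ← hc, ← ha']
    · have := subsingleton_single_X (Rep.trivial F (KleinFour ⋊[φ] Q) F) h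
      refine ⟨0, map_zero _, ?_⟩
      rw [ha', Subsingleton.elim (a (n - j)) 0, map_zero, TensorProduct.tmul_zero,
        TensorProduct.zero_tmul]
  | zero => exact ⟨0, map_zero _, (TensorProduct.zero_tmul _ _).symm⟩
  | add x y _ _ hx hy =>
    obtain ⟨f, hf, rfl⟩ := hx
    obtain ⟨g, hg, rfl⟩ := hy
    exact ⟨f + g, by rw [map_add, hf, hg], (TensorProduct.add_tmul _ _ _).symm⟩
  | smul c x _ hx =>
    obtain ⟨f, hf, rfl⟩ := hx
    exact ⟨c • f, by rw [map_smul, hf], rfl⟩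

lemma ev_trivialUnit : ev (φ := φ) 0 ((1 : BiPoly F) ⊗ₜ[F] trivialUnit F φ) =
    Cochain.ofHom (resPMap φ (koszulResolutionπ F φ)) := by
  refine cochain_koszulResolution_ext fun i j hij b ↦ ?_
  obtain rfl : i = j := by lia
  refine (ev_v_single 0 _ i i hij b).trans ?_
  rw [contract_tmul]
  by_cases hi : i = 0
  · subst hi
    refine singleZeroIso_hom_injective (Rep.trivial F (KleinFour ⋊[φ] Q) F) ?_
    refine Eq.trans ?_ (singleZeroIso_koszulResolutionπ φ (Pi.single 1 b)).symm
    rw [trivialUnit, ← map_smul]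
    refine (congrArg _ (DirectSum.component.lof_self (R := F) (ι := ℤ)
      (M := fun n ↦ ((trivialComplex F φ).X n : Type u)) 0 _)).trans ?_
    refine (singleZeroIso_hom_smul_inv _).trans ?_
    rw [koszulAug_apply, Finset.sum_eq_single 1]
    · rw [Pi.single_eq_same]
    · intro p _ hp
      rw [Pi.single_eq_of_ne hp]
      rfl
    · simp
  · have := subsingleton_single_X (Rep.trivial F (KleinFour ⋊[φ] Q) F) hi
    exact Subsingleton.elim (α := (trivialComplex F φ).X i) _ _

variable (φ) in
/-- The linear map that sends a homogeneous polynomial to the class of its action on the Koszul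
resolution. -/
def mulClassLin (n : ℕ) : MvPolynomial.homogeneousSubmodule (Fin 2) F n →ₗ[F]
    HomCohomology φ (koszulResolution F φ) (koszulResolution F φ) n where
  toFun f := mulClass φ n f.1 (isHomogeneous_iff_hpart.1 f.2)
  map_add' f g := congrArg Submodule.Quotient.mk (Subtype.ext (mulCochain_add n f.1 g.1))
  map_smul' a f := congrArg Submodule.Quotient.mk (Subtype.ext (mulCochain_smul n a f.1))

variable {ε : ProjectiveResolution (Rep.trivial F (KleinFour ⋊[φ] Q) F)}

namespace KoszulComparison

variable (c : KoszulComparison ε)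

/-- Composition with the augmentation identifies the endomorphism Ext of the resolution with the
twisted homology of the trivial module, where the class of `f` is `f ⊗ 1`. Bijectivity of the ring
isomorphism is read off there. -/
lemma homClass_u_π_extClass (n : ℤ) (f : BiPoly F) (hf : hpart n f = f) :
    homCohomologyComp (add_zero n) (homClass (c.u ≫ koszulResolutionπ F φ)) (c.extClass n f hf) =
      c.cycleClass subsingleton_trivialComplex n (f ⊗ₜ[F] trivialUnit F φ)
        (totalExt_trivialComplex_D _) := by
  have hπ : homClass (φ := φ) (koszulResolutionπ F φ) = evClass subsingleton_trivialComplex 0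
      ((1 : BiPoly F) ⊗ₜ[F] trivialUnit F φ) (totalExt_trivialComplex_D _) :=
    congrArg Submodule.Quotient.mk (Subtype.ext ev_trivialUnit.symm)
  have h1 : homCohomologyComp (φ := φ) (zero_add 0) (homClass (c.u ≫ koszulResolutionπ F φ))
      (homClass c.v) = homClass (koszulResolutionπ F φ) := by
    rw [homClass_comp, ← Category.assoc]
    refine (homClass_eq_of_homotopy (c.v_u.some.compRight _)).trans ?_
    rw [Category.id_comp]
  refine (homCohomologyComp_assoc (add_zero n) (zero_add 0) (add_zero n) (add_zero n)
    (homCohomologyComp (zero_add n) (mulClass φ n f hf) (homClass c.u)) (homClass c.v)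
    (homClass (c.u ≫ koszulResolutionπ F φ))).trans ?_
  refine (congrArg (fun y ↦ homCohomologyComp (add_zero n) y
    (homCohomologyComp (zero_add n) (mulClass φ n f hf) (homClass c.u))) h1).trans ?_
  refine (homCohomologyComp_assoc (zero_add n) (add_zero n) (add_zero n) (zero_add n)
    (homClass c.u) (mulClass φ n f hf) (homClass (koszulResolutionπ F φ))).trans ?_
  refine congrArg (fun y ↦ homCohomologyComp (zero_add n) y (homClass c.u)) ?_
  rw [hπ]
  refine (evClass_mulClass subsingleton_trivialComplex (add_zero n) hf _).trans ?_
  simp only [TensorProduct.smul_tmul', smul_eq_mul, mul_one]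

lemma bijective_homClass_u_π (n : ℤ) :
    Function.Bijective (homCohomologyComp (φ := φ) (K := ε.cochainComplex) (add_zero n)
      (homClass (c.u ≫ koszulResolutionπ F φ))) := by
  have := c.quasiIso
  have : (resP φ ε.cochainComplex).IsKProjective := isKProjective_resP φ _ 0 fun n ↦ inferInstance
  have := quasiIso_resPMap (φ := φ) (c.u ≫ koszulResolutionπ F φ)
  exact bijective_homClass_homCohomologyComp _ n

/-- The linear map that sends a homogeneous polynomial to its class in `Ext`. -/
def extClassLin (n : ℕ) : MvPolynomial.homogeneousSubmodule (Fin 2) F n →ₗ[F]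
    HomCohomology φ ε.cochainComplex ε.cochainComplex n :=
  homCohomologyComp (add_zero (n : ℤ)) (homClass c.v) ∘ₗ
    (homCohomologyComp (zero_add (n : ℤ))).flip (homClass c.u) ∘ₗ mulClassLin φ n

lemma extClassLin_apply (n : ℕ) (f : MvPolynomial.homogeneousSubmodule (Fin 2) F n) :
    c.extClassLin n f = c.extClass n f.1 (isHomogeneous_iff_hpart.1 f.2) := rfl

lemma exists_extClass_eq (n : ℤ) (x : extRep ε ε.cochainComplex n) :
    ∃ f hf, x = c.extClass n f hf := by
  obtain ⟨z, hz, hz', h⟩ := c.exists_cycleClass_eq subsingleton_trivialComplex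
    (homCohomologyComp (add_zero n) (homClass (c.u ≫ koszulResolutionπ F φ)) x)
  obtain ⟨f, hf, rfl⟩ := exists_eq_tmul_trivialUnit hz
  exact ⟨f, hf, (c.bijective_homClass_u_π n).1 (h.trans (c.homClass_u_π_extClass n f hf).symm)⟩

lemma bijective_extClassLin (n : ℕ) : Function.Bijective (c.extClassLin n) := by
  refine ⟨(injective_iff_map_eq_zero _).2 fun f hf ↦ ?_, fun x ↦ ?_⟩
  · have h := c.homClass_u_π_extClass n f.1 (isHomogeneous_iff_hpart.1 f.2)
    have h2 : c.extClass n f.1 (isHomogeneous_iff_hpart.1 f.2) = 0 := (c.extClassLin_apply n f).symm.trans hf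
    have h3 := h.symm.trans ((congrArg _ h2).trans (map_zero _))
    obtain ⟨y, hy⟩ := (c.cycleClass_eq_zero_iff subsingleton_trivialComplex
      (tmul_trivialUnit_mem_total (isHomogeneous_iff_hpart.1 f.2))).1 h3
    exact Subtype.ext (eq_zero_of_tmul_trivialUnit (hy.trans (totalExt_trivialComplex_D y)))
  · obtain ⟨f, hf, rfl⟩ := c.exists_extClass_eq n x
    exact ⟨⟨f, isHomogeneous_iff_hpart.2 hf⟩, c.extClassLin_apply n _⟩

/-- The isomorphism of the polynomial ring with `Ext` given by a comparison with the Koszul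
resolution. -/
def cohomologyRingIso : CohomologyRingIso ε where
  toExt n := LinearEquiv.ofBijective (c.extClassLin n) (c.bijective_extClassLin n)
  subsingleton_of_neg n hn := by
    have h : ∀ x : extRep ε ε.cochainComplex n, x = 0 := fun x ↦ by
      obtain ⟨f, hf, rfl⟩ := c.exists_extClass_eq n x
      obtain rfl : f = 0 := hf.symm.trans (hpart_of_neg hn f)
      refine (c.bijective_homClass_u_π n).1 ?_
      refine (c.homClass_u_π_extClass n 0 hf).trans (Eq.trans ?_ (map_zero _).symm)
      refine (c.cycleClass_eq_zero_iff subsingleton_trivialComplex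
        (tmul_trivialUnit_mem_total hf)).2 ⟨0, ?_⟩
      rw [TensorProduct.zero_tmul, map_zero]
    exact ⟨fun x y ↦ (h x).trans (h y).symm⟩
  map_one := c.extClass_one (isHomogeneous_iff_hpart.1 (MvPolynomial.isHomogeneous_one _ _))
  map_mul a b f g := c.extClass_mul (isHomogeneous_iff_hpart.1 f.2)
    (isHomogeneous_iff_hpart.1 g.2) (isHomogeneous_iff_hpart.1
      (MvPolynomial.IsHomogeneous.mul f.2 g.2)) (by push_cast; ring)
  map_act q n f := c.extClass_rep q n f.1 (isHomogeneous_iff_hpart.1 f.2)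

end KoszulComparison

end RingIso
end

/-! ### Equivariance of the comparison with a cyclic module -/

noncomputable section

open scoped TensorProduct DirectSum
open KleinFour (gen coord)
open MvPolynomial (X C constantCoeff)

section TwistAct

variable {F : Type u} [Field F] {Q : Type u} [Group Q] {φ : Q →* MulAut KleinFour}

lemma extGen_inr [CharP F 2] (Y : Rep.{u} F (KleinFour ⋊[φ] Q)) (q : Q) (k : Fin 2) (y : Y) :
    extGen (repP Y.ρ) k (Y.ρ (SemidirectProduct.inr q) y) = Y.ρ (SemidirectProduct.inr q)
      (∑ i, ((coord i (φ q⁻¹ (gen k))).cast : F) • extGen (repP Y.ρ) i y) := by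
  have h : ∀ p, Y.ρ (SemidirectProduct.inl p) (Y.ρ (SemidirectProduct.inr q) y) =
      Y.ρ (SemidirectProduct.inr q) (Y.ρ (SemidirectProduct.inl (φ q⁻¹ p)) y) := fun p ↦ by
    rw [← Module.End.mul_apply, ← Module.End.mul_apply, ← map_mul, ← map_mul]
    congr 2
    refine SemidirectProduct.ext ?_ ?_
    · simp
    · simp
  have h2 := LinearMap.congr_fun (extGen_conj (repP Y.ρ) (φ q⁻¹) k) y
  rw [LinearMap.add_apply, LinearMap.sum_apply] at h2
  simp only [LinearMap.smul_apply] at h2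
  rw [← h2, extGen_apply, map_add]
  exact congrArg₂ (· + ·) (h _) (h _)

variable (K : CochainComplex (Rep.{u} F (KleinFour ⋊[φ] Q)) ℤ)

/-- The action of `Q` on the total space. -/
abbrev totalAct (q : Q) : Module.End F (TotalSpace K) :=
  gradedMap fun n ↦ (K.X n).ρ (SemidirectProduct.inr q)

lemma twistAct_tmul (q : Q) (s : BiPoly F) (a : TotalSpace K) :
    twistAct K q (s ⊗ₜ[F] a) = polyAct φ q s ⊗ₜ[F] totalAct K q a := rfl

lemma totalAct_mul (q r : Q) (a : TotalSpace K) :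
    totalAct K (q * r) a = totalAct K q (totalAct K r a) := by
  refine LinearMap.congr_fun (f := totalAct K (q * r)) (g := totalAct K q ∘ₗ totalAct K r)
    (total_ext fun n x ↦ ?_) a
  rw [LinearMap.comp_apply, gradedMap_lof, gradedMap_lof, gradedMap_lof, map_mul, map_mul]
  rfl

lemma totalAct_one (a : TotalSpace K) : totalAct K 1 a = a := by
  refine LinearMap.congr_fun (f := totalAct K 1) (g := LinearMap.id) (total_ext fun n x ↦ ?_) a
  rw [gradedMap_lof, map_one, map_one]
  rfl

lemma twistAct_smul (q : Q) (f : BiPoly F) (v : BiPoly F ⊗[F] TotalSpace K) :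
    twistAct K q (f • v) = polyAct φ q f • twistAct K q v := by
  induction v using TensorProduct.induction_on with
  | zero => simp
  | tmul s a =>
    rw [TensorProduct.smul_tmul', twistAct_tmul, twistAct_tmul, TensorProduct.smul_tmul',
      smul_eq_mul, smul_eq_mul, map_mul]
  | add x y hx hy => simp only [map_add, smul_add, hx, hy]

lemma totalD_totalAct (q : Q) (a : TotalSpace K) :
    totalD K (totalAct K q a) = totalAct K q (totalD K a) := by
  refine LinearMap.congr_fun (f := totalD K ∘ₗ totalAct K q) (g := totalAct K q ∘ₗ totalD K)
    (total_ext fun n x ↦ ?_) a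
  rw [LinearMap.comp_apply, LinearMap.comp_apply, gradedMap_lof, totalD_lof, totalD_lof,
    gradedMap_lof]
  exact congrArg _ (Rep.hom_comm_apply (K.d n (n + 1)) _ x)

variable [CharP F 2] {s : Finset ℤ} (hs : ∀ n ∉ s, Subsingleton (K.X n))

lemma twistAct_mul (q r : Q) (v : BiPoly F ⊗[F] TotalSpace K) :
    twistAct K (q * r) v = twistAct K q (twistAct K r v) := by
  induction v using TensorProduct.induction_on with
  | zero => simp
  | tmul s a => rw [twistAct_tmul, twistAct_tmul, twistAct_tmul, totalAct_mul, polyAct_mul]; rfl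
  | add x y hx hy => simp only [map_add, hx, hy]

lemma twistAct_one (v : BiPoly F ⊗[F] TotalSpace K) : twistAct K 1 v = v := by
  induction v using TensorProduct.induction_on with
  | zero => simp
  | tmul s a => rw [twistAct_tmul, totalAct_one, polyAct_one]; rfl
  | add x y hx hy => simp only [map_add, hx, hy]

lemma twistAct_mem_total (q : Q) {n : ℤ} {v : BiPoly F ⊗[F] TotalSpace K}
    (hv : v ∈ (totalExt K s hs).total n) : twistAct K q v ∈ (totalExt K s hs).total n := by
  induction hv using Submodule.span_induction with
  | mem v hv =>
    obtain ⟨j, p, a, hp, ha, rfl⟩ := hv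
    rw [twistAct_tmul]
    have := ExteriorComplex.tmul_mem_total (T := totalExt K s hs) (j := j) (n := n - j)
      (s := polyAct φ q p) (a := totalAct K q a) (by rw [hpart_polyAct, hp])
      ((gradedMap_gradedProj _ (n - j) a).symm.trans (congrArg (totalAct K q) ha))
    rwa [add_sub_cancel] at this
  | zero => rw [map_zero]; exact zero_mem _
  | add x y _ _ hx hy => rw [map_add]; exact add_mem hx hy
  | smul c x _ hx => rw [map_smul]; exact Submodule.smul_mem _ c hx

lemma totalW_totalAct (q : Q) (k : Fin 2) (a : TotalSpace K) :
    totalW K k (totalAct K q a) = totalAct K q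
      (∑ i, ((coord i (φ q⁻¹ (gen k))).cast : F) • totalW K i a) := by
  refine LinearMap.congr_fun (f := totalW K k ∘ₗ totalAct K q) (g := totalAct K q ∘ₗ
    ∑ i, ((coord i (φ q⁻¹ (gen k))).cast : F) • totalW K i) (total_ext fun n x ↦ ?_) a |>.trans ?_
  · rw [LinearMap.comp_apply, LinearMap.comp_apply, gradedMap_lof, totalW_lof, extGen_inr,
      LinearMap.sum_apply]
    simp only [LinearMap.smul_apply, totalW_lof, ← map_smul, ← map_sum]
    rw [gradedMap_lof]
  · simp

/-- Invariance of `Σ xᵢ ⊗ wᵢ`: the matrices by which `q` changes the variables and the generators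
are transposes of each other. -/
lemma D_twistAct (q : Q) (v : BiPoly F ⊗[F] TotalSpace K) :
    (totalExt K s hs).D (twistAct K q v) = twistAct K q ((totalExt K s hs).D v) := by
  induction v using TensorProduct.induction_on with
  | zero => simp
  | tmul p a =>
    rw [twistAct_tmul, ExteriorComplex.D_tmul, ExteriorComplex.D_tmul]
    change _ ⊗ₜ[F] totalD K (totalAct K q a) + (_ ⊗ₜ[F] totalW K 0 (totalAct K q a) +
      _ ⊗ₜ[F] totalW K 1 (totalAct K q a)) = twistAct K q (p ⊗ₜ[F] totalD K a +
        (_ ⊗ₜ[F] totalW K 0 a + _ ⊗ₜ[F] totalW K 1 a))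
    rw [totalD_totalAct, totalW_totalAct, totalW_totalAct, map_add, map_add, twistAct_tmul,
      twistAct_tmul, twistAct_tmul, map_mul, map_mul, polyAct_X, polyAct_X]
    simp only [Fin.sum_univ_two, map_add, map_smul, TensorProduct.tmul_add, add_mul,
      TensorProduct.add_tmul, TensorProduct.tmul_smul, MvPolynomial.C_mul', smul_mul_assoc,
      TensorProduct.smul_tmul']
    abel
  | add x y hx hy => simp only [map_add, hx, hy]

end TwistAct

section

variable {F : Type u} [Field F]

lemma IsParameterIdeal.constantCoeff_eq_zero {J : Ideal (BiPoly F)} (hJ : IsParameterIdeal J)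
    {f : BiPoly F} (hf : f ∈ J) : constantCoeff f = 0 := by
  obtain ⟨⟨g, h, a, b, ha, hb, hg, hh, rfl⟩, _⟩ := hJ
  obtain ⟨x, y, rfl⟩ := Ideal.mem_span_pair.1 hf
  rw [map_add, map_mul, map_mul, constantCoeff_of_isHomogeneous ha hg,
    constantCoeff_of_isHomogeneous hb hh, mul_zero, mul_zero, add_zero]

namespace ExteriorComplex.CyclicComparison

variable {A : Type*} [AddCommGroup A] [Module F A] {T : ExteriorComplex F A} {l : ℤ}
  {J : Ideal (BiPoly F)}

lemma exists_eq_smul_add (c : T.CyclicComparison l J) {z : BiPoly F ⊗[F] A} (hz : T.D z = 0) (hz1 : polyExt c.ψ z = 1)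
    {v : BiPoly F ⊗[F] A} (hv : T.D v = 0) : ∃ y, v = polyExt c.ψ v • z + T.D y := by
  obtain ⟨y, hy⟩ := c.exists_eq_D (v - polyExt c.ψ v • z)
    (by rw [map_sub, map_smul, hv, hz, smul_zero, sub_zero])
    (by rw [map_sub, map_smul, hz1, smul_eq_mul, mul_one, sub_self]; exact zero_mem _)
  exact ⟨y, by rw [← hy, add_sub_cancel]⟩

lemma smul_eq_D (c : T.CyclicComparison l J) {z : BiPoly F ⊗[F] A} (hz : T.D z = 0) {f : BiPoly F} (hf : f ∈ J) :
    ∃ y, f • z = T.D y :=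
  c.exists_eq_D _ (by rw [map_smul, hz, smul_zero])
    (by rw [map_smul, smul_eq_mul]; exact J.mul_mem_right _ hf)

end ExteriorComplex.CyclicComparison

end

section EquivariantComparison

open ExteriorComplex

variable {F : Type u} [Field F] [CharP F 2] {Q : Type u} [Group Q] {φ : Q →* MulAut KleinFour}
variable (K : CochainComplex (Rep.{u} F (KleinFour ⋊[φ] Q)) ℤ)
variable {s : Finset ℤ} (hs : ∀ n ∉ s, Subsingleton (K.X n))

/-- A `Q`-equivariant comparison of the homology of a twisted complex with a cyclic module
`F[x₀, x₁] / J` placed in degree `l` and twisted by a character. -/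
structure EquivariantComparison (l : ℤ) (χ : Q →* F) (J : Ideal (BiPoly F)) extends
    (totalExt K s hs).CyclicComparison l J where
  ψ_act (q : Q) (a : TotalSpace K) : ψ (totalAct K q a) = χ q • polyAct φ q (ψ a)
  polyAct_mem (q : Q) (f : BiPoly F) (hf : f ∈ J) : polyAct φ q f ∈ J

variable {K hs}

lemma EquivariantComparison.polyExt_twistAct {l : ℤ} {χ : Q →* F} {J : Ideal (BiPoly F)}
    (e : EquivariantComparison K hs l χ J) (q : Q) (v : BiPoly F ⊗[F] TotalSpace K) :
    ExteriorComplex.polyExt e.ψ (twistAct K q v) =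
      χ q • polyAct φ q (ExteriorComplex.polyExt e.ψ v) := by
  induction v using TensorProduct.induction_on with
  | zero => simp
  | tmul f a =>
    rw [twistAct_tmul, ExteriorComplex.polyExt_tmul, ExteriorComplex.polyExt_tmul, e.ψ_act,
      map_mul, mul_smul_comm]
  | add x y hx hy => rw [map_add, map_add, hx, hy, map_add, map_add, smul_add]

-- The degree `l` twisted homology is spanned by the class of one cycle `z`, so `Q` acts on it by a
-- character `χ`. As the annihilator of that class, `J` is invariant, and the `χ`-twisted average of
-- `ψ` over `Q` is an equivariant comparison.
set_option maxHeartbeats 1000000 in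
theorem exists_equivariantComparison {l : ℤ} {J : Ideal (BiPoly F)} (hJ : IsParameterIdeal J)
    (hQ : Odd (Nat.card Q)) (c : (totalExt K s hs).CyclicComparison l J) :
    ∃ χ : Q →* F, Nonempty (EquivariantComparison K hs l χ J) := by
  have : Finite Q := Nat.finite_of_card_ne_zero fun h ↦ by simp [h] at hQ
  have := Fintype.ofFinite Q
  obtain ⟨z, hzl, hz, hz1⟩ := c.exists_gen
  set τ := twistAct K with hτ
  set p := polyExt c.ψ with hp
  have hτz : ∀ q, (totalExt K s hs).D (τ q z) = 0 := fun q ↦ by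
    rw [hτ, D_twistAct, hz, map_zero]
  -- The image of a translate of `z` has polynomial degree `l - l = 0`, so it is a constant: this is
  -- the character value.
  have hpτ : ∀ q, p (τ q z) = C (constantCoeff (p (τ q z))) := fun q ↦ by
    have h := ExteriorComplex.polyExt_mem_hpart c.hpart_ψ (twistAct_mem_total K hs q hzl)
    rw [sub_self, ← Nat.cast_zero, hpart_natCast, MvPolynomial.homogeneousComponent_zero] at h
    exact h.symm
  have key : ∀ q, ∃ y, τ q z = C (constantCoeff (p (τ q z))) • z + (totalExt K s hs).D y :=
    fun q ↦ by
      obtain ⟨y, hy⟩ := c.exists_eq_smul_add hz hz1 (hτz q)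
      exact ⟨y, by rw [← hpτ]; exact hy⟩
  have hpD : ∀ v, constantCoeff (p ((totalExt K s hs).D v)) = 0 := fun v ↦
    hJ.constantCoeff_eq_zero (c.ψ_D v)
  have hC : ∀ (q : Q) (a : F), polyAct φ q (C a : BiPoly F) = C a := fun q a ↦
    (polyAct φ q).commutes a
  let χ : Q →* F :=
    { toFun := fun q ↦ constantCoeff (p (τ q z))
      map_one' := by rw [hτ, twistAct_one, hp, hz1, map_one]
      map_mul' := fun q r ↦ by
        obtain ⟨y, hy⟩ := key r
        conv_lhs => rw [hτ, twistAct_mul, ← hτ, hy, map_add]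
        rw [hτ, twistAct_smul, ← D_twistAct, hC, map_add, map_smul, map_add, hpD, add_zero,
          smul_eq_mul, map_mul, MvPolynomial.constantCoeff_C, mul_comm] }
  have hχ : ∀ q, p (τ q z) = C (χ q) := hpτ
  have hχχ : ∀ q, χ q * χ q⁻¹ = 1 := fun q ↦ by rw [← map_mul, mul_inv_cancel, map_one]
  -- If `f` kills the class of `z`, then the translate of `f` kills the class of the translate of
  -- `z`, which is a unit multiple of the class of `z`.
  have hinv : ∀ q, ∀ f ∈ J, polyAct φ q f ∈ J := fun q f hf ↦ by
    obtain ⟨y, hy⟩ := c.smul_eq_D hz hf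
    have h1 := congrArg (fun v ↦ p (τ q v)) hy
    simp only [hτ] at h1
    rw [twistAct_smul, ← D_twistAct, map_smul, ← hτ, hχ] at h1
    have h2 : polyAct φ q f • C (χ q) ∈ J := h1 ▸ c.ψ_D _
    have h3 := J.mul_mem_right (C (χ q⁻¹)) h2
    rwa [smul_eq_mul, mul_assoc, ← map_mul, hχχ, map_one, mul_one] at h3
  -- Each summand sends `z` to `1`, and the number of summands is odd, so the average is still
  -- normalised on `z`.
  let ψ : TotalSpace K →ₗ[F] BiPoly F :=
    ∑ q, χ q • ((polyAct φ q).toLinearMap ∘ₗ c.ψ ∘ₗ totalAct K q⁻¹)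
  have hψ : ∀ a, ψ a = ∑ q, χ q • polyAct φ q (c.ψ (totalAct K q⁻¹ a)) := fun a ↦ by
    simp only [ψ, LinearMap.sum_apply, LinearMap.smul_apply]
    rfl
  have hψ' : ∀ v, polyExt ψ v = ∑ q, χ q • polyAct φ q (p (τ q⁻¹ v)) := fun v ↦ by
    induction v using TensorProduct.induction_on with
    | zero => simp
    | tmul f a =>
      simp only [hp, hτ, twistAct_tmul, ExteriorComplex.polyExt_tmul, map_mul,
        polyAct_polyAct_inv, hψ, Finset.mul_sum, mul_smul_comm]
    | add x y hx hy => simp only [map_add, hx, hy, smul_add, Finset.sum_add_distrib]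
  have hψD : ∀ v, polyExt ψ ((totalExt K s hs).D v) ∈ J := fun v ↦ by
    rw [hψ']
    refine Submodule.sum_mem _ fun q _ ↦ Submodule.smul_of_tower_mem _ _ (hinv q _ ?_)
    rw [hτ, ← D_twistAct]
    exact c.ψ_D _
  have hψz : polyExt ψ z = 1 := by
    rw [hψ']
    have h1 : ∀ q, χ q • polyAct φ q (p (τ q⁻¹ z)) = 1 := fun q ↦ by
      rw [hχ, hC, MvPolynomial.smul_eq_C_mul, ← map_mul, hχχ, map_one]
    rw [Finset.sum_congr rfl fun q _ ↦ h1 q, Finset.sum_const, Finset.card_univ, nsmul_eq_mul,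
      mul_one, ← Nat.card_eq_fintype_card]
    have : CharP (BiPoly F) 2 := inferInstance
    obtain ⟨k, hk⟩ := hQ
    rw [hk, Nat.cast_add, Nat.cast_mul, CharP.cast_eq_zero, zero_mul, zero_add, Nat.cast_one]
  refine ⟨χ, ⟨⟨⟨ψ, fun m a ha ↦ ?_, hψD, ⟨z, hzl, hz, hψz⟩, fun v hv hvJ ↦ ?_, c.exists_homology,
    c.le_of_homology⟩, fun q a ↦ ?_, hinv⟩⟩⟩
  · rw [hψ, map_sum]
    refine Finset.sum_congr rfl fun q _ ↦ ?_
    rw [map_smul, hpart_polyAct, c.hpart_ψ]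
    exact (gradedMap_gradedProj _ m a).symm.trans (congrArg (totalAct K q⁻¹) ha)
  · obtain ⟨y, hy⟩ := c.exists_eq_smul_add hz hz1 hv
    rw [hy, map_add, map_smul, hψz, smul_eq_mul, mul_one] at hvJ
    exact c.exists_eq_D v hv ((Ideal.add_mem_iff_left _ (hψD y)).1 hvJ)
  · simp only [hψ, Finset.smul_sum, map_sum, map_smul]
    refine Fintype.sum_equiv (Equiv.mulLeft q⁻¹) _ _ fun r ↦ ?_
    rw [Equiv.coe_mulLeft, ← totalAct_mul, mul_inv_rev, inv_inv, smul_smul, ← map_mul,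
      mul_inv_cancel_left, ← AlgHom.comp_apply, ← polyAct_mul, mul_inv_cancel_left]

end EquivariantComparison
end

/-! ### Strictly perfect complexes; socles of quotients by parameter ideals -/

noncomputable section

open scoped TensorProduct DirectSum
open KleinFour (gen coord)
open MvPolynomial (X C constantCoeff)

lemma finite_of_odd_card {Q : Type*} (hQ : Odd (Nat.card Q)) : Finite Q :=
  Nat.finite_of_card_ne_zero fun h ↦ by simp [h] at hQ

section StrictlyPerfect

variable {F : Type u} [Field F] {Q : Type u} [Group Q] {φ : Q →* MulAut KleinFour}
variable {K : CochainComplex (Rep.{u} F (KleinFour ⋊[φ] Q)) ℤ}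

lemma IsStrictlyPerfect.exists_subsingleton (hK : IsStrictlyPerfect K) :
    ∃ s : Finset ℤ, ∀ n ∉ s, Subsingleton (K.X n) := by
  obtain ⟨⟨a, b, ha, hb⟩, _⟩ := hK
  refine ⟨Finset.Icc a b, fun n hn ↦ ?_⟩
  rw [Finset.mem_Icc, not_and_or, not_le, not_le] at hn
  rcases hn with hn | hn
  · exact (Rep.isZero_iff _ _ _).1 (K.isZero_of_isStrictlyGE a n hn)
  · exact (Rep.isZero_iff _ _ _).1 (K.isZero_of_isStrictlyLE b n hn)

lemma IsStrictlyPerfect.finite [Finite Q] (hK : IsStrictlyPerfect K) (n : ℤ) :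
    Module.Finite F (K.X n) := by
  have h := (hK.2 n).2
  have : Finite (KleinFour ⋊[φ] Q) := Finite.of_equiv _ SemidirectProduct.equivProd.symm
  have : Module.Finite F (MonoidAlgebra F (KleinFour ⋊[φ] Q)) :=
    inferInstance
  have : Module.Finite F (K.X n).ρ.asModule :=
    Module.Finite.trans (MonoidAlgebra F (KleinFour ⋊[φ] Q)) _
  exact Module.Finite.equiv (K.X n).ρ.asModuleEquiv

theorem IsStrictlyPerfect.exists_equivariantComparison [CharP F 2] (hQ : Odd (Nat.card Q))
    (hK : IsStrictlyPerfect K) (hdim : Module.finrank F (⨁ n, (K.homology n : Type u)) = 4)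
    {s : Finset ℤ} (hs : ∀ n ∉ s, Subsingleton (K.X n)) :
    ∃ (l : ℤ) (χ : Q →* F) (J : Ideal (BiPoly F)), IsParameterIdeal J ∧
      Nonempty (EquivariantComparison K hs l χ J) := by
  have := finite_of_odd_card hQ
  have := finite_totalSpace K s hs hK.finite
  obtain ⟨q, hq⟩ := exists_X_pow_smul_totalExt K s hs fun n ↦ (hK.2 n).1
  obtain ⟨l, J, hJ, ⟨c⟩⟩ := ExteriorComplex.exists_cyclicComparison (totalExt K s hs)
    ((finrank_homology K).trans (by rw [hdim]; rfl)) q hq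
  obtain ⟨χ, hχ⟩ := _root_.exists_equivariantComparison hJ hQ c
  exact ⟨l, χ, J, hJ, hχ⟩

end StrictlyPerfect

section ParameterIdeal

variable {F : Type u} [Field F] {J : Ideal (BiPoly F)} (hJ : IsParameterIdeal J)

namespace IsParameterIdeal

lemma hpart_mem (hJ : IsParameterIdeal J) {f : BiPoly F} (hf : f ∈ J) (k : ℤ) :
    hpart k f ∈ J := by
  obtain ⟨⟨g, h, a, b, _, _, hg, hh, rfl⟩, _⟩ := hJ
  exact hpart_mem_span hg hh hf k

/-- Finitely many representatives span the quotient, so every class has a representative of bounded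
degree. Since `J` is homogeneous, the higher components of any polynomial lie in `J`. -/
lemma exists_hpart_mem (hJ : IsParameterIdeal J) :
    ∃ N : ℕ, ∀ n : ℤ, N ≤ n → ∀ f : BiPoly F, hpart n f ∈ J := by
  obtain ⟨t, ht⟩ := hJ.2.fg_top
  have hlift : ∀ b : BiPoly F ⧸ J, ∃ N : ℕ, ∃ f, Ideal.Quotient.mk J f = b ∧
      ∀ n : ℤ, N ≤ n → hpart n f = 0 := fun b ↦ by
    obtain ⟨f, rfl⟩ := Ideal.Quotient.mk_surjective b
    refine ⟨f.totalDegree + 1, f, rfl, fun n hn ↦ ?_⟩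
    lift n to ℕ using (by lia)
    rw [hpart_natCast]
    exact MvPolynomial.homogeneousComponent_eq_zero _ _ (by exact_mod_cast hn)
  choose N σ hσ hN using hlift
  refine ⟨t.sup N, fun n hn f ↦ ?_⟩
  have hf : Ideal.Quotient.mk J f ∈ Submodule.span F (t : Set (BiPoly F ⧸ J)) := by
    rw [ht]; trivial
  have key : ∀ b ∈ Submodule.span F (t : Set (BiPoly F ⧸ J)), ∃ g, Ideal.Quotient.mk J g = b ∧
      hpart n g = 0 := fun b hb ↦ by
    induction hb using Submodule.span_induction with
    | mem b hb => exact ⟨σ b, hσ b, hN b n (le_trans (by exact_mod_cast Finset.le_sup hb) hn)⟩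
    | zero => exact ⟨0, map_zero _, map_zero _⟩
    | add x y _ _ hx hy =>
      obtain ⟨f, rfl, hf⟩ := hx
      obtain ⟨g, rfl, hg⟩ := hy
      exact ⟨f + g, map_add _ _ _, by rw [map_add, hf, hg, add_zero]⟩
    | smul c x _ hx =>
      obtain ⟨f, rfl, hf⟩ := hx
      exact ⟨c • f, rfl, by rw [map_smul, hf, smul_zero]⟩
  obtain ⟨g, hg, hg0⟩ := key _ hf
  have := hJ.hpart_mem (Ideal.Quotient.eq.1 hg.symm) n
  rwa [map_sub, hg0, sub_zero] at this

lemma one_notMem (hJ : IsParameterIdeal J) : (1 : BiPoly F) ∉ J := fun h ↦ by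
  have := hJ.constantCoeff_eq_zero h
  rw [map_one] at this
  exact one_ne_zero this

lemma exists_X_pow_mem (hJ : IsParameterIdeal J) : ∃ q, ∀ i, (X i : BiPoly F) ^ q ∈ J := by
  obtain ⟨N, hN⟩ := hJ.exists_hpart_mem
  refine ⟨N, fun i ↦ ?_⟩
  rw [← isHomogeneous_iff_hpart.1 (MvPolynomial.isHomogeneous_X_pow (R := F) i N)]
  exact hN _ le_rfl _

/-- An element outside `J` in the top nonzero degree of the quotient is killed by the variables. -/
lemma exists_socle_notMem (hJ : IsParameterIdeal J) :
    ∃ s ∉ J, ∀ i, (X i : BiPoly F) * s ∈ J := by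
  classical
  have hex : ∃ N : ℕ, ∀ n : ℤ, N ≤ n → ∀ f : BiPoly F, hpart n f ∈ J := hJ.exists_hpart_mem
  have hN := Nat.find_spec hex
  obtain ⟨m, hm⟩ : ∃ m, Nat.find hex = m + 1 := by
    refine Nat.exists_eq_succ_of_ne_zero fun h0 ↦ hJ.one_notMem ?_
    rw [h0] at hN
    have := hN 0 le_rfl 1
    rwa [← Nat.cast_zero, isHomogeneous_iff_hpart.1 (MvPolynomial.isHomogeneous_one _ _)] at this
  have hmin := Nat.find_min hex (m := m) (by lia)
  push Not at hmin
  obtain ⟨n, hn, f, hf⟩ := hmin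
  refine ⟨hpart n f, hf, fun i ↦ ?_⟩
  rw [hm] at hN
  have h := hN (n + 1) (by push_cast; lia) (X i * f)
  rwa [hpart_X_mul, add_sub_cancel_right] at h

/-- Multiplication by a variable on the quotient by an ideal. -/
abbrev _root_.quotMulX (J : Ideal (BiPoly F)) (i : Fin 2) : Module.End F (BiPoly F ⧸ J) :=
  LinearMap.mulLeft F (Ideal.Quotient.mk J (X i))

/-- The quotient by a homogeneous system of parameters is Gorenstein: `exists_socle` bounds the
socle by one dimension, and an element of top degree shows that it is not zero. -/
lemma finrank_socle (hJ : IsParameterIdeal J) : Module.finrank F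
    (LinearMap.ker (quotMulX J 0) ⊓ LinearMap.ker (quotMulX J 1) : Submodule F _) = 1 := by
  obtain ⟨s, hs, hXs⟩ := hJ.exists_socle_notMem
  obtain ⟨q, hq⟩ := hJ.exists_X_pow_mem
  obtain ⟨⟨g, h, a, b, ha, hb, hg, hh, rfl⟩, _⟩ := hJ
  set J := Ideal.span {g, h}
  have hmk : ∀ i (t : BiPoly F), quotMulX J i (Ideal.Quotient.mk J t) =
    Ideal.Quotient.mk J (X i * t) := fun i t ↦ (map_mul _ _ _).symm
  obtain ⟨Δ, -, hΔ⟩ := exists_socle ha hb hg hh (isRelPrime_of_X_pow hq)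
  refine finrank_eq_one (⟨Ideal.Quotient.mk J s, ?_, ?_⟩ : (LinearMap.ker (quotMulX J 0) ⊓
    LinearMap.ker (quotMulX J 1) : Submodule F _)) ?_ ?_
  · exact (hmk 0 s).trans (Ideal.Quotient.eq_zero_iff_mem.2 (hXs 0))
  · exact (hmk 1 s).trans (Ideal.Quotient.eq_zero_iff_mem.2 (hXs 1))
  · intro h0
    exact hs (Ideal.Quotient.eq_zero_iff_mem.1 (congrArg Subtype.val h0))
  · rintro ⟨t, ht0, ht1⟩
    obtain ⟨t, rfl⟩ := Ideal.Quotient.mk_surjective t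
    obtain ⟨c, hc⟩ := hΔ t (Ideal.Quotient.eq_zero_iff_mem.1 ((hmk 0 t).symm.trans ht0))
      (Ideal.Quotient.eq_zero_iff_mem.1 ((hmk 1 t).symm.trans ht1))
    obtain ⟨d, hd⟩ := hΔ s (hXs 0) (hXs 1)
    have hd0 : d ≠ 0 := by
      rintro rfl
      rw [map_zero, zero_mul, sub_zero] at hd
      exact hs hd
    refine ⟨c * d⁻¹, Subtype.ext ?_⟩
    change (c * d⁻¹) • Ideal.Quotient.mk J s = Ideal.Quotient.mk J t
    have h1 : (c * d⁻¹) • Ideal.Quotient.mk J s = Ideal.Quotient.mk J (C (c * d⁻¹) * s) := by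
      rw [← MvPolynomial.smul_eq_C_mul]; rfl
    rw [h1, Ideal.Quotient.eq]
    have h2 : C (c * d⁻¹) * s - t = C (c * d⁻¹) * (s - C d * Δ) - (t - C c * Δ) := by
      have : (C (c * d⁻¹) * C d : BiPoly F) = C c := by
        rw [← map_mul, mul_assoc, inv_mul_cancel₀ hd0, mul_one]
      linear_combination Δ * this
    rw [h2]
    exact sub_mem (Ideal.mul_mem_left _ _ hd) hc

/-- The range is the maximal ideal of the quotient, that is, the kernel of the constant-term map. -/
lemma finrank_range_coprod (hJ : IsParameterIdeal J) :
    Module.finrank F (LinearMap.range ((quotMulX J 0).coprod (quotMulX J 1))) + 1 =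
      Module.finrank F (BiPoly F ⧸ J) := by
  have := hJ.2
  have hcc : ∀ f ∈ J, MvPolynomial.aeval (0 : Fin 2 → F) f = 0 := fun f hf ↦ by
    rw [MvPolynomial.aeval_zero, hJ.constantCoeff_eq_zero hf]; rfl
  let κ : (BiPoly F ⧸ J) →ₗ[F] F := (Ideal.Quotient.liftₐ J (MvPolynomial.aeval 0) hcc).toLinearMap
  have hκ : ∀ f, κ (Ideal.Quotient.mk J f) = constantCoeff f := fun f ↦ by
    change MvPolynomial.aeval (0 : Fin 2 → F) f = _
    rw [MvPolynomial.aeval_zero]; rfl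
  have hr : LinearMap.range ((quotMulX J 0).coprod (quotMulX J 1)) = LinearMap.ker κ := by
    ext b
    obtain ⟨f, rfl⟩ := Ideal.Quotient.mk_surjective b
    constructor
    · rintro ⟨⟨x, y⟩, hxy⟩
      obtain ⟨x, rfl⟩ := Ideal.Quotient.mk_surjective x
      obtain ⟨y, rfl⟩ := Ideal.Quotient.mk_surjective y
      rw [← hxy]
      change κ (Ideal.Quotient.mk J (X 0 * x + X 1 * y)) = 0
      rw [hκ]
      simp
    · intro h
      obtain ⟨α, β, hf⟩ := exists_eq_X_mul_add ((hκ f).symm.trans h)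
      exact ⟨(Ideal.Quotient.mk J α, Ideal.Quotient.mk J β), by rw [hf]; rfl⟩
  have hs : LinearMap.range κ = ⊤ := by
    rw [LinearMap.range_eq_top]
    intro a
    exact ⟨Ideal.Quotient.mk J (C a), by rw [hκ, MvPolynomial.constantCoeff_C]⟩
  have h := LinearMap.finrank_range_add_finrank_ker κ
  rw [hs, finrank_top, Module.finrank_self] at h
  rw [hr]
  lia

end IsParameterIdeal

end ParameterIdeal
end

/-! ### Dimension count for Koszul differentials and the cyclic modules -/

noncomputable section

open scoped TensorProduct DirectSum
open KleinFour (gen coord)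
open MvPolynomial (X C constantCoeff)

namespace GradedQModule

variable {F : Type u} [Field F] {Q : Type u} [Group Q] {φ : Q →* MulAut KleinFour}
variable {B : Type u} [AddCommGroup B] [Module F B] (N : GradedQModule (F := F) φ B)

/-- The element of `B⁴` with given sum of values, given values of two differences and given last
value. -/
def kernelParam : ((LinearMap.ker (N.mulX 0) ⊓ LinearMap.ker (N.mulX 1) : Submodule F B) ×
    LinearMap.ker ((N.mulX 0).coprod (N.mulX 1))) × B →ₗ[F] (KleinFour → B) where
  toFun a p := if p = gen 0 * gen 1 then a.2 else if p = gen 1 then a.1.2.1.1 + a.2 else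
    if p = gen 0 then a.1.2.1.2 + a.2 else a.1.1.1 + a.1.2.1.1 + a.1.2.1.2 + a.2
  map_add' a b := by
    funext p
    simp only [Pi.add_apply]
    split_ifs
    · rfl
    all_goals
      simp only [Prod.fst_add, Prod.snd_add, Submodule.coe_add]
      abel
  map_smul' c a := by
    funext p
    simp only [Pi.smul_apply, RingHom.id_apply]
    split_ifs
    · rfl
    all_goals simp only [Prod.smul_fst, Prod.smul_snd, Submodule.coe_smul, smul_add]

lemma kernelParam_values (a) :
    N.kernelParam a (gen 0 * gen 1) = a.2 ∧ N.kernelParam a (gen 1) = a.1.2.1.1 + a.2 ∧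
      N.kernelParam a (gen 0) = a.1.2.1.2 + a.2 ∧
      N.kernelParam a 1 = a.1.1.1 + a.1.2.1.1 + a.1.2.1.2 + a.2 := by
  have h1 : (gen 1 : KleinFour) ≠ gen 0 * gen 1 := by decide
  have h2 : (gen 0 : KleinFour) ≠ gen 0 * gen 1 := by decide
  have h3 : (gen 0 : KleinFour) ≠ gen 1 := by decide
  have h4 : (1 : KleinFour) ≠ gen 0 * gen 1 := by decide
  have h5 : (1 : KleinFour) ≠ gen 1 := by decide
  have h6 : (1 : KleinFour) ≠ gen 0 := by decide
  refine ⟨?_, ?_, ?_, ?_⟩ <;> simp only [kernelParam, LinearMap.coe_mk, AddHom.coe_mk, if_true]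
  · rw [if_neg h1]
  · rw [if_neg h2, if_neg h3]
  · rw [if_neg h4, if_neg h5, if_neg h6]

lemma kernelParam_injective : Function.Injective N.kernelParam := by
  refine (injective_iff_map_eq_zero _).2 fun a ha ↦ ?_
  obtain ⟨h1, h2, h3, h4⟩ := N.kernelParam_values a
  rw [ha] at h1 h2 h3 h4
  have e1 : a.2 = 0 := h1.symm
  rw [e1, add_zero] at h2 h3 h4
  have e2 : a.1.2.1.1 = 0 := h2.symm
  have e3 : a.1.2.1.2 = 0 := h3.symm
  rw [e2, e3, add_zero, add_zero] at h4
  have e4 : a.1.1.1 = 0 := h4.symm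
  exact Prod.ext (Prod.ext (Subtype.ext e4) (Subtype.ext (Prod.ext e2 e3))) e1

lemma range_kernelParam [CharP F 2] :
    LinearMap.range N.kernelParam = LinearMap.ker N.koszulEnd := by
  have t : ∀ b : B, (2 : ℤ) • b = 0 := fun b ↦ (two_smul ℤ b).trans (add_self_of_charTwo F b)
  ext f
  rw [LinearMap.mem_ker, koszulEnd_eq_zero_iff]
  constructor
  · rintro ⟨a, rfl⟩
    obtain ⟨h1, h2, h3, h4⟩ := N.kernelParam_values a
    have e1 : N.kernelParam a 1 + N.kernelParam a (gen 0) + N.kernelParam a (gen 1) +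
        N.kernelParam a (gen 0 * gen 1) = a.1.1.1 := by
      rw [h1, h2, h3, h4]
      abel_nf
      simp only [t, zero_add]
      rw [show (4 : ℤ) • a.2 = (2 : ℤ) • (2 : ℤ) • a.2 by rw [smul_smul]; norm_num, t, add_zero]
    have e2 : ∀ b c : B, b + c + c = b := fun b c ↦ by
      rw [add_assoc, add_self_of_charTwo F c, add_zero]
    refine ⟨fun i ↦ ?_, ?_⟩
    · rw [e1]
      fin_cases i
      · exact a.1.1.2.1
      · exact a.1.1.2.2
    · rw [h1, h2, h3, e2, e2]
      exact a.1.2.2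
  · rintro ⟨hs, hp⟩
    refine ⟨⟨⟨⟨_, hs 0, hs 1⟩, ⟨(f (gen 1) + f (gen 0 * gen 1), f (gen 0) + f (gen 0 * gen 1)), hp⟩⟩,
      f (gen 0 * gen 1)⟩, funext fun p ↦ ?_⟩
    obtain ⟨h1, h2, h3, h4⟩ := N.kernelParam_values ⟨⟨⟨_, hs 0, hs 1⟩, ⟨(f (gen 1) +
      f (gen 0 * gen 1), f (gen 0) + f (gen 0 * gen 1)), hp⟩⟩, f (gen 0 * gen 1)⟩
    have e2 : ∀ b c : B, b + c + c = b := fun b c ↦ by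
      rw [add_assoc, add_self_of_charTwo F c, add_zero]
    rcases KleinFour.cases 0 p with rfl | rfl | hp | rfl
    · rw [h4]
      simp only
      abel_nf
      simp only [t, zero_add]
      rw [show (4 : ℤ) • f (gen 0 * gen 1) = (2 : ℤ) • (2 : ℤ) • f (gen 0 * gen 1) by
        rw [smul_smul]; norm_num, t, add_zero]
    · rw [h3]; exact e2 _ _
    · obtain rfl : p = gen 1 := hp
      rw [h2]; exact e2 _ _
    · rw [h1]

/-- The kernel is parametrised by the socle, the syzygies of the variables on `B`, and one free
value. The syzygies have dimension twice that of `B` minus the rank of `(x₀, x₁)`; the equation is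
kept additive to avoid subtraction. -/
lemma finrank_ker_koszulEnd [CharP F 2] [Module.Finite F B] :
    Module.finrank F (LinearMap.ker N.koszulEnd) + Module.finrank F
        (LinearMap.range ((N.mulX 0).coprod (N.mulX 1))) = Module.finrank F
      (LinearMap.ker (N.mulX 0) ⊓ LinearMap.ker (N.mulX 1) : Submodule F B) +
        3 * Module.finrank F B := by
  rw [← N.range_kernelParam, LinearMap.finrank_range_of_inj N.kernelParam_injective,
    Module.finrank_prod, Module.finrank_prod]
  have h := LinearMap.finrank_range_add_finrank_ker ((N.mulX 0).coprod (N.mulX 1))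
  rw [Module.finrank_prod] at h
  lia

variable [CharP F 2]

/-- The inclusion of a term of the Koszul complex into the total space. -/
def koszulLof (n : ℤ) : (KleinFour → N.gr n) →ₗ[F] TotalSpace N.koszul :=
  DirectSum.lof F ℤ (fun n ↦ (N.koszul.X n : Type u)) n

lemma koszul_total_ext {W : Type*} [AddCommGroup W] [Module F W]
    {f g : TotalSpace N.koszul →ₗ[F] W}
    (h : ∀ n x, f (N.koszulLof n x) = g (N.koszulLof n x)) : f = g :=
  total_ext h

lemma totalD_koszulLof (n : ℤ) (f : KleinFour → N.gr n) :
    totalD N.koszul (N.koszulLof n f) = N.koszulLof (n + 1) (N.koszulDLin n f) :=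
  (totalD_lof (K := N.koszul) n f).trans (congrArg (N.koszulLof (n + 1)) (N.koszul_d_apply n f))

lemma totalW_koszulLof (i : Fin 2) (n : ℤ) (f : KleinFour → N.gr n) :
    totalW N.koszul i (N.koszulLof n f) =
      N.koszulLof n (extGen (repP (indRep φ (N.grAct n))) i f) :=
  totalW_lof (K := N.koszul) i n f

lemma totalAct_koszulLof (q : Q) (n : ℤ) (f : KleinFour → N.gr n) :
    totalAct N.koszul q (N.koszulLof n f) =
      N.koszulLof n (indRep φ (N.grAct n) (SemidirectProduct.inr q) f) :=
  gradedMap_lof (K := N.koszul) (L := N.koszul) _ n f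

/-- The functions on the Klein four group underlying the total space of the Koszul complex. -/
def totalToFun : TotalSpace N.koszul →ₗ[F] (KleinFour → B) :=
  DirectSum.toModule F ℤ _ fun n ↦
    ((N.gr n).subtype.compLeft KleinFour : (KleinFour → N.gr n) →ₗ[F] (KleinFour → B))

lemma totalToFun_koszulLof (n : ℤ) (f : KleinFour → N.gr n) :
    N.totalToFun (N.koszulLof n f) = fun p ↦ (f p : B) :=
  DirectSum.toModule_lof ..

lemma totalToFun_totalD (a : TotalSpace N.koszul) :
    N.totalToFun (totalD N.koszul a) = N.koszulEnd (N.totalToFun a) := by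
  refine LinearMap.congr_fun (f := N.totalToFun ∘ₗ totalD N.koszul)
    (g := N.koszulEnd ∘ₗ N.totalToFun) (N.koszul_total_ext fun n f ↦ ?_) a
  rw [LinearMap.comp_apply, LinearMap.comp_apply, totalD_koszulLof, totalToFun_koszulLof,
    totalToFun_koszulLof]
  rfl

lemma totalToFun_totalW (i : Fin 2) (a : TotalSpace N.koszul) (p : KleinFour) :
    N.totalToFun (totalW N.koszul i a) p =
      N.totalToFun a (gen (i + 1) * p) + N.totalToFun a (gen 0 * gen 1 * p) := by
  refine LinearMap.congr_fun (f := LinearMap.proj p ∘ₗ N.totalToFun ∘ₗ totalW N.koszul i)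
    (g := LinearMap.proj (gen (i + 1) * p) ∘ₗ N.totalToFun +
      LinearMap.proj (gen 0 * gen 1 * p) ∘ₗ N.totalToFun)
    (N.koszul_total_ext fun n f ↦ ?_) a
  simp only [LinearMap.add_apply, LinearMap.comp_apply, LinearMap.proj_apply, totalW_koszulLof,
    totalToFun_koszulLof, extGen_indRep]
  rfl

end GradedQModule

section CyclicModule

variable {F : Type u} [Field F] {Q : Type u} [Group Q] {φ : Q →* MulAut KleinFour}
variable (l : ℤ) (χ : Q →* F) [CharP F 2] {J : Ideal (BiPoly F)}
  (hinv : ∀ (q : Q), ∀ f ∈ J, polyAct φ q f ∈ J)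

/-- The quotient `F[x₀, x₁] / J` placed in degree `l` and twisted by a character. -/
def cyclicModule : GradedQModule (F := F) φ (BiPoly F ⧸ J) where
  mulX := quotMulX J
  mulX_comm := LinearMap.ext fun b ↦
    mul_left_comm (Ideal.Quotient.mk J (X 0)) (Ideal.Quotient.mk J (X 1)) b
  act :=
    { toFun := fun q ↦ χ q • (Ideal.quotientMapₐ J (polyAct φ q) (hinv q)).toLinearMap
      map_one' := LinearMap.ext fun b ↦ by
        obtain ⟨f, rfl⟩ := Ideal.Quotient.mk_surjective b
        change χ 1 • Ideal.Quotient.mk J (polyAct φ 1 f) = _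
        rw [map_one, one_smul, polyAct_one]
        rfl
      map_mul' := fun q r ↦ LinearMap.ext fun b ↦ by
        obtain ⟨f, rfl⟩ := Ideal.Quotient.mk_surjective b
        change χ (q * r) • Ideal.Quotient.mk J (polyAct φ (q * r) f) =
          χ q • (Ideal.quotientMapₐ J (polyAct φ q) (hinv q)).toLinearMap
            (χ r • Ideal.Quotient.mk J (polyAct φ r f))
        rw [map_smul, map_mul, mul_smul, polyAct_mul]
        rfl }
  act_mulX q i b := by
    obtain ⟨f, rfl⟩ := Ideal.Quotient.mk_surjective b
    change χ q • Ideal.Quotient.mk J (polyAct φ q (X i * f)) =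
      ∑ j, ((coord i (φ q⁻¹ (gen j))).cast : F) • (Ideal.Quotient.mk J (X j) *
        χ q • Ideal.Quotient.mk J (polyAct φ q f))
    have h : ∀ (c : F) (g : BiPoly F), Ideal.Quotient.mk J (C c * g) = c • Ideal.Quotient.mk J g :=
      fun c g ↦ by rw [← MvPolynomial.smul_eq_C_mul]; rfl
    rw [map_mul, polyAct_X, Finset.sum_mul, map_sum, Finset.smul_sum]
    refine Finset.sum_congr rfl fun j _ ↦ ?_
    rw [mul_assoc, h, map_mul, mul_smul_comm, smul_comm]
  gr n := (LinearMap.range (hpart (F := F) (n - l))).map (Ideal.Quotient.mkₐ F J).toLinearMap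
  mulX_mem i n b hb := by
    obtain ⟨_, ⟨f, rfl⟩, rfl⟩ := hb
    refine ⟨_, ⟨X i * f, rfl⟩, ?_⟩
    rw [hpart_X_mul, show n + 1 - l - 1 = n - l by ring]
    exact map_mul (Ideal.Quotient.mk J) _ _
  act_mem q n b hb := by
    obtain ⟨_, ⟨f, rfl⟩, rfl⟩ := hb
    refine ⟨_, ⟨χ q • polyAct φ q f, rfl⟩, ?_⟩
    rw [map_smul, hpart_polyAct, map_smul]
    rfl

end CyclicModule
end

/-! ### The model complexes: perfection and dimension of homology -/

noncomputable section

open scoped TensorProduct DirectSum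
open KleinFour (gen coord)
open MvPolynomial (X C constantCoeff)

section CyclicModule

variable {F : Type u} [Field F] [CharP F 2] {Q : Type u} [Group Q] {φ : Q →* MulAut KleinFour}
variable (l : ℤ) (χ : Q →* F) {J : Ideal (BiPoly F)}
  (hinv : ∀ (q : Q), ∀ f ∈ J, polyAct φ q f ∈ J)

lemma mem_cyclicModule_gr {n : ℤ} {b : BiPoly F ⧸ J} (hb : b ∈ (cyclicModule l χ hinv).gr n) :
    ∃ f, hpart (n - l) f = f ∧ Ideal.Quotient.mk J f = b := by
  obtain ⟨_, ⟨f, rfl⟩, rfl⟩ := hb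
  exact ⟨_, by rw [hpart_hpart, if_pos rfl], rfl⟩

lemma mk_mem_cyclicModule_gr {n : ℤ} {f : BiPoly F} (hf : hpart (n - l) f = f) :
    Ideal.Quotient.mk J f ∈ (cyclicModule l χ hinv).gr n :=
  ⟨f, ⟨f, hf⟩, rfl⟩

lemma cyclicModule_act_mk (q : Q) (f : BiPoly F) : (cyclicModule l χ hinv).act q
    (Ideal.Quotient.mk J f) = χ q • Ideal.Quotient.mk J (polyAct φ q f) := rfl

lemma subsingleton_koszul_cyclicModule {N : ℕ} (hN : ∀ n : ℤ, N ≤ n → ∀ f : BiPoly F, hpart n f ∈ J)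
    (n : ℤ) (hn : n < l ∨ l + N ≤ n) : Subsingleton ((cyclicModule l χ hinv).koszul.X n) := by
  have h : ∀ b : (cyclicModule l χ hinv).gr n, b = 0 := fun b ↦ by
    obtain ⟨f, hf, hb⟩ := mem_cyclicModule_gr l χ hinv b.2
    refine Subtype.ext (hb.symm.trans (Ideal.Quotient.eq_zero_iff_mem.2 ?_))
    rw [← hf]
    rcases hn with hn | hn
    · rw [hpart_of_neg (by lia)]; exact zero_mem _
    · exact hN _ (by lia) _
  have : Subsingleton ((cyclicModule l χ hinv).gr n) := ⟨fun a b ↦ (h a).trans (h b).symm⟩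
  exact inferInstanceAs (Subsingleton (KleinFour → (cyclicModule l χ hinv).gr n))

/-- Because `J` is homogeneous, a sum of classes of distinct degrees vanishes only if each of them
does. -/
lemma totalToFun_cyclicModule_injective (hJ : IsParameterIdeal J) :
    Function.Injective (cyclicModule l χ hinv).totalToFun := by
  classical
  refine (injective_iff_map_eq_zero _).2 fun a ha ↦ ?_
  choose g hg hga using fun (n : ℤ) (p : KleinFour) ↦
    mem_cyclicModule_gr l χ hinv (((a n : KleinFour → (cyclicModule l χ hinv).gr n)) p).2
  have hsum : a = ∑ n ∈ DFinsupp.support a, (cyclicModule l χ hinv).koszulLof n (a n) :=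
    (DirectSum.sum_support_of a).symm
  have h0 : ∀ n p, Ideal.Quotient.mk J (g n p) = 0 := by
    intro n p
    by_cases hn : n ∈ DFinsupp.support a
    · have h1 : ∑ m ∈ DFinsupp.support a, Ideal.Quotient.mk J (g m p) = 0 := by
        have h2 := congrFun ha p
        rw [hsum, map_sum, Finset.sum_apply] at h2
        refine Eq.trans (Finset.sum_congr rfl fun m _ ↦ ?_) h2
        exact (hga m p).trans (congrFun
          ((cyclicModule l χ hinv).totalToFun_koszulLof m (a m)) p).symm
      rw [← map_sum] at h1
      have h3 := hJ.hpart_mem (Ideal.Quotient.eq_zero_iff_mem.1 h1) (n - l)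
      rw [map_sum, Finset.sum_eq_single n] at h3
      · rw [hg] at h3
        exact Ideal.Quotient.eq_zero_iff_mem.2 h3
      · intro m _ hm
        rw [← hg m p, hpart_hpart, if_neg (by lia)]
      · exact fun h ↦ absurd hn h
    · rw [hga, DFinsupp.notMem_support_iff.1 hn]
      rfl
  refine DFinsupp.ext fun n ↦ ?_
  have : (a n : KleinFour → (cyclicModule l χ hinv).gr n) = 0 := funext fun p ↦ Subtype.ext
    ((hga n p).symm.trans (h0 n p))
  exact this

lemma totalToFun_cyclicModule_surjective :
    Function.Surjective (cyclicModule l χ hinv).totalToFun := by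
  intro f
  choose g hg using fun p ↦ Ideal.Quotient.mk_surjective (f p)
  refine ⟨∑ i ∈ Finset.range ((Finset.univ.sup fun p ↦ (g p).totalDegree) + 1),
    (cyclicModule l χ hinv).koszulLof (l + i) fun p ↦ ⟨Ideal.Quotient.mk J (hpart (i : ℤ) (g p)),
      mk_mem_cyclicModule_gr l χ hinv (by rw [hpart_hpart, if_pos (by lia)])⟩, ?_⟩
  rw [map_sum]
  funext p
  rw [Finset.sum_apply]
  refine (Finset.sum_congr rfl fun i _ ↦ congrFun
    ((cyclicModule l χ hinv).totalToFun_koszulLof _ _) p).trans ?_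
  simp only
  rw [← map_sum, ← hg p]
  congr 1
  conv_rhs => rw [← sum_hpart (g p)]
  symm
  refine Finset.sum_subset (fun i hi ↦ ?_) fun i _ hi ↦ ?_
  · have := Finset.le_sup (f := fun p ↦ (g p).totalDegree) (Finset.mem_univ p)
    simp only [Finset.mem_range] at hi ⊢
    lia
  · rw [Finset.mem_range, not_lt] at hi
    rw [hpart_natCast]
    exact MvPolynomial.homogeneousComponent_eq_zero _ _ (by lia)

/-- The total space of the Koszul complex of `F[x₀, x₁] / J` is the space of functions on the
Klein four group with values in `F[x₀, x₁] / J`. -/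
def totalEquivFun (hJ : IsParameterIdeal J) : TotalSpace (cyclicModule l χ hinv).koszul ≃ₗ[F] (KleinFour → BiPoly F ⧸ J) :=
  LinearEquiv.ofBijective (cyclicModule l χ hinv).totalToFun
    ⟨totalToFun_cyclicModule_injective l χ hinv hJ, totalToFun_cyclicModule_surjective l χ hinv⟩

theorem isStrictlyPerfect_koszul_cyclicModule (hJ : IsParameterIdeal J) (hQ : Odd (Nat.card Q)) :
    IsStrictlyPerfect (cyclicModule l χ hinv).koszul := by
  obtain ⟨N, hN⟩ := hJ.exists_hpart_mem
  have := hJ.2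
  refine ⟨⟨l, l + N, ?_, ?_⟩, fun n ↦ ⟨projective_koszul_X φ hQ _ n, ?_⟩⟩
  · rw [CochainComplex.isStrictlyGE_iff]
    intro i hi
    have := subsingleton_koszul_cyclicModule l χ hinv hN i (Or.inl hi)
    exact (Rep.isZero_iff _ _ _).2 this
  · rw [CochainComplex.isStrictlyLE_iff]
    intro i hi
    have := subsingleton_koszul_cyclicModule l χ hinv hN i (Or.inr hi.le)
    exact (Rep.isZero_iff _ _ _).2 this
  · have : Module.Finite F ((cyclicModule l χ hinv).koszul.X n).ρ.asModule :=
      inferInstanceAs (Module.Finite F (KleinFour → (cyclicModule l χ hinv).gr n))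
    exact Module.Finite.of_restrictScalars_finite F _ _

/-- Let `b` be the dimension of the quotient by `J`. The socle has dimension `1` and the maximal
ideal `b - 1`, so the kernel of the differential has dimension `2b + 2` in a space of dimension
`4b`. This leaves homology of dimension `2(2b + 2) - 4b = 4`. -/
theorem finrank_homology_koszul_cyclicModule (hJ : IsParameterIdeal J) : Module.finrank F
    (⨁ n, ((cyclicModule l χ hinv).koszul.homology n : Type u)) = 4 := by
  have := hJ.2
  set N := cyclicModule l χ hinv
  let e := totalEquivFun l χ hinv hJ
  have : Module.Finite F (TotalSpace N.koszul) := Module.Finite.equiv e.symm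
  have hker : (LinearMap.ker (totalD N.koszul)).map (e : TotalSpace N.koszul →ₗ[F] _) =
      LinearMap.ker N.koszulEnd := by
    ext f
    rw [Submodule.mem_map_equiv, LinearMap.mem_ker, LinearMap.mem_ker]
    have h1 := N.totalToFun_totalD (e.symm f)
    have h2 : N.totalToFun (e.symm f) = f := e.apply_symm_apply f
    rw [h2] at h1
    rw [← h1]
    exact (map_eq_zero_iff _ (totalToFun_cyclicModule_injective l χ hinv hJ)).symm
  have h1 := finrank_homology N.koszul
  have h2 := LinearMap.finrank_range_add_finrank_ker (totalD N.koszul)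
  have h3 : Module.finrank F (LinearMap.ker (totalD N.koszul)) =
      Module.finrank F (LinearMap.ker N.koszulEnd) := by
    rw [← hker]; exact (LinearEquiv.finrank_map_eq e _).symm
  have h4 := N.finrank_ker_koszulEnd
  have h5 : Module.finrank F (LinearMap.ker (N.mulX 0) ⊓ LinearMap.ker (N.mulX 1) :
    Submodule F _) = 1 := hJ.finrank_socle
  have h6 : Module.finrank F (LinearMap.range ((N.mulX 0).coprod (N.mulX 1))) + 1 =
      Module.finrank F (BiPoly F ⧸ J) := hJ.finrank_range_coprod
  have h7 : Module.finrank F (TotalSpace N.koszul) = 4 * Module.finrank F (BiPoly F ⧸ J) := by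
    rw [e.finrank_eq, Module.finrank_pi_fintype, Finset.sum_const, Finset.card_univ, smul_eq_mul]
    rfl
  lia

end CyclicModule
end

/-! ### Invariants of the model complexes -/

noncomputable section

open scoped TensorProduct DirectSum
open KleinFour (gen coord)
open MvPolynomial (X C constantCoeff)

section

variable {F : Type u} [Field F]

lemma BiPoly.smul_quotient {J : Ideal (BiPoly F)} (f : BiPoly F) (b : BiPoly F ⧸ J) :
    f • b = Ideal.Quotient.mk J f * b := by
  obtain ⟨g, rfl⟩ := Ideal.Quotient.mk_surjective b
  rfl

end

section CyclicModule

variable {F : Type u} [Field F] [CharP F 2] {Q : Type u} [Group Q] {φ : Q →* MulAut KleinFour}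
variable (l : ℤ) (χ : Q →* F) {J : Ideal (BiPoly F)}
  (hinv : ∀ (q : Q), ∀ f ∈ J, polyAct φ q f ∈ J)

/-- The `F[x₀, x₁]`-linear extension of the evaluation at the identity. -/
def evalOne : BiPoly F ⊗[F] TotalSpace (cyclicModule l χ hinv).koszul →ₗ[BiPoly F] BiPoly F ⧸ J :=
  (LinearMap.proj 1 ∘ₗ (cyclicModule l χ hinv).totalToFun).liftBaseChange (BiPoly F)

lemma evalOne_tmul (f : BiPoly F) (a : TotalSpace (cyclicModule l χ hinv).koszul) :
    evalOne l χ hinv (f ⊗ₜ[F] a) =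
      Ideal.Quotient.mk J f * (cyclicModule l χ hinv).totalToFun a 1 :=
  (LinearMap.liftBaseChange_tmul ..).trans (BiPoly.smul_quotient _ _)

variable {s : Finset ℤ} (hs : ∀ n ∉ s, Subsingleton ((cyclicModule l χ hinv).koszul.X n))

/-- At the identity the internal differential is `Σ xᵢ wᵢ` with the variables acting on the values,
and the twist is the same sum with the variables acting on the polynomial factor. Modulo `J` the two
agree and cancel in characteristic 2. -/
lemma evalOne_D (v : BiPoly F ⊗[F] TotalSpace (cyclicModule l χ hinv).koszul) :
    evalOne l χ hinv ((totalExt _ s hs).D v) = 0 := by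
  induction v using TensorProduct.induction_on with
  | zero => rw [map_zero, map_zero]
  | add x y hx hy => rw [map_add, map_add, hx, hy, add_zero]
  | tmul f a =>
    rw [ExteriorComplex.D_tmul]
    change evalOne l χ hinv (f ⊗ₜ[F] totalD _ a + ((X 0 * f) ⊗ₜ[F] totalW _ 0 a +
      (X 1 * f) ⊗ₜ[F] totalW _ 1 a)) = 0
    rw [map_add, map_add, evalOne_tmul, evalOne_tmul, evalOne_tmul,
      GradedQModule.totalToFun_totalD, GradedQModule.totalToFun_totalW,
      GradedQModule.totalToFun_totalW, GradedQModule.koszulEnd_apply, Fin.sum_univ_two, map_mul,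
      map_mul]
    have hm : ∀ i b, (cyclicModule l χ hinv).mulX i b = Ideal.Quotient.mk J (X i) * b :=
      fun _ _ ↦ rfl
    rw [hm, hm]
    refine Eq.trans ?_ (add_self_of_charTwo F (Ideal.Quotient.mk J f * (Ideal.Quotient.mk J (X 0) *
      ((cyclicModule l χ hinv).totalToFun a (gen (0 + 1) * 1) +
        (cyclicModule l χ hinv).totalToFun a (gen 0 * gen 1 * 1)) + Ideal.Quotient.mk J (X 1) *
      ((cyclicModule l χ hinv).totalToFun a (gen (1 + 1) * 1) +
        (cyclicModule l χ hinv).totalToFun a (gen 0 * gen 1 * 1)))))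
    ring

section

variable (hJ : IsParameterIdeal J)

/-- The element of the twisted complex given by a constant function. -/
def constTensor : (BiPoly F ⧸ J) →ₗ[F] BiPoly F ⊗[F] TotalSpace (cyclicModule l χ hinv).koszul :=
  TensorProduct.mk F (BiPoly F) _ 1 ∘ₗ (totalEquivFun l χ hinv hJ).symm.toLinearMap ∘ₗ
    LinearMap.pi fun _ ↦ LinearMap.id

lemma constTensor_apply (b : BiPoly F ⧸ J) : constTensor l χ hinv hJ b =
    1 ⊗ₜ[F] (totalEquivFun l χ hinv hJ).symm fun _ ↦ b := rfl

lemma totalToFun_totalEquivFun_symm (f : KleinFour → BiPoly F ⧸ J) :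
    (cyclicModule l χ hinv).totalToFun ((totalEquivFun l χ hinv hJ).symm f) = f :=
  (totalEquivFun l χ hinv hJ).apply_symm_apply f

lemma evalOne_constTensor (b : BiPoly F ⧸ J) : evalOne l χ hinv (constTensor l χ hinv hJ b) = b := by
  rw [constTensor_apply, evalOne_tmul, totalToFun_totalEquivFun_symm, map_one, one_mul]

lemma totalD_totalEquivFun_symm (f : KleinFour → BiPoly F ⧸ J) :
    totalD _ ((totalEquivFun l χ hinv hJ).symm f) =
      (totalEquivFun l χ hinv hJ).symm ((cyclicModule l χ hinv).koszulEnd f) := by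
  refine totalToFun_cyclicModule_injective l χ hinv hJ ?_
  rw [GradedQModule.totalToFun_totalD, totalToFun_totalEquivFun_symm,
    totalToFun_totalEquivFun_symm]

lemma totalW_totalEquivFun_symm (i : Fin 2) (f : KleinFour → BiPoly F ⧸ J) :
    totalW _ i ((totalEquivFun l χ hinv hJ).symm f) =
      (totalEquivFun l χ hinv hJ).symm fun p ↦ f (gen (i + 1) * p) + f (gen 0 * gen 1 * p) := by
  refine totalToFun_cyclicModule_injective l χ hinv hJ ?_
  funext p
  rw [GradedQModule.totalToFun_totalW, totalToFun_totalEquivFun_symm,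
    totalToFun_totalEquivFun_symm]

lemma D_constTensor (b : BiPoly F ⧸ J) :
    (totalExt _ s hs).D (constTensor l χ hinv hJ b) = 0 := by
  have h0 : (fun p : KleinFour ↦ b + b) = 0 := funext fun _ ↦ add_self_of_charTwo F b
  have h1 : (cyclicModule l χ hinv).koszulEnd (fun _ ↦ b) = 0 := by
    funext p
    rw [GradedQModule.koszulEnd_apply, Fin.sum_univ_two, add_self_of_charTwo F b, map_zero,
      map_zero, add_zero]
    rfl
  rw [constTensor_apply, ExteriorComplex.D_tmul]
  change (1 : BiPoly F) ⊗ₜ[F] totalD _ _ + ((X 0 * 1) ⊗ₜ[F] totalW _ 0 _ +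
    (X 1 * 1) ⊗ₜ[F] totalW _ 1 _) = 0
  rw [totalD_totalEquivFun_symm, totalW_totalEquivFun_symm, totalW_totalEquivFun_symm, h1, h0]
  simp

/-- The function `p ↦ coordᵢ(p) · b` is a primitive: `wⱼ` sends it to the constant `b` if `j = i`
and to zero otherwise, so its twisted differential is the sum of the external and the internal
multiplication by `xᵢ`. -/
lemma X_smul_constTensor (i : Fin 2) (b : BiPoly F ⧸ J) : ∃ y,
    (X i : BiPoly F) • constTensor l χ hinv hJ b =
      constTensor l χ hinv hJ (quotMulX J i b) + (totalExt _ s hs).D y := by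
  set f : KleinFour → BiPoly F ⧸ J := fun p ↦ if coord i p = 1 then b else 0 with hf
  refine ⟨1 ⊗ₜ[F] (totalEquivFun l χ hinv hJ).symm f, ?_⟩
  have hw : ∀ j, (fun p ↦ f (gen (j + 1) * p) + f (gen 0 * gen 1 * p)) =
      if j = i then (fun _ ↦ b) else (0 : KleinFour → BiPoly F ⧸ J) := fun j ↦ by
    have hb := add_self_of_charTwo F b
    funext p
    have h1 : ∀ (i j : Fin 2) (p : KleinFour),
        coord i (gen (j + 1) * p) = coord i p + if j = i then 0 else 1 := by decide
    have h2 : ∀ (i : Fin 2) (p : KleinFour), coord i (gen 0 * gen 1 * p) = coord i p + 1 := by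
      decide
    simp only [hf]
    rw [h1, h2]
    by_cases hj : j = i
    · rw [if_pos hj, if_pos hj]
      rcases (by decide : ∀ c : ZMod 2, c = 0 ∨ c = 1) (coord i p) with h | h <;> rw [h]
      · rw [if_neg (by decide), if_pos (by decide), zero_add]
      · rw [if_pos (by decide), if_neg (by decide), add_zero]
    · rw [if_neg hj, if_neg hj]
      exact add_self_of_charTwo F _
  have hd : (cyclicModule l χ hinv).koszulEnd f = fun _ ↦ quotMulX J i b := by
    funext p
    rw [GradedQModule.koszulEnd_apply]
    have h : ∀ j, f (gen (j + 1) * p) + f (gen 0 * gen 1 * p) = if j = i then b else 0 := fun j ↦ by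
      refine (congrFun (hw j) p).trans ?_
      split_ifs <;> rfl
    simp only [h]
    rw [Finset.sum_eq_single i]
    · rw [if_pos rfl]; rfl
    · intro j _ hj
      rw [if_neg hj, map_zero]
    · simp
  rw [ExteriorComplex.D_tmul]
  change _ = _ + ((1 : BiPoly F) ⊗ₜ[F] totalD _ _ + ((X 0 * 1) ⊗ₜ[F] totalW _ 0 _ +
    (X 1 * 1) ⊗ₜ[F] totalW _ 1 _))
  rw [totalD_totalEquivFun_symm, totalW_totalEquivFun_symm, totalW_totalEquivFun_symm, hd, hw, hw,
    ← constTensor_apply, ← add_assoc, add_self_of_charTwo F, zero_add, constTensor_apply,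
    TensorProduct.smul_tmul']
  fin_cases i
  · simp
  · simp

lemma smul_constTensor (f : BiPoly F) (b : BiPoly F ⧸ J) : ∃ y,
    f • constTensor l χ hinv hJ b =
      constTensor l χ hinv hJ (Ideal.Quotient.mk J f * b) + (totalExt _ s hs).D y := by
  induction f using MvPolynomial.induction_on generalizing b with
  | C a =>
    refine ⟨0, ?_⟩
    have h : Ideal.Quotient.mk J (C a) * b = a • b := (Algebra.smul_def a b).symm
    rw [map_zero, add_zero, h, map_smul]
    exact IsScalarTower.algebraMap_smul (BiPoly F) a _
  | add f g hf hg =>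
    obtain ⟨y, hy⟩ := hf b
    obtain ⟨z, hz⟩ := hg b
    refine ⟨y + z, ?_⟩
    rw [add_smul, hy, hz, map_add, add_mul, map_add, map_add]
    abel
  | mul_X f i hf =>
    obtain ⟨y, hy⟩ := X_smul_constTensor l χ hinv hs hJ i b
    obtain ⟨z, hz⟩ := hf (quotMulX J i b)
    refine ⟨f • y + z, ?_⟩
    have hD : (totalExt _ s hs).D (f • y + z) =
        f • (totalExt _ s hs).D y + (totalExt _ s hs).D z := by rw [map_add, LinearMap.map_smul]
    have hm : Ideal.Quotient.mk J (f * X i) * b = Ideal.Quotient.mk J f * quotMulX J i b :=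
      (congrArg (· * b) (map_mul _ _ _)).trans (mul_assoc _ _ _)
    rw [mul_smul, hy, smul_add, hz, hD, hm]
    abel

lemma constTensor_one_mem_total :
    constTensor l χ hinv hJ 1 ∈ (totalExt _ s hs).total l := by
  have h1 : (1 : BiPoly F ⧸ J) ∈ (cyclicModule l χ hinv).gr l := by
    rw [← map_one (Ideal.Quotient.mk J)]
    exact mk_mem_cyclicModule_gr l χ hinv (by
      rw [sub_self]; exact isHomogeneous_iff_hpart.1 (MvPolynomial.isHomogeneous_one _ _))
  have h : (totalEquivFun l χ hinv hJ).symm (fun _ ↦ 1) =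
      (cyclicModule l χ hinv).koszulLof l fun _ ↦ ⟨1, h1⟩ := by
    refine totalToFun_cyclicModule_injective l χ hinv hJ ?_
    rw [totalToFun_totalEquivFun_symm, GradedQModule.totalToFun_koszulLof]
  rw [constTensor_apply, h]
  exact ExteriorComplex.one_tmul_mem_total ((gradedProj_lof _ _ _).trans (if_pos rfl))

lemma twistAct_constTensor_one (q : Q) :
    twistAct _ q (constTensor l χ hinv hJ 1) = χ q • constTensor l χ hinv hJ 1 := by
  have h1 : (1 : BiPoly F ⧸ J) ∈ (cyclicModule l χ hinv).gr l := by
    rw [← map_one (Ideal.Quotient.mk J)]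
    exact mk_mem_cyclicModule_gr l χ hinv (by
      rw [sub_self]; exact isHomogeneous_iff_hpart.1 (MvPolynomial.isHomogeneous_one _ _))
  have h : (totalEquivFun l χ hinv hJ).symm (fun _ ↦ 1) =
      (cyclicModule l χ hinv).koszulLof l fun _ ↦ ⟨1, h1⟩ := by
    refine totalToFun_cyclicModule_injective l χ hinv hJ ?_
    rw [totalToFun_totalEquivFun_symm, GradedQModule.totalToFun_koszulLof]
  rw [← map_smul, constTensor_apply, constTensor_apply, twistAct_tmul, map_one, h,
    GradedQModule.totalAct_koszulLof]
  congr 1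
  refine totalToFun_cyclicModule_injective l χ hinv hJ ?_
  rw [totalToFun_totalEquivFun_symm, GradedQModule.totalToFun_koszulLof]
  funext p
  rw [indRep_inr]
  change (cyclicModule l χ hinv).act q (Ideal.Quotient.mk J 1) = χ q • 1
  rw [cyclicModule_act_mk, map_one, map_one]

end

/-- The model is strictly perfect with four-dimensional homology, so it has a comparison for some
triple `(l', χ', J')`. Testing it on the constant function `1`, with `evalOne` in the other
direction, identifies that triple with the given one. -/
theorem exists_equivariantComparison_koszul_cyclicModule (hJ : IsParameterIdeal J)
    (hQ : Odd (Nat.card Q)) :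
    Nonempty (EquivariantComparison (cyclicModule l χ hinv).koszul hs l χ J) := by
  obtain ⟨l', χ', J', hJ', ⟨c⟩⟩ := (isStrictlyPerfect_koszul_cyclicModule l χ hinv hJ
    hQ).exists_equivariantComparison hQ (finrank_homology_koszul_cyclicModule l χ hinv hJ) hs
  obtain ⟨z, hzl, hz, hz1⟩ := c.exists_gen
  set z₀ := constTensor l χ hinv hJ 1 with hz₀
  have hz₀D : (totalExt _ s hs).D z₀ = 0 := D_constTensor l χ hinv hs hJ 1
  obtain ⟨y, hy⟩ := c.exists_eq_smul_add hz hz1 hz₀D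
  set t := ExteriorComplex.polyExt c.ψ z₀ with ht
  -- The constant cycle is `t` times the generator up to a boundary, and `evalOne` kills boundaries
  -- and sends that cycle to `1`. Thus `t` has nonzero constant term; being homogeneous of degree `l
  -- - l'`, it is a nonzero constant and `l = l'`.
  have hΨ : Ideal.Quotient.mk J t * evalOne l χ hinv z = 1 := by
    have h := congrArg (evalOne l χ hinv) hy
    rw [evalOne_constTensor, map_add, map_smul, evalOne_D, add_zero, BiPoly.smul_quotient] at h
    exact h.symm
  obtain ⟨r, hr⟩ := Ideal.Quotient.mk_surjective (evalOne l χ hinv z)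
  have hc : constantCoeff t * constantCoeff r = 1 := by
    rw [← hr, ← map_mul, ← map_one (Ideal.Quotient.mk J), Ideal.Quotient.eq] at hΨ
    have := hJ.constantCoeff_eq_zero hΨ
    rwa [map_sub, map_mul, map_one, sub_eq_zero] at this
  have hth : hpart (l - l') t = t := ExteriorComplex.polyExt_mem_hpart c.hpart_ψ
    (constTensor_one_mem_total l χ hinv hs hJ)
  obtain rfl : l = l' := by
    by_contra hne
    have : constantCoeff t = 0 := by
      rw [← hth]
      rcases lt_or_ge (l - l') 0 with h | h
      · rw [hpart_of_neg h, map_zero]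
      · lift l - l' to ℕ using h with k hk
        exact constantCoeff_of_isHomogeneous (by lia) (isHomogeneous_hpart k t)
    rw [this, zero_mul] at hc
    exact zero_ne_one hc
  have htC : t = C (constantCoeff t) := by
    rw [sub_self, ← Nat.cast_zero, hpart_natCast, MvPolynomial.homogeneousComponent_zero] at hth
    exact hth.symm
  set a := constantCoeff t
  -- Both ideals annihilate the same class: `J` kills the constant cycle up to a boundary, which the
  -- comparison detects in `J'`, and `J'` kills the generator, which `evalOne` detects in `J`.
  have hJJ : J = J' := by
    ext f
    constructor
    · intro hf
      obtain ⟨w, hw⟩ := smul_constTensor l χ hinv hs hJ f 1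
      rw [Ideal.Quotient.eq_zero_iff_mem.2 hf, zero_mul, map_zero, zero_add] at hw
      have h := c.ψ_D w
      rw [← hw, map_smul, ← hz₀, ← ht, htC, smul_eq_mul] at h
      have h2 := J'.mul_mem_right (C (constantCoeff r)) h
      rwa [mul_assoc, ← map_mul, hc, map_one, mul_one] at h2
    · intro hf
      obtain ⟨w, hw⟩ := c.smul_eq_D hz hf
      have h := congrArg (evalOne l χ hinv) hw
      rw [evalOne_D, map_smul, BiPoly.smul_quotient] at h
      have h2 := congrArg (Ideal.Quotient.mk J t * ·) h
      simp only [mul_zero] at h2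
      rw [mul_left_comm, hΨ, mul_one] at h2
      exact Ideal.Quotient.eq_zero_iff_mem.1 h2
  subst hJJ
  have hχ : χ' = χ := by
    ext q
    have h1 := c.polyExt_twistAct q z₀
    rw [twistAct_constTensor_one, ← IsScalarTower.algebraMap_smul (BiPoly F) (χ q), map_smul, ← hz₀,
      ← ht, htC, MvPolynomial.algebraMap_eq, smul_eq_mul] at h1
    have h2 : polyAct φ q (C a : BiPoly F) = C a := (polyAct φ q).commutes a
    rw [h2, MvPolynomial.smul_eq_C_mul, ← map_mul, ← map_mul] at h1
    have h3 := MvPolynomial.C_injective _ _ h1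
    have ha : a ≠ 0 := left_ne_zero_of_mul_eq_one hc
    exact (mul_right_cancel₀ ha h3).symm
  subst hχ
  exact ⟨c⟩

end CyclicModule
end

/-! ### The quasi-isomorphism to the model -/

noncomputable section

open scoped TensorProduct DirectSum
open KleinFour (gen coord)
open MvPolynomial (X C constantCoeff)

lemma eq_smul_add_of_eq_smul_add {R M : Type*} [CommRing R] [AddCommGroup M] [Module R M]
    (D : M →ₗ[R] M) {v z u y y' w : M} {p p' r : R} (hv : v = p • z + D y)
    (hu : u = p' • z + D y') (hw : (1 - p' * r) • z = D w) :
    v = (p * r) • u + D (y + p • w - (p * r) • y') := by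
  rw [map_sub, map_add, map_smul, map_smul, ← hw, hu, hv]
  module

section

variable {F : Type u} [Field F] {Q : Type u} [Group Q] {φ : Q →* MulAut KleinFour}
variable {K : CochainComplex (Rep.{u} F (KleinFour ⋊[φ] Q)) ℤ}

lemma lof_apply_self (n : ℤ) (x : K.X n) :
    (DirectSum.lof F ℤ (fun n ↦ (K.X n : Type u)) n x) n = x :=
  DirectSum.component.lof_self (R := F) (ι := ℤ) (M := fun n ↦ (K.X n : Type u)) n x

lemma totalD_lof_eq_zero_iff {n : ℤ} {x : K.X n} :
    totalD K (DirectSum.lof F ℤ (fun n ↦ (K.X n : Type u)) n x) = 0 ↔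
      (K.d n (n + 1)).hom x = 0 := by
  rw [totalD_lof]
  refine ⟨fun h ↦ ?_, fun h ↦ by rw [h, map_zero]⟩
  rw [← lof_apply_self (n + 1) ((K.d n (n + 1)).hom x), h]
  rfl

lemma exists_lof_eq_totalD_iff {n : ℤ} {x : K.X n} :
    (∃ b, DirectSum.lof F ℤ (fun n ↦ (K.X n : Type u)) n x = totalD K b) ↔
      ∃ y, x = (K.d (n - 1) n).hom y := by
  obtain ⟨m, rfl⟩ : ∃ m, n = m + 1 := ⟨n - 1, by lia⟩
  rw [add_sub_cancel_right]
  constructor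
  · rintro ⟨b, hb⟩
    refine ⟨b m, ?_⟩
    rw [← totalD_apply, ← hb, lof_apply_self]
  · rintro ⟨y, rfl⟩
    exact ⟨_, (totalD_lof m y).symm⟩

variable {L : CochainComplex (Rep.{u} F (KleinFour ⋊[φ] Q)) ℤ}

lemma gradedMap_totalD (f : K ⟶ L) (a : TotalSpace K) : gradedMap (fun n ↦ (f.f n).hom.toLinearMap) (totalD K a) =
    totalD L (gradedMap (fun n ↦ (f.f n).hom.toLinearMap) a) := by
  refine LinearMap.congr_fun (f := gradedMap (fun n ↦ (f.f n).hom.toLinearMap) ∘ₗ totalD K)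
    (g := totalD L ∘ₗ gradedMap (fun n ↦ (f.f n).hom.toLinearMap)) (total_ext fun n x ↦ ?_) a
  rw [LinearMap.comp_apply, LinearMap.comp_apply, totalD_lof, gradedMap_lof, gradedMap_lof,
    totalD_lof]
  exact congrArg _ (congrArg (fun g : K.X n ⟶ L.X (n + 1) ↦ g.hom x) (f.comm n (n + 1))).symm

lemma gradedMap_totalW (f : K ⟶ L) (i : Fin 2) (a : TotalSpace K) :
    gradedMap (fun n ↦ (f.f n).hom.toLinearMap) (totalW K i a) =
      totalW L i (gradedMap (fun n ↦ (f.f n).hom.toLinearMap) a) := by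
  refine LinearMap.congr_fun (f := gradedMap (fun n ↦ (f.f n).hom.toLinearMap) ∘ₗ totalW K i)
    (g := totalW L i ∘ₗ gradedMap (fun n ↦ (f.f n).hom.toLinearMap)) (total_ext fun n x ↦ ?_) a
  rw [LinearMap.comp_apply, LinearMap.comp_apply, totalW_lof, gradedMap_lof, gradedMap_lof,
    totalW_lof]
  exact congrArg _ (hom_extGen (f.f n) i x)

end

section

variable {F : Type u} [Field F] [CharP F 2] {Q : Type u} [Group Q] {φ : Q →* MulAut KleinFour}
variable {K L : CochainComplex (Rep.{u} F (KleinFour ⋊[φ] Q)) ℤ}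
variable {s : Finset ℤ} (hs : ∀ n ∉ s, Subsingleton (K.X n))
variable {t : Finset ℤ} (ht : ∀ n ∉ t, Subsingleton (L.X n))

theorem quasiIso_of_twisted (hK : Module.Finite F (TotalSpace K))
    (hL : Module.Finite F (TotalSpace L)) (f : K ⟶ L)
    (hinj : ∀ v, (totalExt K s hs).D v = 0 →
      (∃ y, (gradedMap fun n ↦ (f.f n).hom.toLinearMap).baseChange (BiPoly F) v =
        (totalExt L t ht).D y) → ∃ y, v = (totalExt K s hs).D y)
    (hsurj : ∀ v', (totalExt L t ht).D v' = 0 → ∃ v y, (totalExt K s hs).D v = 0 ∧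
      v' = (gradedMap fun n ↦ (f.f n).hom.toLinearMap).baseChange (BiPoly F) v +
        (totalExt L t ht).D y) : QuasiIso f := by
  obtain ⟨h1, h2⟩ := ExteriorComplex.isomorphism_of_twisted (T := totalExt K s hs)
    (T' := totalExt L t ht) _ (gradedMap_totalD f) (gradedMap_totalW f) hinj hsurj
  refine (quasiIso_iff_forall f).2 fun n ↦ ⟨fun x hx hy ↦ ?_, fun x' hx' ↦ ?_⟩
  · refine exists_lof_eq_totalD_iff.1 (h1 _ (totalD_lof_eq_zero_iff.2 hx) ?_)
    obtain ⟨b, hb⟩ := exists_lof_eq_totalD_iff.2 hy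
    exact ⟨b, (gradedMap_lof _ n x).trans hb⟩
  · obtain ⟨a, b, ha, hab⟩ := h2 _ (totalD_lof_eq_zero_iff.2 hx')
    obtain ⟨m, rfl⟩ : ∃ m, n = m + 1 := ⟨n - 1, by lia⟩
    rw [add_sub_cancel_right]
    refine ⟨a (m + 1), b m, ?_, ?_⟩
    · rw [← totalD_apply]
      exact congrArg (fun c : TotalSpace K ↦ c (m + 1 + 1)) ha
    · have h := congrArg (fun c : TotalSpace L ↦ c (m + 1)) hab
      simp only at h
      rw [lof_apply_self, totalSpace_add_apply, gradedMap_apply] at h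
      exact h.trans (congrArg _ (totalD_apply (K := L) b m))

namespace EquivariantComparison

variable {hs} {l : ℤ} {χ : Q →* F} {J : Ideal (BiPoly F)} (c : EquivariantComparison K hs l χ J)

/-- The comparison map in degree `n` as a map to functions on the Klein four group. -/
def toKoszulLin (n : ℤ) : K.X n →ₗ[F]
    (KleinFour → (cyclicModule l χ c.polyAct_mem).gr n) where
  toFun x p := ⟨Ideal.Quotient.mk J (c.ψ (DirectSum.lof F ℤ (fun n ↦ (K.X n : Type u)) n
    ((K.X n).ρ (SemidirectProduct.inl p⁻¹) x))), mk_mem_cyclicModule_gr l χ c.polyAct_mem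
      (c.hpart_ψ n _ ((gradedProj_lof _ _ _).trans (if_pos rfl)))⟩
  map_add' x y := by
    funext p
    refine Subtype.ext ?_
    simp only [map_add]
    rfl
  map_smul' a x := by
    funext p
    refine Subtype.ext ?_
    simp only [map_smul]
    rfl

lemma coe_toKoszulLin (n : ℤ) (x : K.X n) (p : KleinFour) :
    (c.toKoszulLin n x p : BiPoly F ⧸ J) = Ideal.Quotient.mk J (c.ψ (DirectSum.lof F ℤ
      (fun n ↦ (K.X n : Type u)) n ((K.X n).ρ (SemidirectProduct.inl p⁻¹) x))) := rfl

lemma toKoszulLin_equivariant (n : ℤ) (g : KleinFour ⋊[φ] Q) (x : K.X n) :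
    c.toKoszulLin n ((K.X n).ρ g x) =
      indRep φ ((cyclicModule l χ c.polyAct_mem).grAct n) g (c.toKoszulLin n x) := by
  funext p
  refine Subtype.ext ?_
  rw [indRep_apply, GradedQModule.coe_grAct, coe_toKoszulLin, coe_toKoszulLin, cyclicModule_act_mk]
  have hm : ∀ (a : F) (f : BiPoly F), a • Ideal.Quotient.mk J f = Ideal.Quotient.mk J (a • f) :=
    fun _ _ ↦ rfl
  rw [hm, ← c.ψ_act, gradedMap_lof, ← Module.End.mul_apply, ← Module.End.mul_apply, ← map_mul,
    ← map_mul]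
  congr 5
  refine SemidirectProduct.ext ?_ ?_
  · simp
  · simp

/-- The condition `ψ(Dv) ∈ J` for `v = 1 ⊗ p⁻¹x` says that `ψ(d p⁻¹x)` equals `Σ xᵢ ψ(wᵢ p⁻¹x)`
modulo `J`, which is the value of the Koszul differential at `p`. -/
lemma toKoszulLin_d (n : ℤ) (x : K.X n) :
    c.toKoszulLin (n + 1) ((K.d n (n + 1)).hom x) =
      (cyclicModule l χ c.polyAct_mem).koszulDLin n (c.toKoszulLin n x) := by
  funext p
  refine Subtype.ext ?_
  rw [coe_toKoszulLin, GradedQModule.coe_koszulDLin]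
  set y := (K.X n).ρ (SemidirectProduct.inl p⁻¹) x with hy
  have hd : (K.X (n + 1)).ρ (SemidirectProduct.inl p⁻¹) ((K.d n (n + 1)).hom x) =
      (K.d n (n + 1)).hom y := (Rep.hom_comm_apply (K.d n (n + 1)) _ x).symm
  have h := c.ψ_D (1 ⊗ₜ[F] DirectSum.lof F ℤ (fun n ↦ (K.X n : Type u)) n y)
  rw [ExteriorComplex.D_tmul, map_add, map_add, ExteriorComplex.polyExt_tmul,
    ExteriorComplex.polyExt_tmul, ExteriorComplex.polyExt_tmul, one_mul, mul_one, mul_one] at h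
  have h' : c.ψ (totalD K (DirectSum.lof F ℤ (fun n ↦ (K.X n : Type u)) n y)) +
    (X 0 * c.ψ (totalW K 0 (DirectSum.lof F ℤ (fun n ↦ (K.X n : Type u)) n y)) +
      X 1 * c.ψ (totalW K 1 (DirectSum.lof F ℤ (fun n ↦ (K.X n : Type u)) n y))) ∈ J := h
  rw [totalD_lof, totalW_lof, totalW_lof, ← Ideal.Quotient.eq_zero_iff_mem, map_add, ← hd] at h'
  have hs : ∀ b b' : BiPoly F ⧸ J, b + b' = 0 → b = b' := fun b b' hb ↦ by
    rw [← sub_eq_of_charTwo F] at hb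
    exact sub_eq_zero.1 hb
  refine (hs _ _ h').trans ?_
  have hg : ∀ g : KleinFour, (c.toKoszulLin n x (g * p) : BiPoly F ⧸ J) =
      Ideal.Quotient.mk J (c.ψ (DirectSum.lof F ℤ (fun n ↦ (K.X n : Type u)) n
        ((K.X n).ρ (SemidirectProduct.inl g) y))) := fun g ↦ by
    rw [coe_toKoszulLin, hy, ← Module.End.mul_apply, ← map_mul, ← map_mul, mul_inv,
      KleinFour.inv_eq g]
  simp only [hg]
  rw [map_add, map_mul, map_mul, Fin.sum_univ_two, extGen_apply, extGen_apply]
  simp only [map_add, mul_add]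
  rfl

/-- The map to the Koszul complex of a cyclic module given by an equivariant comparison. -/
def toKoszul : K ⟶ (cyclicModule l χ c.polyAct_mem).koszul where
  f n := Rep.ofHom (LinearMap.intertwiningMap_of_isIntertwiningMap (K.X n).ρ
    (indRep φ ((cyclicModule l χ c.polyAct_mem).grAct n)) (c.toKoszulLin n)
      (c.toKoszulLin_equivariant n))
  comm' n m hnm := by
    obtain rfl : n + 1 = m := hnm
    refine Rep.hom_ext (Representation.IntertwiningMap.ext (LinearMap.ext fun x ↦ ?_))
    exact (((cyclicModule l χ c.polyAct_mem).koszul_d_apply n (c.toKoszulLin n x)).trans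
      (c.toKoszulLin_d n x).symm)

/-- Only the value at the identity is read, so `evalOne` on the model recovers the comparison map of
`K` modulo `J`. -/
lemma evalOne_baseChange_toKoszul (v : BiPoly F ⊗[F] TotalSpace K) :
    evalOne l χ c.polyAct_mem ((gradedMap fun n ↦
      (c.toKoszul.f n).hom.toLinearMap).baseChange (BiPoly F) v) =
      Ideal.Quotient.mk J (ExteriorComplex.polyExt c.ψ v) := by
  have h : ∀ a, (cyclicModule l χ c.polyAct_mem).totalToFun (gradedMap (fun n ↦
      (c.toKoszul.f n).hom.toLinearMap) a) 1 = Ideal.Quotient.mk J (c.ψ a) := fun a ↦ by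
    refine LinearMap.congr_fun (f := LinearMap.proj 1 ∘ₗ
      (cyclicModule l χ c.polyAct_mem).totalToFun ∘ₗ gradedMap (fun n ↦
      (c.toKoszul.f n).hom.toLinearMap)) (g := (Ideal.Quotient.mkₐ F J).toLinearMap ∘ₗ c.ψ)
      (total_ext fun n x ↦ ?_) a
    rw [LinearMap.comp_apply, LinearMap.comp_apply, gradedMap_lof]
    refine (congrFun ((cyclicModule l χ c.polyAct_mem).totalToFun_koszulLof n
      (c.toKoszulLin n x)) 1).trans ?_
    rw [coe_toKoszulLin, inv_one, map_one, map_one]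
    rfl
  induction v using TensorProduct.induction_on with
  | zero => simp only [map_zero]
  | tmul f a => rw [LinearMap.baseChange_tmul, evalOne_tmul, ExteriorComplex.polyExt_tmul, h, map_mul]
  | add x y hx hy => simp only [map_add, hx, hy]

/-- It suffices to treat twisted homology, which is cyclic with annihilator `J` on both sides.
Injectivity holds because `evalOne` recovers `ψ` modulo `J`; surjectivity because the generator of
`K` goes to a generator of the model. -/
theorem quasiIso_toKoszul (hJ : IsParameterIdeal J) (hQ : Odd (Nat.card Q))
    (hK : Module.Finite F (TotalSpace K)) : QuasiIso c.toKoszul := by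
  have hX := isStrictlyPerfect_koszul_cyclicModule l χ c.polyAct_mem hJ hQ
  obtain ⟨t, ht⟩ := hX.exists_subsingleton
  have := finite_of_odd_card hQ
  obtain ⟨c'⟩ := exists_equivariantComparison_koszul_cyclicModule l χ c.polyAct_mem ht hJ hQ
  obtain ⟨z, hzl, hz, hz1⟩ := c.exists_gen
  obtain ⟨z', hzl', hz', hz1'⟩ := c'.exists_gen
  refine quasiIso_of_twisted hs ht hK (finite_totalSpace _ t ht hX.finite) _ (fun v hv hy ↦ ?_)
    fun v' hv' ↦ ?_
  · obtain ⟨y, hy⟩ := hy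
    refine c.exists_eq_D v hv (Ideal.Quotient.eq_zero_iff_mem.1 ?_)
    rw [← evalOne_baseChange_toKoszul, hy, evalOne_D]
  · set g := (gradedMap fun n ↦ (c.toKoszul.f n).hom.toLinearMap).baseChange (BiPoly F)
    obtain ⟨y, hy⟩ := c'.exists_eq_smul_add hz' hz1' hv'
    have hgz : (totalExt _ t ht).D (g z) = 0 := by
      rw [← ExteriorComplex.baseChange_D (T := totalExt K s hs) (gradedMap_totalD c.toKoszul)
        (gradedMap_totalW c.toKoszul), hz, map_zero]
    obtain ⟨y', hy'⟩ := c'.exists_eq_smul_add hz' hz1' hgz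
    obtain ⟨r, hr⟩ := Ideal.Quotient.mk_surjective (evalOne l χ c.polyAct_mem z')
    set p := ExteriorComplex.polyExt c'.ψ v'
    set p' := ExteriorComplex.polyExt c'.ψ (g z)
    -- Applying `evalOne` to the image of `z` shows that its coefficient `p'` against `z'` is
    -- invertible modulo `J`, with inverse `r`, the value of `evalOne` at `z'`.
    have hJ1 : 1 - p' * r ∈ J := by
      have h := congrArg (evalOne l χ c.polyAct_mem) hy'
      rw [map_add, evalOne_D, add_zero, LinearMap.map_smul, BiPoly.smul_quotient, ← hr, ← map_mul,
        evalOne_baseChange_toKoszul, hz1] at h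
      exact Ideal.Quotient.eq.1 h
    obtain ⟨w, hw⟩ := c'.smul_eq_D hz' hJ1
    refine ⟨(p * r) • z, y + p • w - (p * r) • y', ?_, ?_⟩
    · rw [LinearMap.map_smul, hz, smul_zero]
    · have h1 : g ((p * r) • z) = (p * r) • g z := LinearMap.map_smul _ _ _
      rw [h1]
      exact eq_smul_add_of_eq_smul_add (totalExt _ t ht).D hy hy' hw

end EquivariantComparison

end
end

/-! ### Ext of a complex with an equivariant comparison -/

noncomputable section

open scoped TensorProduct DirectSum
open KleinFour (gen coord)
open MvPolynomial (X C constantCoeff)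

section

variable {F : Type u} [Field F]

lemma hpart_mul_eq_self {f g : BiPoly F} {a b : ℤ} (hf : hpart a f = f) (hg : hpart b g = g) :
    hpart (a + b) (f * g) = f * g := by
  rcases lt_or_ge a 0 with ha | ha
  · rw [← hf, hpart_of_neg ha, zero_mul, map_zero]
  · lift a to ℕ using ha
    rw [hpart_mul (isHomogeneous_iff_hpart.2 hf), add_sub_cancel_left, hg]

variable {A : Type*} [AddCommGroup A] [Module F A] {T : ExteriorComplex F A}

lemma ExteriorComplex.smul_mem_total {a n k : ℤ} {f : BiPoly F} (hf : hpart a f = f)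
    {v : BiPoly F ⊗[F] A} (hv : v ∈ T.total n) (h : a + n = k) : f • v ∈ T.total k := by
  subst h
  induction hv using Submodule.span_induction with
  | mem v hv =>
    obtain ⟨j, p, x, hp, hx, rfl⟩ := hv
    have := tmul_mem_total (T := T) (hpart_mul_eq_self hf hp) hx
    rwa [show a + j + (n - j) = a + n by ring] at this
  | zero => rw [smul_zero]; exact zero_mem _
  | add x y _ _ hx hy => rw [smul_add]; exact add_mem hx hy
  | smul c x _ hx => rw [smul_comm]; exact Submodule.smul_mem _ c hx

end

section CyclicExt

variable {F : Type u} [Field F] {Q : Type u} [Group Q] {φ : Q →* MulAut KleinFour}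
variable {ε : ProjectiveResolution (Rep.trivial F (KleinFour ⋊[φ] Q) F)}

/-- The graded module `Ext^*_{F[P]}(F, K)` over `F[x₀, x₁]` is generated by an element of degree
`l` with annihilator `J`, on which `Q` acts through the character `χ`. -/
structure CyclicExt (θ : CohomologyRingIso ε)
    (K : CochainComplex (Rep.{u} F (KleinFour ⋊[φ] Q)) ℤ) (l : ℤ) (χ : Q →* F)
    (J : Ideal (BiPoly F)) : Prop where
  eq_zero_of_lt (k : ℤ) (hk : k < l) (x : extRep ε K k) : x = 0
  exists_gen : ∃ z : extRep ε K l, (∀ q, (extRep ε K l).ρ q z = χ q • z) ∧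
    (∀ (n : ℕ) (k : ℤ) (h : (n : ℤ) + l = k) (x : extRep ε K k),
      ∃ f, x = extMul ε h z (θ.toExt n f)) ∧
    ∀ (n : ℕ) (k : ℤ) (h : (n : ℤ) + l = k) (f : MvPolynomial.homogeneousSubmodule (Fin 2) F n),
      extMul ε h z (θ.toExt n f) = 0 ↔ f.1 ∈ J

variable [CharP F 2] {K : CochainComplex (Rep.{u} F (KleinFour ⋊[φ] Q)) ℤ}
variable {s : Finset ℤ} {hs : ∀ n ∉ s, Subsingleton (K.X n)}

lemma KoszulComparison.cycleClass_eq (c : KoszulComparison ε) {n : ℤ}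
    {z z' y : BiPoly F ⊗[F] TotalSpace K} (hz : (totalExt K s hs).D z = 0)
    (hz' : (totalExt K s hs).D z' = 0) (hzn : z ∈ (totalExt K s hs).total n)
    (hzn' : z' ∈ (totalExt K s hs).total n) (h : z' = z + (totalExt K s hs).D y) :
    c.cycleClass hs n z' hz' = c.cycleClass hs n z hz := by
  have hy : (totalExt K s hs).D y = z' - z := by rw [h, add_sub_cancel_left]
  have hDy : (totalExt K s hs).D ((totalExt K s hs).D y) = 0 := by rw [hy, map_sub, hz, hz', sub_zero]
  have h0 : c.cycleClass hs n ((totalExt K s hs).D y) hDy = 0 :=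
    (c.cycleClass_eq_zero_iff hs (by rw [hy]; exact sub_mem hzn' hzn)).2 ⟨y, rfl⟩
  subst h
  refine (c.cycleClass_add hs n hz hDy hz').trans ?_
  rw [h0, add_zero]

/-- A twisted cycle is determined up to boundary by its image under `ψ` modulo `J`, so it is a
polynomial multiple of the generator. Nothing occurs below degree `l` because polynomials have no
negative degrees. -/
theorem EquivariantComparison.cyclicExt {l : ℤ} {χ : Q →* F} {J : Ideal (BiPoly F)}
    (e : EquivariantComparison K hs l χ J) (c : KoszulComparison ε) :
    CyclicExt c.cohomologyRingIso K l χ J := by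
  obtain ⟨z, hzl, hz, hz1⟩ := e.exists_gen
  have key : ∀ (k : ℤ) (x : extRep ε K k), ∃ p hp, hpart (k - l) p = p ∧
      x = c.cycleClass hs k (p • z) hp := fun k x ↦ by
    obtain ⟨v, hv, hv', rfl⟩ := c.exists_cycleClass_eq hs x
    obtain ⟨y, hy⟩ := e.exists_eq_smul_add hz hz1 hv'
    have hp := ExteriorComplex.polyExt_mem_hpart e.hpart_ψ hv
    have hpz : (totalExt K s hs).D (ExteriorComplex.polyExt e.ψ v • z) = 0 := by
      rw [map_smul, hz, smul_zero]
    exact ⟨_, hpz, hp, c.cycleClass_eq hpz hv'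
      (ExteriorComplex.smul_mem_total hp hzl (by ring)) hv hy⟩
  refine ⟨fun k hk x ↦ ?_, c.cycleClass hs l z hz, fun q ↦ ?_, fun n k h x ↦ ?_, fun n k h f ↦ ?_⟩
  · obtain ⟨p, hpz, hp, rfl⟩ := key k x
    obtain rfl : p = 0 := by rw [← hp, hpart_of_neg (by lia)]
    refine (c.cycleClass_eq_zero_iff hs ?_).2 ⟨0, by rw [zero_smul, map_zero]⟩
    rw [zero_smul]
    exact zero_mem _
  · have hz' : (totalExt K s hs).D (twistAct K q z) = 0 := by rw [D_twistAct, hz, map_zero]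
    have hχz : (totalExt K s hs).D (χ q • z) = 0 := by
      rw [← IsScalarTower.algebraMap_smul (BiPoly F), map_smul, hz, smul_zero]
    obtain ⟨y, hy⟩ := e.exists_eq_smul_add hz hz1 hz'
    rw [e.polyExt_twistAct, hz1, map_one, smul_assoc, one_smul] at hy
    exact ((c.cycleClass_rep hs q l hz hz').trans (c.cycleClass_eq hχz hz'
      (Submodule.smul_mem _ _ hzl) (twistAct_mem_total K hs q hzl) hy)).trans
      (c.cycleClass_smul hs l (χ q) hz hχz)
  · obtain ⟨p, hpz, hp, rfl⟩ := key k x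
    rw [show k - l = n by lia] at hp
    exact ⟨⟨p, isHomogeneous_iff_hpart.2 hp⟩, (c.cycleClass_extClass hs h hp hz).symm⟩
  · have hf := isHomogeneous_iff_hpart.1 f.2
    have hfz : (totalExt K s hs).D (f.1 • z) = 0 := by rw [map_smul, hz, smul_zero]
    have h1 : extMul ε h (c.cycleClass hs l z hz) (c.cohomologyRingIso.toExt n f) =
      c.cycleClass hs k (f.1 • z) hfz := c.cycleClass_extClass hs h hf hz
    rw [h1, c.cycleClass_eq_zero_iff hs (ExteriorComplex.smul_mem_total hf hzl h)]
    refine ⟨fun ⟨y, hy⟩ ↦ ?_, fun hJ ↦ e.smul_eq_D hz hJ⟩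
    have h2 := e.ψ_D y
    rwa [← hy, map_smul, hz1, smul_eq_mul, mul_one] at h2

lemma EquivariantComparison.isLeast {l : ℤ} {χ : Q →* F} {J : Ideal (BiPoly F)}
    (e : EquivariantComparison K hs l χ J) : IsLeast {i : ℤ | Nontrivial (K.homology i)} l := by
  have hpr : ∀ (m : ℤ) (a : TotalSpace K), (totalExt K s hs).pr m a = a →
      a = DirectSum.lof F ℤ (fun n ↦ (K.X n : Type u)) m (a m) := fun m a h ↦ h.symm
  refine ⟨?_, fun m hm ↦ ?_⟩
  · obtain ⟨a, hal, ha, hab⟩ := e.exists_homology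
    rw [hpr l a hal] at ha hab
    refine (nontrivial_homology_iff (sub_add_cancel l 1) rfl).2
      ⟨a l, totalD_lof_eq_zero_iff.1 ha, fun hy ↦ hab ?_⟩
    exact exists_lof_eq_totalD_iff.2 hy
  · by_contra! hml
    obtain ⟨x, hx, hxy⟩ := (nontrivial_homology_iff (sub_add_cancel m 1) rfl).1 hm
    obtain ⟨b, hb⟩ := e.le_of_homology m _ hml ((gradedProj_lof _ _ _).trans (if_pos rfl))
      (totalD_lof_eq_zero_iff.2 hx)
    exact hxy (exists_lof_eq_totalD_iff.1 ⟨b, hb⟩)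

end CyclicExt
end

/-! ### Change of the ring isomorphism -/

noncomputable section

open scoped TensorProduct DirectSum
open KleinFour (gen coord)
open MvPolynomial (X C constantCoeff)

section Transfer

variable {F : Type u} [Field F] {Q : Type u} [Group Q] {φ : Q →* MulAut KleinFour}
variable {ε : ProjectiveResolution (Rep.trivial F (KleinFour ⋊[φ] Q) F)}

namespace CohomologyRingIso

variable (θ θ' θ'' : CohomologyRingIso ε)

/-- The linear automorphism `θ'⁻¹ θ` of the forms of degree `n`. -/
def transferForm (n : ℕ) : MvPolynomial.homogeneousSubmodule (Fin 2) F n ≃ₗ[F]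
    MvPolynomial.homogeneousSubmodule (Fin 2) F n :=
  (θ.toExt n).trans (θ'.toExt n).symm

lemma toExt_transferForm (n : ℕ) (f : MvPolynomial.homogeneousSubmodule (Fin 2) F n) :
    θ'.toExt n (transferForm θ θ' n f) = θ.toExt n f :=
  (θ'.toExt n).apply_symm_apply _

/-- The automorphism `θ'⁻¹ θ` of the polynomial ring. -/
def transferHom : BiPoly F →ₐ[F] BiPoly F :=
  MvPolynomial.aeval fun i ↦ (transferForm θ θ' 1 ⟨X i, MvPolynomial.isHomogeneous_X F i⟩).1

lemma transferForm_C (a : F) : (transferForm θ θ' 0 ⟨C a, MvPolynomial.isHomogeneous_C _ a⟩).1 = C a := by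
  have h : (⟨C a, MvPolynomial.isHomogeneous_C _ a⟩ : MvPolynomial.homogeneousSubmodule (Fin 2) F 0) =
      a • ⟨1, MvPolynomial.isHomogeneous_one _ _⟩ :=
    Subtype.ext (by rw [Submodule.coe_smul, MvPolynomial.smul_eq_C_mul, mul_one])
  have h1 : transferForm θ θ' 0 ⟨1, MvPolynomial.isHomogeneous_one _ _⟩ =
      ⟨1, MvPolynomial.isHomogeneous_one _ _⟩ :=
    (θ'.toExt 0).injective ((toExt_transferForm θ θ' 0 _).trans (θ.map_one.trans θ'.map_one.symm))
  rw [h, map_smul, h1, Submodule.coe_smul, MvPolynomial.smul_eq_C_mul, mul_one]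

lemma transferForm_add (n : ℕ) (f g : MvPolynomial.homogeneousSubmodule (Fin 2) F n) :
    (transferForm θ θ' n (f + g)).1 = (transferForm θ θ' n f).1 + (transferForm θ θ' n g).1 := by
  rw [map_add, Submodule.coe_add]

lemma transferForm_mul (a b : ℕ) (f : MvPolynomial.homogeneousSubmodule (Fin 2) F a)
    (g : MvPolynomial.homogeneousSubmodule (Fin 2) F b) :
    (transferForm θ θ' (a + b) ⟨f.1 * g.1, MvPolynomial.IsHomogeneous.mul f.2 g.2⟩).1 =
      (transferForm θ θ' a f).1 * (transferForm θ θ' b g).1 := by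
  have h : transferForm θ θ' (a + b) ⟨f.1 * g.1, MvPolynomial.IsHomogeneous.mul f.2 g.2⟩ =
      ⟨(transferForm θ θ' a f).1 * (transferForm θ θ' b g).1,
        MvPolynomial.IsHomogeneous.mul (transferForm θ θ' a f).2 (transferForm θ θ' b g).2⟩ := ?_
  · exact congrArg Subtype.val h
  refine (θ'.toExt (a + b)).injective ?_
  refine ((toExt_transferForm θ θ' (a + b) _).trans (θ.map_mul a b f g)).trans
    (Eq.trans ?_ (θ'.map_mul a b _ _).symm)
  rw [toExt_transferForm, toExt_transferForm]

lemma transferHom_X (i : Fin 2) : transferHom θ θ' (X i) =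
    (transferForm θ θ' 1 ⟨X i, MvPolynomial.isHomogeneous_X F i⟩).1 :=
  MvPolynomial.aeval_X _ i

lemma isHomogeneous_transferHom_X (i : Fin 2) : (transferHom θ θ' (X i)).IsHomogeneous 1 := by
  rw [transferHom_X]
  exact (transferForm θ θ' 1 ⟨X i, MvPolynomial.isHomogeneous_X F i⟩).2

/-- The degreewise maps `θ'⁻¹θ` are multiplicative and unital, so they assemble to the algebra map
determined by the images of the variables. The induction runs over all components at once. -/
lemma transferForm_hpart (f : BiPoly F) (n : ℕ) :
    (transferForm θ θ' n ⟨hpart n f, isHomogeneous_hpart n f⟩).1 =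
      hpart n (transferHom θ θ' f) := by
  have hz : ∀ (n : ℕ) (p : BiPoly F) (hp : p.IsHomogeneous n), p = 0 →
      (transferForm θ θ' n ⟨p, hp⟩).1 = 0 := by
    rintro n p hp rfl
    exact congrArg Subtype.val (map_zero (transferForm θ θ' n))
  have he : ∀ (n : ℕ) (p p' : BiPoly F) (hp : p.IsHomogeneous n) (hp' : p'.IsHomogeneous n),
      p = p' → (transferForm θ θ' n ⟨p, hp⟩).1 = (transferForm θ θ' n ⟨p', hp'⟩).1 := by
    rintro n p p' hp hp' rfl
    rfl
  induction f using MvPolynomial.induction_on generalizing n with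
  | C a =>
    have hC : transferHom θ θ' (C a) = C a := (transferHom θ θ').commutes a
    have h := hpart_of_isHomogeneous (MvPolynomial.isHomogeneous_C (Fin 2) a) n
    rw [hC]
    rcases Nat.eq_zero_or_pos n with rfl | hn
    · rw [if_pos (by simp)] at h
      exact (he 0 _ _ _ _ h).trans ((transferForm_C θ θ' a).trans h.symm)
    · rw [if_neg (by simpa using hn.ne')] at h
      exact (hz n _ _ h).trans h.symm
  | add f g hf hg =>
    have h1 : (transferForm θ θ' n ⟨_, isHomogeneous_hpart n f⟩).1 +
        (transferForm θ θ' n ⟨_, isHomogeneous_hpart n g⟩).1 =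
        hpart n (transferHom θ θ' (f + g)) := by
      rw [hf n, hg n, map_add, map_add]
    refine Eq.trans ?_ h1
    exact (he n _ _ _ ((isHomogeneous_hpart n f).add (isHomogeneous_hpart n g))
      (map_add (hpart (F := F) n) f g)).trans (transferForm_add θ θ' n
        ⟨_, isHomogeneous_hpart n f⟩ ⟨_, isHomogeneous_hpart n g⟩)
  | mul_X f i hf =>
    have h1 := hpart_mul (isHomogeneous_transferHom_X θ θ' i) n (transferHom θ θ' f)
    have h2 := hpart_mul (MvPolynomial.isHomogeneous_X F i) n f
    rw [mul_comm, ← _root_.map_mul] at h1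
    rw [mul_comm] at h2
    rcases n with _ | n
    · rw [hpart_of_neg (k := ((0 : ℕ) : ℤ) - (1 : ℕ)) (by lia), mul_zero] at h1 h2
      exact (hz 0 _ _ h2).trans h1.symm
    · rw [show ((n + 1 : ℕ) : ℤ) - (1 : ℕ) = n by simp] at h1 h2
      rw [mul_comm (X i) (hpart _ _)] at h2
      refine (he (n + 1) _ _ _ ((isHomogeneous_hpart n f).mul (MvPolynomial.isHomogeneous_X F i))
        h2).trans (Eq.trans (transferForm_mul θ θ' n 1 ⟨_, isHomogeneous_hpart n f⟩
          ⟨_, MvPolynomial.isHomogeneous_X F i⟩) ?_)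
      rw [h1, mul_comm, ← transferHom_X]
      exact congrArg (_ * ·) (hf n)

lemma transferForm_eq_transferHom (n : ℕ) (f : MvPolynomial.homogeneousSubmodule (Fin 2) F n) :
    (transferForm θ θ' n f).1 = transferHom θ θ' f.1 := by
  have h : ∀ k : ℕ, hpart k (transferHom θ θ' f.1) =
      if (k : ℤ) = n then (transferForm θ θ' n f).1 else 0 := fun k ↦ by
    rw [← transferForm_hpart]
    have hk := hpart_of_isHomogeneous f.2 k
    split_ifs with h
    · obtain rfl : k = n := by exact_mod_cast h
      rw [if_pos rfl] at hk
      exact congrArg (fun x ↦ (transferForm θ θ' k x).1) (Subtype.ext hk)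
    · rw [if_neg h] at hk
      exact congrArg Subtype.val ((congrArg (transferForm θ θ' k) (Subtype.ext hk)).trans
        (map_zero (transferForm θ θ' k)))
  refine sub_eq_zero.1 (eq_zero_of_hpart fun k ↦ ?_)
  rw [map_sub, h, hpart_of_isHomogeneous (transferForm θ θ' n f).2, sub_self]

lemma isHomogeneous_transferHom {n : ℕ} {f : BiPoly F} (hf : f.IsHomogeneous n) :
    (transferHom θ θ' f).IsHomogeneous n := by
  rw [← transferForm_eq_transferHom θ θ' n ⟨f, hf⟩]
  exact (transferForm θ θ' n ⟨f, hf⟩).2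

lemma toExt_transferHom {n : ℕ} {f : BiPoly F} (hf : f.IsHomogeneous n) :
    θ'.toExt n ⟨transferHom θ θ' f, isHomogeneous_transferHom θ θ' hf⟩ = θ.toExt n ⟨f, hf⟩ :=
  (congrArg (θ'.toExt n) (Subtype.ext (transferForm_eq_transferHom θ θ' n ⟨f, hf⟩).symm)).trans
    (toExt_transferForm θ θ' n ⟨f, hf⟩)

lemma transferHom_transferHom (f : BiPoly F) : transferHom θ' θ (transferHom θ θ' f) = f := by
  refine AlgHom.congr_fun (φ₁ := (transferHom θ' θ).comp (transferHom θ θ'))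
    (φ₂ := AlgHom.id F _) (MvPolynomial.algHom_ext fun i ↦ ?_) f
  have hX := isHomogeneous_transferHom_X θ θ' i
  exact congrArg Subtype.val ((θ.toExt 1).injective ((toExt_transferHom θ' θ hX).trans
    (toExt_transferHom θ θ' (MvPolynomial.isHomogeneous_X F i))))

lemma transferHom_polyAct (q : Q) (f : BiPoly F) :
    transferHom θ θ' (polyAct φ q f) = polyAct φ q (transferHom θ θ' f) := by
  refine AlgHom.congr_fun (φ₁ := (transferHom θ θ').comp (polyAct φ q))
    (φ₂ := (polyAct φ q).comp (transferHom θ θ')) (MvPolynomial.algHom_ext fun i ↦ ?_) f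
  have hX := MvPolynomial.isHomogeneous_X F i
  have h1 := toExt_transferHom θ θ' (polyAct_isHomogeneous φ q hX)
  have h2 := θ'.map_act q 1 ⟨_, isHomogeneous_transferHom θ θ' hX⟩
  have h3 := congrArg ((extRep ε ε.cochainComplex (1 : ℕ)).ρ q) (toExt_transferHom θ θ' hX)
  exact congrArg Subtype.val ((θ'.toExt 1).injective
    ((h1.trans (θ.map_act q 1 ⟨X i, hX⟩)).trans (h2.trans h3).symm))

/-- The automorphism `θ'⁻¹ θ` of the polynomial ring. -/
def transfer : BiPoly F ≃ₐ[F] BiPoly F :=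
  AlgEquiv.ofAlgHom (transferHom θ θ') (transferHom θ' θ)
    (AlgHom.ext (transferHom_transferHom θ' θ)) (AlgHom.ext (transferHom_transferHom θ θ'))

end CohomologyRingIso

lemma IsParameterIdeal.map {J : Ideal (BiPoly F)} (hJ : IsParameterIdeal J)
    (e : BiPoly F ≃ₐ[F] BiPoly F) (he : ∀ n f, f.IsHomogeneous n → (e f).IsHomogeneous n) :
    IsParameterIdeal (J.map e) := by
  obtain ⟨⟨f, g, a, b, ha, hb, hf, hg, rfl⟩, hfin⟩ := hJ
  refine ⟨⟨e f, e g, a, b, ha, hb, he _ _ hf, he _ _ hg, ?_⟩, ?_⟩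
  · rw [Ideal.map_span, Set.image_pair]
  · exact Module.Finite.equiv (Ideal.quotientEquivAlg _ _ e rfl).toLinearEquiv

/-- The bijection of the invariant parameter ideals given by the automorphism `θ'⁻¹ θ`. -/
def transferIdeal (θ θ' : CohomologyRingIso ε) (J : InvariantParameterIdeal F φ) :
    InvariantParameterIdeal F φ :=
  ⟨J.1.map (θ.transfer θ'), J.2.1.map _ fun _ _ ↦ θ.isHomogeneous_transferHom θ', fun q f hf ↦ by
    obtain ⟨g, hg, rfl⟩ := (Ideal.mem_map_of_equiv (θ.transfer θ') _).1 hf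
    exact (Ideal.mem_map_of_equiv (θ.transfer θ') _).2
      ⟨_, J.2.2 q g hg, θ.transferHom_polyAct θ' q g⟩⟩

lemma transferHom_mem_transferIdeal_iff (θ θ' : CohomologyRingIso ε) {J : InvariantParameterIdeal F φ}
    {f : BiPoly F} : θ.transferHom θ' f ∈ (transferIdeal θ θ' J).1 ↔ f ∈ J.1 := by
  refine ⟨fun h ↦ ?_, fun h ↦ (Ideal.mem_map_of_equiv (θ.transfer θ') _).2 ⟨f, h, rfl⟩⟩
  obtain ⟨g, hg, h⟩ := (Ideal.mem_map_of_equiv (θ.transfer θ') _).1 h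
  rwa [← (θ.transfer θ').injective h]

lemma transferIdeal_transferIdeal (θ θ' : CohomologyRingIso ε) (J : InvariantParameterIdeal F φ) :
    transferIdeal θ θ' (transferIdeal θ' θ J) = J := by
  refine Subtype.ext (Ideal.ext fun f ↦ ?_)
  rw [← θ'.transferHom_transferHom θ f, transferHom_mem_transferIdeal_iff,
    transferHom_mem_transferIdeal_iff, θ'.transferHom_transferHom θ f]

/-- The generator, its degree and its character do not involve the ring isomorphism; only the naming
of ring elements changes, and with it the annihilator. -/
lemma CyclicExt.transfer {θ θ' : CohomologyRingIso ε}
    {K : CochainComplex (Rep.{u} F (KleinFour ⋊[φ] Q)) ℤ} {l : ℤ} {χ : Q →* F}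
    {J : InvariantParameterIdeal F φ} (h : CyclicExt θ K l χ J.1) :
    CyclicExt θ' K l χ (transferIdeal θ θ' J).1 := by
  obtain ⟨h0, z, hz, h1, h2⟩ := h
  refine ⟨h0, z, hz, fun n k hk x ↦ ?_, fun n k hk f ↦ ?_⟩
  · obtain ⟨f, rfl⟩ := h1 n k hk x
    exact ⟨_, congrArg (extMul ε hk z) (θ.toExt_transferHom θ' f.2).symm⟩
  · have hf := θ'.toExt_transferHom θ f.2
    have h3 := (congrArg (fun y ↦ extMul ε hk z y = 0) hf.symm).to_iff.trans (h2 n k hk ⟨_, _⟩)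
    refine h3.trans ?_
    rw [← transferHom_mem_transferIdeal_iff θ θ']
    exact (congrArg (· ∈ (transferIdeal θ θ' J).1) (θ'.transferHom_transferHom θ f.1)).to_iff



end Transfer
end

/-! ### Quasi-isomorphism invariance and one-dimensional representations -/

noncomputable section

open scoped TensorProduct DirectSum
open KleinFour (gen coord)
open MvPolynomial (X C constantCoeff)

section QuasiIso

variable {F : Type u} [Field F] {G : Type v} [Group G]

lemma nonempty_homology_iso {K L : CochainComplex (Rep.{u} F G) ℤ}
    (h : quasiIsoSetoid F G K L) (n : ℤ) : Nonempty (K.homology n ≅ L.homology n) := by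
  induction (h : Relation.EqvGen _ K L) with
  | rel K L h =>
    obtain ⟨f, _⟩ := h
    exact ⟨isoOfQuasiIsoAt f n⟩
  | refl K => exact ⟨Iso.refl _⟩
  | symm K L _ h => exact ⟨h.some.symm⟩
  | trans K L M _ _ h h' => exact ⟨h.some ≪≫ h'.some⟩

/-- The linear equivalence underlying an isomorphism of representations. -/
def Rep.linearEquivOfIso {X Y : Rep.{u} F G} (e : X ≅ Y) : X ≃ₗ[F] Y :=
  LinearEquiv.ofLinearMap e.hom.hom.toLinearMap e.inv.hom.toLinearMap
    (LinearMap.ext fun x ↦ congrArg (fun f : Y ⟶ Y ↦ f.hom x) e.inv_hom_id)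
    (LinearMap.ext fun x ↦ congrArg (fun f : X ⟶ X ↦ f.hom x) e.hom_inv_id)

lemma finrank_homology_eq {K L : CochainComplex (Rep.{u} F G) ℤ} (h : quasiIsoSetoid F G K L) :
    Module.finrank F (⨁ n, (K.homology n : Type u)) =
      Module.finrank F (⨁ n, (L.homology n : Type u)) :=
  (DFinsupp.mapRange.linearEquiv fun n ↦
    Rep.linearEquivOfIso (nonempty_homology_iso h n).some).finrank_eq

lemma nontrivial_homology_congr {K L : CochainComplex (Rep.{u} F G) ℤ}
    (h : quasiIsoSetoid F G K L) (n : ℤ) : Nontrivial (K.homology n) ↔ Nontrivial (L.homology n) :=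
  (Rep.linearEquivOfIso (nonempty_homology_iso h n).some).toEquiv.nontrivial_congr

end QuasiIso

section OneDim

variable {F : Type u} [Field F] {Q : Type u} [Group Q]

/-- The determinant character of a representation. -/
def Rep.character (V : Rep.{u} F Q) : Q →* F :=
  (LinearMap.det : (V →ₗ[F] V) →* F).comp V.ρ

lemma Rep.character_eq {V : Rep.{u} F Q} (hV : Module.finrank F V = 1) {χ : Q →* F}
    (h : ∀ q x, V.ρ q x = χ q • x) : V.character = χ := by
  ext q
  have h1 : V.ρ q = χ q • LinearMap.id := LinearMap.ext fun x ↦ h q x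
  change LinearMap.det (V.ρ q) = χ q
  rw [h1, LinearMap.det_smul, hV, pow_one, LinearMap.det_id, mul_one]

lemma Rep.ρ_eq_character {V : Rep.{u} F Q} (hV : Module.finrank F V = 1) (q : Q) (x : V) :
    V.ρ q x = V.character q • x := by
  obtain ⟨v, hv, hvw⟩ := finrank_eq_one_iff'.1 hV
  obtain ⟨c, hc⟩ := hvw (V.ρ q v)
  have h : V.ρ q = c • LinearMap.id := LinearMap.ext fun x ↦ by
    obtain ⟨a, rfl⟩ := hvw x
    rw [map_smul, ← hc, LinearMap.smul_apply, LinearMap.id_apply, smul_comm]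
  have h' : V.character q = c := by
    change LinearMap.det (V.ρ q) = c
    rw [h, LinearMap.det_smul, hV, pow_one, LinearMap.det_id, mul_one]
  rw [h', h]
  rfl

/-- On a one-dimensional space the group acts by the scalar `character`, so every linear isomorphism
between spaces with equal characters is equivariant. -/
lemma OneDimRep.mk_eq_mk_iff {V W : OneDimRep.{u} F Q} :
    (Quotient.mk _ V : Quotient (OneDimRep.setoid F Q)) = Quotient.mk _ W ↔
      V.1.character = W.1.character := by
  rw [Quotient.eq]
  constructor
  · rintro ⟨e⟩
    refine Rep.character_eq V.2 fun q x ↦ (Rep.linearEquivOfIso e).injective ?_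
    refine (Rep.hom_comm_apply e.hom q x).trans ((Rep.ρ_eq_character W.2 q _).trans ?_)
    exact (map_smul (Rep.linearEquivOfIso e) _ x).symm
  · intro h
    obtain ⟨V, hV⟩ := V
    obtain ⟨W, hW⟩ := W
    have : FiniteDimensional F V := Module.finite_of_finrank_eq_succ hV
    have : FiniteDimensional F W := Module.finite_of_finrank_eq_succ hW
    let e : V ≃ₗ[F] W := LinearEquiv.ofFinrankEq _ _ (hV.trans hW.symm)
    refine ⟨Rep.mkIso (Representation.Equiv.mk e fun q ↦ LinearMap.ext fun x ↦ ?_)⟩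
    rw [LinearMap.comp_apply, LinearMap.comp_apply, Rep.ρ_eq_character hV, map_smul]
    refine (congrArg (· • e x) (DFunLike.congr_fun h q)).trans ?_
    exact (Rep.ρ_eq_character hW q (e x)).symm

/-- The one-dimensional representation given by a character. -/
def OneDimRep.ofCharacter (χ : Q →* F) : OneDimRep.{u} F Q :=
  ⟨Rep.of (((Algebra.lmul F F : F →ₐ[F] Module.End F F) : F →* Module.End F F).comp χ), Module.finrank_self F⟩

lemma OneDimRep.character_ofCharacter (χ : Q →* F) :
    (OneDimRep.ofCharacter χ).1.character = χ :=
  Rep.character_eq (OneDimRep.ofCharacter χ).2 fun _ _ ↦ rfl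

end OneDim

section CyclicExt

variable {F : Type u} [Field F] {Q : Type u} [Group Q] {φ : Q →* MulAut KleinFour}
variable {ε : ProjectiveResolution (Rep.trivial F (KleinFour ⋊[φ] Q) F)}
variable {θ : CohomologyRingIso ε} {K L : CochainComplex (Rep.{u} F (KleinFour ⋊[φ] Q)) ℤ}
  {l : ℤ} {χ : Q →* F} {J : Ideal (BiPoly F)}

namespace CyclicExt

lemma of_linearEquiv (h : CyclicExt θ K l χ J) (e : ∀ n, extRep ε K n ≃ₗ[F] extRep ε L n)
    (hρ : ∀ n q x, (extRep ε L n).ρ q (e n x) = e n ((extRep ε K n).ρ q x))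
    (hmul : ∀ (n k m : ℤ) (h : n + k = m) x y,
      e m (extMul ε h x y) = extMul ε h (e k x) y) : CyclicExt θ L l χ J := by
  obtain ⟨h0, z, hz, h1, h2⟩ := h
  refine ⟨fun k hk x ↦ ?_, e l z, fun q ↦ ?_, fun n k hk x ↦ ?_, fun n k hk f ↦ ?_⟩
  · rw [← (e k).apply_symm_apply x, h0 k hk ((e k).symm x), map_zero]
  · rw [hρ, hz, map_smul]
  · obtain ⟨f, hf⟩ := h1 n k hk ((e k).symm x)
    exact ⟨f, by rw [← hmul, ← hf, LinearEquiv.apply_symm_apply]⟩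
  · rw [← hmul, LinearEquiv.map_eq_zero_iff, h2]

lemma extMul_toExt_one {k : ℤ} (h : ((0 : ℕ) : ℤ) + k = k) (x : extRep ε K k) :
    extMul ε h x (θ.toExt 0 ⟨1, MvPolynomial.isHomogeneous_one _ _⟩) = x :=
  (congrArg (extMul ε h x) (θ.map_one.trans homClass_id.symm)).trans
    (homClass_id_homCohomologyComp x)

lemma exists_smul_eq (h : CyclicExt θ K l χ J) (h1J : 1 ∉ J) :
    ∃ z : extRep ε K l, z ≠ 0 ∧ (∀ q, (extRep ε K l).ρ q z = χ q • z) ∧ ∀ x, ∃ a : F, a • z = x := by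
  obtain ⟨h0, z, hz, h1, h2⟩ := h
  have h : ((0 : ℕ) : ℤ) + l = l := zero_add l
  refine ⟨z, ?_, hz, fun x ↦ ?_⟩
  · rintro rfl
    refine h1J ((h2 0 l h ⟨1, MvPolynomial.isHomogeneous_one _ _⟩).1 ?_)
    rw [map_zero, LinearMap.zero_apply]
  · obtain ⟨f, rfl⟩ := h1 0 l h x
    have hf := isHomogeneous_iff_hpart.1 f.2
    rw [hpart_natCast, MvPolynomial.homogeneousComponent_zero] at hf
    have hf' : f = MvPolynomial.coeff 0 f.1 • ⟨1, MvPolynomial.isHomogeneous_one _ _⟩ :=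
      Subtype.ext (by rw [Submodule.coe_smul, MvPolynomial.smul_eq_C_mul, mul_one, hf])
    refine ⟨MvPolynomial.coeff 0 f.1, ?_⟩
    rw [hf', map_smul, map_smul, extMul_toExt_one h z, ← hf']

lemma finrank_eq_one (h : CyclicExt θ K l χ J) (h1J : 1 ∉ J) :
    Module.finrank F (extRep ε K l) = 1 := by
  obtain ⟨z, hz0, _, hz⟩ := h.exists_smul_eq h1J
  exact finrank_eq_one_iff'.2 ⟨z, hz0, hz⟩

lemma character_eq (h : CyclicExt θ K l χ J) (h1J : 1 ∉ J) : (extRep ε K l).character = χ := by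
  obtain ⟨z, hz0, hzχ, hz⟩ := h.exists_smul_eq h1J
  refine Rep.character_eq (h.finrank_eq_one h1J) fun q x ↦ ?_
  obtain ⟨a, rfl⟩ := hz x
  rw [map_smul, hzχ, smul_comm]

/-- Over a commutative ring the annihilator of a cyclic module is that of its generator. The set is
defined through homogeneous components, so homogeneity of `J` is used to pass to components and
back. -/
theorem annihilatorSet_eq (h : CyclicExt θ K l χ J) (hJ : IsParameterIdeal J) :
    (J : Set (BiPoly F)) = annihilatorSet θ K := by
  obtain ⟨h0, z, hz, h1, h2⟩ := h
  have hs : ∀ (n : ℕ) (s : BiPoly F), s ∈ J → MvPolynomial.homogeneousComponent n s ∈ J :=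
    fun n s hs ↦ by
      rw [← hpart_natCast]
      exact hJ.hpart_mem hs n
  ext s
  refine ⟨fun hsJ n k m ↦ ?_, fun hsJ ↦ ?_⟩
  · rcases lt_or_ge k l with hk | hk
    · rw [h0 k hk m, map_zero, LinearMap.zero_apply]
    · obtain ⟨a, rfl⟩ : ∃ a : ℕ, k = a + l := ⟨(k - l).toNat, by lia⟩
      obtain ⟨g, rfl⟩ := h1 a _ rfl m
      refine (homCohomologyComp_assoc (by push_cast; ring : (n : ℤ) + a = ((a + n : ℕ) : ℤ)) rfl
        (by push_cast; ring) rfl (θ.toExt n _) (θ.toExt a g) z).symm.trans ?_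
      refine (congrArg (extMul ε (by push_cast; ring) z) (θ.map_mul a n g _).symm).trans ?_
      exact (h2 (a + n) _ _ _).2 (J.mul_mem_left _ (hs n s hsJ))
  · rw [SetLike.mem_coe, ← MvPolynomial.sum_homogeneousComponent s]
    exact Submodule.sum_mem _ fun n _ ↦ (h2 n _ rfl _).1 (hsJ n l z)

variable (ε) in
/-- The map on `Ext` induced by a quasi-isomorphism. -/
def extEquiv (f : K ⟶ L) [QuasiIso f] (n : ℤ) : extRep ε K n ≃ₗ[F] extRep ε L n :=
  have := isKProjective_resP φ ε.cochainComplex 0 fun _ ↦ inferInstance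
  have := quasiIso_resPMap (φ := φ) f
  LinearEquiv.ofBijective (homCohomologyComp (add_zero n) (homClass f))
    (bijective_homClass_homCohomologyComp f n)

/-- The resolution is K-projective over `P`, so composition with `f` is bijective on Ext. It
respects products by associativity, and the `Q`-action because the class of a map over the full
group is `Q`-invariant. -/
lemma congr_quasiIso (f : K ⟶ L) [QuasiIso f] : CyclicExt θ K l χ J ↔ CyclicExt θ L l χ J := by
  have hρ : ∀ n q x, (extRep ε L n).ρ q (extEquiv ε f n x) =
      extEquiv ε f n ((extRep ε K n).ρ q x) := fun n q x ↦
    (homCohomologyRep_homCohomologyComp (add_zero n) q (homClass f) x).trans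
      (congrArg (fun y ↦ homCohomologyComp (add_zero n) y (homCohomologyRep _ K n q x))
        (homCohomologyRep_homClass q f))
  have hmul : ∀ (n k m : ℤ) (h : n + k = m) x y,
      extEquiv ε f m (extMul ε h x y) = extMul ε h (extEquiv ε f k x) y := fun _ k m h x y ↦
    homCohomologyComp_assoc h (add_zero k) (add_zero m) h y x (homClass f)
  refine ⟨fun h ↦ h.of_linearEquiv _ hρ hmul, fun h ↦ h.of_linearEquiv
    (fun n ↦ (extEquiv ε f n).symm) (fun n q x ↦ ?_) fun n k m h x y ↦ ?_⟩
  · rw [LinearEquiv.eq_symm_apply, ← hρ, LinearEquiv.apply_symm_apply]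
  · rw [LinearEquiv.symm_apply_eq, hmul, LinearEquiv.apply_symm_apply]

lemma congr (h : quasiIsoSetoid F _ K L) : CyclicExt θ K l χ J ↔ CyclicExt θ L l χ J := by
  induction (h : Relation.EqvGen _ K L) with
  | rel K L h =>
    obtain ⟨f, _⟩ := h
    exact congr_quasiIso f
  | refl K => exact Iff.rfl
  | symm K L _ h => exact h.symm
  | trans K L M _ _ h h' => exact h.trans h'

end CyclicExt

end CyclicExt
end

/-! ### The classification -/

noncomputable section

open scoped TensorProduct DirectSum
open KleinFour (gen coord)
open MvPolynomial (X C constantCoeff)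

section Classification

lemma quasiIsoSetoid_of_quasiIso {F : Type u} [Field F] {G : Type v} [Group G]
    {K L : CochainComplex (Rep.{u} F G) ℤ} (f : K ⟶ L) (h : QuasiIso f) :
    quasiIsoSetoid F G K L :=
  Relation.EqvGen.rel _ _ ⟨f, h⟩

variable {F : Type u} [Field F] {Q : Type u} [Group Q] {φ : Q →* MulAut KleinFour}
variable {ε : ProjectiveResolution (Rep.trivial F (KleinFour ⋊[φ] Q) F)}

/-- The invariants attached to a perfect complex with four-dimensional homology. -/
def HasInvariants (θ : CohomologyRingIso ε) (K : FourDimPerfect.{u} F (KleinFour ⋊[φ] Q)) (l : ℤ)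
    (L : Quotient (OneDimRep.setoid.{u} F Q)) (J : InvariantParameterIdeal F φ) : Prop :=
  IsLeast {i : ℤ | Nontrivial (K.1.homology i)} l ∧
    (∃ h : Module.finrank F (extRep ε K.1 l) = 1,
      L = Quotient.mk _ (⟨extRep ε K.1 l, h⟩ : OneDimRep F Q)) ∧
    (J.1 : Set (MvPolynomial (Fin 2) F)) = annihilatorSet θ K.1

lemma HasInvariants.unique {θ : CohomologyRingIso ε}
    {K : FourDimPerfect.{u} F (KleinFour ⋊[φ] Q)} {l l' : ℤ}
    {L L' : Quotient (OneDimRep.setoid.{u} F Q)} {J J' : InvariantParameterIdeal F φ}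
    (h : HasInvariants θ K l L J) (h' : HasInvariants θ K l' L' J') : l = l' ∧ L = L' ∧ J = J' := by
  obtain ⟨hl, ⟨h1, hL⟩, hJ⟩ := h
  obtain ⟨hl', ⟨h1', hL'⟩, hJ'⟩ := h'
  obtain rfl := hl.unique hl'
  exact ⟨rfl, hL.trans hL'.symm, Subtype.ext (SetLike.coe_injective (hJ.trans hJ'.symm))⟩

variable [CharP F 2]

/-- The perfect complex given by a degree, a character and an invariant parameter ideal. -/
def modelComplex (hQ : Odd (Nat.card Q)) (l : ℤ) (χ : Q →* F) (J : InvariantParameterIdeal F φ) :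
    FourDimPerfect.{u} F (KleinFour ⋊[φ] Q) :=
  ⟨(cyclicModule l χ J.2.2).koszul,
    ⟨_, isStrictlyPerfect_koszul_cyclicModule l χ J.2.2 J.2.1 hQ, (quasiIsoSetoid F _).refl _⟩,
    finrank_homology_koszul_cyclicModule l χ J.2.2 J.2.1⟩

lemma isLeast_and_cyclicExt_modelComplex (hQ : Odd (Nat.card Q)) (c : KoszulComparison ε) (l : ℤ)
    (χ : Q →* F) (J : InvariantParameterIdeal F φ) :
    IsLeast {i : ℤ | Nontrivial ((modelComplex hQ l χ J).1.homology i)} l ∧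
      CyclicExt c.cohomologyRingIso (modelComplex hQ l χ J).1 l χ J.1 := by
  obtain ⟨s, hs⟩ := (isStrictlyPerfect_koszul_cyclicModule l χ J.2.2 J.2.1 hQ).exists_subsingleton
  obtain ⟨e⟩ := exists_equivariantComparison_koszul_cyclicModule l χ J.2.2 hs J.2.1 hQ
  exact ⟨e.isLeast, e.cyclicExt c⟩

/-- A strictly perfect representative has an equivariant comparison, and this is a quasi-isomorphism
to the corresponding model. -/
theorem exists_modelComplex (hQ : Odd (Nat.card Q)) (K : FourDimPerfect.{u} F (KleinFour ⋊[φ] Q)) :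
    ∃ (l : ℤ) (χ : Q →* F) (J : InvariantParameterIdeal F φ), modelComplex hQ l χ J ≈ K := by
  obtain ⟨C, ⟨K, hK, hKC⟩, hdim⟩ := K
  have := finite_of_odd_card hQ
  obtain ⟨s, hs⟩ := hK.exists_subsingleton
  obtain ⟨l, χ, J, hJ, ⟨e⟩⟩ := hK.exists_equivariantComparison hQ
    ((finrank_homology_eq hKC).trans hdim) hs
  exact ⟨l, χ, ⟨J, hJ, e.polyAct_mem⟩, (quasiIsoSetoid F _).trans ((quasiIsoSetoid F _).symm
    (quasiIsoSetoid_of_quasiIso _ (e.quasiIso_toKoszul hJ hQ (finite_totalSpace K s hs hK.finite))))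
    hKC⟩

lemma hasInvariants_of_equiv_modelComplex (hQ : Odd (Nat.card Q)) (c : KoszulComparison ε)
    (θ : CohomologyRingIso ε) {l : ℤ} {χ : Q →* F} {J : InvariantParameterIdeal F φ}
    {K : FourDimPerfect.{u} F (KleinFour ⋊[φ] Q)} (h : modelComplex hQ l χ J ≈ K) :
    HasInvariants θ K l (Quotient.mk _ (OneDimRep.ofCharacter χ))
      (transferIdeal c.cohomologyRingIso θ J) := by
  obtain ⟨hl, hE⟩ := isLeast_and_cyclicExt_modelComplex hQ c l χ J
  have hE' := ((CyclicExt.congr h).1 hE).transfer (θ' := θ)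
  have hJ := (transferIdeal c.cohomologyRingIso θ J).2.1
  refine ⟨?_, ⟨hE'.finrank_eq_one hJ.one_notMem, OneDimRep.mk_eq_mk_iff.2 ?_⟩,
    hE'.annihilatorSet_eq hJ⟩
  · have hs : {i : ℤ | Nontrivial (K.1.homology i)} =
        {i : ℤ | Nontrivial ((modelComplex hQ l χ J).1.homology i)} :=
      Set.ext fun i ↦ (nontrivial_homology_congr h i).symm
    rwa [hs]
  · exact (OneDimRep.character_ofCharacter χ).trans (hE'.character_eq hJ.one_notMem).symm

/-- The inverse map, from triples to models, is the one constructed. It is injective because the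
invariants recover the triple, and surjective because every complex is equivalent to a model. -/
theorem bijective_modelComplex (hQ : Odd (Nat.card Q)) (θ : CohomologyRingIso ε) :
    ∃ Φ : Quotient (FourDimPerfect.setoid.{u} F (KleinFour ⋊[φ] Q)) ≃
        ℤ × Quotient (OneDimRep.setoid.{u} F Q) × InvariantParameterIdeal F φ,
      ∀ (K : FourDimPerfect.{u} F (KleinFour ⋊[φ] Q)),
        HasInvariants θ K (Φ (Quotient.mk _ K)).1 (Φ (Quotient.mk _ K)).2.1
          (Φ (Quotient.mk _ K)).2.2 := by
  obtain ⟨c⟩ := nonempty_koszulComparison ε hQ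
  -- Models are labelled by their annihilators for the Koszul ring isomorphism, so the ideal is
  -- first transferred from `θ`; transferring back then gives the annihilator for `θ`.
  let Ψ : ℤ × Quotient (OneDimRep.setoid.{u} F Q) × InvariantParameterIdeal F φ →
      Quotient (FourDimPerfect.setoid.{u} F (KleinFour ⋊[φ] Q)) := fun t ↦
    Quotient.mk _ (modelComplex hQ t.1 t.2.1.out.1.character
      (transferIdeal θ c.cohomologyRingIso t.2.2))
  have hΨ : ∀ t K, Ψ t = Quotient.mk _ K → HasInvariants θ K t.1 t.2.1 t.2.2 := fun t K h ↦ by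
    have h1 := hasInvariants_of_equiv_modelComplex hQ c θ (Quotient.exact h)
    rw [transferIdeal_transferIdeal] at h1
    have h2 : Quotient.mk _ (OneDimRep.ofCharacter t.2.1.out.1.character) = t.2.1 :=
      (OneDimRep.mk_eq_mk_iff.2 (OneDimRep.character_ofCharacter _)).trans (Quotient.out_eq _)
    rwa [h2] at h1
  have hbij : Function.Bijective Ψ := by
    refine ⟨fun t t' h ↦ ?_, fun x ↦ ?_⟩
    · obtain ⟨h1, h2, h3⟩ := (hΨ t _ h).unique (hΨ t' _ rfl)
      exact Prod.ext h1 (Prod.ext h2 h3)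
    · obtain ⟨K, rfl⟩ := Quotient.exists_rep x
      obtain ⟨l, χ, J, h⟩ := exists_modelComplex hQ K
      refine ⟨(l, Quotient.mk _ (OneDimRep.ofCharacter χ), transferIdeal c.cohomologyRingIso θ J),
        Eq.trans ?_ (Quotient.sound h)⟩
      have hχ : (Quotient.mk (OneDimRep.setoid F Q) (OneDimRep.ofCharacter χ)).out.1.character = χ :=
        (OneDimRep.mk_eq_mk_iff.1 (Quotient.out_eq _)).trans (OneDimRep.character_ofCharacter χ)
      simp only [Ψ]
      rw [hχ, transferIdeal_transferIdeal]
  refine ⟨(Equiv.ofBijective Ψ hbij).symm, fun K ↦ hΨ _ K ?_⟩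
  exact (Equiv.ofBijective Ψ hbij).apply_symm_apply _

end Classification
end

theorem mainTheorem1 {F Q : Type u} [Field F] [CharP F 2] [Group Q] (hQ : Odd (Nat.card Q))
    (φ : Q →* MulAut KleinFour)
    (ε : ProjectiveResolution (Rep.trivial F (KleinFour ⋊[φ] Q) F)) :
    Nonempty (CohomologyRingIso ε) ∧
    ∀ θ : CohomologyRingIso ε,
      ∃ Φ : Quotient (FourDimPerfect.setoid.{u} F (KleinFour ⋊[φ] Q)) ≃
          ℤ × Quotient (OneDimRep.setoid.{u} F Q) × InvariantParameterIdeal F φ,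
        ∀ (C : FourDimPerfect.{u} F (KleinFour ⋊[φ] Q)) (l : ℤ)
          (L : Quotient (OneDimRep.setoid.{u} F Q)) (J : InvariantParameterIdeal F φ),
          Φ (Quotient.mk _ C) = (l, L, J) →
            IsLeast {i : ℤ | Nontrivial (C.1.homology i)} l ∧
            (∃ h : Module.finrank F (extRep ε C.1 l) = 1,
              L = Quotient.mk _ (⟨extRep ε C.1 l, h⟩ : OneDimRep F Q)) ∧
            (J.1 : Set (MvPolynomial (Fin 2) F)) = annihilatorSet θ C.1 := by
  refine ⟨(nonempty_koszulComparison ε hQ).map (·.cohomologyRingIso), fun θ ↦ ?_⟩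
  obtain ⟨Φ, hΦ⟩ := bijective_modelComplex hQ θ
  refine ⟨Φ, fun C l L J h ↦ ?_⟩
  have hC := hΦ C
  rw [h] at hC
  exact hC
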